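/- **Setting.** For a nonempty connected open set $\Omega\subseteq\mathbb R^2$ and a smooth nowhere vanishing $f\colon\Omega\to\mathbb R$ let $\mathcal L_f$ be the generalized Burgers equation $u_t+uu_x+f(t,x)u_{xx}=0$ on $\Omega$. Its maximal Lie invariance algebra $\mathfrak g_f$ is the space of all smooth vector fields $Q=\tau\partial_t+\xi\partial_x+\eta\partial_u$ on $\Omega\times\mathbb R$ (components depending on $t,x,u$) that satisfy the infinitesimal invariance criterion $Q_{(2)}(u_t+uu_x+fu_{xx})=0$ whenever $u_t+uu_x+fu_{xx}=0$, where $Q_{(2)}$ is the second prolongation. Let $\mathfrak g=\langle P^t,P^x,D^t,D^x,G,\Pi\rangle$ with $$P^t=\partial_t,\quad P^x=\partial_x,\quad D^t=t\partial_t-u\partial_u,\quad D^x=x\partial_x+u\partial_u,\quad G=t\partial_x+\partial_u,\quad \Pi=t^2\partial_t+tx\partial_x+(x-tu)\partial_u,$$ $\mathfrak f=\langle P^t,D^t+\tfrac12D^x,\Pi\rangle$, $\mathfrak c=\langle D^x\rangle$, $\mathfrak n=\langle P^x,G\rangle$, $\mathfrak r=\mathfrak c\oplus\mathfrak n$, so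 $\mathfrak g=\mathfrak f\oplus\mathfrak c\oplus\mathfrak n$. Let $G^\sim$ be the equivalence group, which consists of the transformations $$\tilde t=\frac{\alpha t+\beta}{\gamma t+\delta},\quad \tilde x=\frac{\kappa x+\mu_1t+\mu_0}{\gamma t+\delta},\quad \tilde u=\frac{\kappa(\gamma t+\delta)u-\kappa\gamma x+\mu_1\delta-\mu_0\gamma}{\alpha\delta-\beta\gamma},\quad \tilde f=\frac{\kappa^2}{\alpha\delta-\beta\gamma}f$$ with real constants such that $\alpha\delta-\beta\gamma\ne0$, $\kappa\ne0$. Subalgebras of $\mathfrak g$ are equivalent if some element of $G^\sim$ pushes one forward onto the other. A subspace $\mathfrak s\subseteq\mathfrak g$ is *appropriate* if $\mathfrak s=\mathfrak g_f$ (restricted to $\Omega\times\mathbb R$) for some $\Omega$ and $f$ as above. **List.** Below $h$ is a smooth function on the interval $\omega(\Omega)$, $\varkappa$, $a$ and $\varepsilon$ are constants, and "$\ne$" between functions means "not identically equal on $\omega(\Omega)$". The entries give the algebra, the form of $f$, and the constraints (if any). * $\mathfrak g^{1.1}=\langle D^x\rangle$: $f=x^2h(\omega)$, $\omega=t$; $((\alpha\omega^2+\beta\omega+\gamma)h)_\omega\ne0$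 for all $(\alpha,\beta,\gamma)\ne0$. * $\mathfrak g^{1.2}=\langle P^t\rangle$: $f=h(\omega)$, $\omega=x$; $(\alpha\omega+\beta)h_\omega\ne\gamma h$ for all $(\alpha,\beta,\gamma)\ne0$. * $\mathfrak g^{1.3}=\langle P^t+G\rangle$: $f=h(\omega)$, $\omega=x-\frac{t^2}2$; $h_\omega\ne0$ and $2(\omega+\beta)h_\omega\ne3h$ for all $\beta$. * $\mathfrak g^{1.4}=\langle P^t+D^x\rangle$: $f=e^{2t}h(\omega)$, $\omega=e^{-t}x$; $h_\omega\ne0$, $\omega h_\omega\ne2h$. * $\mathfrak g^{1.5}=\langle D^t+P^x\rangle$: $f=t^{-1}h(\omega)$, $\omega=x-\ln|t|$; $h_\omega\ne0$, $h_\omega\ne-h$. * $\mathfrak g^{1.6}_a=\langle D^t+aD^x\rangle$: $f=\frac{|t|^{2a}}th(\omega)$, $\omega=|t|^{-a}x$; $h_\omega\ne0$; $a(\omega+\alpha)h_\omega\ne(2a-1)h$ for all $\alpha$ with $(a-2)(a-1)\alpha=0$; $(\omega+\beta)h_\omega\ne2h$ for all $\beta$ with $(a-1)a\beta=0$; $(a-1)(\omega+\gamma)h_\omega\ne(2a-1)h$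 for all $\gamma$ with $a(a+1)\gamma=0$. Gauge: $a\geqslant\frac12$. * $\mathfrak g^{1.7}=\langle D^t+D^x+G\rangle$: $f=t\,h(\omega)$, $\omega=\frac xt-\ln|t|$; $h_\omega\ne0$, $h_\omega\ne h$. * $\mathfrak g^{1.8}_a=\langle P^t+\Pi+aD^x\rangle$: $f=e^{2a\arctan t}h(\omega)$, $\omega=\frac{e^{-a\arctan t}}{\sqrt{t^2+1}}x$; $h_\omega\ne0$, $\omega h_\omega\ne2h$. Gauge: $a\geqslant0$. * $\mathfrak g^{2.1}=\langle P^x,G\rangle$: $f=h(\omega)$, $\omega=t$; $(\alpha\omega^2+\beta\omega+\gamma)h_\omega\ne\delta h$ for all $(\alpha,\beta,\gamma,\delta)\ne0$. * $\mathfrak g^{2.2}=\langle D^x,P^t\rangle$: $f=\varkappa x^2$. Gauge: $\varkappa=1$. * $\mathfrak g^{2.3}=\langle D^x,D^t\rangle$: $f=\varkappa x^2/t$. Gauge: $\varkappa>0$. * $\mathfrak g^{2.4}=\langle D^x,P^t+\Pi\rangle$: $f=\varkappa x^2/(t^2+1)$. Gauge: $\varkappa>0$. * $\mathfrak g^{2.5}=\langle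 P^t,D^t+P^x\rangle$: $f=\varkappa e^{-x}$. Gauge: $\varkappa=1$. * $\mathfrak g^{2.6}_a=\langle P^t,D^t+aD^x\rangle$: $f=\varkappa|x|^{2-1/a}$; $a\ne0,\frac12$. Gauge: $\varkappa=1$. * $\mathfrak g^{2.7}=\langle P^t+G,D^t+2D^x\rangle$: $f=\varkappa|x-\frac{t^2}2|^{3/2}$. Gauge: $\varkappa>0$. * $\mathfrak g^{3.1}=\langle P^x,G,P^t+\frac12D^x\rangle$: $f=\varepsilon e^t$. Gauge: $\varepsilon=\pm1$. * $\mathfrak g^{3.2}_a=\langle P^x,G,D^t+aD^x\rangle$: $f=\varepsilon|t|^{2a-1}$; $a\ne\frac12$. Gauge: $a>\frac12$, $\varepsilon=\pm1$. * $\mathfrak g^{3.3}_a=\langle P^x,G,P^t+\Pi+aD^x\rangle$: $f=\varepsilon e^{2a\arctan t}$; $a\ne0$. Gauge: $a>0$, $\varepsilon=\pm1$. * $\mathfrak g^{5}=\langle P^x,G,P^t,D^t+\frac12D^x,\Pi\rangle$: $f=\varkappa$. Gauge: $\varkappa=1$. **Theorem.** 1. $\mathfrak g$ is a Lie algebra isomorphic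 to $\mathrm{aff}(2,\mathbb R)$. If an element of $G^\sim$ is defined on $\Omega$, it maps $f$ to a smooth nonvanishing $\tilde f$ on the image of $\Omega$, and the solutions of $\mathcal L_f$ correspond to those of $\mathcal L_{\tilde f}$. Every $\mathfrak g_f$ is (the restriction to $\Omega\times\mathbb R$ of) a Lie subalgebra of $\mathfrak g$. 2. The kernel algebra is zero: on every $\Omega$, $\bigcap_f\mathfrak g_f=\{0\}$. 3. $\dim\mathfrak g_f\in\{0,1,2,3,5\}$, every one of these values occurs, and $\dim\mathfrak g_f=5$ if and only if $f$ is constant (the classical Burgers equation). 4. Let $\mathfrak s$ be appropriate. If $\mathfrak s\cap\mathfrak n\ne\{0\}$, then $\mathfrak s\cap\mathfrak r=\mathfrak n$. If $\mathfrak s\cap\mathfrak r=\mathfrak c$, then $\mathfrak s\subseteq\mathfrak f\oplus\mathfrak c$ and $\dim\mathfrak s\leqslant2$. If $\mathfrak s\cap\mathfrak r=\mathfrak n$, then either $\dim\mathfrak s\leqslant3$ and $\mathfrak s\cap\mathfrak f=\{0\}$, or $\mathfrak s=\mathfrak f\oplus\mathfrak n$. If $\mathfrak s\cap\mathfrak r=\{0\}$,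 then $\dim\mathfrak s\leqslant2$, and if moreover $\dim\mathfrak s=2$, then the projection of $\mathfrak s$ to $\mathfrak c$ along $\mathfrak f\oplus\mathfrak n$ is $\mathfrak c$ and $\mathfrak s$ is not $G^\sim$-equivalent to $\langle P^t,D^t\rangle$. 5. A nonzero subspace of $\mathfrak g$ is appropriate if and only if it is $G^\sim$-equivalent to one of the nineteen families of algebras of the list with gauged $a$. These algebras (for different families, or different gauged values of $a$) are pairwise $G^\sim$-inequivalent, except that $\mathfrak g^{1.5}$ and $\mathfrak g^{1.7}$ are equivalent. 6. If $f$ has on $\Omega$ the form of an entry of the list ($a$, and the nonzero $\varkappa$, $\varepsilon$, not necessarily gauged), then $\mathfrak g_f$ is the algebra of this entry if and only if the constraints of the entry hold. 7. For every $\mathcal L_f$ on $\Omega$, each nonempty open subset of $\Omega$ contains a nonempty connected open set $V$ such that either the maximal Lie invariance algebra of $\mathcal L_f$ on $V$ is zero, or some element of $G^\sim$ defined on $V$ maps $f|_V$ to a function that has on the image of $V$ the form of an entry of the list with gauged constants and with the constraints satisfied. -/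

import Mathlib

/-! Generalized Burgers equations `u_t + u u_x + f(t,x) u_xx = 0` with `f ≠ 0`:
Lie symmetries, equivalence transformations and the classification list. -/

open scoped ContDiff

noncomputable section

namespace GBE

/-- `u` solves the equation `u_t + u u_x + f u_xx = 0` on `Ω`. -/
def IsSolution (Ω : Set (ℝ × ℝ)) (f u : ℝ × ℝ → ℝ) : Prop :=
  ∀ p ∈ Ω, fderiv ℝ u p (1, 0) + u p * fderiv ℝ u p (0, 1)
    + f p * fderiv ℝ (fun q => fderiv ℝ u q (0, 1)) p (0, 1) = 0

/-! ### Vector fields and the infinitesimal invariance criterion -/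

/-- The space of the variables `(t, x, u)`. -/
abbrev E := ℝ × ℝ × ℝ

/-- Vector fields `Q = τ ∂_t + ξ ∂_x + η ∂_u`, given by `p ↦ (τ p, ξ p, η p)`. -/
abbrev VF := E → E

def tau (Q : VF) : E → ℝ := fun p => (Q p).1
def xi (Q : VF) : E → ℝ := fun p => (Q p).2.1
def eta (Q : VF) : E → ℝ := fun p => (Q p).2.2

/-- Derivative of `F` in the constant direction `v`. -/
def der (v : E) (F : E → ℝ) : E → ℝ := fun p => fderiv ℝ F p v

/-- The partial derivatives with respect to `t`, `x` and `u`. -/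
def pdt (F : E → ℝ) : E → ℝ := der (1, 0, 0) F
def pdx (F : E → ℝ) : E → ℝ := der (0, 1, 0) F
def pdu (F : E → ℝ) : E → ℝ := der (0, 0, 1) F

/-- Points of the second-order jet space. -/
structure Jet where
  t : ℝ
  x : ℝ
  u : ℝ
  ut : ℝ
  ux : ℝ
  utt : ℝ
  utx : ℝ
  uxx : ℝ

/-- Projection of the jet space to the space of `(t, x, u)`. -/
def Jet.base (j : Jet) : E := (j.t, j.x, j.u)

/-- The total derivatives `D_t F`, `D_x F` and `D_x² F` of a function `F = F(t, x, u)`. -/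
def totT (F : E → ℝ) (j : Jet) : ℝ := pdt F j.base + j.ut * pdu F j.base
def totX (F : E → ℝ) (j : Jet) : ℝ := pdx F j.base + j.ux * pdu F j.base
def totXX (F : E → ℝ) (j : Jet) : ℝ :=
  pdx (pdx F) j.base + 2 * j.ux * pdx (pdu F) j.base + j.ux ^ 2 * pdu (pdu F) j.base
    + j.uxx * pdu F j.base

/-- The coefficients `η^t`, `η^x`, `η^xx` of the second prolongation of `Q`. -/
def prolT (Q : VF) (j : Jet) : ℝ :=
  totT (eta Q) j - j.ut * totT (tau Q) j - j.ux * totT (xi Q) j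
def prolX (Q : VF) (j : Jet) : ℝ :=
  totX (eta Q) j - j.ut * totX (tau Q) j - j.ux * totX (xi Q) j
def prolXX (Q : VF) (j : Jet) : ℝ :=
  totXX (eta Q) j - j.ut * totXX (tau Q) j - 2 * j.utx * totX (tau Q) j
    - j.ux * totXX (xi Q) j - 2 * j.uxx * totX (xi Q) j

/-- The left-hand side `u_t + u u_x + f u_xx` as a function on the jet space. -/
def lhs (f : ℝ × ℝ → ℝ) (j : Jet) : ℝ := j.ut + j.u * j.ux + f (j.t, j.x) * j.uxx

/-- The second prolongation of `Q` applied to `u_t + u u_x + f u_xx`. -/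
def prolLhs (f : ℝ × ℝ → ℝ) (Q : VF) (j : Jet) : ℝ :=
  prolT Q j + eta Q j.base * j.ux + prolX Q j * j.u
    + (xi Q j.base * fderiv ℝ f (j.t, j.x) (0, 1)
        + tau Q j.base * fderiv ℝ f (j.t, j.x) (1, 0)) * j.uxx
    + prolXX Q j * f (j.t, j.x)

/-- The domain `Ω × ℝ` in the space of `(t, x, u)`. -/
def cyl (Ω : Set (ℝ × ℝ)) : Set E := {p | (p.1, p.2.1) ∈ Ω}

/-- `f` is an arbitrary element of the class on the domain `Ω`: smooth and nonvanishing. -/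
structure IsGBE (Ω : Set (ℝ × ℝ)) (f : ℝ × ℝ → ℝ) : Prop where
  isOpen : IsOpen Ω
  isConnected : IsConnected Ω
  smooth : ContDiffOn ℝ ∞ f Ω
  ne_zero : ∀ p ∈ Ω, f p ≠ 0

/-- `Q` is smooth over `Ω × ℝ` and satisfies the infinitesimal invariance criterion for the
equation with the arbitrary element `f` there. -/
structure IsLieSymmetry (Ω : Set (ℝ × ℝ)) (f : ℝ × ℝ → ℝ) (Q : VF) : Prop where
  smooth : ContDiffOn ℝ ∞ Q (cyl Ω)
  invariant : ∀ j : Jet, (j.t, j.x) ∈ Ω → lhs f j = 0 → prolLhs f Q j = 0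

/-- Restriction of vector fields to the domain `Ω × ℝ`. -/
def res (Ω : Set (ℝ × ℝ)) : VF →ₗ[ℝ] (cyl Ω → E) := LinearMap.funLeft ℝ E Subtype.val

theorem isOpen_cyl {Ω : Set (ℝ × ℝ)} (h : IsOpen Ω) : IsOpen (cyl Ω) :=
  h.preimage (by fun_prop : Continuous fun p : E => (p.1, p.2.1))

section linearity

variable {W : Set E} {F K : E → ℝ}

theorem smooth_der (hW : IsOpen W) (hF : ContDiffOn ℝ ∞ F W) (v : E) :
    ContDiffOn ℝ ∞ (der v F) W :=
  (hF.fderiv_of_isOpen hW (by simp)).clm_apply contDiffOn_const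

theorem diffAt (hW : IsOpen W) (hF : ContDiffOn ℝ ∞ F W) {p : E} (hp : p ∈ W) :
    DifferentiableAt ℝ F p :=
  (hF.contDiffAt (hW.mem_nhds hp)).differentiableAt (by simp)

theorem der_lin (hW : IsOpen W) (hF : ContDiffOn ℝ ∞ F W) (hK : ContDiffOn ℝ ∞ K W)
    (c : ℝ) (v : E) {p : E} (hp : p ∈ W) :
    der v (fun q => c * F q + K q) p = c * der v F p + der v K p := by
  have h := ((diffAt hW hF hp).hasFDerivAt.const_mul c).add (diffAt hW hK hp).hasFDerivAt
  have h2 : fderiv ℝ (fun q => c * F q + K q) p = c • fderiv ℝ F p + fderiv ℝ K p := h.fderiv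
  simp [der, h2]

theorem der_der_lin (hW : IsOpen W) (hF : ContDiffOn ℝ ∞ F W) (hK : ContDiffOn ℝ ∞ K W)
    (c : ℝ) (v w : E) {p : E} (hp : p ∈ W) :
    der w (der v (fun q => c * F q + K q)) p = c * der w (der v F) p + der w (der v K) p := by
  rw [← der_lin hW (smooth_der hW hF v) (smooth_der hW hK v) c w hp]
  have : der v (fun q => c * F q + K q) =ᶠ[nhds p] fun q => c * der v F q + der v K q := by
    filter_upwards [hW.mem_nhds hp] with q hq using der_lin hW hF hK c v hq
  simp [der, this.fderiv_eq]

end linearity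

/-- A linear combination of two Lie symmetries is a Lie symmetry. -/
theorem IsLieSymmetry.lin {Ω : Set (ℝ × ℝ)} (hΩ : IsOpen Ω) {f : ℝ × ℝ → ℝ} {Q R : VF}
    (hQ : IsLieSymmetry Ω f Q) (hR : IsLieSymmetry Ω f R) (c : ℝ) :
    IsLieSymmetry Ω f (c • Q + R) := by
  refine ⟨(hQ.smooth.const_smul c).add hR.smooth, fun j hj h0 => ?_⟩
  have hW := isOpen_cyl hΩ
  have hp : j.base ∈ cyl Ω := hj
  have e1 := hQ.invariant j hj h0
  have e2 := hR.invariant j hj h0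
  have t1 : ContDiffOn ℝ ∞ (tau Q) (cyl Ω) := hQ.smooth.fst
  have t2 : ContDiffOn ℝ ∞ (tau R) (cyl Ω) := hR.smooth.fst
  have x1 : ContDiffOn ℝ ∞ (xi Q) (cyl Ω) := hQ.smooth.snd.fst
  have x2 : ContDiffOn ℝ ∞ (xi R) (cyl Ω) := hR.smooth.snd.fst
  have n1 : ContDiffOn ℝ ∞ (eta Q) (cyl Ω) := hQ.smooth.snd.snd
  have n2 : ContDiffOn ℝ ∞ (eta R) (cyl Ω) := hR.smooth.snd.snd
  have et : tau (c • Q + R) = fun q => c * tau Q q + tau R q := rfl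
  have ex : xi (c • Q + R) = fun q => c * xi Q q + xi R q := rfl
  have en : eta (c • Q + R) = fun q => c * eta Q q + eta R q := rfl
  simp only [prolLhs, prolT, prolX, prolXX, totT, totX, totXX, pdt, pdx, pdu, et, ex, en,
    der_lin hW t1 t2 c _ hp, der_lin hW x1 x2 c _ hp, der_lin hW n1 n2 c _ hp,
    der_der_lin hW t1 t2 c _ _ hp, der_der_lin hW x1 x2 c _ _ hp,
    der_der_lin hW n1 n2 c _ _ hp] at e1 e2 ⊢
  linear_combination c * e1 + e2

theorem IsLieSymmetry.zero (Ω : Set (ℝ × ℝ)) (f : ℝ × ℝ → ℝ) : IsLieSymmetry Ω f 0 := by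
  refine ⟨contDiffOn_const, fun j _ _ => ?_⟩
  have z : ∀ v : E, der v (fun _ => (0 : ℝ)) = fun _ => 0 := fun v => by
    funext p; simp [der]
  have et : tau 0 = fun _ => (0 : ℝ) := rfl
  have ex : xi 0 = fun _ => (0 : ℝ) := rfl
  have en : eta 0 = fun _ => (0 : ℝ) := rfl
  simp [prolLhs, prolT, prolX, prolXX, totT, totX, totXX, pdt, pdx, pdu, et, ex, en, z]

/-- The maximal Lie invariance algebra `𝔤_f` of the equation with the arbitrary element `f` on
the open set `Ω`: the space of all vector fields on `Ω × ℝ` that are its Lie symmetries.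
(The interior is taken only for the definition to make sense for all `Ω`.) -/
def maxAlg (Ω : Set (ℝ × ℝ)) (f : ℝ × ℝ → ℝ) : Submodule ℝ (cyl Ω → E) :=
  Submodule.map (res Ω)
    { carrier := {Q | IsLieSymmetry (interior Ω) f Q}
      zero_mem' := IsLieSymmetry.zero _ f
      add_mem' := fun {a b} ha hb => by
        have := IsLieSymmetry.lin isOpen_interior ha hb 1
        rwa [one_smul] at this
      smul_mem' := fun c a ha => by
        have := IsLieSymmetry.lin isOpen_interior ha (IsLieSymmetry.zero _ f) c
        rwa [add_zero] at this }

/-! ### The algebra `𝔤` and its subalgebras -/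

def vPt : VF := fun _ => (1, 0, 0)
def vPx : VF := fun _ => (0, 1, 0)
def vDt : VF := fun p => (p.1, 0, -p.2.2)
def vDx : VF := fun p => (0, p.2.1, p.2.2)
def vG : VF := fun p => (0, p.1, 1)
def vPi : VF := fun p => (p.1 ^ 2, p.1 * p.2.1, p.2.1 - p.1 * p.2.2)

/-- The algebra `𝔤`, the projection of the equivalence algebra to the space of `(t, x, u)`. -/
def algG : Submodule ℝ VF := Submodule.span ℝ {vPt, vPx, vDt, vDx, vG, vPi}

/-- The Levi factor `𝔣`, the subspace `𝔠`, the nilradical `𝔫` and the radical `𝔯` of `𝔤`. -/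
def levi : Submodule ℝ VF := Submodule.span ℝ {vPt, vDt + (1 / 2 : ℝ) • vDx, vPi}
def cartan : Submodule ℝ VF := Submodule.span ℝ {vDx}
def nilrad : Submodule ℝ VF := Submodule.span ℝ {vPx, vG}
def rad : Submodule ℝ VF := Submodule.span ℝ {vDx, vPx, vG}

/-- The image of `s` under the projection of `𝔤 = 𝔣 ⊕ 𝔠 ⊕ 𝔫` onto `𝔠`. -/
def prC (s : Submodule ℝ VF) : Submodule ℝ VF := cartan ⊓ (s ⊔ (levi ⊔ nilrad))

/-- Closedness under the Lie bracket of vector fields. -/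
def IsBracketClosed (s : Submodule ℝ VF) : Prop :=
  ∀ X ∈ s, ∀ Y ∈ s, VectorField.lieBracket ℝ X Y ∈ s

/-- The affine Lie algebra `aff(2, ℝ)`: the real 3 × 3 matrices with zero last row. Its bracket
is the commutator `A * B - B * A`. -/
def aff2 : Submodule ℝ (Matrix (Fin 3) (Fin 3) ℝ) where
  carrier := {A | ∀ j, A 2 j = 0}
  zero_mem' := fun _ => rfl
  add_mem' := fun {A B} hA hB j => by
    have h1 := hA j
    have h2 := hB j
    simp [h1, h2]
  smul_mem' := fun c A hA j => by
    have h1 := hA j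
    simp [h1]

/-- A subspace `s ⊆ 𝔤` is appropriate if it is the maximal Lie invariance algebra of some
equation of the class. -/
def IsAppropriate (s : Submodule ℝ VF) : Prop :=
  s ≤ algG ∧ ∃ Ω f, IsGBE Ω f ∧ maxAlg Ω f = s.map (res Ω)

/-! ### The equivalence group -/

/-- An element of the equivalence group `G^∼` of the class. -/
structure EqTrans where
  α : ℝ
  β : ℝ
  γ : ℝ
  δ : ℝ
  κ : ℝ
  μ₁ : ℝ
  μ₀ : ℝ
  det_ne : α * δ - β * γ ≠ 0
  κ_ne : κ ≠ 0

namespace EqTrans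

/-- The `(t, x)`-components of the transformation. -/
def onTX (T : EqTrans) (p : ℝ × ℝ) : ℝ × ℝ :=
  ((T.α * p.1 + T.β) / (T.γ * p.1 + T.δ),
    (T.κ * p.2 + T.μ₁ * p.1 + T.μ₀) / (T.γ * p.1 + T.δ))

/-- The action on the space of `(t, x, u)`. -/
def onE (T : EqTrans) (p : E) : E :=
  ((T.α * p.1 + T.β) / (T.γ * p.1 + T.δ),
    (T.κ * p.2.1 + T.μ₁ * p.1 + T.μ₀) / (T.γ * p.1 + T.δ),
    (T.κ * (T.γ * p.1 + T.δ) * p.2.2 - T.κ * T.γ * p.2.1 + T.μ₁ * T.δ - T.μ₀ * T.γ)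
      / (T.α * T.δ - T.β * T.γ))

/-- `T` is defined on the whole of `Ω`. -/
def DefinedOn (T : EqTrans) (Ω : Set (ℝ × ℝ)) : Prop := ∀ p ∈ Ω, T.γ * p.1 + T.δ ≠ 0

/-- `T` maps the equation with the arbitrary element `f` on `Ω` to the one with the arbitrary
element `f'` on `T(Ω)`. -/
def MapsEq (T : EqTrans) (Ω : Set (ℝ × ℝ)) (f f' : ℝ × ℝ → ℝ) : Prop :=
  ∀ p ∈ Ω, f' (T.onTX p) = T.κ ^ 2 / (T.α * T.δ - T.β * T.γ) * f p

/-- `Q'` is the pushforward of `Q` by `T`. -/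
def Pushes (T : EqTrans) (Q Q' : VF) : Prop :=
  ∀ p : E, T.γ * p.1 + T.δ ≠ 0 → fderiv ℝ T.onE p (Q p) = Q' (T.onE p)

end EqTrans

/-- `G^∼`-equivalence of subalgebras of `𝔤`: some `T ∈ G^∼` maps `s` onto `s'`. -/
def SubalgEquiv (s s' : Submodule ℝ VF) : Prop :=
  ∃ T : EqTrans, (∀ Q ∈ s, ∃ Q' ∈ s', T.Pushes Q Q') ∧ (∀ Q' ∈ s', ∃ Q ∈ s, T.Pushes Q Q')

/-! ### The classification list -/

/-- The nine families whose `f` contains an arbitrary function `h` of one variable. -/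
inductive FunRow
  | g11
  | g12
  | g13
  | g14
  | g15
  | g16 (a : ℝ)
  | g17
  | g18 (a : ℝ)
  | g21

namespace FunRow

/-- The Lie algebra. -/
def alg : FunRow → Submodule ℝ VF
  | g11 => Submodule.span ℝ {vDx}
  | g12 => Submodule.span ℝ {vPt}
  | g13 => Submodule.span ℝ {vPt + vG}
  | g14 => Submodule.span ℝ {vPt + vDx}
  | g15 => Submodule.span ℝ {vDt + vPx}
  | g16 a => Submodule.span ℝ {vDt + a • vDx}
  | g17 => Submodule.span ℝ {vDt + vDx + vG}
  | g18 a => Submodule.span ℝ {vPt + vPi + a • vDx}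
  | g21 => Submodule.span ℝ {vPx, vG}

/-- The argument `ω` of the function `h`. -/
def omega : FunRow → ℝ × ℝ → ℝ
  | g11 => fun p => p.1
  | g12 => fun p => p.2
  | g13 => fun p => p.2 - p.1 ^ 2 / 2
  | g14 => fun p => Real.exp (-p.1) * p.2
  | g15 => fun p => p.2 - Real.log |p.1|
  | g16 a => fun p => |p.1| ^ (-a) * p.2
  | g17 => fun p => p.2 / p.1 - Real.log |p.1|
  | g18 a => fun p => Real.exp (-a * Real.arctan p.1) / Real.sqrt (p.1 ^ 2 + 1) * p.2
  | g21 => fun p => p.1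

/-- The coefficient of `h(ω)` in `f`. -/
def coeff : FunRow → ℝ × ℝ → ℝ
  | g11 => fun p => p.2 ^ 2
  | g12 => fun _ => 1
  | g13 => fun _ => 1
  | g14 => fun p => Real.exp (2 * p.1)
  | g15 => fun p => 1 / p.1
  | g16 a => fun p => |p.1| ^ (2 * a) / p.1
  | g17 => fun p => p.1
  | g18 a => fun p => Real.exp (2 * a * Real.arctan p.1)
  | g21 => fun _ => 1

/-- The constraints on `h` for the algebra to be maximal; `I` is the range of `ω`, and each
inequality `≠` between functions means that they do not coincide identically on `I`. -/
def Constraint (I : Set ℝ) (h : ℝ → ℝ) : FunRow → Prop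
  | g11 => ∀ α β γ : ℝ, (α, β, γ) ≠ 0 →
      ∃ w ∈ I, deriv (fun z => (α * z ^ 2 + β * z + γ) * h z) w ≠ 0
  | g12 => ∀ α β γ : ℝ, (α, β, γ) ≠ 0 → ∃ w ∈ I, (α * w + β) * deriv h w ≠ γ * h w
  | g13 => (∃ w ∈ I, deriv h w ≠ 0) ∧ ∀ β : ℝ, ∃ w ∈ I, 2 * (w + β) * deriv h w ≠ 3 * h w
  | g14 => (∃ w ∈ I, deriv h w ≠ 0) ∧ ∃ w ∈ I, w * deriv h w ≠ 2 * h w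
  | g15 => (∃ w ∈ I, deriv h w ≠ 0) ∧ ∃ w ∈ I, deriv h w ≠ -h w
  | g16 a => (∃ w ∈ I, deriv h w ≠ 0)
      ∧ (∀ α : ℝ, (a - 2) * (a - 1) * α = 0 →
          ∃ w ∈ I, a * (w + α) * deriv h w ≠ (2 * a - 1) * h w)
      ∧ (∀ β : ℝ, (a - 1) * a * β = 0 → ∃ w ∈ I, (w + β) * deriv h w ≠ 2 * h w)
      ∧ (∀ γ : ℝ, a * (a + 1) * γ = 0 →
          ∃ w ∈ I, (a - 1) * (w + γ) * deriv h w ≠ (2 * a - 1) * h w)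
  | g17 => (∃ w ∈ I, deriv h w ≠ 0) ∧ ∃ w ∈ I, deriv h w ≠ h w
  | g18 _ => (∃ w ∈ I, deriv h w ≠ 0) ∧ ∃ w ∈ I, w * deriv h w ≠ 2 * h w
  | g21 => ∀ α β γ δ : ℝ, (α, β, γ, δ) ≠ 0 →
      ∃ w ∈ I, (α * w ^ 2 + β * w + γ) * deriv h w ≠ δ * h w

/-- The range of the parameter after gauging by equivalence transformations. -/
def Gauged : FunRow → Prop
  | g16 a => 1 / 2 ≤ a
  | g18 a => 0 ≤ a
  | _ => True

/-- `f` has on `Ω` the form of the family, with the smooth function `h`. (Points with `t = 0`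
where the expression is singular lie outside `Ω`, since `f` does not vanish on `Ω`.) -/
def HasForm (r : FunRow) (Ω : Set (ℝ × ℝ)) (f : ℝ × ℝ → ℝ) (h : ℝ → ℝ) : Prop :=
  ContDiffOn ℝ ∞ h (r.omega '' Ω) ∧ ∀ p ∈ Ω, f p = r.coeff p * h (r.omega p)

end FunRow

/-- The ten families whose `f` contains at most constant parameters. -/
inductive ConstRow
  | g22
  | g23
  | g24
  | g25
  | g26 (a : ℝ)
  | g27
  | g31
  | g32 (a : ℝ)
  | g33 (a : ℝ)
  | g5

namespace ConstRow

/-- The Lie algebra. -/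
def alg : ConstRow → Submodule ℝ VF
  | g22 => Submodule.span ℝ {vDx, vPt}
  | g23 => Submodule.span ℝ {vDx, vDt}
  | g24 => Submodule.span ℝ {vDx, vPt + vPi}
  | g25 => Submodule.span ℝ {vPt, vDt + vPx}
  | g26 a => Submodule.span ℝ {vPt, vDt + a • vDx}
  | g27 => Submodule.span ℝ {vPt + vG, vDt + (2 : ℝ) • vDx}
  | g31 => Submodule.span ℝ {vPx, vG, vPt + (1 / 2 : ℝ) • vDx}
  | g32 a => Submodule.span ℝ {vPx, vG, vDt + a • vDx}
  | g33 a => Submodule.span ℝ {vPx, vG, vPt + vPi + a • vDx}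
  | g5 => Submodule.span ℝ {vPx, vG, vPt, vDt + (1 / 2 : ℝ) • vDx, vPi}

/-- The function `f` up to a constant multiplier. -/
def shape : ConstRow → ℝ × ℝ → ℝ
  | g22 => fun p => p.2 ^ 2
  | g23 => fun p => p.2 ^ 2 / p.1
  | g24 => fun p => p.2 ^ 2 / (p.1 ^ 2 + 1)
  | g25 => fun p => Real.exp (-p.2)
  | g26 a => fun p => |p.2| ^ (2 - 1 / a)
  | g27 => fun p => |p.2 - p.1 ^ 2 / 2| ^ (3 / 2 : ℝ)
  | g31 => fun p => Real.exp p.1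
  | g32 a => fun p => |p.1| ^ (2 * a - 1)
  | g33 a => fun p => Real.exp (2 * a * Real.arctan p.1)
  | g5 => fun _ => 1

/-- The values of the parameter for which the algebra is maximal. -/
def Admissible : ConstRow → Prop
  | g26 a => a ≠ 0 ∧ a ≠ 1 / 2
  | g32 a => a ≠ 1 / 2
  | g33 a => a ≠ 0
  | _ => True

/-- The range of the parameter after gauging by equivalence transformations. -/
def Gauged : ConstRow → Prop
  | g26 a => a ≠ 0 ∧ a ≠ 1 / 2
  | g32 a => 1 / 2 < a
  | g33 a => 0 < a
  | _ => True

/-- The values of the constant multiplier of `f` after gauging. -/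
def multipliers : ConstRow → Set ℝ
  | g22 => {1}
  | g23 => {c | 0 < c}
  | g24 => {c | 0 < c}
  | g25 => {1}
  | g26 _ => {1}
  | g27 => {c | 0 < c}
  | g31 => {1, -1}
  | g32 _ => {1, -1}
  | g33 _ => {1, -1}
  | g5 => {1}

/-- `f` has on `Ω` the form of the family, with the constant multiplier `c`. -/
def HasForm (r : ConstRow) (Ω : Set (ℝ × ℝ)) (f : ℝ × ℝ → ℝ) (c : ℝ) : Prop :=
  ∀ p ∈ Ω, f p = c * r.shape p

end ConstRow

/-- The list of the nineteen families. -/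
inductive Row
  | fn (r : FunRow)
  | const (r : ConstRow)

namespace Row

def alg : Row → Submodule ℝ VF
  | fn r => r.alg
  | const r => r.alg

def Gauged : Row → Prop
  | fn r => r.Gauged
  | const r => r.Gauged

/-- `f` is on `Ω` an entry of the list, with gauged parameters and all constraints. -/
def IsEntry (Ω : Set (ℝ × ℝ)) (f : ℝ × ℝ → ℝ) : Row → Prop
  | fn r => r.Gauged ∧ ∃ h, r.HasForm Ω f h ∧ r.Constraint (r.omega '' Ω) h
  | const r => r.Gauged ∧ ∃ c ∈ r.multipliers, r.HasForm Ω f c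

end Row

end GBE

end

open GBE

noncomputable section

namespace GBE

/-! ### Coordinates in `𝔤` -/

/-! Everything is reduced to linear algebra in the six coordinates of 𝔤. Splitting the invariance
criterion with respect to the free jet variables u_tx, u_x, u_xx gives τ = τ(t), ξ = ξ(t, x) and
four further equations. Since f does not depend on u, differentiating these in u gives η = u(ξ_x -
τ_t) + ξ_t, ξ_xx = ξ_tt = 0 and τ_tt = 2 ξ_tx for every nonvanishing f. So Q is a polynomial field
`gv a b c d e k`, and a single condition `cls` involving f remains: (a + ct + kt²) f_t + (b + dx +
et + ktx) f_x = (2d - c) f. Thus 𝔤_f is the restriction of the subspace `symAlg` of 𝔤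
(`isLieSymmetry_iff`, `maxAlg_eq`).

The equivalence group acts on 𝔤 by conjugating the matrix A with rows (c - d, a), (-k, -d),
accompanied by an affine action on the row n = (e, b) (`pushes_iff`); the expression `cls` only gets
a constant factor (`cls_map`). Invariants of an element are its weight 2d - c (minus the trace of
A), its discriminant c² - 4ak, the property τ = 0 (A is scalar), and whether a shift can remove n
(`Splits`).

The structure theorem `symStructure` rests on two remarks. Symmetries satisfy Xf = wf with a
constant weight w, so brackets of symmetries have weight zero. And a polynomial coefficient that
multiplies f, f_x or f_t to zero vanishes identically as soon as that factor is nonzero at one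
point. If f_x = 0, the nilradical lies in 𝔤_f, and a nonconstant f allows at most one further
generator, of nonzero weight. If f_x is nonzero somewhere, no nonzero element of the nilradical is a
symmetry. Then either there is a dilation D^x + b₀P^x + e₀G, and at most one τ up to
proportionality; or τ determines the symmetry, all three τ cannot occur because weight-zero
symmetries have proportional τ, and a two-dimensional algebra has a basis with [Q, R] = Q and R of
nonzero weight. Dimensions and the properties of intersections with the radical are read off from
these cases.

For normal forms, τ is brought to 1, t or 1 + t² by a fractional linear map (`exists_tauMap`), after
which shifts, scalings and the inversion of t do the rest. The algebra ⟨P^t, D^t⟩ drops out, because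
f_t = 0 and t f_t = -f give f = 0.

Maximality of the rows with constant parameters follows from the dimension bounds. For a row with a
function h, each extension permitted by `symStructure` amounts to a linear first-order equation for
h, and the constraints say that h satisfies none of them (`FunRow.symAlg_eq_iff`). The function
exp(ω³) meets all constraints, so every row is realised; inequivalence is decided by the invariants.
For the local statement one passes to a domain where the symmetry algebra no longer grows under
restriction, normalises it, and integrates `cls` along the orbits. -/

/-- The vector field `a P^t + b P^x + c D^t + d D^x + e G + k Π`. -/
def gv (a b c d e k : ℝ) : VF := fun p =>
  (a + c * p.1 + k * p.1 ^ 2, b + d * p.2.1 + e * p.1 + k * p.1 * p.2.1,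
    (d - c) * p.2.2 + e + k * (p.2.1 - p.1 * p.2.2))

theorem gv_add (a b c d e k a' b' c' d' e' k' : ℝ) :
    gv a b c d e k + gv a' b' c' d' e' k'
      = gv (a + a') (b + b') (c + c') (d + d') (e + e') (k + k') := by
  funext p
  simp only [gv, Pi.add_apply, Prod.mk_add_mk, Prod.mk.injEq]
  refine ⟨by ring, by ring, by ring⟩

theorem smul_gv (l a b c d e k : ℝ) :
    l • gv a b c d e k = gv (l * a) (l * b) (l * c) (l * d) (l * e) (l * k) := by
  funext p
  simp only [gv, Pi.smul_apply, Prod.smul_mk, smul_eq_mul, Prod.mk.injEq]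
  refine ⟨by ring, by ring, by ring⟩

theorem gv_zero : gv 0 0 0 0 0 0 = 0 := by
  funext p
  simp only [gv, Pi.zero_apply, Prod.mk_eq_zero]
  refine ⟨by ring, by ring, by ring⟩

theorem vPt_eq : vPt = gv 1 0 0 0 0 0 := by funext p; simp [gv, vPt]
theorem vPx_eq : vPx = gv 0 1 0 0 0 0 := by funext p; simp [gv, vPx]
theorem vDt_eq : vDt = gv 0 0 1 0 0 0 := by funext p; simp [gv, vDt]
theorem vDx_eq : vDx = gv 0 0 0 1 0 0 := by funext p; simp [gv, vDx]
theorem vG_eq : vG = gv 0 0 0 0 1 0 := by funext p; simp [gv, vG]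
theorem vPi_eq : vPi = gv 0 0 0 0 0 1 := by funext p; simp [gv, vPi]

/-- A quadratic polynomial that vanishes near a point is zero. -/
theorem quadratic_eq_zero {a b c t : ℝ}
    (h : ∀ᶠ s in nhds t, a + b * s + c * s ^ 2 = 0) : a = 0 ∧ b = 0 ∧ c = 0 := by
  obtain ⟨ε, hε, H⟩ := Metric.eventually_nhds_iff.1 h
  -- Three equidistant points suffice: the second difference isolates `c`, then the first difference
  -- isolates `b`.
  have h0 := H (y := t) (by simpa using hε)
  have h1 := H (y := t + ε / 2) (by rw [Real.dist_eq, abs_lt]; constructor <;> linarith)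
  have h2 := H (y := t - ε / 2) (by rw [Real.dist_eq, abs_lt]; constructor <;> linarith)
  have hc : c = 0 := by
    have : c * ε ^ 2 = 0 := by linear_combination 2 * h1 + 2 * h2 - 4 * h0
    simpa [hε.ne'] using this
  subst hc
  have hb : b = 0 := by
    have : b * ε = 0 := by linear_combination h1 - h2
    simpa [hε.ne'] using this
  subst hb
  exact ⟨by linarith, rfl, rfl⟩

theorem eventually_fst {P : ℝ × ℝ → Prop} {p : ℝ × ℝ} (h : ∀ᶠ q in nhds p, P q) :
    ∀ᶠ s in nhds p.1, P (s, p.2) :=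
  (show Continuous fun s : ℝ => (s, p.2) by fun_prop).continuousAt.eventually h

theorem eventually_snd {P : ℝ × ℝ → Prop} {p : ℝ × ℝ} (h : ∀ᶠ q in nhds p, P q) :
    ∀ᶠ s in nhds p.2, P (p.1, s) :=
  (show Continuous fun s : ℝ => (p.1, s) by fun_prop).continuousAt.eventually h

/-- A polynomial of degree at most two in each variable that vanishes near a point is zero. -/
theorem biquadratic_eq_zero {a₀ a₁ a₂ b₀ b₁ b₂ c₀ c₁ c₂ : ℝ} {p : ℝ × ℝ}
    (h : ∀ᶠ q in nhds p, (a₀ + a₁ * q.1 + a₂ * q.1 ^ 2) + (b₀ + b₁ * q.1 + b₂ * q.1 ^ 2) * q.2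
      + (c₀ + c₁ * q.1 + c₂ * q.1 ^ 2) * q.2 ^ 2 = 0) :
    (a₀ = 0 ∧ a₁ = 0 ∧ a₂ = 0) ∧ (b₀ = 0 ∧ b₁ = 0 ∧ b₂ = 0) ∧ (c₀ = 0 ∧ c₁ = 0 ∧ c₂ = 0) := by
  have h2 := h.eventually_nhds
  have key : ∀ᶠ q in nhds p, (a₀ + a₁ * q.1 + a₂ * q.1 ^ 2) = 0 ∧
      (b₀ + b₁ * q.1 + b₂ * q.1 ^ 2) = 0 ∧ (c₀ + c₁ * q.1 + c₂ * q.1 ^ 2) = 0 := by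
    -- The identity also holds near each q close to p, so t can be frozen at q.1 and the polynomial
    -- in x split first.
    filter_upwards [h2] with q hq
    exact quadratic_eq_zero (eventually_snd hq)
  have k1 := eventually_fst key
  exact ⟨quadratic_eq_zero (k1.mono fun _ h => h.1), quadratic_eq_zero (k1.mono fun _ h => h.2.1),
    quadratic_eq_zero (k1.mono fun _ h => h.2.2)⟩

/-- The coordinates of an element of `𝔤` are determined by its values near a point. -/
theorem gv_eventually_eq {a b c d e k a' b' c' d' e' k' : ℝ} {p : ℝ × ℝ} {y : ℝ}
    (h : ∀ᶠ q in nhds p, gv a b c d e k (q.1, q.2, y) = gv a' b' c' d' e' k' (q.1, q.2, y)) :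
    a = a' ∧ b = b' ∧ c = c' ∧ d = d' ∧ e = e' ∧ k = k' := by
  -- The components τ and ξ already determine all six coordinates.
  have h1 := biquadratic_eq_zero (a₀ := a - a') (a₁ := c - c') (a₂ := k - k') (b₀ := 0) (b₁ := 0)
    (b₂ := 0) (c₀ := 0) (c₁ := 0) (c₂ := 0) (p := p) <| by
      filter_upwards [h] with q hq
      have := congrArg Prod.fst hq
      simp only [gv] at this
      linear_combination this
  have h2 := biquadratic_eq_zero (a₀ := b - b') (a₁ := e - e') (a₂ := 0) (b₀ := d - d')
    (b₁ := k - k') (b₂ := 0) (c₀ := 0) (c₁ := 0) (c₂ := 0) (p := p) <| by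
      filter_upwards [h] with q hq
      have := congrArg (fun z => z.2.1) hq
      simp only [gv] at this
      linear_combination this
  refine ⟨?_, ?_, ?_, ?_, ?_, ?_⟩ <;> linarith [h1.1.1, h1.1.2.1, h1.1.2.2, h2.1.1, h2.1.2.1,
    h2.1.2.2, h2.2.1.1, h2.2.1.2.1]

theorem gv_inj {a b c d e k a' b' c' d' e' k' : ℝ} :
    gv a b c d e k = gv a' b' c' d' e' k' ↔
      a = a' ∧ b = b' ∧ c = c' ∧ d = d' ∧ e = e' ∧ k = k' := by
  constructor
  · intro h
    exact gv_eventually_eq (p := 0) (y := 0) (by simp [h])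
  · rintro ⟨rfl, rfl, rfl, rfl, rfl, rfl⟩; rfl

theorem span_le_coords {S : Set VF} (M : Submodule ℝ VF) (hS : ∀ Q ∈ S, Q ∈ M) :
    Submodule.span ℝ S ≤ M := Submodule.span_le.2 hS

theorem mem_algG {Q : VF} : Q ∈ algG ↔ ∃ a b c d e k, Q = gv a b c d e k := by
  constructor
  · intro h
    refine Submodule.span_induction (p := fun Q _ => ∃ a b c d e k, Q = gv a b c d e k)
      ?_ ?_ ?_ ?_ h
    · rintro x (rfl | rfl | rfl | rfl | rfl | rfl)
      exacts [⟨_, _, _, _, _, _, vPt_eq⟩, ⟨_, _, _, _, _, _, vPx_eq⟩, ⟨_, _, _, _, _, _, vDt_eq⟩,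
        ⟨_, _, _, _, _, _, vDx_eq⟩, ⟨_, _, _, _, _, _, vG_eq⟩, ⟨_, _, _, _, _, _, vPi_eq⟩]
    · exact ⟨_, _, _, _, _, _, gv_zero.symm⟩
    · rintro _ _ _ _ ⟨a, b, c, d, e, k, rfl⟩ ⟨a', b', c', d', e', k', rfl⟩
      exact ⟨_, _, _, _, _, _, gv_add ..⟩
    · rintro l _ _ ⟨a, b, c, d, e, k, rfl⟩
      exact ⟨_, _, _, _, _, _, smul_gv ..⟩
  · rintro ⟨a, b, c, d, e, k, rfl⟩
    have : gv a b c d e k = a • vPt + b • vPx + c • vDt + d • vDx + e • vG + k • vPi := by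
      simp [vPt_eq, vPx_eq, vDt_eq, vDx_eq, vG_eq, vPi_eq, smul_gv, gv_add]
    rw [this]
    have hm : ∀ v ∈ ({vPt, vPx, vDt, vDx, vG, vPi} : Set VF), v ∈ algG :=
      fun v hv => Submodule.subset_span hv
    refine add_mem (add_mem (add_mem (add_mem (add_mem ?_ ?_) ?_) ?_) ?_) ?_ <;>
      exact Submodule.smul_mem _ _ (hm _ (by simp))

theorem gv_mem_algG (a b c d e k : ℝ) : gv a b c d e k ∈ algG := mem_algG.2 ⟨_, _, _, _, _, _, rfl⟩

theorem mem_nilrad {a b c d e k : ℝ} :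
    gv a b c d e k ∈ nilrad ↔ a = 0 ∧ c = 0 ∧ d = 0 ∧ k = 0 := by
  simp only [nilrad, vPx_eq, vG_eq, Submodule.mem_span_pair, smul_gv, gv_add, gv_inj]
  constructor
  · rintro ⟨x, y, h⟩; simp at h; tauto
  · rintro ⟨rfl, rfl, rfl, rfl⟩; exact ⟨b, e, by simp⟩

theorem mem_cartan {a b c d e k : ℝ} :
    gv a b c d e k ∈ cartan ↔ a = 0 ∧ b = 0 ∧ c = 0 ∧ e = 0 ∧ k = 0 := by
  simp only [cartan, vDx_eq, Submodule.mem_span_singleton, smul_gv, gv_inj]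
  constructor
  · rintro ⟨x, h⟩; simp at h; tauto
  · rintro ⟨rfl, rfl, rfl, rfl, rfl⟩; exact ⟨d, by simp⟩

theorem mem_rad {a b c d e k : ℝ} :
    gv a b c d e k ∈ rad ↔ a = 0 ∧ c = 0 ∧ k = 0 := by
  simp only [rad, vPx_eq, vG_eq, vDx_eq, Submodule.mem_span_triple, smul_gv, gv_add, gv_inj]
  constructor
  · rintro ⟨x, y, z, h⟩; simp at h; tauto
  · rintro ⟨rfl, rfl, rfl⟩; exact ⟨d, b, e, by simp⟩

theorem mem_levi {a b c d e k : ℝ} :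
    gv a b c d e k ∈ levi ↔ b = 0 ∧ 2 * d = c ∧ e = 0 := by
  simp only [levi, vPt_eq, vDt_eq, vDx_eq, vPi_eq, Submodule.mem_span_triple, smul_gv, gv_add,
    gv_inj]
  constructor
  · rintro ⟨x, y, z, h⟩; simp at h
    obtain ⟨rfl, rfl, rfl, rfl, rfl, rfl⟩ := h
    exact ⟨rfl, by ring, rfl⟩
  · rintro ⟨rfl, rfl, rfl⟩; exact ⟨a, 2 * d, k, by simp [mul_comm]⟩

theorem levi_le : levi ≤ algG := by
  refine span_le_coords _ ?_
  rintro Q (rfl | rfl | rfl) <;>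
    simp only [vPt_eq, vDt_eq, vDx_eq, vPi_eq, smul_gv, gv_add, gv_mem_algG]

theorem cartan_le : cartan ≤ algG := by
  refine span_le_coords _ ?_
  rintro Q rfl
  simp only [vDx_eq, gv_mem_algG]

theorem nilrad_le : nilrad ≤ algG := by
  refine span_le_coords _ ?_
  rintro Q (rfl | rfl) <;> simp only [vPx_eq, vG_eq, gv_mem_algG]

/-- The functional 2d - c, called the weight below, is thus up to a factor the projection to 𝔠 along
𝔣 ⊕ 𝔫; it is also the coefficient of f in the classifying condition. -/
theorem mem_levi_sup_nilrad {a b c d e k : ℝ} :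
    gv a b c d e k ∈ levi ⊔ nilrad ↔ 2 * d = c := by
  rw [Submodule.mem_sup]
  constructor
  · rintro ⟨y, hy, z, hz, h⟩
    obtain ⟨a1, b1, c1, d1, e1, k1, rfl⟩ := mem_algG.1 (levi_le hy)
    obtain ⟨a2, b2, c2, d2, e2, k2, rfl⟩ := mem_algG.1 (nilrad_le hz)
    rw [mem_levi] at hy
    rw [mem_nilrad] at hz
    rw [gv_add, gv_inj] at h
    linarith [h.2.2.1, h.2.2.2.1, hy.2.1, hz.2.1, hz.2.2.1]
  · intro h
    refine ⟨gv a 0 c d 0 k, mem_levi.2 ⟨rfl, h, rfl⟩, gv 0 b 0 0 e 0,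
      mem_nilrad.2 ⟨rfl, rfl, rfl, rfl⟩, ?_⟩
    simp [gv_add]

theorem mem_levi_sup_cartan {a b c d e k : ℝ} :
    gv a b c d e k ∈ levi ⊔ cartan ↔ b = 0 ∧ e = 0 := by
  rw [Submodule.mem_sup]
  constructor
  · rintro ⟨y, hy, z, hz, h⟩
    obtain ⟨a1, b1, c1, d1, e1, k1, rfl⟩ := mem_algG.1 (levi_le hy)
    obtain ⟨a2, b2, c2, d2, e2, k2, rfl⟩ := mem_algG.1 (cartan_le hz)
    rw [mem_levi] at hy
    rw [mem_cartan] at hz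
    rw [gv_add, gv_inj] at h
    constructor <;> linarith [h.2.1, h.2.2.2.2.1, hy.1, hy.2.2, hz.2.1, hz.2.2.2.1]
  · rintro ⟨rfl, rfl⟩
    refine ⟨gv a 0 c (c / 2) 0 k, mem_levi.2 ⟨rfl, by ring, rfl⟩, gv 0 0 0 (d - c / 2) 0 0,
      mem_cartan.2 ⟨rfl, rfl, rfl, rfl, rfl⟩, ?_⟩
    simp [gv_add]

/-! ### The bracket -/

theorem hasFDerivAt_gv (a b c d e k : ℝ) (p : E) :
    HasFDerivAt (gv a b c d e k)
      (((c + 2 * k * p.1) • ContinuousLinearMap.fst ℝ ℝ (ℝ × ℝ)).prod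
        (((e + k * p.2.1) • ContinuousLinearMap.fst ℝ ℝ (ℝ × ℝ)
          + (d + k * p.1) • (ContinuousLinearMap.fst ℝ ℝ ℝ ∘L ContinuousLinearMap.snd ℝ ℝ (ℝ × ℝ))).prod
        ((-k * p.2.2) • ContinuousLinearMap.fst ℝ ℝ (ℝ × ℝ)
          + k • (ContinuousLinearMap.fst ℝ ℝ ℝ ∘L ContinuousLinearMap.snd ℝ ℝ (ℝ × ℝ))
          + (d - c - k * p.1) • (ContinuousLinearMap.snd ℝ ℝ ℝ ∘L
            ContinuousLinearMap.snd ℝ ℝ (ℝ × ℝ))))) p := by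
  have h1 : HasFDerivAt (fun p : E => p.1) (ContinuousLinearMap.fst ℝ ℝ (ℝ × ℝ)) p :=
    hasFDerivAt_fst
  have h2 : HasFDerivAt (fun p : E => p.2.1)
    (ContinuousLinearMap.fst ℝ ℝ ℝ ∘L ContinuousLinearMap.snd ℝ ℝ (ℝ × ℝ)) p :=
    hasFDerivAt_fst.comp p hasFDerivAt_snd
  have h3 : HasFDerivAt (fun p : E => p.2.2)
    (ContinuousLinearMap.snd ℝ ℝ ℝ ∘L ContinuousLinearMap.snd ℝ ℝ (ℝ × ℝ)) p :=
    hasFDerivAt_snd.comp p hasFDerivAt_snd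
  refine HasFDerivAt.prodMk ?_ (HasFDerivAt.prodMk ?_ ?_)
  · refine (((h1.const_mul c).const_add a).add ((h1.pow 2).const_mul k)).congr_fderiv ?_
    exact ContinuousLinearMap.ext fun v => by simp; ring
  · refine ((((h2.const_mul d).const_add b).add (h1.const_mul e)).add
      ((h1.const_mul k).mul h2)).congr_fderiv ?_
    exact ContinuousLinearMap.ext fun v => by simp; ring
  · refine ((((h3.const_mul (d - c))).add_const e).add
      ((h2.sub (h1.mul h3)).const_mul k)).congr_fderiv ?_
    exact ContinuousLinearMap.ext fun v => by simp; ring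

theorem lieBracket_gv (a b c d e k a' b' c' d' e' k' : ℝ) :
    VectorField.lieBracket ℝ (gv a b c d e k) (gv a' b' c' d' e' k')
      = gv (a * c' - c * a') (a * e' + b * d' - a' * e - b' * d) (2 * (a * k' - k * a'))
          (a * k' - a' * k) (c * e' + e * d' + b * k' - c' * e - e' * d - b' * k)
          (c * k' - k * c') := by
  funext p
  rw [VectorField.lieBracket, (hasFDerivAt_gv a b c d e k p).fderiv,
    (hasFDerivAt_gv a' b' c' d' e' k' p).fderiv]
  simp only [gv, ContinuousLinearMap.prod_apply, smul_apply,
    add_apply, ContinuousLinearMap.comp_apply, ContinuousLinearMap.coe_fst',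
    ContinuousLinearMap.coe_snd', smul_eq_mul, Prod.mk_sub_mk, Prod.mk.injEq]
  refine ⟨by ring, by ring, by ring⟩

/-- The linear map from `aff(2, ℝ)` to `𝔤`. -/
def ofAff2 : aff2 →ₗ[ℝ] algG where
  toFun M := ⟨gv (M.1 1 0) (M.1 1 2) (M.1 0 0 - M.1 1 1) (-M.1 1 1) (M.1 0 2) (-M.1 0 1),
    gv_mem_algG _ _ _ _ _ _⟩
  map_add' M N := by
    apply Subtype.ext
    simp only [Submodule.coe_add, gv_add, gv_inj, Matrix.add_apply]
    refine ⟨trivial, trivial, ?_, ?_, trivial, ?_⟩ <;> ring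
  map_smul' l M := by
    apply Subtype.ext
    simp only [Submodule.coe_smul, smul_gv, gv_inj, Matrix.smul_apply, smul_eq_mul,
      RingHom.id_apply]
    refine ⟨trivial, trivial, ?_, ?_, trivial, ?_⟩ <;> ring

theorem ofAff2_bijective : Function.Bijective ofAff2 := by
  constructor
  · intro M N h
    have h' := congrArg Subtype.val h
    simp only [ofAff2, LinearMap.coe_mk, AddHom.coe_mk, gv_inj] at h'
    obtain ⟨h1, h2, h3, h4, h5, h6⟩ := h'
    apply Subtype.ext
    ext i j
    fin_cases i <;> fin_cases j <;> simp <;>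
      first
        | linarith
        | exact (M.2 _).trans (N.2 _).symm
  · rintro ⟨Q, hQ⟩
    obtain ⟨a, b, c, d, e, k, rfl⟩ := mem_algG.1 hQ
    refine ⟨⟨!![c - d, -k, e; a, -d, b; 0, 0, 0], ?_⟩, ?_⟩
    · intro j
      fin_cases j <;> simp
    · apply Subtype.ext
      simp [ofAff2]

/-- In homogeneous coordinates t = y₀/y₁, x = y₂/y₁ the fields of 𝔤 come from linear fields whose
matrices can be normalised to have zero last column. Transposition makes the last row zero and also
compensates the sign in the bracket of linear fields; `ofAff2` is the resulting dictionary. -/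
theorem algG_equiv_aff2 :
    ∃ φ : algG ≃ₗ[ℝ] aff2, ∀ X Y : algG, ∃ Z : algG,
      (Z : VF) = VectorField.lieBracket ℝ (X : VF) (Y : VF) ∧
        (φ Z : Matrix (Fin 3) (Fin 3) ℝ) = (φ X).1 * (φ Y).1 - (φ Y).1 * (φ X).1 := by
  let ψ := LinearEquiv.ofBijective ofAff2 ofAff2_bijective
  refine ⟨ψ.symm, fun X Y => ?_⟩
  obtain ⟨M, rfl⟩ := ψ.surjective X
  obtain ⟨N, rfl⟩ := ψ.surjective Y
  have hmem : M.1 * N.1 - N.1 * M.1 ∈ aff2 := by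
    intro j
    have h1 : ∀ j, M.1 2 j = 0 := M.2
    have h2 : ∀ j, N.1 2 j = 0 := N.2
    simp [Matrix.mul_apply, h1, h2]
  refine ⟨ψ ⟨_, hmem⟩, ?_, ?_⟩
  · have h1 : ∀ j, M.1 2 j = 0 := M.2
    have h2 : ∀ j, N.1 2 j = 0 := N.2
    change (ofAff2 ⟨_, hmem⟩ : algG).1 = VectorField.lieBracket ℝ (ofAff2 M).1 (ofAff2 N).1
    simp only [ofAff2, LinearMap.coe_mk, AddHom.coe_mk, lieBracket_gv, gv_inj, Matrix.sub_apply,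
      Matrix.mul_apply, Fin.sum_univ_three, h1, h2]
    refine ⟨by ring, by ring, by ring, by ring, by ring, by ring⟩
  · simp

/-! ### The determining equations -/

/-! ### Directional derivatives on the space of (t, x, u) -/

section calculus

variable {W : Set E} {F K : E → ℝ} {p : E}

theorem der_congr (hW : IsOpen W) (h : ∀ q ∈ W, F q = K q) (hp : p ∈ W) (v : E) :
    der v F p = der v K p := by
  have : F =ᶠ[nhds p] K := by filter_upwards [hW.mem_nhds hp] with q hq using h q hq
  simp [der, this.fderiv_eq]

theorem der_const (c : ℝ) (v : E) : der v (fun _ => c) p = 0 := by simp [der]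

theorem der_eq_zero (hW : IsOpen W) (h : ∀ q ∈ W, F q = 0) (hp : p ∈ W) (v : E) :
    der v F p = 0 := by
  rw [der_congr hW h hp, der_const]

theorem der_add (hF : DifferentiableAt ℝ F p) (hK : DifferentiableAt ℝ K p) (v : E) :
    der v (fun q => F q + K q) p = der v F p + der v K p := by
  simp [der, fderiv_fun_add hF hK]

theorem der_sub (hF : DifferentiableAt ℝ F p) (hK : DifferentiableAt ℝ K p) (v : E) :
    der v (fun q => F q - K q) p = der v F p - der v K p := by
  simp [der, fderiv_fun_sub hF hK]

theorem der_mul (hF : DifferentiableAt ℝ F p) (hK : DifferentiableAt ℝ K p) (v : E) :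
    der v (fun q => F q * K q) p = F p * der v K p + K p * der v F p := by
  simp [der, fderiv_fun_mul hF hK]

theorem der_t (v : E) : der v (fun q => q.1) p = v.1 := by
  simp [der, fderiv_fst]

theorem der_x (v : E) : der v (fun q => q.2.1) p = v.2.1 := by
  have : HasFDerivAt (fun p : E => p.2.1)
    (ContinuousLinearMap.fst ℝ ℝ ℝ ∘L ContinuousLinearMap.snd ℝ ℝ (ℝ × ℝ)) p :=
    hasFDerivAt_fst.comp p hasFDerivAt_snd
  simp [der, this.fderiv]

theorem der_u (v : E) : der v (fun q => q.2.2) p = v.2.2 := by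
  have : HasFDerivAt (fun p : E => p.2.2)
    (ContinuousLinearMap.snd ℝ ℝ ℝ ∘L ContinuousLinearMap.snd ℝ ℝ (ℝ × ℝ)) p :=
    hasFDerivAt_snd.comp p hasFDerivAt_snd
  simp [der, this.fderiv]

theorem der_comm (hW : IsOpen W) (hF : ContDiffOn ℝ ∞ F W) (hp : p ∈ W) (v w : E) :
    der v (der w F) p = der w (der v F) p := by
  have h1 : ContDiffAt ℝ ∞ F p := hF.contDiffAt (hW.mem_nhds hp)
  have h2 : DifferentiableAt ℝ (fderiv ℝ F) p :=
    (h1.fderiv_right (m := ∞) (by simp)).differentiableAt (by simp)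
  have h3 := (h1.isSymmSndFDerivAt (by simpa using ENat.LEInfty.out)).eq v w
  have e : ∀ v w : E, der v (der w F) p = fderiv ℝ (fderiv ℝ F) p v w := by
    intro v w
    have := (h2.hasFDerivAt.clm_apply (hasFDerivAt_const w p)).fderiv
    have e2 : der w F = fun q => fderiv ℝ F q w := rfl
    simp [der, e2, this]
  rw [e, e, h3]

theorem exists_const_of_der (hW : IsOpen W) (hc : IsPreconnected W) (hF : ContDiffOn ℝ ∞ F W)
    (h : ∀ q ∈ W, der (1, 0, 0) F q = 0 ∧ der (0, 1, 0) F q = 0 ∧ der (0, 0, 1) F q = 0) :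
    ∃ c, ∀ q ∈ W, F q = c := by
  refine hW.exists_is_const_of_fderiv_eq_zero hc (hF.differentiableOn (by simp)) ?_
  intro q hq
  obtain ⟨h1, h2, h3⟩ := h q hq
  refine ContinuousLinearMap.ext fun v => ?_
  have hv : v = v.1 • ((1, 0, 0) : E) + v.2.1 • ((0, 1, 0) : E) + v.2.2 • ((0, 0, 1) : E) := by
    simp
  simp only [der] at h1 h2 h3
  rw [hv]
  simp only [map_add, map_smul, h1, h2, h3]
  simp

end calculus

theorem isPreconnected_cyl {Ω : Set (ℝ × ℝ)} (h : IsPreconnected Ω) : IsPreconnected (cyl Ω) := by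
  have := (h.prod isPreconnected_univ (β := ℝ)).image (fun q : (ℝ × ℝ) × ℝ => (q.1.1, q.1.2, q.2))
    (by fun_prop)
  convert this using 1
  ext ⟨t, x, u⟩
  simp [cyl]

/-- The classifying condition for the coordinates of a vector field from `𝔤`, as an expression
that has to vanish. -/
def cls (f : ℝ × ℝ → ℝ) (p : ℝ × ℝ) (a b c d e k : ℝ) : ℝ :=
  (a + c * p.1 + k * p.1 ^ 2) * fderiv ℝ f p (1, 0)
    + (b + d * p.2 + e * p.1 + k * p.1 * p.2) * fderiv ℝ f p (0, 1) - (2 * d - c) * f p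

section gvder

variable (a b c d e k : ℝ) (v : E)

theorem der_tau_gv : der v (tau (gv a b c d e k)) = fun p => (c + 2 * k * p.1) * v.1 := by
  funext p
  have := (hasFDerivAt_gv a b c d e k p).fst
  simp only [der]
  rw [show tau (gv a b c d e k) = fun q => (gv a b c d e k q).1 from rfl, this.fderiv]
  simp

theorem der_xi_gv : der v (xi (gv a b c d e k))
    = fun p => (e + k * p.2.1) * v.1 + (d + k * p.1) * v.2.1 := by
  funext p
  have := (hasFDerivAt_gv a b c d e k p).snd.fst
  simp only [der]
  rw [show xi (gv a b c d e k) = fun q => (gv a b c d e k q).2.1 from rfl, this.fderiv]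
  simp

theorem der_eta_gv : der v (eta (gv a b c d e k))
    = fun p => -k * p.2.2 * v.1 + k * v.2.1 + (d - c - k * p.1) * v.2.2 := by
  funext p
  have := (hasFDerivAt_gv a b c d e k p).snd.snd
  simp only [der]
  rw [show eta (gv a b c d e k) = fun q => (gv a b c d e k q).2.2 from rfl, this.fderiv]
  simp

end gvder

/-- The first term vanishes on solutions of lhs = 0 and u_xx is free there, so for fields of 𝔤 the
invariance criterion is exactly the vanishing of `cls`. -/
theorem prolLhs_gv (f : ℝ × ℝ → ℝ) (a b c d e k : ℝ) (j : Jet) :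
    prolLhs f (gv a b c d e k) j
      = (d - 2 * c - 3 * k * j.t) * lhs f j + cls f (j.t, j.x) a b c d e k * j.uxx := by
  have a1 : ∀ (x y : ℝ) (v : E), der v (fun p => x * y) j.base = 0 := fun x y v => der_const _ v
  have hx : ∀ v : E, der v (fun p => (d + k * p.1)) j.base = k * v.1 := by
    intro v
    rw [der_add (by fun_prop) (by fun_prop), der_const, der_mul (by fun_prop) (by fun_prop),
      der_const, der_t]
    ring
  have hu : ∀ v : E, der v (fun p => (d - c - k * p.1)) j.base = -k * v.1 := by
    intro v
    rw [der_sub (by fun_prop) (by fun_prop), der_const, der_mul (by fun_prop) (by fun_prop),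
      der_const, der_t]
    ring
  simp only [prolLhs, prolT, prolX, prolXX, totT, totX, totXX, pdt, pdx, pdu, der_tau_gv,
    der_xi_gv, der_eta_gv, mul_zero, mul_one, add_zero, zero_add, der_const, hx, hu]
  simp only [cls, lhs, tau, xi, eta, gv, Jet.base]
  ring

theorem isLieSymmetry_gv {Ω : Set (ℝ × ℝ)} (hΩ : IsOpen Ω) {f : ℝ × ℝ → ℝ} {Q : VF}
    {a b c d e k : ℝ} (hQ : ∀ p ∈ cyl Ω, Q p = gv a b c d e k p)
    (h : ∀ p ∈ Ω, cls f p a b c d e k = 0) : IsLieSymmetry Ω f Q := by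
  have hW := isOpen_cyl hΩ
  refine ⟨?_, ?_⟩
  · have : ContDiff ℝ ∞ (gv a b c d e k) := by unfold gv; fun_prop
    exact this.contDiffOn.congr hQ
  · intro j hj h0
    have hp : j.base ∈ cyl Ω := hj
    have e1 : ∀ q ∈ cyl Ω, tau Q q = tau (gv a b c d e k) q := fun q hq => by
      simp [tau, hQ q hq]
    have e2 : ∀ q ∈ cyl Ω, xi Q q = xi (gv a b c d e k) q := fun q hq => by
      simp [xi, hQ q hq]
    have e3 : ∀ q ∈ cyl Ω, eta Q q = eta (gv a b c d e k) q := fun q hq => by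
      simp [eta, hQ q hq]
    have f1 : ∀ v, ∀ q ∈ cyl Ω, der v (tau Q) q = der v (tau (gv a b c d e k)) q :=
      fun v q hq => der_congr hW e1 hq v
    have f2 : ∀ v, ∀ q ∈ cyl Ω, der v (xi Q) q = der v (xi (gv a b c d e k)) q :=
      fun v q hq => der_congr hW e2 hq v
    have f3 : ∀ v, ∀ q ∈ cyl Ω, der v (eta Q) q = der v (eta (gv a b c d e k)) q :=
      fun v q hq => der_congr hW e3 hq v
    -- Q agrees with the polynomial field only over Ω; openness makes its first and second
    -- derivatives there agree as well.
    have key : prolLhs f Q j = prolLhs f (gv a b c d e k) j := by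
      simp only [prolLhs, prolT, prolX, prolXX, totT, totX, totXX, pdt, pdx, pdu, e1 _ hp, e2 _ hp,
        e3 _ hp, f1 _ _ hp, f2 _ _ hp, f3 _ _ hp, der_congr hW (f1 _) hp, der_congr hW (f2 _) hp,
        der_congr hW (f3 _) hp]
    rw [key, prolLhs_gv, h0, h _ hj]
    ring

section determining

variable {Ω : Set (ℝ × ℝ)} {f : ℝ × ℝ → ℝ} {Q : VF}

/-- The variable u_tx is not restricted by the equation and enters the criterion only through -2 f
u_tx D_xτ. Comparing the values 1 and 0 of u_tx gives τ_x + u_x τ_u = 0 for all u_x. The jets used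
have u_xx = 0, hence u_t = -u u_x. -/
theorem IsLieSymmetry.tau_eq (hΩ : ∀ p ∈ Ω, f p ≠ 0) (hQ : IsLieSymmetry Ω f Q) :
    ∀ p ∈ cyl Ω, der (0, 1, 0) (tau Q) p = 0 ∧ der (0, 0, 1) (tau Q) p = 0 := by
  rintro ⟨t, x, u⟩ hp
  have hf := hΩ _ hp
  simp only at hf
  have key : ∀ ux : ℝ, der (0, 1, 0) (tau Q) (t, x, u) + ux * der (0, 0, 1) (tau Q) (t, x, u) = 0 := by
    intro ux
    have h1 := hQ.invariant ⟨t, x, u, -u * ux, ux, 0, 1, 0⟩ hp (by simp [lhs])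
    have h0 := hQ.invariant ⟨t, x, u, -u * ux, ux, 0, 0, 0⟩ hp (by simp [lhs])
    simp only [prolLhs, prolT, prolX, prolXX, totT, totX, totXX, pdt, pdx, pdu, Jet.base] at h1 h0
    have : f (t, x) * (der (0, 1, 0) (tau Q) (t, x, u)
        + ux * der (0, 0, 1) (tau Q) (t, x, u)) = 0 := by
      linear_combination (1 / 2) * h0 - (1 / 2) * h1
    exact (mul_eq_zero.1 this).resolve_left hf
  have k0 := key 0
  have k1 := key 1
  constructor <;> linarith

/-- The determining equations for the components of a Lie symmetry, before integration. -/
theorem IsLieSymmetry.xi_u (hΩo : IsOpen Ω) (hΩ : ∀ p ∈ Ω, f p ≠ 0) (hQ : IsLieSymmetry Ω f Q) :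
    ∀ p ∈ cyl Ω, der (0, 0, 1) (xi Q) p = 0 := by
  have hW := isOpen_cyl hΩo
  have ht := hQ.tau_eq hΩ
  have t1 : ∀ v, ∀ p ∈ cyl Ω, der v (der (0, 1, 0) (tau Q)) p = 0 := fun v p hp =>
    der_eq_zero hW (fun q hq => (ht q hq).1) hp v
  have t2 : ∀ v, ∀ p ∈ cyl Ω, der v (der (0, 0, 1) (tau Q)) p = 0 := fun v p hp =>
    der_eq_zero hW (fun q hq => (ht q hq).2) hp v
  rintro ⟨t, x, u⟩ hp
  have hf := hΩ _ hp
  simp only at hf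
  have P := fun ux uxx : ℝ =>
    hQ.invariant ⟨t, x, u, -u * ux - f (t, x) * uxx, ux, 0, 0, uxx⟩ hp (by simp only [lhs]; ring)
  have h00 := P 0 0
  have h10 := P 1 0
  have h01 := P 0 1
  have h11 := P 1 1
  simp only [prolLhs, prolT, prolX, prolXX, totT, totX, totXX, pdt, pdx, pdu, Jet.base,
    (ht _ hp).1, (ht _ hp).2, t1 _ _ hp, t2 _ _ hp] at h00 h10 h01 h11
  -- The mixed second difference in (u_x, u_xx) isolates the coefficient of u_x u_xx, which is -2 f
  -- ξ_u.
  have : f (t, x) * der (0, 0, 1) (xi Q) (t, x, u) = 0 := by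
    linear_combination (-1 / 2) * (h11 - h10 - h01 + h00)
  exact (mul_eq_zero.1 this).resolve_left hf

/-- Once τ depends on t only and ξ_u = 0, the criterion with u_t eliminated is a polynomial in u_x
and u_xx. The four equations are its coefficients at u_x², u_xx, u_x and 1. -/
theorem IsLieSymmetry.determining (hΩo : IsOpen Ω) (hΩ : ∀ p ∈ Ω, f p ≠ 0)
    (hQ : IsLieSymmetry Ω f Q) : ∀ p ∈ cyl Ω,
      der (0, 0, 1) (der (0, 0, 1) (eta Q)) p = 0 ∧
      tau Q p * fderiv ℝ f (p.1, p.2.1) (1, 0) + xi Q p * fderiv ℝ f (p.1, p.2.1) (0, 1)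
        + (der (1, 0, 0) (tau Q) p - 2 * der (0, 1, 0) (xi Q) p) * f (p.1, p.2.1) = 0 ∧
      eta Q p + p.2.2 * (der (1, 0, 0) (tau Q) p - der (0, 1, 0) (xi Q) p)
        - der (1, 0, 0) (xi Q) p + f (p.1, p.2.1) * (2 * der (0, 1, 0) (der (0, 0, 1) (eta Q)) p
          - der (0, 1, 0) (der (0, 1, 0) (xi Q)) p) = 0 ∧
      der (1, 0, 0) (eta Q) p + p.2.2 * der (0, 1, 0) (eta Q) p
        + f (p.1, p.2.1) * der (0, 1, 0) (der (0, 1, 0) (eta Q)) p = 0 := by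
  have hW := isOpen_cyl hΩo
  have ht := hQ.tau_eq hΩ
  have hx := hQ.xi_u hΩo hΩ
  have t1 : ∀ v, ∀ p ∈ cyl Ω, der v (der (0, 1, 0) (tau Q)) p = 0 := fun v p hp =>
    der_eq_zero hW (fun q hq => (ht q hq).1) hp v
  have t2 : ∀ v, ∀ p ∈ cyl Ω, der v (der (0, 0, 1) (tau Q)) p = 0 := fun v p hp =>
    der_eq_zero hW (fun q hq => (ht q hq).2) hp v
  have x2 : ∀ v, ∀ p ∈ cyl Ω, der v (der (0, 0, 1) (xi Q)) p = 0 := fun v p hp =>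
    der_eq_zero hW hx hp v
  rintro ⟨t, x, u⟩ hp
  have hf := hΩ _ hp
  simp only at hf
  have P := fun ux uxx : ℝ =>
    hQ.invariant ⟨t, x, u, -u * ux - f (t, x) * uxx, ux, 0, 0, uxx⟩ hp (by simp only [lhs]; ring)
  have h00 := P 0 0
  have h10 := P 1 0
  have hm0 := P (-1) 0
  have h01 := P 0 1
  simp only [prolLhs, prolT, prolX, prolXX, totT, totX, totXX, pdt, pdx, pdu, Jet.base,
    (ht _ hp).1, (ht _ hp).2, t1 _ _ hp, t2 _ _ hp, hx _ hp, x2 _ _ hp] at h00 h10 h01 hm0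
  have huu : f (t, x) * der (0, 0, 1) (der (0, 0, 1) (eta Q)) (t, x, u) = 0 := by
    linear_combination (1 / 2) * (h10 + hm0 - 2 * h00)
  refine ⟨(mul_eq_zero.1 huu).resolve_left hf, ?_, ?_, ?_⟩
  · linear_combination h01 - h00
  · linear_combination (1 / 2) * (h10 - hm0)
  · linear_combination h00


theorem der_base (hΩo : IsOpen Ω) (hf : ContDiffOn ℝ ∞ f Ω) {p : E} (hp : p ∈ cyl Ω) :
    DifferentiableAt ℝ (fun q : E => f (q.1, q.2.1)) p ∧
      der (0, 0, 1) (fun q : E => f (q.1, q.2.1)) p = 0 := by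
  have h1 : DifferentiableAt ℝ f (p.1, p.2.1) :=
    (hf.contDiffAt (hΩo.mem_nhds hp)).differentiableAt (by simp)
  have h2 : HasFDerivAt (fun q : E => (q.1, q.2.1)) ((ContinuousLinearMap.fst ℝ ℝ (ℝ × ℝ)).prod
      (ContinuousLinearMap.fst ℝ ℝ ℝ ∘L ContinuousLinearMap.snd ℝ ℝ (ℝ × ℝ))) p :=
    hasFDerivAt_fst.prodMk (hasFDerivAt_fst.comp p hasFDerivAt_snd)
  have h3 : HasFDerivAt (fun q : E => f (q.1, q.2.1)) _ p := h1.hasFDerivAt.comp p h2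
  refine ⟨h3.differentiableAt, ?_⟩
  rw [der, h3.fderiv]
  exact map_zero (fderiv ℝ f (p.1, p.2.1))

/-- Differentiation in u removes f without any splitting on it. The coefficient of u_x
differentiated once gives η_u = ξ_x - τ_t; the free coefficient differentiated twice gives η_xu = 0,
hence ξ_xx = 0 and the formula for η. Substituting that formula back into the free coefficient and
its first u-derivative yields the two remaining equations. -/
theorem IsLieSymmetry.integrated (hf : IsGBE Ω f) (hQ : IsLieSymmetry Ω f Q) :
    ∀ p ∈ cyl Ω,
      eta Q p = p.2.2 * (der (0, 1, 0) (xi Q) p - der (1, 0, 0) (tau Q) p)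
        + der (1, 0, 0) (xi Q) p ∧
      der (0, 1, 0) (der (0, 1, 0) (xi Q)) p = 0 ∧
      der (1, 0, 0) (der (1, 0, 0) (xi Q)) p = 0 ∧
      der (1, 0, 0) (der (1, 0, 0) (tau Q)) p = 2 * der (1, 0, 0) (der (0, 1, 0) (xi Q)) p := by
  have hΩo := hf.isOpen
  have hW := isOpen_cyl hΩo
  have hT : ContDiffOn ℝ ∞ (tau Q) (cyl Ω) := hQ.smooth.fst
  have hX : ContDiffOn ℝ ∞ (xi Q) (cyl Ω) := hQ.smooth.snd.fst
  have hN : ContDiffOn ℝ ∞ (eta Q) (cyl Ω) := hQ.smooth.snd.snd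
  have ht := hQ.tau_eq hf.ne_zero
  have hx := hQ.xi_u hΩo hf.ne_zero
  have hdet := hQ.determining hΩo hf.ne_zero
  have dT := smooth_der hW hT
  have dX := smooth_der hW hX
  have dN := smooth_der hW hN
  have ddX := fun v w => smooth_der hW (dX v) w
  have ddN := fun v w => smooth_der hW (dN v) w
  have dfb := fun {p : E} (hp : p ∈ cyl Ω) => der_base hΩo hf.smooth hp
  have du : ∀ p : E, DifferentiableAt ℝ (fun q : E => q.2.2) p := fun p => by fun_prop
  -- derivatives in `u` of derivatives of `τ` and `ξ` vanish
  have Tu : ∀ v, ∀ p ∈ cyl Ω, der (0, 0, 1) (der v (tau Q)) p = 0 := fun v p hp => by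
    rw [der_comm hW hT hp]; exact der_eq_zero hW (fun q hq => (ht q hq).2) hp v
  have Xu : ∀ v, ∀ p ∈ cyl Ω, der (0, 0, 1) (der v (xi Q)) p = 0 := fun v p hp => by
    rw [der_comm hW hX hp]; exact der_eq_zero hW hx hp v
  have Xuu : ∀ v w, ∀ p ∈ cyl Ω, der (0, 0, 1) (der w (der v (xi Q))) p = 0 := fun v w p hp => by
    rw [der_comm hW (dX v) hp]; exact der_eq_zero hW (Xu v) hp w
  have Nuu : ∀ v, ∀ p ∈ cyl Ω, der (0, 0, 1) (der v (der (0, 0, 1) (eta Q))) p = 0 :=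
    fun v p hp => by
      rw [der_comm hW (dN _) hp]; exact der_eq_zero hW (fun q hq => (hdet q hq).1) hp v
  have S1 : ∀ p ∈ cyl Ω, der (0, 0, 1) (eta Q) p
      = der (0, 1, 0) (xi Q) p - der (1, 0, 0) (tau Q) p := by
    intro p hp
    have h := der_eq_zero hW (fun q hq => (hdet q hq).2.2.1) hp (0, 0, 1)
    have a1 := diffAt hW hN hp
    have a2 := fun v => diffAt hW (dT v) hp
    have a3 := fun v => diffAt hW (dX v) hp
    have a4 := fun v w => diffAt hW (ddX v w) hp
    have a5 := fun v w => diffAt hW (ddN v w) hp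
    have a6 := du p
    have a7 := (dfb hp).1
    have b1 := (a2 (1, 0, 0)).fun_sub (a3 (0, 1, 0))
    have b2 := a6.fun_mul b1
    have b3 := ((a5 (0, 0, 1) (0, 1, 0)).const_mul 2).fun_sub (a4 (0, 1, 0) (0, 1, 0))
    rw [der_add ((a1.fun_add b2).fun_sub (a3 _)) (a7.fun_mul b3), der_sub (a1.fun_add b2) (a3 _), der_add a1 b2,
      der_mul a6 b1, der_sub (a2 _) (a3 _), der_mul a7 b3, der_sub ((a5 _ _).const_mul 2) (a4 _ _),
      der_mul (differentiableAt_const _) (a5 _ _), (dfb hp).2, Tu _ _ hp, Xu _ _ hp, Xuu _ _ _ hp,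
      Nuu _ _ hp, der_u, Xu _ _ hp, der_const] at h
    linear_combination h
  have S1' : ∀ v, ∀ p ∈ cyl Ω, der v (der (0, 0, 1) (eta Q)) p
      = der v (der (0, 1, 0) (xi Q)) p - der v (der (1, 0, 0) (tau Q)) p := fun v p hp => by
    rw [der_congr hW S1 hp, der_sub (diffAt hW (dX _) hp) (diffAt hW (dT _) hp)]
  have Tx : ∀ v, ∀ p ∈ cyl Ω, der (0, 1, 0) (der v (tau Q)) p = 0 := fun v p hp => by
    rw [der_comm hW hT hp]; exact der_eq_zero hW (fun q hq => (ht q hq).1) hp v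
  -- the last determining equation, differentiated in `u`
  have S2 : ∀ p ∈ cyl Ω, der (1, 0, 0) (der (0, 0, 1) (eta Q)) p + der (0, 1, 0) (eta Q) p
      + p.2.2 * der (0, 1, 0) (der (0, 0, 1) (eta Q)) p
      + f (p.1, p.2.1) * der (0, 1, 0) (der (0, 1, 0) (der (0, 0, 1) (eta Q))) p = 0 := by
    intro p hp
    have h := der_eq_zero hW (fun q hq => (hdet q hq).2.2.2) hp (0, 0, 1)
    have a2 := fun v => diffAt hW (dN v) hp
    have a5 := fun v w => diffAt hW (ddN v w) hp
    have a6 := du p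
    have a7 := (dfb hp).1
    rw [der_add ((a2 _).fun_add (a6.fun_mul (a2 _))) (a7.fun_mul (a5 _ _)), der_add (a2 _) (a6.fun_mul (a2 _)),
      der_mul a6 (a2 _), der_mul a7 (a5 _ _), (dfb hp).2, der_u,
      der_comm hW hN hp (0, 0, 1) (1, 0, 0), der_comm hW hN hp (0, 0, 1) (0, 1, 0),
      der_comm hW (dN _) hp (0, 0, 1) (0, 1, 0),
      der_congr hW (fun q hq => der_comm hW hN hq (0, 0, 1) (0, 1, 0)) hp] at h
    linear_combination h
  have S3 : ∀ p ∈ cyl Ω, der (0, 1, 0) (der (0, 0, 1) (eta Q)) p = 0 := by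
    intro p hp
    have h := der_eq_zero hW S2 hp (0, 0, 1)
    have a2 := fun v => diffAt hW (dN v) hp
    have a5 := fun v w => diffAt hW (ddN v w) hp
    have a8 := diffAt hW (smooth_der hW (ddN (0, 0, 1) (0, 1, 0)) (0, 1, 0)) hp
    have a6 := du p
    have a7 := (dfb hp).1
    have Nuuu : der (0, 0, 1) (der (0, 1, 0) (der (0, 1, 0) (der (0, 0, 1) (eta Q)))) p = 0 := by
      rw [der_comm hW (ddN _ _) hp]
      exact der_eq_zero hW (Nuu _) hp _
    rw [der_add (((a5 _ _).fun_add (a2 _)).fun_add (a6.fun_mul (a5 _ _))) (a7.fun_mul a8),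
      der_add ((a5 _ _).fun_add (a2 _)) (a6.fun_mul (a5 _ _)), der_add (a5 _ _) (a2 _),
      der_mul a6 (a5 _ _), der_mul a7 a8, (dfb hp).2, der_u, Nuu _ _ hp, Nuu _ _ hp, Nuuu,
      der_comm hW hN hp] at h
    linear_combination (1 / 2) * h
  have Xxx : ∀ p ∈ cyl Ω, der (0, 1, 0) (der (0, 1, 0) (xi Q)) p = 0 := fun p hp => by
    have := S1' (0, 1, 0) p hp
    rw [S3 p hp, Tx _ p hp] at this
    linarith
  have S4 : ∀ p ∈ cyl Ω, eta Q p
      = p.2.2 * (der (0, 1, 0) (xi Q) p - der (1, 0, 0) (tau Q) p) + der (1, 0, 0) (xi Q) p := by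
    intro p hp
    have := (hdet p hp).2.2.1
    rw [S3 p hp, Xxx p hp] at this
    linear_combination this
  have S5 : ∀ v, ∀ p ∈ cyl Ω, der v (eta Q) p
      = p.2.2 * (der v (der (0, 1, 0) (xi Q)) p - der v (der (1, 0, 0) (tau Q)) p)
        + (der (0, 1, 0) (xi Q) p - der (1, 0, 0) (tau Q) p) * v.2.2
        + der v (der (1, 0, 0) (xi Q)) p := by
    intro v p hp
    have a2 := fun v => diffAt hW (dT v) hp
    have a3 := fun v => diffAt hW (dX v) hp
    rw [der_congr hW S4 hp, der_add ((du p).fun_mul ((a3 _).fun_sub (a2 _))) (a3 _),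
      der_mul (du p) ((a3 _).fun_sub (a2 _)), der_sub (a3 _) (a2 _), der_u]
  have S6 : ∀ p ∈ cyl Ω, der (0, 1, 0) (eta Q) p = der (1, 0, 0) (der (0, 1, 0) (xi Q)) p := by
    intro p hp
    rw [S5 _ p hp, Xxx p hp, Tx _ p hp, der_comm hW hX hp]
    simp
  have S7 : ∀ p ∈ cyl Ω, der (1, 0, 0) (der (1, 0, 0) (tau Q)) p
      = 2 * der (1, 0, 0) (der (0, 1, 0) (xi Q)) p := by
    intro p hp
    have := S2 p hp
    rw [S3 p hp, der_eq_zero hW S3 hp, S6 p hp, S1' _ p hp] at this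
    linear_combination -this
  refine fun p hp => ⟨S4 p hp, Xxx p hp, ?_, S7 p hp⟩
  have h1 := (hdet p hp).2.2.2
  have h2 : der (0, 1, 0) (der (0, 1, 0) (eta Q)) p = 0 := by
    rw [der_congr hW S6 hp, der_comm hW (dX _) hp]
    exact der_eq_zero hW Xxx hp _
  rw [h2, S6 p hp, S5 _ p hp, S7 p hp] at h1
  linear_combination h1

/-- The system from `IsLieSymmetry.integrated` is integrated from the top: ξ_tx is a constant k,
then ξ_t - kx, ξ_x - kt, τ_t - 2kt, and finally ξ and τ minus their polynomial parts have zero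
gradient. Connectedness of Ω makes each of these a single constant. -/
theorem isLieSymmetry_iff (hf : IsGBE Ω f) : IsLieSymmetry Ω f Q ↔ ∃ a b c d e k,
    (∀ p ∈ cyl Ω, Q p = gv a b c d e k p) ∧ ∀ p ∈ Ω, cls f p a b c d e k = 0 := by
  refine ⟨fun hQ => ?_, fun ⟨a, b, c, d, e, k, h1, h2⟩ => isLieSymmetry_gv hf.isOpen h1 h2⟩
  have hΩo := hf.isOpen
  have hW := isOpen_cyl hΩo
  have hc := isPreconnected_cyl hf.isConnected.isPreconnected
  have hT : ContDiffOn ℝ ∞ (tau Q) (cyl Ω) := hQ.smooth.fst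
  have hX : ContDiffOn ℝ ∞ (xi Q) (cyl Ω) := hQ.smooth.snd.fst
  have ht := hQ.tau_eq hf.ne_zero
  have hx := hQ.xi_u hΩo hf.ne_zero
  have hi := hQ.integrated hf
  have dT := smooth_der hW hT
  have dX := smooth_der hW hX
  have Tu : ∀ v, ∀ p ∈ cyl Ω, der (0, 0, 1) (der v (tau Q)) p = 0 := fun v p hp => by
    rw [der_comm hW hT hp]; exact der_eq_zero hW (fun q hq => (ht q hq).2) hp v
  have Tx : ∀ v, ∀ p ∈ cyl Ω, der (0, 1, 0) (der v (tau Q)) p = 0 := fun v p hp => by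
    rw [der_comm hW hT hp]; exact der_eq_zero hW (fun q hq => (ht q hq).1) hp v
  have Xu : ∀ v, ∀ p ∈ cyl Ω, der (0, 0, 1) (der v (xi Q)) p = 0 := fun v p hp => by
    rw [der_comm hW hX hp]; exact der_eq_zero hW hx hp v
  obtain ⟨k, hk⟩ := exists_const_of_der hW hc (smooth_der hW (dX (0, 1, 0)) (1, 0, 0))
    (fun p hp => ⟨by
      rw [der_congr hW (fun q hq => der_comm hW hX hq (1, 0, 0) (0, 1, 0)) hp,
        der_comm hW (dX _) hp]
      exact der_eq_zero hW (fun q hq => (hi q hq).2.2.1) hp _, by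
      rw [der_comm hW (dX _) hp]
      exact der_eq_zero hW (fun q hq => (hi q hq).2.1) hp _, by
      rw [der_comm hW (dX _) hp]
      exact der_eq_zero hW (Xu _) hp _⟩)
  have ct : ContDiffOn ℝ ∞ (fun q : E => q.1) (cyl Ω) := by fun_prop
  have cx : ContDiffOn ℝ ∞ (fun q : E => q.2.1) (cyl Ω) := by fun_prop
  have tt : ∀ {p : E}, DifferentiableAt ℝ (fun q : E => q.1) p := by fun_prop
  have xx : ∀ {p : E}, DifferentiableAt ℝ (fun q : E => q.2.1) p := by fun_prop
  obtain ⟨e, he⟩ := exists_const_of_der hW hc (F := fun q => der (1, 0, 0) (xi Q) q - k * q.2.1)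
    ((dX _).sub (contDiffOn_const.mul cx)) (fun p hp => by
      have a := fun v => diffAt hW (dX v) hp
      have D : ∀ v, der v (fun q => der (1, 0, 0) (xi Q) q - k * q.2.1) p
          = der v (der (1, 0, 0) (xi Q)) p - k * v.2.1 := fun v => by
        rw [der_sub (a _) (xx.const_mul k), der_mul (differentiableAt_const k) xx, der_x, der_const]
        ring
      rw [D, D, D, (hi p hp).2.2.1, der_comm hW hX hp, hk p hp, Xu _ p hp]
      simp)
  obtain ⟨d, hd⟩ := exists_const_of_der hW hc (F := fun q => der (0, 1, 0) (xi Q) q - k * q.1)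
    ((dX _).sub (contDiffOn_const.mul ct)) (fun p hp => by
      have a := fun v => diffAt hW (dX v) hp
      have D : ∀ v, der v (fun q => der (0, 1, 0) (xi Q) q - k * q.1) p
          = der v (der (0, 1, 0) (xi Q)) p - k * v.1 := fun v => by
        rw [der_sub (a _) (tt.const_mul k), der_mul (differentiableAt_const k) tt, der_t, der_const]
        ring
      rw [D, D, D, (hi p hp).2.1, hk p hp, Xu _ p hp]
      simp)
  obtain ⟨c, hc'⟩ := exists_const_of_der hW hc
    (F := fun q => der (1, 0, 0) (tau Q) q - 2 * k * q.1)
    ((dT _).sub (contDiffOn_const.mul ct)) (fun p hp => by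
      have a := fun v => diffAt hW (dT v) hp
      have D : ∀ v, der v (fun q => der (1, 0, 0) (tau Q) q - 2 * k * q.1) p
          = der v (der (1, 0, 0) (tau Q)) p - 2 * k * v.1 := fun v => by
        rw [der_sub (a _) (tt.const_mul _), der_mul (differentiableAt_const _) tt, der_t, der_const]
        ring
      rw [D, D, D, (hi p hp).2.2.2, Tx _ p hp, Tu _ p hp, hk p hp]
      simp)
  obtain ⟨b, hb⟩ := exists_const_of_der hW hc
    (F := fun q => xi Q q - (d * q.2.1 + e * q.1 + k * (q.1 * q.2.1)))
    (hX.sub (((contDiffOn_const.mul cx).add (contDiffOn_const.mul ct)).add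
      (contDiffOn_const.mul (ct.mul cx)))) (fun p hp => by
      have a := diffAt hW hX hp
      have D : ∀ v, der v (fun q => xi Q q - (d * q.2.1 + e * q.1 + k * (q.1 * q.2.1))) p
          = der v (xi Q) p - (d * v.2.1 + e * v.1 + k * (p.1 * v.2.1 + p.2.1 * v.1)) := fun v => by
        rw [der_sub a (((xx.const_mul d).fun_add (tt.const_mul e)).fun_add ((tt.fun_mul xx).const_mul k)),
          der_add ((xx.const_mul d).fun_add (tt.const_mul e)) ((tt.fun_mul xx).const_mul k),
          der_add (xx.const_mul d) (tt.const_mul e), der_mul (differentiableAt_const _) xx,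
          der_mul (differentiableAt_const _) tt, der_mul (differentiableAt_const _) (tt.fun_mul xx),
          der_mul tt xx, der_t, der_x, der_const, der_const, der_const]
        ring
      have h1 := he p hp
      have h2 := hd p hp
      have h3 := hx p hp
      refine ⟨?_, ?_, ?_⟩ <;> rw [D]
      · simp only [mul_zero, mul_one]; linarith
      · simp only [mul_zero, mul_one]; linarith
      · simp [h3])
  obtain ⟨a, ha⟩ := exists_const_of_der hW hc
    (F := fun q => tau Q q - (c * q.1 + k * (q.1 * q.1)))
    (hT.sub ((contDiffOn_const.mul ct).add (contDiffOn_const.mul (ct.mul ct)))) (fun p hp => by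
      have a := diffAt hW hT hp
      have D : ∀ v, der v (fun q => tau Q q - (c * q.1 + k * (q.1 * q.1))) p
          = der v (tau Q) p - (c * v.1 + k * (p.1 * v.1 + p.1 * v.1)) := fun v => by
        rw [der_sub a ((tt.const_mul c).fun_add ((tt.fun_mul tt).const_mul k)),
          der_add (tt.const_mul c) ((tt.fun_mul tt).const_mul k),
          der_mul (differentiableAt_const _) tt, der_mul (differentiableAt_const _) (tt.fun_mul tt),
          der_mul tt tt, der_t, der_const, der_const]
        ring
      have h1 := hc' p hp
      have h2 := ht p hp
      refine ⟨?_, ?_, ?_⟩ <;> rw [D]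
      · simp only [mul_one]; linarith
      · simp [h2.1]
      · simp [h2.2])
  refine ⟨a, b, c, d, e, k, ?_, ?_⟩
  · intro p hp
    refine Prod.ext ?_ (Prod.ext ?_ ?_)
    · have := ha p hp
      simp only [tau] at this
      simp only [gv]; linear_combination this
    · have := hb p hp
      simp only [xi] at this
      simp only [gv]; linear_combination this
    · have h1 := (hi p hp).1
      have h2 := he p hp
      have h3 := hd p hp
      have h4 := hc' p hp
      simp only [eta] at h1
      simp only [gv]
      linear_combination h1 + h2 + p.2.2 * h3 - p.2.2 * h4
  · rintro ⟨t, x⟩ hp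
    -- The classifying condition does not involve u, so the slice u = 0 is enough.
    have hp' : (t, x, 0) ∈ cyl Ω := hp
    have h := (hQ.determining hΩo hf.ne_zero _ hp').2.1
    have h1 := ha _ hp'
    have h2 := hb _ hp'
    have h3 := hd _ hp'
    have h4 := hc' _ hp'
    simp only at h h1 h2 h3 h4
    simp only [cls]
    linear_combination h - fderiv ℝ f (t, x) (1, 0) * h1 - fderiv ℝ f (t, x) (0, 1) * h2
      - f (t, x) * h4 + 2 * f (t, x) * h3

end determining

/-! ### The maximal Lie invariance algebra as a subspace of `𝔤` -/

/-- The subspace of the elements of `𝔤` that satisfy the classifying condition. -/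
def symAlg (Ω : Set (ℝ × ℝ)) (f : ℝ × ℝ → ℝ) : Submodule ℝ VF where
  carrier := {Q | ∃ a b c d e k, Q = gv a b c d e k ∧ ∀ p ∈ Ω, cls f p a b c d e k = 0}
  zero_mem' := ⟨0, 0, 0, 0, 0, 0, gv_zero.symm, fun p _ => by simp [cls]⟩
  add_mem' := by
    rintro _ _ ⟨a, b, c, d, e, k, rfl, h⟩ ⟨a', b', c', d', e', k', rfl, h'⟩
    refine ⟨_, _, _, _, _, _, gv_add .., fun p hp => ?_⟩
    have h1 := h p hp
    have h2 := h' p hp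
    simp only [cls] at h1 h2 ⊢
    linear_combination h1 + h2
  smul_mem' := by
    rintro l _ ⟨a, b, c, d, e, k, rfl, h⟩
    refine ⟨_, _, _, _, _, _, smul_gv .., fun p hp => ?_⟩
    have h1 := h p hp
    simp only [cls] at h1 ⊢
    linear_combination l * h1

section symAlg

variable {Ω : Set (ℝ × ℝ)} {f : ℝ × ℝ → ℝ}

theorem mem_symAlg {a b c d e k : ℝ} :
    gv a b c d e k ∈ symAlg Ω f ↔ ∀ p ∈ Ω, cls f p a b c d e k = 0 := by
  constructor
  · rintro ⟨a', b', c', d', e', k', h, h'⟩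
    obtain ⟨rfl, rfl, rfl, rfl, rfl, rfl⟩ := gv_inj.1 h
    exact h'
  · intro h
    exact ⟨_, _, _, _, _, _, rfl, h⟩

theorem symAlg_le : symAlg Ω f ≤ algG := by
  rintro _ ⟨a, b, c, d, e, k, rfl, h⟩
  exact gv_mem_algG _ _ _ _ _ _

/-- This replaces 𝔤_f by the subspace `symAlg` of 𝔤, on which all further arguments are carried out
in coordinates. -/
theorem maxAlg_eq (hf : IsGBE Ω f) : maxAlg Ω f = (symAlg Ω f).map (res Ω) := by
  apply le_antisymm
  · rintro _ ⟨Q, hQ, rfl⟩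
    have hQ' : IsLieSymmetry (interior Ω) f Q := hQ
    rw [hf.isOpen.interior_eq] at hQ'
    obtain ⟨a, b, c, d, e, k, h1, h2⟩ := (isLieSymmetry_iff hf).1 hQ'
    refine ⟨gv a b c d e k, mem_symAlg.2 h2, ?_⟩
    funext p
    exact (h1 p.1 p.2).symm
  · rintro _ ⟨_, ⟨a, b, c, d, e, k, rfl, h⟩, rfl⟩
    refine ⟨gv a b c d e k, ?_, rfl⟩
    change IsLieSymmetry (interior Ω) f _
    rw [hf.isOpen.interior_eq]
    exact isLieSymmetry_gv hf.isOpen (fun _ _ => rfl) h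

theorem res_injOn (hΩ : IsOpen Ω) (hne : Ω.Nonempty) {Q R : VF} (hQ : Q ∈ algG) (hR : R ∈ algG)
    (h : res Ω Q = res Ω R) : Q = R := by
  obtain ⟨a, b, c, d, e, k, rfl⟩ := mem_algG.1 hQ
  obtain ⟨a', b', c', d', e', k', rfl⟩ := mem_algG.1 hR
  obtain ⟨p, hp⟩ := hne
  rw [gv_inj]
  refine gv_eventually_eq (p := p) (y := 0) ?_
  filter_upwards [hΩ.mem_nhds hp] with q hq
  exact congrFun h ⟨(q.1, q.2, 0), hq⟩

theorem map_res_inj (hΩ : IsOpen Ω) (hne : Ω.Nonempty) {s s' : Submodule ℝ VF} (hs : s ≤ algG)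
    (hs' : s' ≤ algG) : s.map (res Ω) = s'.map (res Ω) ↔ s = s' := by
  refine ⟨fun h => ?_, fun h => h ▸ rfl⟩
  apply le_antisymm
  · intro Q hQ
    have : res Ω Q ∈ s'.map (res Ω) := h ▸ ⟨Q, hQ, rfl⟩
    obtain ⟨R, hR, hRQ⟩ := this
    rwa [← res_injOn hΩ hne (hs' hR) (hs hQ) hRQ]
  · intro Q hQ
    have : res Ω Q ∈ s.map (res Ω) := h ▸ ⟨Q, hQ, rfl⟩
    obtain ⟨R, hR, hRQ⟩ := this
    rwa [← res_injOn hΩ hne (hs hR) (hs' hQ) hRQ]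

theorem maxAlg_eq_map_iff (hf : IsGBE Ω f) {s : Submodule ℝ VF} (hs : s ≤ algG) :
    maxAlg Ω f = s.map (res Ω) ↔ symAlg Ω f = s := by
  rw [maxAlg_eq hf, map_res_inj hf.isOpen hf.isConnected.nonempty symAlg_le hs]

theorem finrank_maxAlg (hf : IsGBE Ω f) :
    Module.finrank ℝ (maxAlg Ω f) = Module.finrank ℝ (symAlg Ω f) := by
  rw [maxAlg_eq hf]
  have inj : Function.Injective ((res Ω).domRestrict (symAlg Ω f)) := by
    intro Q R h
    exact Subtype.ext (res_injOn hf.isOpen hf.isConnected.nonempty (symAlg_le Q.2)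
      (symAlg_le R.2) h)
  rw [← LinearMap.finrank_range_of_inj inj, LinearMap.range_domRestrict]

theorem isAppropriate_iff {s : Submodule ℝ VF} :
    IsAppropriate s ↔ ∃ Ω f, IsGBE Ω f ∧ symAlg Ω f = s := by
  constructor
  · rintro ⟨hs, Ω, f, hf, h⟩
    exact ⟨Ω, f, hf, (maxAlg_eq_map_iff hf hs).1 h⟩
  · rintro ⟨Ω, f, hf, rfl⟩
    exact ⟨symAlg_le, Ω, f, hf, maxAlg_eq hf⟩

end symAlg

/-! ### The equivalence group -/

theorem hasFDerivAt_div {V : Type*} [NormedAddCommGroup V] [NormedSpace ℝ V] {F K : V → ℝ}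
    {F' K' : V →L[ℝ] ℝ} {p : V} (hF : HasFDerivAt F F' p) (hK : HasFDerivAt K K' p)
    (h : K p ≠ 0) :
    HasFDerivAt (fun q => F q / K q) ((1 / K p) • F' - (F p / K p ^ 2) • K') p := by
  have h1 := hF.mul ((hasDerivAt_inv h).comp_hasFDerivAt p hK)
  simp only [div_eq_mul_inv]
  refine h1.congr_fderiv ?_
  refine ContinuousLinearMap.ext fun v => ?_
  simp
  field_simp
  ring

namespace EqTrans

variable (T : EqTrans)

theorem fderiv_onE {p : E} (hp : T.γ * p.1 + T.δ ≠ 0) (v : E) :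
    fderiv ℝ T.onE p v
      = ((T.α * T.δ - T.β * T.γ) * v.1 / (T.γ * p.1 + T.δ) ^ 2,
        ((T.κ * v.2.1 + T.μ₁ * v.1) * (T.γ * p.1 + T.δ)
          - (T.κ * p.2.1 + T.μ₁ * p.1 + T.μ₀) * (T.γ * v.1)) / (T.γ * p.1 + T.δ) ^ 2,
        (T.κ * (T.γ * v.1) * p.2.2 + T.κ * (T.γ * p.1 + T.δ) * v.2.2 - T.κ * T.γ * v.2.1)
          / (T.α * T.δ - T.β * T.γ)) := by
  have h1 : HasFDerivAt (fun p : E => p.1) (ContinuousLinearMap.fst ℝ ℝ (ℝ × ℝ)) p :=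
    hasFDerivAt_fst
  have h2 : HasFDerivAt (fun p : E => p.2.1)
    (ContinuousLinearMap.fst ℝ ℝ ℝ ∘L ContinuousLinearMap.snd ℝ ℝ (ℝ × ℝ)) p :=
    hasFDerivAt_fst.comp p hasFDerivAt_snd
  have h3 : HasFDerivAt (fun p : E => p.2.2)
    (ContinuousLinearMap.snd ℝ ℝ ℝ ∘L ContinuousLinearMap.snd ℝ ℝ (ℝ × ℝ)) p :=
    hasFDerivAt_snd.comp p hasFDerivAt_snd
  have hd := (h1.const_mul T.γ).add_const T.δ
  have e1 := hasFDerivAt_div ((h1.const_mul T.α).add_const T.β) hd hp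
  have e2 := hasFDerivAt_div (((h2.const_mul T.κ).add (h1.const_mul T.μ₁)).add_const T.μ₀) hd hp
  have e3 := ((((((hd.const_mul T.κ).mul h3).sub (h2.const_mul (T.κ * T.γ)))).add_const
    (T.μ₁ * T.δ)).sub_const (T.μ₀ * T.γ)).mul_const ((T.α * T.δ - T.β * T.γ)⁻¹)
  have e : HasFDerivAt T.onE _ p := e1.prodMk (e2.prodMk e3)
  rw [e.fderiv]
  have hΔ := T.det_ne
  refine Prod.ext ?_ (Prod.ext ?_ ?_) <;> simp <;> field_simp <;> ring

/-- The relation between the coordinates of a vector field and of its pushforward by `T`: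
`A' B = B A` and `n' B = μ A + κ n` for the matrices `B` and `A`, `A'` and the rows `μ`, `n`, `n'`
that represent the transformation and the vector fields. -/
def Inter (a b c d e k a' b' c' d' e' k' : ℝ) : Prop :=
  (c' - d') * T.α + a' * T.γ = T.α * (c - d) - T.β * k ∧
  (c' - d') * T.β + a' * T.δ = T.α * a - T.β * d ∧
  -k' * T.α - d' * T.γ = T.γ * (c - d) - T.δ * k ∧
  -k' * T.β - d' * T.δ = T.γ * a - T.δ * d ∧
  e' * T.α + b' * T.γ = T.μ₁ * (c - d) - T.μ₀ * k + T.κ * e ∧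
  e' * T.β + b' * T.δ = T.μ₁ * a - T.μ₀ * d + T.κ * b

variable {T}

theorem Inter.pushes {a b c d e k a' b' c' d' e' k' : ℝ}
    (h : T.Inter a b c d e k a' b' c' d' e' k') :
    T.Pushes (gv a b c d e k) (gv a' b' c' d' e' k') := by
  obtain ⟨h1, h2, h3, h4, h5, h6⟩ := h
  rintro ⟨t, x, u⟩ hp
  have hΔ := T.det_ne
  rw [T.fderiv_onE hp]
  simp only at hp
  refine Prod.ext ?_ (Prod.ext ?_ ?_) <;> simp only [gv, onE]
  · generalize hs : T.γ * t + T.δ = s at hp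
    have : a' + c' * ((T.α * t + T.β) / s) + k' * ((T.α * t + T.β) / s) ^ 2
        = (a' * s ^ 2 + c' * (T.α * t + T.β) * s + k' * (T.α * t + T.β) ^ 2) / s ^ 2 := by
      field_simp
    rw [this, ← hs]
    congr 1
    linear_combination (-(T.γ * t + T.δ)) * (t * h1 + h2) + (T.α * t + T.β) * (t * h3 + h4)
  · generalize hs : T.γ * t + T.δ = s at hp
    have : b' + d' * ((T.κ * x + T.μ₁ * t + T.μ₀) / s) + e' * ((T.α * t + T.β) / s)
        + k' * ((T.α * t + T.β) / s) * ((T.κ * x + T.μ₁ * t + T.μ₀) / s)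
        = (b' * s ^ 2 + d' * (T.κ * x + T.μ₁ * t + T.μ₀) * s + e' * (T.α * t + T.β) * s
          + k' * (T.α * t + T.β) * (T.κ * x + T.μ₁ * t + T.μ₀)) / s ^ 2 := by
      field_simp
    rw [this, ← hs]
    congr 1
    linear_combination (-(T.γ * t + T.δ)) * (t * h5 + h6)
      + (T.κ * x + T.μ₁ * t + T.μ₀) * (t * h3 + h4)
  -- The u-component of T has the constant denominator αδ - βγ, so the primed coordinates are first
  -- found by Cramer's rule and then inserted.
  · have hA : d' - c' = -((T.α * (c - d) - T.β * k) * T.δ - (T.α * a - T.β * d) * T.γ)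
        / (T.α * T.δ - T.β * T.γ) := by
      rw [eq_div_iff hΔ]; linear_combination -T.δ * h1 + T.γ * h2
    have hk : k' = -((T.γ * (c - d) - T.δ * k) * T.δ - (T.γ * a - T.δ * d) * T.γ)
        / (T.α * T.δ - T.β * T.γ) := by
      rw [eq_div_iff hΔ]; linear_combination -T.δ * h3 + T.γ * h4
    have he : e' = ((T.μ₁ * (c - d) - T.μ₀ * k + T.κ * e) * T.δ
        - (T.μ₁ * a - T.μ₀ * d + T.κ * b) * T.γ) / (T.α * T.δ - T.β * T.γ) := by
      rw [eq_div_iff hΔ]; linear_combination T.δ * h5 - T.γ * h6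
    rw [hA, hk, he]
    generalize hs : T.γ * t + T.δ = s at hp
    generalize hD : T.α * T.δ - T.β * T.γ = D at hΔ
    field_simp
    rw [← hs, ← hD]
    ring

/-- The witnesses are the entries of A' = B A B⁻¹ and n' = (μA + κn) B⁻¹, with B⁻¹ written through
the adjugate. -/
theorem exists_inter (T : EqTrans) (a b c d e k : ℝ) :
    ∃ a' b' c' d' e' k', T.Inter a b c d e k a' b' c' d' e' k' := by
  have hΔ := T.det_ne
  refine ⟨(T.α * (T.α * a - T.β * d) - T.β * (T.α * (c - d) - T.β * k)) / (T.α * T.δ - T.β * T.γ),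
    (T.α * (T.μ₁ * a - T.μ₀ * d + T.κ * b) - T.β * (T.μ₁ * (c - d) - T.μ₀ * k + T.κ * e))
      / (T.α * T.δ - T.β * T.γ),
    ((T.α * (c - d) - T.β * k) * T.δ - (T.α * a - T.β * d) * T.γ
      - (T.α * (T.γ * a - T.δ * d) - T.β * (T.γ * (c - d) - T.δ * k))) / (T.α * T.δ - T.β * T.γ),
    -(T.α * (T.γ * a - T.δ * d) - T.β * (T.γ * (c - d) - T.δ * k)) / (T.α * T.δ - T.β * T.γ),
    ((T.μ₁ * (c - d) - T.μ₀ * k + T.κ * e) * T.δ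
        - (T.μ₁ * a - T.μ₀ * d + T.κ * b) * T.γ) / (T.α * T.δ - T.β * T.γ),
    -((T.γ * (c - d) - T.δ * k) * T.δ - (T.γ * a - T.δ * d) * T.γ)
        / (T.α * T.δ - T.β * T.γ), ?_, ?_, ?_, ?_, ?_, ?_⟩ <;>
    (generalize hD : T.α * T.δ - T.β * T.γ = D at hΔ; field_simp; rw [← hD]; ring)

variable (T)

/-- The inverse transformation. -/
def inv : EqTrans where
  α := T.δ
  β := -T.β
  γ := -T.γ
  δ := T.α
  -- The parameters are those of the inverse homogeneous 3 × 3 matrix multiplied by αδ - βγ; a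
  -- common factor of all seven parameters does not change the transformation.
  κ := (T.α * T.δ - T.β * T.γ) / T.κ
  μ₁ := -(T.μ₁ * T.δ - T.μ₀ * T.γ) / T.κ
  μ₀ := -(T.μ₀ * T.α - T.μ₁ * T.β) / T.κ
  det_ne := by
    have := T.det_ne
    intro h
    apply this
    linear_combination h
  κ_ne := div_ne_zero T.det_ne T.κ_ne

/-- The composition: first `T`, then `S`. -/
def comp (S T : EqTrans) : EqTrans where
  α := S.α * T.α + S.β * T.γ
  β := S.α * T.β + S.β * T.δ
  γ := S.γ * T.α + S.δ * T.γ
  δ := S.γ * T.β + S.δ * T.δ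
  κ := S.κ * T.κ
  μ₁ := S.κ * T.μ₁ + S.μ₁ * T.α + S.μ₀ * T.γ
  μ₀ := S.κ * T.μ₀ + S.μ₁ * T.β + S.μ₀ * T.δ
  det_ne := by
    have h := mul_ne_zero S.det_ne T.det_ne
    intro h0
    apply h
    linear_combination h0
  κ_ne := mul_ne_zero S.κ_ne T.κ_ne

variable {T}

theorem inv_den {p : ℝ × ℝ} (hp : T.γ * p.1 + T.δ ≠ 0) :
    T.inv.γ * (T.onTX p).1 + T.inv.δ = (T.α * T.δ - T.β * T.γ) / (T.γ * p.1 + T.δ) := by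
  simp only [inv, onTX]
  field_simp
  ring

theorem inv_den_ne {p : ℝ × ℝ} (hp : T.γ * p.1 + T.δ ≠ 0) :
    T.inv.γ * (T.onTX p).1 + T.inv.δ ≠ 0 := by
  rw [inv_den hp]
  exact div_ne_zero T.det_ne hp

theorem inv_onTX {p : ℝ × ℝ} (hp : T.γ * p.1 + T.δ ≠ 0) : T.inv.onTX (T.onTX p) = p := by
  have h := inv_den hp
  have hΔ := T.det_ne
  have hκ := T.κ_ne
  rw [onTX, h]
  refine Prod.ext ?_ ?_ <;> simp only [inv, onTX] <;>
    (generalize hs : T.γ * p.1 + T.δ = s at hp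
     generalize hD : T.α * T.δ - T.β * T.γ = D at hΔ
     field_simp
     rw [← hs, ← hD]
     ring)

/-- Lets the facts about `T.inv ∘ T` be applied to `T.inv`, giving those about `T ∘ T.inv`. -/
theorem inv_inv_onTX (p : ℝ × ℝ) : T.inv.inv.onTX p = T.onTX p := by
  have hΔ := T.det_ne
  have hκ := T.κ_ne
  have h3 : -(-(T.μ₁ * T.δ - T.μ₀ * T.γ) / T.κ * T.α - -(T.μ₀ * T.α - T.μ₁ * T.β) / T.κ * -T.γ)
      / ((T.α * T.δ - T.β * T.γ) / T.κ) = T.μ₁ := by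
    rw [div_eq_iff (div_ne_zero hΔ hκ)]; field_simp; ring
  have h4 : -(-(T.μ₀ * T.α - T.μ₁ * T.β) / T.κ * T.δ - -(T.μ₁ * T.δ - T.μ₀ * T.γ) / T.κ * -T.β)
      / ((T.α * T.δ - T.β * T.γ) / T.κ) = T.μ₀ := by
    rw [div_eq_iff (div_ne_zero hΔ hκ)]; field_simp; ring
  have h2 : (T.δ * T.α - -T.β * -T.γ) / ((T.α * T.δ - T.β * T.γ) / T.κ) = T.κ := by
    rw [div_div_eq_mul_div, div_eq_iff hΔ]; ring
  refine Prod.ext ?_ ?_ <;> simp only [inv, onTX, neg_neg, h2, h3, h4]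

theorem onTX_inv {p : ℝ × ℝ} (hp : T.inv.γ * p.1 + T.inv.δ ≠ 0) : T.onTX (T.inv.onTX p) = p := by
  rw [← inv_inv_onTX (T := T), inv_onTX hp]

theorem onTX_inv_den {p : ℝ × ℝ} (hp : T.inv.γ * p.1 + T.inv.δ ≠ 0) :
    T.γ * (T.inv.onTX p).1 + T.δ ≠ 0 := by
  have := inv_den_ne hp
  simpa [inv] using this

theorem comp_den {S : EqTrans} {p : ℝ × ℝ} (hp : T.γ * p.1 + T.δ ≠ 0) :
    (S.comp T).γ * p.1 + (S.comp T).δ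
      = (S.γ * (T.onTX p).1 + S.δ) * (T.γ * p.1 + T.δ) := by
  simp only [comp, onTX]
  field_simp
  ring

theorem comp_onTX {S : EqTrans} {p : ℝ × ℝ} (hp : T.γ * p.1 + T.δ ≠ 0)
    (hS : S.γ * (T.onTX p).1 + S.δ ≠ 0) :
    (S.comp T).onTX p = S.onTX (T.onTX p) := by
  have h : S.γ * (T.onTX p).1 + S.δ
      = (S.γ * (T.α * p.1 + T.β) + S.δ * (T.γ * p.1 + T.δ)) / (T.γ * p.1 + T.δ) := by
    simp only [onTX]
    generalize T.γ * p.1 + T.δ = s at hp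
    field_simp
  have h' : S.γ * (T.α * p.1 + T.β) + S.δ * (T.γ * p.1 + T.δ) ≠ 0 := by
    intro h0
    rw [h, h0, zero_div] at hS
    exact hS rfl
  have h2 : (S.γ * T.α + S.δ * T.γ) * p.1 + (S.γ * T.β + S.δ * T.δ)
      = S.γ * (T.α * p.1 + T.β) + S.δ * (T.γ * p.1 + T.δ) := by ring
  conv_rhs => rw [onTX, h]
  refine Prod.ext ?_ ?_ <;> simp only [comp, onTX, h2] <;> field_simp <;> ring

theorem Inter.inv {a b c d e k a' b' c' d' e' k' : ℝ}
    (h : T.Inter a b c d e k a' b' c' d' e' k') : T.inv.Inter a' b' c' d' e' k' a b c d e k := by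
  obtain ⟨h1, h2, h3, h4, h5, h6⟩ := h
  have hκ := T.κ_ne
  have hΔ := T.det_ne
  have g1 : (c - d) * T.δ + a * -T.γ = T.δ * (c' - d') - -T.β * k' :=
    mul_left_cancel₀ hΔ (by
      linear_combination -(T.δ * h1 - T.β * h3) * T.δ + (T.δ * h2 - T.β * h4) * T.γ)
  have g2 : (c - d) * -T.β + a * T.α = T.δ * a' - -T.β * d' :=
    mul_left_cancel₀ hΔ (by
      linear_combination (T.δ * h1 - T.β * h3) * T.β - (T.δ * h2 - T.β * h4) * T.α)
  have g3 : -k * T.δ - d * -T.γ = -T.γ * (c' - d') - T.α * k' :=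
    mul_left_cancel₀ hΔ (by
      linear_combination -(-T.γ * h1 + T.α * h3) * T.δ + (-T.γ * h2 + T.α * h4) * T.γ)
  have g4 : -k * -T.β - d * T.α = -T.γ * a' - T.α * d' :=
    mul_left_cancel₀ hΔ (by
      linear_combination (-T.γ * h1 + T.α * h3) * T.β - (-T.γ * h2 + T.α * h4) * T.α)
  refine ⟨g1, g2, g3, g4, ?_, ?_⟩ <;> simp only [EqTrans.inv]
  · apply mul_left_cancel₀ hκ
    field_simp
    linear_combination -T.δ * h5 + T.γ * h6 - T.μ₁ * g1 - T.μ₀ * g3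
  · apply mul_left_cancel₀ hκ
    field_simp
    linear_combination T.β * h5 - T.α * h6 - T.μ₁ * g2 - T.μ₀ * g4

theorem Inter.comp {S : EqTrans} {a b c d e k a' b' c' d' e' k' a'' b'' c'' d'' e'' k'' : ℝ}
    (h : T.Inter a b c d e k a' b' c' d' e' k')
    (h' : S.Inter a' b' c' d' e' k' a'' b'' c'' d'' e'' k'') :
    (S.comp T).Inter a b c d e k a'' b'' c'' d'' e'' k'' := by
  obtain ⟨h1, h2, h3, h4, h5, h6⟩ := h
  obtain ⟨g1, g2, g3, g4, g5, g6⟩ := h'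
  refine ⟨?_, ?_, ?_, ?_, ?_, ?_⟩ <;> simp only [EqTrans.comp]
  · linear_combination T.α * g1 + T.γ * g2 + S.α * h1 + S.β * h3
  · linear_combination T.β * g1 + T.δ * g2 + S.α * h2 + S.β * h4
  · linear_combination T.α * g3 + T.γ * g4 + S.γ * h1 + S.δ * h3
  · linear_combination T.β * g3 + T.δ * g4 + S.γ * h2 + S.δ * h4
  · linear_combination T.α * g5 + T.γ * g6 + S.μ₁ * h1 + S.μ₀ * h3 + S.κ * h5
  · linear_combination T.β * g5 + T.δ * g6 + S.μ₁ * h2 + S.μ₀ * h4 + S.κ * h6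

/-- For every (t, x) outside the line where the denominator of `T.inv` vanishes, a suitable u in the
source gives the target point (t, x, 0). Hence the image of T contains such a slice over a nonempty
open set, and this determines the coordinates. -/
theorem gv_onE_inj {a b c d e k a' b' c' d' e' k' : ℝ}
    (h : ∀ p : E, T.γ * p.1 + T.δ ≠ 0 → gv a b c d e k (T.onE p) = gv a' b' c' d' e' k' (T.onE p)) :
    a = a' ∧ b = b' ∧ c = c' ∧ d = d' ∧ e = e' ∧ k = k' := by
  have key : ∀ q : ℝ × ℝ, T.inv.γ * q.1 + T.inv.δ ≠ 0 → ∃ u,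
      T.onE ((T.inv.onTX q).1, (T.inv.onTX q).2, u) = (q.1, q.2, 0) := by
    intro q hq
    have h1 := onTX_inv hq
    have hΔ := T.det_ne
    have hκ := T.κ_ne
    have hd := onTX_inv_den hq
    refine ⟨(T.κ * T.γ * (T.inv.onTX q).2 - T.μ₁ * T.δ + T.μ₀ * T.γ)
      / (T.κ * (T.γ * (T.inv.onTX q).1 + T.δ)), ?_⟩
    refine Prod.ext (Prod.ext_iff.1 h1).1 (Prod.ext (Prod.ext_iff.1 h1).2 ?_)
    simp only [onE]
    generalize T.inv.onTX q = r at *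
    generalize hs : T.γ * r.1 + T.δ = s at hd
    field_simp
    ring
  have hT : ∃ q : ℝ × ℝ, T.inv.γ * q.1 + T.inv.δ ≠ 0 := by
    by_contra hc
    push Not at hc
    have h0 := hc (0, 0)
    have h1 := hc (1, 0)
    simp only [mul_zero, zero_add, mul_one] at h0 h1
    apply T.inv.det_ne
    have : T.inv.γ = 0 := by linarith
    rw [this, h0]
    ring
  obtain ⟨q, hq⟩ := hT
  refine gv_eventually_eq (p := q) (y := 0) ?_
  have ho : ∀ᶠ r in nhds q, T.inv.γ * r.1 + T.inv.δ ≠ 0 :=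
    (show Continuous fun r : ℝ × ℝ => T.inv.γ * r.1 + T.inv.δ by fun_prop).continuousAt.eventually_ne
      hq
  filter_upwards [ho] with r hr
  obtain ⟨u, hu⟩ := key r hr
  rw [← hu]
  exact h _ (onTX_inv_den hr)

/-- `exists_inter` supplies a pushforward and `gv_onE_inj` makes it unique. From here on, statements
about pushforwards are matrix identities. -/
theorem pushes_iff {a b c d e k a' b' c' d' e' k' : ℝ} :
    T.Pushes (gv a b c d e k) (gv a' b' c' d' e' k') ↔
      T.Inter a b c d e k a' b' c' d' e' k' := by
  refine ⟨fun h => ?_, Inter.pushes⟩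
  obtain ⟨a1, b1, c1, d1, e1, k1, h1⟩ := exists_inter T a b c d e k
  have h2 := h1.pushes
  obtain ⟨rfl, rfl, rfl, rfl, rfl, rfl⟩ := gv_onE_inj (T := T)
    fun p hp => (h2 p hp).symm.trans (h p hp)
  exact h1

/-- The invariants of the adjoint action of the equivalence group: the weight, the
discriminant, and the property of belonging to the radical or to the nilradical. -/
theorem Inter.weight {a b c d e k a' b' c' d' e' k' : ℝ}
    (h : T.Inter a b c d e k a' b' c' d' e' k') : 2 * d' - c' = 2 * d - c := by
  obtain ⟨h1, h2, h3, h4, -, -⟩ := h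
  apply mul_left_cancel₀ T.det_ne
  linear_combination -T.δ * h1 + T.γ * h2 + T.β * h3 - T.α * h4

/-- The matrix A has trace c - 2d and determinant ak - d(c - d), so c² - 4ak is the discriminant of
its characteristic polynomial, which conjugation preserves. -/
theorem Inter.disc {a b c d e k a' b' c' d' e' k' : ℝ}
    (h : T.Inter a b c d e k a' b' c' d' e' k') :
    c' ^ 2 - 4 * a' * k' = c ^ 2 - 4 * a * k := by
  have hw := h.weight
  obtain ⟨h1, h2, h3, h4, -, -⟩ := h
  have hdet : (T.α * T.δ - T.β * T.γ) * (-(c' - d') * d' + a' * k')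
      = (T.α * T.δ - T.β * T.γ) * (-(c - d) * d + a * k) := by
    have e1 : (T.α * T.δ - T.β * T.γ) * (-(c' - d') * d' + a' * k')
        = ((c' - d') * T.α + a' * T.γ) * (-k' * T.β - d' * T.δ)
          - ((c' - d') * T.β + a' * T.δ) * (-k' * T.α - d' * T.γ) := by ring
    rw [e1, h1, h2, h3, h4]
    ring
  have := mul_left_cancel₀ T.det_ne hdet
  linear_combination (2 * d' - c' + 2 * d - c) * hw - 4 * this

end EqTrans

/-! ### The relation of equivalence of subalgebras -/

open EqTrans

theorem EqTrans.exists_pushes (T : EqTrans) {Q : VF} (hQ : Q ∈ algG) :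
    ∃ Q' ∈ algG, T.Pushes Q Q' := by
  obtain ⟨a, b, c, d, e, k, rfl⟩ := mem_algG.1 hQ
  obtain ⟨a1, b1, c1, d1, e1, k1, h1⟩ := exists_inter T a b c d e k
  exact ⟨_, gv_mem_algG _ _ _ _ _ _, h1.pushes⟩

theorem EqTrans.Pushes.inv {T : EqTrans} {Q Q' : VF} (hQ : Q ∈ algG) (hQ' : Q' ∈ algG)
    (h : T.Pushes Q Q') : T.inv.Pushes Q' Q := by
  obtain ⟨a, b, c, d, e, k, rfl⟩ := mem_algG.1 hQ
  obtain ⟨a', b', c', d', e', k', rfl⟩ := mem_algG.1 hQ'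
  exact (pushes_iff.1 h).inv.pushes

theorem EqTrans.Pushes.comp {S T : EqTrans} {Q Q' Q'' : VF} (hQ : Q ∈ algG) (hQ' : Q' ∈ algG)
    (hQ'' : Q'' ∈ algG) (h : T.Pushes Q Q') (h' : S.Pushes Q' Q'') :
    (S.comp T).Pushes Q Q'' := by
  obtain ⟨a, b, c, d, e, k, rfl⟩ := mem_algG.1 hQ
  obtain ⟨a', b', c', d', e', k', rfl⟩ := mem_algG.1 hQ'
  obtain ⟨a2, b2, c2, d2, e2, k2, rfl⟩ := mem_algG.1 hQ''
  exact ((pushes_iff.1 h).comp (pushes_iff.1 h')).pushes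

theorem EqTrans.Pushes.add {T : EqTrans} {Q Q' R R' : VF} (h : T.Pushes Q Q')
    (h' : T.Pushes R R') : T.Pushes (Q + R) (Q' + R') := by
  intro p hp
  simp [h p hp, h' p hp]

theorem EqTrans.Pushes.smul {T : EqTrans} {Q Q' : VF} (h : T.Pushes Q Q') (l : ℝ) :
    T.Pushes (l • Q) (l • Q') := by
  intro p hp
  simp [h p hp]

theorem EqTrans.pushes_zero {T : EqTrans} : T.Pushes 0 0 := by
  intro p hp
  simp

theorem EqTrans.pushes_span {T : EqTrans} {A B : Set VF}
    (h : ∀ Q ∈ A, ∃ Q' ∈ Submodule.span ℝ B, T.Pushes Q Q') :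
    ∀ Q ∈ Submodule.span ℝ A, ∃ Q' ∈ Submodule.span ℝ B, T.Pushes Q Q' := by
  intro Q hQ
  refine Submodule.span_induction (p := fun Q _ => ∃ Q' ∈ Submodule.span ℝ B, T.Pushes Q Q')
    h ⟨0, zero_mem _, pushes_zero⟩ ?_ ?_ hQ
  · rintro x y - - ⟨x', hx, hx'⟩ ⟨y', hy, hy'⟩
    exact ⟨_, add_mem hx hy, hx'.add hy'⟩
  · rintro l x - ⟨x', hx, hx'⟩
    exact ⟨_, Submodule.smul_mem _ l hx, hx'.smul l⟩

theorem EqTrans.pushes_span' {T : EqTrans} {A B : Set VF}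
    (h : ∀ Q' ∈ B, ∃ Q ∈ Submodule.span ℝ A, T.Pushes Q Q') :
    ∀ Q' ∈ Submodule.span ℝ B, ∃ Q ∈ Submodule.span ℝ A, T.Pushes Q Q' := by
  intro Q hQ
  refine Submodule.span_induction (p := fun Q' _ => ∃ Q ∈ Submodule.span ℝ A, T.Pushes Q Q')
    h ⟨0, zero_mem _, pushes_zero⟩ ?_ ?_ hQ
  · rintro x y - - ⟨x', hx, hx'⟩ ⟨y', hy, hy'⟩
    exact ⟨_, add_mem hx hy, hx'.add hy'⟩
  · rintro l x - ⟨x', hx, hx'⟩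
    exact ⟨_, Submodule.smul_mem _ l hx, hx'.smul l⟩

theorem SubalgEquiv.symm {s s' : Submodule ℝ VF} (hs : s ≤ algG) (hs' : s' ≤ algG)
    (h : SubalgEquiv s s') : SubalgEquiv s' s := by
  obtain ⟨T, h1, h2⟩ := h
  refine ⟨T.inv, fun Q' hQ' => ?_, fun Q hQ => ?_⟩
  · obtain ⟨Q, hQ, h⟩ := h2 Q' hQ'
    exact ⟨Q, hQ, h.inv (hs hQ) (hs' hQ')⟩
  · obtain ⟨Q', hQ', h⟩ := h1 Q hQ
    exact ⟨Q', hQ', h.inv (hs hQ) (hs' hQ')⟩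

theorem SubalgEquiv.trans {s s' s'' : Submodule ℝ VF} (hs : s ≤ algG) (hs' : s' ≤ algG)
    (hs'' : s'' ≤ algG) (h : SubalgEquiv s s') (h' : SubalgEquiv s' s'') : SubalgEquiv s s'' := by
  obtain ⟨T, h1, h2⟩ := h
  obtain ⟨S, g1, g2⟩ := h'
  refine ⟨S.comp T, fun Q hQ => ?_, fun Q'' hQ'' => ?_⟩
  · obtain ⟨Q', hQ', h⟩ := h1 Q hQ
    obtain ⟨Q'', hQ'', g⟩ := g1 Q' hQ'
    exact ⟨Q'', hQ'', h.comp (hs hQ) (hs' hQ') (hs'' hQ'') g⟩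
  · obtain ⟨Q', hQ', g⟩ := g2 Q'' hQ''
    obtain ⟨Q, hQ, h⟩ := h2 Q' hQ'
    exact ⟨Q, hQ, h.comp (hs hQ) (hs' hQ') (hs'' hQ'') g⟩

theorem SubalgEquiv.refl {s : Submodule ℝ VF} (hs : s ≤ algG) : SubalgEquiv s s := by
  have h : ∀ Q ∈ s, EqTrans.Pushes ⟨1, 0, 0, 1, 1, 0, 0, by norm_num, one_ne_zero⟩ Q Q := by
    intro Q hQ
    obtain ⟨a, b, c, d, e, k, rfl⟩ := mem_algG.1 (hs hQ)
    apply Inter.pushes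
    refine ⟨?_, ?_, ?_, ?_, ?_, ?_⟩ <;> ring
  exact ⟨_, fun Q hQ => ⟨Q, hQ, h Q hQ⟩, fun Q hQ => ⟨Q, hQ, h Q hQ⟩⟩

/-! ### The action of the equivalence group on the class -/

namespace EqTrans

variable {T : EqTrans} {Ω : Set (ℝ × ℝ)} {f f' : ℝ × ℝ → ℝ}

theorem contDiffAt_onTX {p : ℝ × ℝ} (hp : T.γ * p.1 + T.δ ≠ 0) : ContDiffAt ℝ ∞ T.onTX p := by
  unfold onTX
  have h : ContDiffAt ℝ ∞ (fun p : ℝ × ℝ => T.γ * p.1 + T.δ) p := by fun_prop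
  exact ContDiffAt.prodMk (ContDiffAt.div (by fun_prop) h hp) (ContDiffAt.div (by fun_prop) h hp)

theorem fderiv_onTX {p : ℝ × ℝ} (hp : T.γ * p.1 + T.δ ≠ 0) (v : ℝ × ℝ) :
    fderiv ℝ T.onTX p v = ((T.α * T.δ - T.β * T.γ) * v.1 / (T.γ * p.1 + T.δ) ^ 2,
        ((T.κ * v.2 + T.μ₁ * v.1) * (T.γ * p.1 + T.δ)
          - (T.κ * p.2 + T.μ₁ * p.1 + T.μ₀) * (T.γ * v.1)) / (T.γ * p.1 + T.δ) ^ 2) := by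
  have h1 : HasFDerivAt (fun p : ℝ × ℝ => p.1) (ContinuousLinearMap.fst ℝ ℝ ℝ) p := hasFDerivAt_fst
  have h2 : HasFDerivAt (fun p : ℝ × ℝ => p.2) (ContinuousLinearMap.snd ℝ ℝ ℝ) p := hasFDerivAt_snd
  have hd := (h1.const_mul T.γ).add_const T.δ
  have e1 := hasFDerivAt_div ((h1.const_mul T.α).add_const T.β) hd hp
  have e2 := hasFDerivAt_div (((h2.const_mul T.κ).add (h1.const_mul T.μ₁)).add_const T.μ₀) hd hp
  have e : HasFDerivAt T.onTX _ p := e1.prodMk e2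
  rw [e.fderiv]
  refine Prod.ext ?_ ?_ <;> simp <;> generalize hs : T.γ * p.1 + T.δ = s at hp <;> field_simp
  rw [← hs]
  ring

theorem image_eq (hT : T.DefinedOn Ω) :
    T.onTX '' Ω = {q | T.inv.γ * q.1 + T.inv.δ ≠ 0} ∩ T.inv.onTX ⁻¹' Ω := by
  ext q
  constructor
  · rintro ⟨p, hp, rfl⟩
    refine ⟨inv_den_ne (hT p hp), ?_⟩
    rw [Set.mem_preimage, inv_onTX (hT p hp)]
    exact hp
  · rintro ⟨h1, h2⟩
    exact ⟨_, h2, onTX_inv h1⟩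

theorem isOpen_den (T : EqTrans) : IsOpen {q : ℝ × ℝ | T.γ * q.1 + T.δ ≠ 0} :=
  isOpen_ne_fun (by fun_prop) continuous_const

theorem continuousOn_onTX (T : EqTrans) :
    ContinuousOn T.onTX {q : ℝ × ℝ | T.γ * q.1 + T.δ ≠ 0} :=
  fun _ hq => (contDiffAt_onTX hq).continuousAt.continuousWithinAt

theorem isOpen_image (hΩ : IsOpen Ω) (hT : T.DefinedOn Ω) : IsOpen (T.onTX '' Ω) := by
  rw [image_eq hT]
  exact T.inv.continuousOn_onTX.isOpen_inter_preimage T.inv.isOpen_den hΩ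

theorem MapsEq.isGBE (hf : IsGBE Ω f) (hT : T.DefinedOn Ω) (h : T.MapsEq Ω f f') :
    IsGBE (T.onTX '' Ω) f' := by
  have hΔ := T.det_ne
  have hκ := T.κ_ne
  refine ⟨isOpen_image hf.isOpen hT, ?_, ?_, ?_⟩
  · exact hf.isConnected.image _ (T.continuousOn_onTX.mono fun p hp => hT p hp)
  · have hc : ContDiffOn ℝ ∞ (fun q => T.κ ^ 2 / (T.α * T.δ - T.β * T.γ) * f (T.inv.onTX q))
        (T.onTX '' Ω) := by
      rw [image_eq hT]
      refine contDiffOn_const.mul (hf.smooth.comp ?_ fun q hq => hq.2)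
      exact fun q hq => (contDiffAt_onTX hq.1).contDiffWithinAt
    refine hc.congr ?_
    rintro _ ⟨p, hp, rfl⟩
    rw [h p hp, inv_onTX (hT p hp)]
  · rintro _ ⟨p, hp, rfl⟩
    rw [h p hp]
    exact mul_ne_zero (div_ne_zero (pow_ne_zero 2 hκ) hΔ) (hf.ne_zero p hp)

theorem definedOn_inv (hT : T.DefinedOn Ω) : T.inv.DefinedOn (T.onTX '' Ω) := by
  rintro _ ⟨p, hp, rfl⟩
  exact inv_den_ne (hT p hp)

theorem inv_image (hT : T.DefinedOn Ω) : T.inv.onTX '' (T.onTX '' Ω) = Ω := by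
  rw [Set.image_image]
  ext p
  constructor
  · rintro ⟨q, hq, rfl⟩
    exact (congrArg (· ∈ Ω) (inv_onTX (hT q hq))).mpr hq
  · intro hp
    exact ⟨p, hp, inv_onTX (hT p hp)⟩

theorem fderiv_comp_onTX {g : ℝ × ℝ → ℝ} {p : ℝ × ℝ} (hp : T.γ * p.1 + T.δ ≠ 0)
    (hg : DifferentiableAt ℝ g (T.onTX p)) (v : ℝ × ℝ) :
    fderiv ℝ (fun q => g (T.onTX q)) p v = fderiv ℝ g (T.onTX p) (fderiv ℝ T.onTX p v) := by
  have h2 : DifferentiableAt ℝ T.onTX p := (contDiffAt_onTX hp).differentiableAt (by simp)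
  have h3 := fderiv_comp (𝕜 := ℝ) p hg h2
  have e : (fun q => g (T.onTX q)) = g ∘ T.onTX := rfl
  rw [e, h3]
  rfl

theorem fderiv_pair (g : ℝ × ℝ → ℝ) (p : ℝ × ℝ) (x y : ℝ) :
    fderiv ℝ g p (x, y) = x * fderiv ℝ g p (1, 0) + y * fderiv ℝ g p (0, 1) := by
  have : ((x, y) : ℝ × ℝ) = x • ((1, 0) : ℝ × ℝ) + y • ((0, 1) : ℝ × ℝ) := by simp
  rw [this, map_add, map_smul, map_smul]
  rfl

/-- The derivative of f' along the pushed field, taken at the image point, is the constant κ²/(αδ -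
βγ) times the derivative of f along the original field; the term with f gets the same factor because
the weight is invariant. -/
theorem cls_map (hf : IsGBE Ω f) (hT : T.DefinedOn Ω) (h : T.MapsEq Ω f f')
    {a b c d e k a' b' c' d' e' k' : ℝ} (hI : T.Inter a b c d e k a' b' c' d' e' k')
    {p : ℝ × ℝ} (hp : p ∈ Ω) :
    cls f' (T.onTX p) a' b' c' d' e' k'
      = T.κ ^ 2 / (T.α * T.δ - T.β * T.γ) * cls f p a b c d e k := by
  have hs := hT p hp
  have hf' := h.isGBE hf hT
  have hdf' : DifferentiableAt ℝ f' (T.onTX p) :=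
    (hf'.smooth.contDiffAt (hf'.isOpen.mem_nhds ⟨p, hp, rfl⟩)).differentiableAt (by simp)
  have hdf : DifferentiableAt ℝ f p :=
    (hf.smooth.contDiffAt (hf.isOpen.mem_nhds hp)).differentiableAt (by simp)
  have key : ∀ v, fderiv ℝ f' (T.onTX p) (fderiv ℝ T.onTX p v)
      = T.κ ^ 2 / (T.α * T.δ - T.β * T.γ) * fderiv ℝ f p v := by
    intro v
    rw [← fderiv_comp_onTX hs hdf']
    have : (fun q => f' (T.onTX q)) =ᶠ[nhds p]
        fun q => T.κ ^ 2 / (T.α * T.δ - T.β * T.γ) * f q := by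
      filter_upwards [hf.isOpen.mem_nhds hp] with q hq using h q hq
    rw [this.fderiv_eq, fderiv_const_mul hdf]
    rfl
  have hpush := hI.pushes (p.1, p.2, 0) hs
  rw [T.fderiv_onE hs] at hpush
  have e1 := congrArg Prod.fst hpush
  have e2 := congrArg (fun z => z.2.1) hpush
  simp only [gv, onE] at e1 e2
  have hk := key (a + c * p.1 + k * p.1 ^ 2, b + d * p.2 + e * p.1 + k * p.1 * p.2)
  rw [fderiv_onTX hs, fderiv_pair, fderiv_pair f] at hk
  simp only at hk
  rw [e1, e2] at hk
  simp only [cls]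
  rw [h p hp, hI.weight]
  simp only [onTX] at hk ⊢
  linear_combination hk

theorem mem_symAlg_map (hf : IsGBE Ω f) (hT : T.DefinedOn Ω) (h : T.MapsEq Ω f f')
    {Q Q' : VF} (hQ : Q ∈ algG) (hQ' : Q' ∈ algG) (hI : T.Pushes Q Q') :
    Q' ∈ symAlg (T.onTX '' Ω) f' ↔ Q ∈ symAlg Ω f := by
  obtain ⟨a, b, c, d, e, k, rfl⟩ := mem_algG.1 hQ
  obtain ⟨a', b', c', d', e', k', rfl⟩ := mem_algG.1 hQ'
  rw [mem_symAlg, mem_symAlg, Set.forall_mem_image]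
  refine forall₂_congr fun p hp => ?_
  rw [cls_map hf hT h (pushes_iff.1 hI) hp]
  simp [T.κ_ne, T.det_ne]

/-- The push-forward of the arbitrary element. -/
def push (T : EqTrans) (f : ℝ × ℝ → ℝ) : ℝ × ℝ → ℝ :=
  fun q => T.κ ^ 2 / (T.α * T.δ - T.β * T.γ) * f (T.inv.onTX q)

theorem mapsEq_push (hT : T.DefinedOn Ω) : T.MapsEq Ω f (T.push f) := by
  intro p hp
  rw [push, inv_onTX (hT p hp)]

theorem symAlg_push (hf : IsGBE Ω f) (hT : T.DefinedOn Ω) (h : T.MapsEq Ω f f')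
    {s s' : Submodule ℝ VF} (hs' : s' ≤ algG) (hs : symAlg Ω f = s)
    (h1 : ∀ Q ∈ s, ∃ Q' ∈ s', T.Pushes Q Q') (h2 : ∀ Q' ∈ s', ∃ Q ∈ s, T.Pushes Q Q') :
    symAlg (T.onTX '' Ω) f' = s' := by
  subst hs
  apply le_antisymm
  · intro R hR
    have hR' := symAlg_le hR
    obtain ⟨Q, hQ, hQR⟩ := T.inv.exists_pushes hR'
    obtain ⟨R2, hR2, hQR2⟩ := T.exists_pushes hQ
    have h3 := hQR2.inv hQ hR2
    obtain ⟨a, b, c, d, e, k, rfl⟩ := mem_algG.1 hQ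
    obtain ⟨a', b', c', d', e', k', rfl⟩ := mem_algG.1 hR'
    obtain ⟨a'', b'', c'', d'', e'', k'', rfl⟩ := mem_algG.1 hR2
    -- The inverse of `T.inv` has the same parameters as T, so a relation for `T.inv` from R to Q
    -- reads backwards as one for T.
    have hR3 : T.Pushes (gv a b c d e k) (gv a' b' c' d' e' k') := by
      obtain ⟨h1, h2, h3, h4, h5, h6⟩ := (pushes_iff.1 hQR).inv
      have hΔ := T.det_ne
      have hκ := T.κ_ne
      apply Inter.pushes
      simp only [EqTrans.inv, neg_neg] at h1 h2 h3 h4 h5 h6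
      have k1 : (T.δ * T.α - -T.β * -T.γ) / ((T.α * T.δ - T.β * T.γ) / T.κ) = T.κ := by
        rw [div_div_eq_mul_div, div_eq_iff hΔ]; ring
      have k3 : -(-(T.μ₁ * T.δ - T.μ₀ * T.γ) / T.κ * T.α
          - -(T.μ₀ * T.α - T.μ₁ * T.β) / T.κ * -T.γ)
          / ((T.α * T.δ - T.β * T.γ) / T.κ) = T.μ₁ := by
        rw [div_eq_iff (div_ne_zero hΔ hκ)]; field_simp; ring
      have k4 : -(-(T.μ₀ * T.α - T.μ₁ * T.β) / T.κ * T.δ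
          - -(T.μ₁ * T.δ - T.μ₀ * T.γ) / T.κ * -T.β)
          / ((T.α * T.δ - T.β * T.γ) / T.κ) = T.μ₀ := by
        rw [div_eq_iff (div_ne_zero hΔ hκ)]; field_simp; ring
      rw [k1, k3, k4] at h5 h6
      exact ⟨h1, h2, h3, h4, h5, h6⟩
    have hm := (mem_symAlg_map hf hT h (gv_mem_algG _ _ _ _ _ _) hR' hR3).1 hR
    obtain ⟨Q', hQ', hp⟩ := h1 _ hm
    obtain ⟨a1, b1, c1, d1, e1, k1, rfl⟩ := mem_algG.1 (hs' hQ')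
    obtain ⟨rfl, rfl, rfl, rfl, rfl, rfl⟩ := gv_onE_inj (T := T)
      fun p hpp => (hR3 p hpp).symm.trans (hp p hpp)
    exact hQ'
  · intro Q' hQ'
    obtain ⟨Q, hQ, hp⟩ := h2 Q' hQ'
    exact (mem_symAlg_map hf hT h (symAlg_le hQ) (hs' hQ') hp).2 hQ

/-- The left-hand side of the equation for u equals (αδ - βγ)²/(κ(γt + δ)³) times the left-hand side
for u' at the image point, and this factor does not vanish. -/
theorem solution_map (hf : IsGBE Ω f) (hT : T.DefinedOn Ω) (h : T.MapsEq Ω f f')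
    {u u' : ℝ × ℝ → ℝ} (hu' : ContDiffOn ℝ ∞ u' (T.onTX '' Ω))
    (hu : ∀ p ∈ Ω, T.onE (p.1, p.2, u p) = ((T.onTX p).1, (T.onTX p).2, u' (T.onTX p))) :
    IsSolution Ω f u ↔ IsSolution (T.onTX '' Ω) f' u' := by
  have hΔ := T.det_ne
  have hκ := T.κ_ne
  have hΩ' := isOpen_image hf.isOpen hT
  have hmem : ∀ p ∈ Ω, T.onTX p ∈ T.onTX '' Ω := fun p hp => ⟨p, hp, rfl⟩
  have hux : ContDiffOn ℝ ∞ (fun q => fderiv ℝ u' q (0, 1)) (T.onTX '' Ω) :=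
    (hu'.fderiv_of_isOpen hΩ' (by simp)).clm_apply contDiffOn_const
  have d1 : ∀ p ∈ Ω, DifferentiableAt ℝ u' (T.onTX p) := fun p hp =>
    (hu'.contDiffAt (hΩ'.mem_nhds (hmem p hp))).differentiableAt (by simp)
  have d2 : ∀ p ∈ Ω, DifferentiableAt ℝ (fun q => fderiv ℝ u' q (0, 1)) (T.onTX p) := fun p hp =>
    (hux.contDiffAt (hΩ'.mem_nhds (hmem p hp))).differentiableAt (by simp)
  have dT : ∀ p ∈ Ω, DifferentiableAt ℝ T.onTX p := fun p hp =>
    (contDiffAt_onTX (hT p hp)).differentiableAt (by simp)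
  have fst : ∀ p : ℝ × ℝ, HasFDerivAt (fun p : ℝ × ℝ => p.1) (ContinuousLinearMap.fst ℝ ℝ ℝ) p :=
    fun p => hasFDerivAt_fst
  have snd : ∀ p : ℝ × ℝ, HasFDerivAt (fun p : ℝ × ℝ => p.2) (ContinuousLinearMap.snd ℝ ℝ ℝ) p :=
    fun p => hasFDerivAt_snd
  -- Solving the third component of T for u expresses u and all its derivatives through those of u'.
  have u_eq : ∀ p ∈ Ω, u p = ((T.α * T.δ - T.β * T.γ) * u' (T.onTX p) + T.κ * T.γ * p.2
      - T.μ₁ * T.δ + T.μ₀ * T.γ) / (T.κ * (T.γ * p.1 + T.δ)) := by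
    intro p hp
    have h1 := congrArg (fun z => z.2.2) (hu p hp)
    have hs := hT p hp
    simp only [onE] at h1
    rw [← h1]
    generalize T.γ * p.1 + T.δ = s at hs
    field_simp
    ring
  have hfd : ∀ p ∈ Ω, HasFDerivAt u _ p := fun p hp => by
    have h1 : HasFDerivAt (fun q => u' (T.onTX q)) _ p :=
      (d1 p hp).hasFDerivAt.comp p (dT p hp).hasFDerivAt
    have h2 := hasFDerivAt_div ((((h1.const_mul (T.α * T.δ - T.β * T.γ)).add
      ((snd p).const_mul (T.κ * T.γ))).sub_const (T.μ₁ * T.δ)).add_const (T.μ₀ * T.γ))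
      ((((fst p).const_mul T.γ).add_const T.δ).const_mul T.κ) (mul_ne_zero hκ (hT p hp))
    refine h2.congr_of_eventuallyEq ?_
    filter_upwards [hf.isOpen.mem_nhds hp] with q hq using u_eq q hq
  have ux : ∀ p ∈ Ω, fderiv ℝ u p (0, 1) = (T.α * T.δ - T.β * T.γ) * fderiv ℝ u' (T.onTX p) (0, 1)
      / (T.γ * p.1 + T.δ) ^ 2 + T.γ / (T.γ * p.1 + T.δ) := by
    intro p hp
    have hs := hT p hp
    rw [(hfd p hp).fderiv]
    simp only [sub_apply, smul_apply, add_apply,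
      ContinuousLinearMap.comp_apply, fderiv_onTX hs, ContinuousLinearMap.coe_fst',
      ContinuousLinearMap.coe_snd', smul_eq_mul, Pi.add_apply]
    rw [fderiv_pair]
    generalize hs' : T.γ * p.1 + T.δ = s at hs
    field_simp
    rw [← hs']
    ring
  have ut : ∀ p ∈ Ω, fderiv ℝ u p (1, 0) = (T.α * T.δ - T.β * T.γ)
      * ((T.α * T.δ - T.β * T.γ) * fderiv ℝ u' (T.onTX p) (1, 0)
        + (T.μ₁ * (T.γ * p.1 + T.δ) - (T.κ * p.2 + T.μ₁ * p.1 + T.μ₀) * T.γ)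
          * fderiv ℝ u' (T.onTX p) (0, 1))
      / (T.κ * (T.γ * p.1 + T.δ) ^ 3) - T.γ * ((T.α * T.δ - T.β * T.γ) * u' (T.onTX p)
        + T.κ * T.γ * p.2 - T.μ₁ * T.δ + T.μ₀ * T.γ) / (T.κ * (T.γ * p.1 + T.δ) ^ 2) := by
    intro p hp
    have hs := hT p hp
    rw [(hfd p hp).fderiv]
    simp only [sub_apply, smul_apply, add_apply,
      ContinuousLinearMap.comp_apply, fderiv_onTX hs, ContinuousLinearMap.coe_fst',
      ContinuousLinearMap.coe_snd', smul_eq_mul, Pi.add_apply]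
    rw [fderiv_pair]
    generalize hs' : T.γ * p.1 + T.δ = s at hs
    field_simp
    ring
  have uxx : ∀ p ∈ Ω, fderiv ℝ (fun q => fderiv ℝ u q (0, 1)) p (0, 1)
      = (T.α * T.δ - T.β * T.γ) * T.κ * fderiv ℝ (fun q => fderiv ℝ u' q (0, 1)) (T.onTX p) (0, 1)
      / (T.γ * p.1 + T.δ) ^ 3 := by
    intro p hp
    have hs := hT p hp
    have h1 : HasFDerivAt (fun q => fderiv ℝ u' (T.onTX q) (0, 1)) _ p :=
      (d2 p hp).hasFDerivAt.comp p (dT p hp).hasFDerivAt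
    have h2 := hasFDerivAt_div (h1.const_mul (T.α * T.δ - T.β * T.γ))
      ((((fst p).const_mul T.γ).add_const T.δ).pow 2) (pow_ne_zero 2 hs)
    have h3 := hasFDerivAt_div (hasFDerivAt_const T.γ p)
      (((fst p).const_mul T.γ).add_const T.δ) hs
    have h4 := (h2.add h3).congr_of_eventuallyEq
      (f₁ := fun q => fderiv ℝ u q (0, 1)) (by
        filter_upwards [hf.isOpen.mem_nhds hp] with q hq using ux q hq)
    rw [h4.fderiv]
    simp only [sub_apply, smul_apply, add_apply,
      ContinuousLinearMap.comp_apply, fderiv_onTX hs, ContinuousLinearMap.coe_fst',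
      smul_eq_mul, zero_apply]
    rw [fderiv_pair]
    generalize hs' : T.γ * p.1 + T.δ = s at hs
    field_simp
    ring
  have key : ∀ p ∈ Ω, fderiv ℝ u p (1, 0) + u p * fderiv ℝ u p (0, 1)
      + f p * fderiv ℝ (fun q => fderiv ℝ u q (0, 1)) p (0, 1)
      = (T.α * T.δ - T.β * T.γ) ^ 2 / (T.κ * (T.γ * p.1 + T.δ) ^ 3)
        * (fderiv ℝ u' (T.onTX p) (1, 0) + u' (T.onTX p) * fderiv ℝ u' (T.onTX p) (0, 1)
          + f' (T.onTX p) * fderiv ℝ (fun q => fderiv ℝ u' q (0, 1)) (T.onTX p) (0, 1)) := by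
    intro p hp
    have hs := hT p hp
    rw [ux p hp, ut p hp, uxx p hp, u_eq p hp, h p hp]
    generalize hs' : T.γ * p.1 + T.δ = s at hs
    generalize hD : T.α * T.δ - T.β * T.γ = D at hΔ
    field_simp
    rw [← hs']
    ring
  unfold IsSolution
  rw [Set.forall_mem_image]
  refine forall₂_congr fun p hp => ?_
  rw [key p hp]
  have : (T.α * T.δ - T.β * T.γ) ^ 2 / (T.κ * (T.γ * p.1 + T.δ) ^ 3) ≠ 0 :=
    div_ne_zero (pow_ne_zero 2 hΔ) (mul_ne_zero hκ (pow_ne_zero 3 (hT p hp)))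
  simp [this]

end EqTrans

/-! ### Consequences of the classifying condition -/

theorem lin_mem {s : Submodule ℝ VF} {a b c d e k a' b' c' d' e' k' : ℝ}
    (h : gv a b c d e k ∈ s) (h' : gv a' b' c' d' e' k' ∈ s) (x y : ℝ) :
    gv (x * a + y * a') (x * b + y * b') (x * c + y * c') (x * d + y * d') (x * e + y * e')
      (x * k + y * k') ∈ s := by
  have := s.add_mem (s.smul_mem x h) (s.smul_mem y h')
  rwa [smul_gv, smul_gv, gv_add] at this

theorem mem_of_eq {s : Submodule ℝ VF} {a b c d e k a' b' c' d' e' k' : ℝ}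
    (h : gv a b c d e k ∈ s) (h1 : a = a') (h2 : b = b') (h3 : c = c') (h4 : d = d')
    (h5 : e = e') (h6 : k = k') : gv a' b' c' d' e' k' ∈ s := by
  subst h1 h2 h3 h4 h5 h6
  exact h

theorem IsGBE.mono {Ω V : Set (ℝ × ℝ)} {f : ℝ × ℝ → ℝ} (hf : IsGBE Ω f) (hV : V ⊆ Ω)
    (h1 : IsOpen V) (h2 : IsConnected V) : IsGBE V f :=
  ⟨h1, h2, hf.smooth.mono hV, fun p hp => hf.ne_zero p (hV hp)⟩

theorem symAlg_mono {Ω V : Set (ℝ × ℝ)} {f : ℝ × ℝ → ℝ} (hV : V ⊆ Ω) :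
    symAlg Ω f ≤ symAlg V f := by
  rintro _ ⟨a, b, c, d, e, k, rfl, h⟩
  exact mem_symAlg.2 fun p hp => h p (hV hp)

theorem exists_ball_subset {U : Set (ℝ × ℝ)} (h : IsOpen U) {p : ℝ × ℝ} (hp : p ∈ U) :
    ∃ V ⊆ U, IsOpen V ∧ IsConnected V ∧ p ∈ V := by
  obtain ⟨ε, hε, hV⟩ := Metric.isOpen_iff.1 h p hp
  exact ⟨Metric.ball p ε, hV, Metric.isOpen_ball,
    (convex_ball p ε).isConnected ⟨p, Metric.mem_ball_self hε⟩, Metric.mem_ball_self hε⟩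

/-- A function of `t` plus another one times `x` vanishes near a point only if both do. -/
theorem affine_eq_zero {A B : ℝ → ℝ} {p : ℝ × ℝ} (h : ∀ᶠ q in nhds p, A q.1 + B q.1 * q.2 = 0) :
    ∀ᶠ t in nhds p.1, A t = 0 ∧ B t = 0 := by
  have key : ∀ᶠ q in nhds p, A q.1 = 0 ∧ B q.1 = 0 := by
    filter_upwards [h.eventually_nhds] with q hq
    have := quadratic_eq_zero (a := A q.1) (b := B q.1) (c := 0)
      ((eventually_snd hq).mono fun s hs => by simp only at hs; linarith)
    exact ⟨this.1, this.2.1⟩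
  exact eventually_fst key

section facts

variable {Ω : Set (ℝ × ℝ)} {f : ℝ × ℝ → ℝ}

theorem IsGBE.continuousOn_fderiv (hf : IsGBE Ω f) (v : ℝ × ℝ) :
    ContinuousOn (fun p => fderiv ℝ f p v) Ω :=
  ((hf.smooth.fderiv_of_isOpen (m := ∞) hf.isOpen (by simp)).clm_apply contDiffOn_const).continuousOn

/-- The basic device for a nonanalytic f: where the continuous factor is nonzero at one point it
stays so nearby, and a polynomial P that vanishes on an open set has zero coefficients. -/
theorem eventually_zero_of_mul (hΩ : IsOpen Ω) {g P : ℝ × ℝ → ℝ} (hg : ContinuousOn g Ω)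
    (h : ∀ p ∈ Ω, P p * g p = 0) {p : ℝ × ℝ} (hp : p ∈ Ω) (h0 : g p ≠ 0) :
    ∀ᶠ q in nhds p, P q = 0 := by
  filter_upwards [hΩ.mem_nhds hp, (hg.continuousAt (hΩ.mem_nhds hp)).eventually_ne h0] with q h1 h2
  exact (mul_eq_zero.1 (h q h1)).resolve_right h2

/-- The classifying condition is (X - w)f = 0 with constant w. The commutator of X - w and X' - w'
is [X, X'], and it kills f; the bracket indeed has weight zero in these coordinates. Symmetry of the
second derivatives of f is what makes the mixed terms cancel. -/
theorem symAlg_bracket (hf : IsGBE Ω f) {a b c d e k a' b' c' d' e' k' : ℝ}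
    (h : gv a b c d e k ∈ symAlg Ω f) (h' : gv a' b' c' d' e' k' ∈ symAlg Ω f) :
    gv (a * c' - c * a') (a * e' + b * d' - a' * e - b' * d) (2 * (a * k' - k * a'))
          (a * k' - a' * k) (c * e' + e * d' + b * k' - c' * e - e' * d - b' * k)
          (c * k' - k * c') ∈ symAlg Ω f := by
  rw [mem_symAlg] at h h' ⊢
  intro p hp
  have hd : ∀ v : ℝ × ℝ, DifferentiableAt ℝ (fun q => fderiv ℝ f q v) p := fun v =>
    (((hf.smooth.fderiv_of_isOpen (m := ∞) hf.isOpen (by simp)).clm_apply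
      contDiffOn_const).contDiffAt (hf.isOpen.mem_nhds hp)).differentiableAt (by simp)
  have hdf : DifferentiableAt ℝ f p :=
    (hf.smooth.contDiffAt (hf.isOpen.mem_nhds hp)).differentiableAt (by simp)
  have h1 : ContDiffAt ℝ ∞ f p := hf.smooth.contDiffAt (hf.isOpen.mem_nhds hp)
  have h2 : DifferentiableAt ℝ (fderiv ℝ f) p :=
    (h1.fderiv_right (m := ∞) (by simp)).differentiableAt (by simp)
  have hsym : fderiv ℝ (fun q => fderiv ℝ f q (1, 0)) p (0, 1)
      = fderiv ℝ (fun q => fderiv ℝ f q (0, 1)) p (1, 0) := by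
    have h3 := (h1.isSymmSndFDerivAt (by simpa using ENat.LEInfty.out)).eq (1, 0) (0, 1)
    have e1 : ∀ v w : ℝ × ℝ, fderiv ℝ (fun q => fderiv ℝ f q w) p v
        = fderiv ℝ (fderiv ℝ f) p v w := by
      intro v w
      have := (h2.hasFDerivAt.clm_apply (hasFDerivAt_const w p)).fderiv
      simp [this]
    rw [e1, e1, h3]
  have fst : HasFDerivAt (fun p : ℝ × ℝ => p.1) (ContinuousLinearMap.fst ℝ ℝ ℝ) p := hasFDerivAt_fst
  have snd : HasFDerivAt (fun p : ℝ × ℝ => p.2) (ContinuousLinearMap.snd ℝ ℝ ℝ) p := hasFDerivAt_snd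
  have key : ∀ a b c d e k : ℝ, (∀ p ∈ Ω, cls f p a b c d e k = 0) → ∀ v : ℝ × ℝ,
      (c + 2 * k * p.1) * v.1 * fderiv ℝ f p (1, 0)
        + (a + c * p.1 + k * p.1 ^ 2) * fderiv ℝ (fun q => fderiv ℝ f q (1, 0)) p v
        + (d * v.2 + e * v.1 + k * (p.1 * v.2 + p.2 * v.1)) * fderiv ℝ f p (0, 1)
        + (b + d * p.2 + e * p.1 + k * p.1 * p.2) * fderiv ℝ (fun q => fderiv ℝ f q (0, 1)) p v
        - (2 * d - c) * fderiv ℝ f p v = 0 := by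
    intro a b c d e k h v
    have e1 := (((((fst.const_mul c).const_add a).add ((fst.pow 2).const_mul k)).mul
      (hd (1, 0)).hasFDerivAt).add (((((snd.const_mul d).const_add b).add (fst.const_mul e)).add
        ((fst.const_mul k).mul snd)).mul (hd (0, 1)).hasFDerivAt)).sub
        (hdf.hasFDerivAt.const_mul (2 * d - c))
    have e2 := e1.congr_of_eventuallyEq (f₁ := fun _ => 0) (by
        filter_upwards [hf.isOpen.mem_nhds hp] with q hq
        exact (h q hq).symm)
    have e3 := congrArg (fun L : ℝ × ℝ →L[ℝ] ℝ => L v)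
      (e2.unique (hasFDerivAt_const (0 : ℝ) p))
    simp at e3
    linear_combination e3
  have k1 := key a b c d e k h
  have k2 := key a' b' c' d' e' k' h'
  have t1 := k1 (1, 0)
  have x1 := k1 (0, 1)
  have t2 := k2 (1, 0)
  have x2 := k2 (0, 1)
  have z1 := h p hp
  have z2 := h' p hp
  rw [← hsym] at t1 t2
  simp only [cls] at z1 z2 ⊢
  linear_combination (a + c * p.1 + k * p.1 ^ 2) * t2 + (b + d * p.2 + e * p.1 + k * p.1 * p.2) * x2
    - (a' + c' * p.1 + k' * p.1 ^ 2) * t1 - (b' + d' * p.2 + e' * p.1 + k' * p.1 * p.2) * x1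
    + (2 * d' - c') * z1 - (2 * d - c) * z2

theorem symAlg_isBracketClosed (hf : IsGBE Ω f) : IsBracketClosed (symAlg Ω f) := by
  intro X hX Y hY
  obtain ⟨a, b, c, d, e, k, rfl⟩ := mem_algG.1 (symAlg_le hX)
  obtain ⟨a', b', c', d', e', k', rfl⟩ := mem_algG.1 (symAlg_le hY)
  rw [lieBracket_gv]
  exact symAlg_bracket hf hX hY

/-- The condition reads (b + et) f_x = 0. A point with f_x ≠ 0 would make the affine function b + et
vanish near it, hence identically. -/
theorem fx_eq_zero_of_nilrad (hf : IsGBE Ω f) {b e : ℝ} (h : gv 0 b 0 0 e 0 ∈ symAlg Ω f)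
    (h0 : b ≠ 0 ∨ e ≠ 0) : ∀ p ∈ Ω, fderiv ℝ f p (0, 1) = 0 := by
  intro p hp
  by_contra hne
  rw [mem_symAlg] at h
  have := eventually_zero_of_mul (P := fun q => b + e * q.1) hf.isOpen (hf.continuousOn_fderiv _)
    (fun q hq => by have := h q hq; simp only [cls] at this; linear_combination this) hp hne
  have := quadratic_eq_zero (a := b) (b := e) (c := 0)
    ((eventually_fst this).mono fun s hs => by simp only at hs; linarith)
  rcases h0 with h0 | h0
  · exact h0 this.1
  · exact h0 this.2.1

theorem nilrad_mem_of_fx (hx : ∀ p ∈ Ω, fderiv ℝ f p (0, 1) = 0) (b e : ℝ) :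
    gv 0 b 0 0 e 0 ∈ symAlg Ω f := by
  rw [mem_symAlg]
  intro p hp
  simp [cls, hx p hp]

theorem weight_eq_zero_of_fx (hf : IsGBE Ω f) (hx : ∀ p ∈ Ω, fderiv ℝ f p (0, 1) = 0) {b d e : ℝ}
    (h : gv 0 b 0 d e 0 ∈ symAlg Ω f) : d = 0 := by
  obtain ⟨p, hp⟩ := hf.isConnected.nonempty
  have := mem_symAlg.1 h p hp
  simp only [cls, hx p hp] at this
  have h2 : d * f p = 0 := by linarith
  exact (mul_eq_zero.1 h2).resolve_right (hf.ne_zero p hp)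

theorem wronskian_of_ft (hf : IsGBE Ω f) (hx : ∀ p ∈ Ω, fderiv ℝ f p (0, 1) = 0)
    {p₀ : ℝ × ℝ} (hp₀ : p₀ ∈ Ω) (ht : fderiv ℝ f p₀ (1, 0) ≠ 0) {a b c d e k : ℝ}
    (h : gv a b c d e k ∈ symAlg Ω f) (hw : 2 * d - c = 0) : a = 0 ∧ c = 0 ∧ k = 0 := by
  have := eventually_zero_of_mul (P := fun q => a + c * q.1 + k * q.1 ^ 2) hf.isOpen
    (hf.continuousOn_fderiv _)
    (fun q hq => by
      have := mem_symAlg.1 h q hq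
      simp only [cls, hx q hq, hw] at this; linear_combination this) hp₀ ht
  exact quadratic_eq_zero (eventually_fst this)

/-- The combination of the two symmetries that has weight zero satisfies τ f_t = 0, so its τ
vanishes; the factor is the ratio of the weights. -/
theorem proportional_of_ft (hf : IsGBE Ω f) (hx : ∀ p ∈ Ω, fderiv ℝ f p (0, 1) = 0)
    {p₀ : ℝ × ℝ} (hp₀ : p₀ ∈ Ω) (ht : fderiv ℝ f p₀ (1, 0) ≠ 0) {a b c d e k a' b' c' d' e' k' : ℝ}
    (h : gv a b c d e k ∈ symAlg Ω f) (h' : gv a' b' c' d' e' k' ∈ symAlg Ω f)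
    (hw : 2 * d - c ≠ 0) : ∃ l, a' = l * a ∧ c' = l * c ∧ k' = l * k := by
  refine ⟨(2 * d' - c') / (2 * d - c), ?_⟩
  have := wronskian_of_ft hf hx hp₀ ht (lin_mem h' h (2 * d - c) (-(2 * d' - c'))) (by ring)
  refine ⟨?_, ?_, ?_⟩ <;> rw [div_mul_eq_mul_div, eq_div_iff hw] <;> linarith [this.1, this.2.1,
    this.2.2]

theorem const_of_fx_ft (hf : IsGBE Ω f) (hx : ∀ p ∈ Ω, fderiv ℝ f p (0, 1) = 0)
    (ht : ∀ p ∈ Ω, fderiv ℝ f p (1, 0) = 0) :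
    (∃ c, ∀ p ∈ Ω, f p = c) ∧ symAlg Ω f = levi ⊔ nilrad := by
  refine ⟨?_, ?_⟩
  · refine hf.isOpen.exists_is_const_of_fderiv_eq_zero hf.isConnected.isPreconnected
      (hf.smooth.differentiableOn (by simp)) ?_
    intro p hp
    refine ContinuousLinearMap.ext fun v => ?_
    rw [← Prod.mk.eta (p := v), EqTrans.fderiv_pair, hx p hp, ht p hp]
    simp
  · obtain ⟨p, hp⟩ := hf.isConnected.nonempty
    have key : ∀ a b c d e k, gv a b c d e k ∈ symAlg Ω f ↔ gv a b c d e k ∈ levi ⊔ nilrad := by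
      intro a b c d e k
      rw [mem_levi_sup_nilrad, mem_symAlg]
      constructor
      · intro h
        have := h p hp
        simp only [cls, hx p hp, ht p hp] at this
        have h2 : (2 * d - c) * f p = 0 := by linarith
        linarith [(mul_eq_zero.1 h2).resolve_right (hf.ne_zero p hp)]
      · intro h q hq
        simp [cls, hx q hq, ht q hq, h]
    apply le_antisymm
    · intro Q hQ
      obtain ⟨a, b, c, d, e, k, rfl⟩ := mem_algG.1 (symAlg_le hQ)
      exact (key _ _ _ _ _ _).1 hQ
    · intro Q hQ
      obtain ⟨a, b, c, d, e, k, rfl⟩ := mem_algG.1 ((sup_le levi_le nilrad_le) hQ)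
      exact (key _ _ _ _ _ _).2 hQ

/-- If `D^x` plus an element of the nilradical is a symmetry and `f` depends on `x`, then the
nilradical components of all symmetries are determined. -/
theorem components_of_dilation (hf : IsGBE Ω f) {p₀ : ℝ × ℝ} (hp₀ : p₀ ∈ Ω)
    (hx : fderiv ℝ f p₀ (0, 1) ≠ 0) {b₀ e₀ a b c d e k : ℝ}
    (h₀ : gv 0 b₀ 0 1 e₀ 0 ∈ symAlg Ω f) (h : gv a b c d e k ∈ symAlg Ω f) :
    b = b₀ * d - a * e₀ ∧ e = e₀ * d + b₀ * k - c * e₀ := by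
  -- The bracket with the dilation, corrected for nothing else, already lies in the nilradical, so
  -- it must vanish where f depends on x.
  have hb := symAlg_bracket hf h₀ h
  have h1 : gv 0 (b₀ * d - a * e₀ - b) 0 0 (e₀ * d + b₀ * k - c * e₀ - e) 0 ∈ symAlg Ω f := by
    refine mem_of_eq hb ?_ ?_ ?_ ?_ ?_ ?_ <;> ring
  by_contra hc
  refine hx (fx_eq_zero_of_nilrad hf h1 ?_ p₀ hp₀)
  by_contra hc2
  push Not at hc2
  exact hc ⟨by linarith [hc2.1], by linarith [hc2.2]⟩

/-- The dilation eliminates f_x from both conditions, and cross multiplication by the two τ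
eliminates f_t. What remains is the Wronskian of the two quadratics τ times f, so the Wronskian is
zero. -/
theorem wronskian_of_dilation (hf : IsGBE Ω f) {p₀ : ℝ × ℝ} (hp₀ : p₀ ∈ Ω)
    (hx : fderiv ℝ f p₀ (0, 1) ≠ 0) {b₀ e₀ a b c d e k a' b' c' d' e' k' : ℝ}
    (h₀ : gv 0 b₀ 0 1 e₀ 0 ∈ symAlg Ω f) (h : gv a b c d e k ∈ symAlg Ω f)
    (h' : gv a' b' c' d' e' k' ∈ symAlg Ω f) :
    a * c' - c * a' = 0 ∧ a * k' - k * a' = 0 ∧ c * k' - k * c' = 0 := by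
  obtain ⟨rfl, rfl⟩ := components_of_dilation hf hp₀ hx h₀ h
  obtain ⟨rfl, rfl⟩ := components_of_dilation hf hp₀ hx h₀ h'
  rw [mem_symAlg] at h₀ h h'
  have := eventually_zero_of_mul (g := f) (P := fun q => (a * c' - c * a')
      + 2 * (a * k' - k * a') * q.1 + (c * k' - k * c') * q.1 ^ 2) hf.isOpen hf.smooth.continuousOn
    (fun q hq => by
      have e0 := h₀ q hq
      have e1 := h q hq
      have e2 := h' q hq
      simp only [cls] at e0 e1 e2
      linear_combination (a + c * q.1 + k * q.1 ^ 2) * (e2 - (d' + k' * q.1) * e0)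
        - (a' + c' * q.1 + k' * q.1 ^ 2) * (e1 - (d + k * q.1) * e0)) hp₀ (hf.ne_zero _ hp₀)
  obtain ⟨h1, h2, h3⟩ := quadratic_eq_zero (eventually_fst this)
  exact ⟨h1, by linarith, h3⟩

/-- Two fields of weight zero both annihilate f. Near a point with f_x ≠ 0 they are therefore
linearly dependent, and the coefficient of x in the determinant of their components is half the
Wronskian of the two τ, because d = c/2. -/
theorem wronskian_of_weight (hf : IsGBE Ω f) {p₀ : ℝ × ℝ} (hp₀ : p₀ ∈ Ω)
    (hx : fderiv ℝ f p₀ (0, 1) ≠ 0) {a b c d e k a' b' c' d' e' k' : ℝ}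
    (h : gv a b c d e k ∈ symAlg Ω f) (h' : gv a' b' c' d' e' k' ∈ symAlg Ω f)
    (hw : 2 * d - c = 0) (hw' : 2 * d' - c' = 0) :
    a * c' - c * a' = 0 ∧ a * k' - k * a' = 0 ∧ c * k' - k * c' = 0 := by
  rw [mem_symAlg] at h h'
  have := eventually_zero_of_mul (P := fun q =>
      ((a + c * q.1 + k * q.1 ^ 2) * (b' + e' * q.1) - (a' + c' * q.1 + k' * q.1 ^ 2)
        * (b + e * q.1)) + ((a * d' - a' * d) + (a * k' - k * a') * q.1
        + (c * k' + k * d' - c' * k - k' * d) * q.1 ^ 2) * q.2) hf.isOpen (hf.continuousOn_fderiv _)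
    (fun q hq => by
      have e1 := h q hq
      have e2 := h' q hq
      simp only [cls, hw, hw'] at e1 e2
      linear_combination (a + c * q.1 + k * q.1 ^ 2) * e2 - (a' + c' * q.1 + k' * q.1 ^ 2) * e1
        + (d' * hw - d * hw') * q.1 * q.2 * fderiv ℝ f q (0, 1)) hp₀ hx
  obtain ⟨h1, h2, h3⟩ := quadratic_eq_zero ((affine_eq_zero
    (A := fun t => (a + c * t + k * t ^ 2) * (b' + e' * t) - (a' + c' * t + k' * t ^ 2) * (b + e * t))
    (B := fun t => (a * d' - a' * d) + (a * k' - k * a') * t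
      + (c * k' + k * d' - c' * k - k' * d) * t ^ 2) this).mono fun _ h => h.2)
  refine ⟨by linear_combination 2 * h1 + a' * hw - a * hw', h2, ?_⟩
  linear_combination 2 * h3 - k * hw' + k' * hw

/-- If both P^t and D^t were symmetries, then f_t = 0 and t f_t = -f, hence f = 0. The
transformation need not be defined on all of Ω, so the argument is run on a small ball. -/
theorem not_equiv_translation_scale (hf : IsGBE Ω f) :
    ¬ SubalgEquiv (symAlg Ω f) (Submodule.span ℝ {vPt, vDt}) := by
  rintro ⟨T, h1, h2⟩
  obtain ⟨Q1, hQ1, hp1⟩ := h2 vPt (Submodule.subset_span (by simp))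
  obtain ⟨Q2, hQ2, hp2⟩ := h2 vDt (Submodule.subset_span (by simp))
  -- T is undefined at most on one line t = const, and Ω is open and nonempty.
  have : ∃ p ∈ Ω, T.γ * p.1 + T.δ ≠ 0 := by
    by_contra hc
    push Not at hc
    obtain ⟨p, hp⟩ := hf.isConnected.nonempty
    have := eventually_zero_of_mul (g := fun _ => 1) (P := fun q => T.γ * q.1 + T.δ) hf.isOpen
      continuousOn_const (fun q hq => by rw [hc q hq, zero_mul]) hp one_ne_zero
    have := quadratic_eq_zero (a := T.δ) (b := T.γ) (c := 0)
      ((eventually_fst this).mono fun s hs => by simp only at hs; linarith)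
    apply T.det_ne
    rw [this.1, this.2.1]
    ring
  obtain ⟨p, hp, hd⟩ := this
  obtain ⟨V, hV, hVo, hVc, hpV⟩ := exists_ball_subset (hf.isOpen.inter T.isOpen_den) ⟨hp, hd⟩
  have hfV := hf.mono (fun q hq => (hV hq).1) hVo hVc
  have hT : T.DefinedOn V := fun q hq => (hV hq).2
  have hm := EqTrans.mapsEq_push (f := f) hT
  have hf' := hm.isGBE hfV hT
  have m1 := (EqTrans.mem_symAlg_map hfV hT hm (symAlg_le hQ1) (vPt_eq ▸ gv_mem_algG _ _ _ _ _ _)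
    hp1).2 (symAlg_mono (fun q hq => (hV hq).1) hQ1)
  have m2 := (EqTrans.mem_symAlg_map hfV hT hm (symAlg_le hQ2) (vDt_eq ▸ gv_mem_algG _ _ _ _ _ _)
    hp2).2 (symAlg_mono (fun q hq => (hV hq).1) hQ2)
  rw [vPt_eq, mem_symAlg] at m1
  rw [vDt_eq, mem_symAlg] at m2
  have n1 := m1 _ ⟨p, hpV, rfl⟩
  have n2 := m2 _ ⟨p, hpV, rfl⟩
  simp only [cls] at n1 n2
  apply hf'.ne_zero _ ⟨p, hpV, rfl⟩
  linear_combination n2 - (T.onTX p).1 * n1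

end facts

/-! ### The structure of the maximal Lie invariance algebras -/

theorem proportional_of_wronskian {a c k a' c' k' : ℝ} (h : a ≠ 0 ∨ c ≠ 0 ∨ k ≠ 0)
    (hw : a * c' - c * a' = 0 ∧ a * k' - k * a' = 0 ∧ c * k' - k * c' = 0) :
    ∃ l, a' = l * a ∧ c' = l * c ∧ k' = l * k := by
  obtain ⟨h1, h2, h3⟩ := hw
  rcases h with h | h | h
  · refine ⟨a' / a, ?_, ?_, ?_⟩ <;> field_simp <;> linarith
  · refine ⟨c' / c, ?_, ?_, ?_⟩ <;> field_simp <;> linarith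
  · refine ⟨k' / k, ?_, ?_, ?_⟩ <;> field_simp <;> linarith

theorem combination_of_det {a₁ c₁ k₁ a₂ c₂ k₂ a c k : ℝ}
    (h : a₁ * c₂ - c₁ * a₂ ≠ 0 ∨ a₁ * k₂ - k₁ * a₂ ≠ 0 ∨ c₁ * k₂ - k₁ * c₂ ≠ 0)
    (hd : a * (c₁ * k₂ - k₁ * c₂) - c * (a₁ * k₂ - k₁ * a₂) + k * (a₁ * c₂ - c₁ * a₂) = 0) :
    ∃ x y, a = x * a₁ + y * a₂ ∧ c = x * c₁ + y * c₂ ∧ k = x * k₁ + y * k₂ := by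
  rcases h with h | h | h
  · refine ⟨(a * c₂ - c * a₂) / (a₁ * c₂ - c₁ * a₂), (a₁ * c - c₁ * a) / (a₁ * c₂ - c₁ * a₂), ?_⟩
    refine ⟨?_, ?_, ?_⟩ <;> rw [div_mul_eq_mul_div, div_mul_eq_mul_div, ← add_div, eq_div_iff h]
    · ring
    · ring
    · linear_combination hd
  · refine ⟨(a * k₂ - k * a₂) / (a₁ * k₂ - k₁ * a₂), (a₁ * k - k₁ * a) / (a₁ * k₂ - k₁ * a₂), ?_⟩
    refine ⟨?_, ?_, ?_⟩ <;> rw [div_mul_eq_mul_div, div_mul_eq_mul_div, ← add_div, eq_div_iff h]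
    · ring
    · linear_combination -hd
    · ring
  · refine ⟨(c * k₂ - k * c₂) / (c₁ * k₂ - k₁ * c₂), (c₁ * k - k₁ * c) / (c₁ * k₂ - k₁ * c₂), ?_⟩
    refine ⟨?_, ?_, ?_⟩ <;> rw [div_mul_eq_mul_div, div_mul_eq_mul_div, ← add_div, eq_div_iff h]
    · linear_combination hd
    · ring
    · ring

theorem cramer_of_det {a₁ c₁ k₁ a₂ c₂ k₂ a c k : ℝ}
    (hd : a * (c₁ * k₂ - k₁ * c₂) - c * (a₁ * k₂ - k₁ * a₂) + k * (a₁ * c₂ - c₁ * a₂) ≠ 0)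
    (p q r : ℝ) : ∃ x y z, p = x * a₁ + y * a₂ + z * a ∧ q = x * c₁ + y * c₂ + z * c ∧
      r = x * k₁ + y * k₂ + z * k := by
  generalize hD : a * (c₁ * k₂ - k₁ * c₂) - c * (a₁ * k₂ - k₁ * a₂) + k * (a₁ * c₂ - c₁ * a₂) = D
    at hd
  refine ⟨(p * (c₂ * k - k₂ * c) - q * (a₂ * k - k₂ * a) + r * (a₂ * c - c₂ * a)) / D,
    (p * (c * k₁ - k * c₁) - q * (a * k₁ - k * a₁) + r * (a * c₁ - c * a₁)) / D,
    (p * (c₁ * k₂ - k₁ * c₂) - q * (a₁ * k₂ - k₁ * a₂) + r * (a₁ * c₂ - c₁ * a₂)) / D, ?_, ?_, ?_⟩ <;>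
    field_simp <;> rw [← hD] <;> ring

section structure_

variable {Ω : Set (ℝ × ℝ)} {f : ℝ × ℝ → ℝ}

theorem nilrad_trivial (hf : IsGBE Ω f) {p₀ : ℝ × ℝ} (hp₀ : p₀ ∈ Ω)
    (hx : fderiv ℝ f p₀ (0, 1) ≠ 0) {b e : ℝ} (h : gv 0 b 0 0 e 0 ∈ symAlg Ω f) :
    b = 0 ∧ e = 0 := by
  by_contra hc
  refine hx (fx_eq_zero_of_nilrad hf h ?_ p₀ hp₀)
  by_contra hc2
  push Not at hc2
  exact hc hc2

/-- Without dependence on x the nilradical acts trivially and the condition is τ f_t = wf. For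
nonconstant f a symmetry outside the nilradical has τ ≠ 0 and w ≠ 0, and any two such have
proportional τ with proportional weights, so one extra generator is enough. -/
theorem structure_of_fx (hf : IsGBE Ω f) (hx : ∀ p ∈ Ω, fderiv ℝ f p (0, 1) = 0) :
    ((∃ c, ∀ p ∈ Ω, f p = c) ∧ symAlg Ω f = levi ⊔ nilrad) ∨ symAlg Ω f = nilrad ∨
      ∃ a c d k, (a ≠ 0 ∨ c ≠ 0 ∨ k ≠ 0) ∧ 2 * d - c ≠ 0 ∧
        symAlg Ω f = Submodule.span ℝ {gv 0 1 0 0 0 0, gv 0 0 0 0 1 0, gv a 0 c d 0 k} := by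
  by_cases ht : ∀ p ∈ Ω, fderiv ℝ f p (1, 0) = 0
  · exact Or.inl (const_of_fx_ft hf hx ht)
  right
  push Not at ht
  obtain ⟨p₀, hp₀, ht⟩ := ht
  by_cases hn : symAlg Ω f ≤ nilrad
  · left
    refine le_antisymm hn ?_
    intro Q hQ
    obtain ⟨a, b, c, d, e, k, rfl⟩ := mem_algG.1 (nilrad_le hQ)
    obtain ⟨rfl, rfl, rfl, rfl⟩ := mem_nilrad.1 hQ
    exact nilrad_mem_of_fx hx _ _
  right
  rw [SetLike.not_le_iff_exists] at hn
  obtain ⟨Q, hQ, hQn⟩ := hn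
  obtain ⟨a, b, c, d, e, k, rfl⟩ := mem_algG.1 (symAlg_le hQ)
  have hτ : a ≠ 0 ∨ c ≠ 0 ∨ k ≠ 0 := by
    by_contra hc
    push Not at hc
    obtain ⟨rfl, rfl, rfl⟩ := hc
    exact hQn (mem_nilrad.2 ⟨rfl, rfl, weight_eq_zero_of_fx hf hx hQ, rfl⟩)
  have hw : 2 * d - c ≠ 0 := by
    intro hw
    have := wronskian_of_ft hf hx hp₀ ht hQ hw
    tauto
  have hQ' : gv a 0 c d 0 k ∈ symAlg Ω f := by
    refine mem_of_eq (lin_mem hQ (nilrad_mem_of_fx hx b e) 1 (-1)) ?_ ?_ ?_ ?_ ?_ ?_ <;> ring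
  refine ⟨a, c, d, k, hτ, hw, le_antisymm ?_ ?_⟩
  · intro R hR
    obtain ⟨a', b', c', d', e', k', rfl⟩ := mem_algG.1 (symAlg_le hR)
    obtain ⟨l, h1, h2, h3⟩ := proportional_of_ft hf hx hp₀ ht hQ hR hw
    have h0 : gv 0 b' 0 (d' - l * d) e' 0 ∈ symAlg Ω f := by
      refine mem_of_eq (lin_mem hR hQ' 1 (-l)) ?_ ?_ ?_ ?_ ?_ ?_ <;> linarith
    have hd := weight_eq_zero_of_fx hf hx h0
    rw [Submodule.mem_span_triple]
    refine ⟨b', e', l, ?_⟩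
    rw [smul_gv, smul_gv, smul_gv, gv_add, gv_add, gv_inj]
    refine ⟨?_, ?_, ?_, ?_, ?_, ?_⟩ <;> linarith
  · rw [Submodule.span_le]
    rintro R (rfl | rfl | rfl)
    · exact nilrad_mem_of_fx hx 1 0
    · exact nilrad_mem_of_fx hx 0 1
    · exact hQ'

/-- All τ are proportional by the Wronskian argument and the nilradical components are fixed by the
dilation, so at most one generator is added. Subtracting a multiple of the dilation makes its weight
zero, that is, d = c/2. -/
theorem structure_of_dilation (hf : IsGBE Ω f) {p₀ : ℝ × ℝ} (hp₀ : p₀ ∈ Ω)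
    (hx : fderiv ℝ f p₀ (0, 1) ≠ 0) {b₀ e₀ : ℝ} (h₀ : gv 0 b₀ 0 1 e₀ 0 ∈ symAlg Ω f) :
    symAlg Ω f = Submodule.span ℝ {gv 0 b₀ 0 1 e₀ 0} ∨
      ∃ a b c e k, (a ≠ 0 ∨ c ≠ 0 ∨ k ≠ 0) ∧ b = b₀ * (c / 2) - a * e₀ ∧
        e = e₀ * (c / 2) + b₀ * k - c * e₀ ∧
        symAlg Ω f = Submodule.span ℝ {gv 0 b₀ 0 1 e₀ 0, gv a b c (c / 2) e k} := by
  have hrad : ∀ b d e, gv 0 b 0 d e 0 ∈ symAlg Ω f →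
      gv 0 b 0 d e 0 = d • gv 0 b₀ 0 1 e₀ 0 := by
    intro b d e h
    obtain ⟨h1, h2⟩ := components_of_dilation hf hp₀ hx h₀ h
    rw [smul_gv, gv_inj]
    refine ⟨?_, ?_, ?_, ?_, ?_, ?_⟩ <;> linarith
  by_cases hn : ∀ a b c d e k, gv a b c d e k ∈ symAlg Ω f → a = 0 ∧ c = 0 ∧ k = 0
  · left
    apply le_antisymm
    · intro R hR
      obtain ⟨a', b', c', d', e', k', rfl⟩ := mem_algG.1 (symAlg_le hR)
      obtain ⟨rfl, rfl, rfl⟩ := hn _ _ _ _ _ _ hR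
      rw [Submodule.mem_span_singleton]
      exact ⟨_, (hrad _ _ _ hR).symm⟩
    · rw [Submodule.span_le]
      rintro R rfl
      exact h₀
  · right
    push Not at hn
    obtain ⟨a, b, c, d, e, k, hQ, hτ⟩ := hn
    have hτ : a ≠ 0 ∨ c ≠ 0 ∨ k ≠ 0 := by tauto
    have hQ' := lin_mem hQ h₀ 1 (c / 2 - d)
    have hQ2 : gv a (b + (c / 2 - d) * b₀) c (c / 2) (e + (c / 2 - d) * e₀) k ∈ symAlg Ω f := by
      refine mem_of_eq hQ' ?_ ?_ ?_ ?_ ?_ ?_ <;> ring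
    obtain ⟨h1, h2⟩ := components_of_dilation hf hp₀ hx h₀ hQ2
    refine ⟨_, _, _, _, _, hτ, h1, h2, le_antisymm ?_ ?_⟩
    · intro R hR
      obtain ⟨a', b', c', d', e', k', rfl⟩ := mem_algG.1 (symAlg_le hR)
      obtain ⟨l, e1, e2, e3⟩ := proportional_of_wronskian hτ
        (wronskian_of_dilation hf hp₀ hx h₀ hQ2 hR)
      have hR' := lin_mem hR hQ2 1 (-l)
      have hR2 : gv 0 (b' - l * (b + (c / 2 - d) * b₀)) 0 (d' - l * (c / 2))
          (e' - l * (e + (c / 2 - d) * e₀)) 0 ∈ symAlg Ω f := by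
        refine mem_of_eq hR' ?_ ?_ ?_ ?_ ?_ ?_ <;> linarith
      have hR3 := hrad _ _ _ hR2
      rw [smul_gv, gv_inj] at hR3
      rw [Submodule.mem_span_pair]
      refine ⟨d' - l * (c / 2), l, ?_⟩
      rw [smul_gv, smul_gv, gv_add, gv_inj]
      obtain ⟨-, g2, -, -, g5, -⟩ := hR3
      refine ⟨?_, ?_, ?_, ?_, ?_, ?_⟩ <;> linarith
    · rw [Submodule.span_le]
      rintro R (rfl | rfl)
      · exact h₀
      · exact hQ2

/-- `[Q, R] = Q` for the vector fields with the given coordinates. -/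
def BracketUnit (a b c d e k a' b' c' d' e' k' : ℝ) : Prop :=
  a * c' - c * a' = a ∧ a * e' + b * d' - a' * e - b' * d = b ∧ 2 * (a * k' - k * a') = c ∧
    a * k' - a' * k = d ∧ c * e' + e * d' + b * k' - c' * e - e' * d - b' * k = e ∧
    c * k' - k * c' = k

/-- With no symmetries having τ = 0, a symmetry is determined by its quadratic τ. If all quadratics
occurred, brackets would supply weight-zero symmetries with nonproportional τ. If exactly two
dimensions occur, the bracket is nonzero, because its τ is the Wronskian, and the algebra is the
nonabelian one. -/
theorem structure_of_no_dilation (hf : IsGBE Ω f) {p₀ : ℝ × ℝ} (hp₀ : p₀ ∈ Ω)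
    (hx : fderiv ℝ f p₀ (0, 1) ≠ 0)
    (hrad : ∀ b d e, gv 0 b 0 d e 0 ∈ symAlg Ω f → b = 0 ∧ d = 0 ∧ e = 0) :
    symAlg Ω f = ⊥ ∨
    (∃ a b c d e k, (a ≠ 0 ∨ c ≠ 0 ∨ k ≠ 0) ∧ symAlg Ω f = Submodule.span ℝ {gv a b c d e k}) ∨
    ∃ a b c d e k a' b' c' d' e' k', (a ≠ 0 ∨ c ≠ 0 ∨ k ≠ 0) ∧
      BracketUnit a b c d e k a' b' c' d' e' k' ∧ 2 * d' - c' ≠ 0 ∧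
      symAlg Ω f = Submodule.span ℝ {gv a b c d e k, gv a' b' c' d' e' k'} := by
  by_cases h0 : symAlg Ω f = ⊥
  · exact Or.inl h0
  right
  have hτ : ∀ a b c d e k, gv a b c d e k ∈ symAlg Ω f → gv a b c d e k ≠ 0 →
      (a ≠ 0 ∨ c ≠ 0 ∨ k ≠ 0) := by
    intro a b c d e k h hne
    by_contra hc
    push Not at hc
    obtain ⟨rfl, rfl, rfl⟩ := hc
    obtain ⟨rfl, rfl, rfl⟩ := hrad _ _ _ h
    exact hne gv_zero
  have hinj : ∀ a b c d e k b' d' e', gv a b c d e k ∈ symAlg Ω f →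
      gv a b' c d' e' k ∈ symAlg Ω f → b = b' ∧ d = d' ∧ e = e' := by
    intro a b c d e k b' d' e' h h'
    have h2 : gv 0 (b - b') 0 (d - d') (e - e') 0 ∈ symAlg Ω f := by
      refine mem_of_eq (lin_mem h h' 1 (-1)) ?_ ?_ ?_ ?_ ?_ ?_ <;> ring
    have := hrad _ _ _ h2
    refine ⟨?_, ?_, ?_⟩ <;> linarith
  obtain ⟨Q, hQ, hQ0⟩ := Submodule.exists_mem_ne_zero_of_ne_bot h0
  obtain ⟨a, b, c, d, e, k, rfl⟩ := mem_algG.1 (symAlg_le hQ)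
  have hτQ := hτ _ _ _ _ _ _ hQ hQ0
  by_cases hp : ∀ a' b' c' d' e' k', gv a' b' c' d' e' k' ∈ symAlg Ω f →
      a * c' - c * a' = 0 ∧ a * k' - k * a' = 0 ∧ c * k' - k * c' = 0
  · left
    refine ⟨a, b, c, d, e, k, hτQ, le_antisymm ?_ ?_⟩
    · intro R hR
      obtain ⟨a', b', c', d', e', k', rfl⟩ := mem_algG.1 (symAlg_le hR)
      obtain ⟨l, rfl, rfl, rfl⟩ := proportional_of_wronskian hτQ (hp _ _ _ _ _ _ hR)
      have hl := lin_mem hQ hQ l 0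
      obtain ⟨rfl, rfl, rfl⟩ := hinj _ _ _ _ _ _ (l * b) (l * d) (l * e) hR (by
        refine mem_of_eq hl ?_ ?_ ?_ ?_ ?_ ?_ <;> ring)
      rw [Submodule.mem_span_singleton]
      exact ⟨l, smul_gv ..⟩
    · rw [Submodule.span_le]
      rintro R rfl
      exact hQ
  right
  push Not at hp
  obtain ⟨a', b', c', d', e', k', hR, hW⟩ := hp
  have hW' : a * c' - c * a' ≠ 0 ∨ a * k' - k * a' ≠ 0 ∨ c * k' - k * c' ≠ 0 := by tauto
  -- the projection to the Levi factor is not surjective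
  have hcomb : ∀ a1 b1 c1 d1 e1 k1, gv a1 b1 c1 d1 e1 k1 ∈ symAlg Ω f →
      ∃ x y, a1 = x * a + y * a' ∧ c1 = x * c + y * c' ∧ k1 = x * k + y * k' := by
    intro a1 b1 c1 d1 e1 k1 h1
    by_contra hc
    have hdet : a1 * (c * k' - k * c') - c1 * (a * k' - k * a') + k1 * (a * c' - c * a') ≠ 0 :=
      fun hd => hc (combination_of_det hW' hd)
    have hE : ∀ p q r : ℝ, ∃ b d e, gv p b q d e r ∈ symAlg Ω f := by
      intro p q r
      obtain ⟨x, y, z, g1, g2, g3⟩ := cramer_of_det hdet p q r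
      have := lin_mem (lin_mem hQ hR x y) h1 1 z
      exact ⟨_, _, _, mem_of_eq this (by linarith) rfl (by linarith) rfl rfl (by linarith)⟩
    -- From τ = 1, t, t² the brackets of neighbours have τ = 1 and τ = t²; they are of weight zero
    -- and not proportional.
    obtain ⟨b1, d1, e1, m1⟩ := hE 1 0 0
    obtain ⟨b2, d2, e2, m2⟩ := hE 0 1 0
    obtain ⟨b3, d3, e3, m3⟩ := hE 0 0 1
    have n1 := symAlg_bracket hf m1 m2
    have n2 := symAlg_bracket hf m2 m3
    have := (wronskian_of_weight hf hp₀ hx n1 n2 (by ring) (by ring)).2.1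
    norm_num at this
  have hspan : ∀ a1 b1 c1 d1 e1 k1, gv a1 b1 c1 d1 e1 k1 ∈ symAlg Ω f →
      ∃ x y : ℝ, gv a1 b1 c1 d1 e1 k1 = x • gv a b c d e k + y • gv a' b' c' d' e' k' := by
    intro a1 b1 c1 d1 e1 k1 h1
    obtain ⟨x, y, rfl, rfl, rfl⟩ := hcomb _ _ _ _ _ _ h1
    obtain ⟨rfl, rfl, rfl⟩ := hinj _ _ _ _ _ _ _ _ _ h1 (lin_mem hQ hR x y)
    refine ⟨x, y, ?_⟩
    rw [smul_gv, smul_gv, gv_add]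
  have hB := symAlg_bracket hf hQ hR
  have hBτ : a * c' - c * a' ≠ 0 ∨ 2 * (a * k' - k * a') ≠ 0 ∨ c * k' - k * c' ≠ 0 := by
    rcases hW' with h | h | h
    · exact Or.inl h
    · exact Or.inr (Or.inl (mul_ne_zero two_ne_zero h))
    · exact Or.inr (Or.inr h)
  obtain ⟨x, y, hxy⟩ := hspan _ _ _ _ _ _ hB
  have hB' := hxy
  rw [smul_gv, smul_gv, gv_add, gv_inj] at hxy
  obtain ⟨g1, g2, g3, g4, g5, g6⟩ := hxy
  suffices hfin : ∃ a1 b1 c1 d1 e1 k1, gv a1 b1 c1 d1 e1 k1 ∈ symAlg Ω f ∧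
      BracketUnit (a * c' - c * a') (a * e' + b * d' - a' * e - b' * d)
        (2 * (a * k' - k * a')) (a * k' - a' * k)
        (c * e' + e * d' + b * k' - c' * e - e' * d - b' * k) (c * k' - k * c')
        a1 b1 c1 d1 e1 k1 ∧
      gv a b c d e k ∈ Submodule.span ℝ {gv (a * c' - c * a') (a * e' + b * d' - a' * e - b' * d)
        (2 * (a * k' - k * a')) (a * k' - a' * k)
        (c * e' + e * d' + b * k' - c' * e - e' * d - b' * k) (c * k' - k * c'),
        gv a1 b1 c1 d1 e1 k1} ∧
      gv a' b' c' d' e' k' ∈ Submodule.span ℝ {gv (a * c' - c * a') (a * e' + b * d' - a' * e - b' * d)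
        (2 * (a * k' - k * a')) (a * k' - a' * k)
        (c * e' + e * d' + b * k' - c' * e - e' * d - b' * k) (c * k' - k * c'),
        gv a1 b1 c1 d1 e1 k1} by
    obtain ⟨a1, b1, c1, d1, e1, k1, m, hu, m1, m2⟩ := hfin
    refine ⟨_, _, _, _, _, _, a1, b1, c1, d1, e1, k1, hBτ, hu, fun hw => ?_,
      le_antisymm (fun Z hZ => ?_) ?_⟩
    -- The first generator is a bracket and has weight zero. Were the second of weight zero too,
    -- their τ would be proportional, against [Q, R] = Q with τ ≠ 0.
    · obtain ⟨v1, v2, v3⟩ := wronskian_of_weight hf hp₀ hx hB m (by ring) hw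
      obtain ⟨u1, -, u3, -, -, u6⟩ := hu
      rw [v1] at u1
      rw [v2] at u3
      rw [v3] at u6
      rcases hBτ with h | h | h
      · exact h u1.symm
      · exact h (by linarith)
      · exact h u6.symm
    · obtain ⟨a2, b2, c2, d2, e2, k2, rfl⟩ := mem_algG.1 (symAlg_le hZ)
      obtain ⟨x', y', hz⟩ := hspan _ _ _ _ _ _ hZ
      rw [hz]
      exact Submodule.add_mem _ (Submodule.smul_mem _ _ m1) (Submodule.smul_mem _ _ m2)
    · rw [Submodule.span_le]
      rintro Z (rfl | rfl)
      · exact hB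
      · exact m
  have hxy0 : x ≠ 0 ∨ y ≠ 0 := by
    by_contra hc
    push Not at hc
    obtain ⟨rfl, rfl⟩ := hc
    simp only [zero_mul, add_zero] at g1 g3 g6
    tauto
  -- If Z = [Q, R] = xQ + yR, then [Z, R/x] = Z when x ≠ 0 and [Z, -Q/y] = Z when y ≠ 0; this gives
  -- the second generator.
  rcases hxy0 with h | h
  · have hi : x⁻¹ * x = 1 := inv_mul_cancel₀ h
    refine ⟨_, _, _, _, _, _, mem_of_eq (lin_mem hR hR x⁻¹ 0) (add_eq_left.2 (zero_mul _))
      (add_eq_left.2 (zero_mul _)) (add_eq_left.2 (zero_mul _)) (add_eq_left.2 (zero_mul _))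
      (add_eq_left.2 (zero_mul _)) (add_eq_left.2 (zero_mul _)), ⟨?_, ?_, ?_, ?_, ?_, ?_⟩, ?_, ?_⟩
    · linear_combination x⁻¹ * (c' * g1 - a' * g3) + (a * c' - c * a') * hi
    · linear_combination x⁻¹ * (e' * g1 + d' * g2 - a' * g5 - b' * g4)
        + (a * e' + b * d' - a' * e - b' * d) * hi
    · linear_combination x⁻¹ * 2 * (k' * g1 - a' * g6) + 2 * (a * k' - k * a') * hi
    · linear_combination x⁻¹ * (k' * g1 - a' * g6) + (a * k' - a' * k) * hi
    · linear_combination x⁻¹ * (e' * g3 + d' * g5 + k' * g2 - c' * g5 - e' * g4 - b' * g6)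
        + (c * e' + e * d' + b * k' - c' * e - e' * d - b' * k) * hi
    · linear_combination x⁻¹ * (k' * g3 - c' * g6) + (c * k' - k * c') * hi
    · rw [Submodule.mem_span_pair]
      refine ⟨x⁻¹, -y, ?_⟩
      rw [hB', ← smul_gv]
      match_scalars <;> field_simp <;> ring
    · rw [Submodule.mem_span_pair]
      refine ⟨0, x, ?_⟩
      rw [← smul_gv]
      match_scalars <;> field_simp
  · have hi : y⁻¹ * y = 1 := inv_mul_cancel₀ h
    refine ⟨_, _, _, _, _, _, mem_of_eq (lin_mem hQ hQ (-y⁻¹) 0) (add_eq_left.2 (zero_mul _))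
      (add_eq_left.2 (zero_mul _)) (add_eq_left.2 (zero_mul _)) (add_eq_left.2 (zero_mul _))
      (add_eq_left.2 (zero_mul _)) (add_eq_left.2 (zero_mul _)), ⟨?_, ?_, ?_, ?_, ?_, ?_⟩, ?_, ?_⟩
    · linear_combination -y⁻¹ * (c * g1 - a * g3) + (a * c' - c * a') * hi
    · linear_combination -y⁻¹ * (e * g1 + d * g2 - a * g5 - b * g4)
        + (a * e' + b * d' - a' * e - b' * d) * hi
    · linear_combination -y⁻¹ * 2 * (k * g1 - a * g6) + 2 * (a * k' - k * a') * hi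
    · linear_combination -y⁻¹ * (k * g1 - a * g6) + (a * k' - a' * k) * hi
    · linear_combination -y⁻¹ * (e * g3 + d * g5 + k * g2 - c * g5 - e * g4 - b * g6)
        + (c * e' + e * d' + b * k' - c' * e - e' * d - b' * k) * hi
    · linear_combination -y⁻¹ * (k * g3 - c * g6) + (c * k' - k * c') * hi
    · rw [Submodule.mem_span_pair]
      refine ⟨0, -y, ?_⟩
      rw [← smul_gv]
      match_scalars <;> field_simp
    · rw [Submodule.mem_span_pair]
      refine ⟨y⁻¹, x, ?_⟩
      rw [hB', ← smul_gv]
      match_scalars <;> field_simp <;> ring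

end structure_

/-- The possible maximal Lie invariance algebras in coordinates. -/
inductive SymStructure (Ω : Set (ℝ × ℝ)) (f : ℝ × ℝ → ℝ) : Prop
  | bot (h : symAlg Ω f = ⊥)
  | full (hc : ∃ c, ∀ p ∈ Ω, f p = c) (h : symAlg Ω f = levi ⊔ nilrad)
  | nil (h : symAlg Ω f = nilrad)
  | nilExt (a c d k : ℝ) (hτ : a ≠ 0 ∨ c ≠ 0 ∨ k ≠ 0) (hw : 2 * d - c ≠ 0)
      (h : symAlg Ω f = Submodule.span ℝ {gv 0 1 0 0 0 0, gv 0 0 0 0 1 0, gv a 0 c d 0 k})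
  | dil (b e : ℝ) (h : symAlg Ω f = Submodule.span ℝ {gv 0 b 0 1 e 0})
  | dilExt (b₀ e₀ a b c e k : ℝ) (hτ : a ≠ 0 ∨ c ≠ 0 ∨ k ≠ 0) (hb : b = b₀ * (c / 2) - a * e₀)
      (he : e = e₀ * (c / 2) + b₀ * k - c * e₀)
      (h : symAlg Ω f = Submodule.span ℝ {gv 0 b₀ 0 1 e₀ 0, gv a b c (c / 2) e k})
  | single (a b c d e k : ℝ) (hτ : a ≠ 0 ∨ c ≠ 0 ∨ k ≠ 0)
      (h : symAlg Ω f = Submodule.span ℝ {gv a b c d e k})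
  | pair (a b c d e k a' b' c' d' e' k' : ℝ) (hτ : a ≠ 0 ∨ c ≠ 0 ∨ k ≠ 0)
      (hb : BracketUnit a b c d e k a' b' c' d' e' k') (hw : 2 * d' - c' ≠ 0)
      (h : symAlg Ω f = Submodule.span ℝ {gv a b c d e k, gv a' b' c' d' e' k'})

section structure_

variable {Ω : Set (ℝ × ℝ)} {f : ℝ × ℝ → ℝ}

theorem symStructure (hf : IsGBE Ω f) : SymStructure Ω f := by
  by_cases hx : ∀ p ∈ Ω, fderiv ℝ f p (0, 1) = 0
  · rcases structure_of_fx hf hx with ⟨hc, h⟩ | h | ⟨a, c, d, k, hτ, hw, h⟩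
    · exact .full hc h
    · exact .nil h
    · exact .nilExt a c d k hτ hw h
  push Not at hx
  obtain ⟨p₀, hp₀, hx⟩ := hx
  by_cases hd : ∃ b d e, gv 0 b 0 d e 0 ∈ symAlg Ω f ∧ d ≠ 0
  · obtain ⟨b, d, e, h, hd⟩ := hd
    have h₀ : gv 0 (b / d) 0 1 (e / d) 0 ∈ symAlg Ω f := by
      refine mem_of_eq (lin_mem h h d⁻¹ 0) ?_ ?_ ?_ ?_ ?_ ?_ <;> field_simp <;> ring
    rcases structure_of_dilation hf hp₀ hx h₀ with h | ⟨a, b, c, e, k, hτ, hb, he, h⟩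
    · exact .dil _ _ h
    · exact .dilExt _ _ _ _ _ _ _ hτ hb he h
  · have hrad : ∀ b d e, gv 0 b 0 d e 0 ∈ symAlg Ω f → b = 0 ∧ d = 0 ∧ e = 0 := by
      intro b d e h
      have hd0 : d = 0 := by
        by_contra hne
        exact hd ⟨b, d, e, h, hne⟩
      subst hd0
      have := nilrad_trivial hf hp₀ hx h
      tauto
    rcases structure_of_no_dilation hf hp₀ hx hrad with
      h | ⟨a, b, c, d, e, k, hτ, h⟩ | ⟨a, b, c, d, e, k, a', b', c', d', e', k', hτ, hb, hw, h⟩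
    · exact .bot h
    · exact .single _ _ _ _ _ _ hτ h
    · exact .pair _ _ _ _ _ _ _ _ _ _ _ _ hτ hb hw h

end structure_

/-! ### Dimensions -/

theorem levi_sup_nilrad_eq :
    levi ⊔ nilrad = Submodule.span ℝ {vPx, vG, vPt, vDt + (1 / 2 : ℝ) • vDx, vPi} := by
  rw [levi, nilrad, ← Submodule.span_union]
  congr 1
  ext Q
  simp only [Set.mem_union, Set.mem_insert_iff, Set.mem_singleton_iff]
  tauto

theorem finrank_span_one {Q : VF} (h : Q ≠ 0) : Module.finrank ℝ (Submodule.span ℝ {Q}) = 1 :=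
  finrank_span_singleton h

theorem finrank_span_two {Q R : VF} (h : ∀ x y : ℝ, x • Q + y • R = 0 → x = 0 ∧ y = 0) :
    Module.finrank ℝ (Submodule.span ℝ {Q, R}) = 2 := by
  have := finrank_span_eq_card (LinearIndependent.pair_iff.2 h)
  rwa [Matrix.range_cons, Matrix.range_cons, Matrix.range_empty, Set.union_empty] at this

theorem finrank_span_three {Q R S : VF}
    (h : ∀ x y z : ℝ, x • Q + y • R + z • S = 0 → x = 0 ∧ y = 0 ∧ z = 0) :
    Module.finrank ℝ (Submodule.span ℝ {Q, R, S}) = 3 := by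
  have hl : LinearIndependent ℝ ![Q, R, S] := by
    rw [Fintype.linearIndependent_iff]
    intro g hg
    simp only [Fin.sum_univ_three, Matrix.cons_val_zero, Matrix.cons_val_one,
      Matrix.cons_val] at hg
    obtain ⟨h0, h1, h2⟩ := h _ _ _ hg
    intro i
    fin_cases i <;> assumption
  have := finrank_span_eq_card hl
  rwa [Matrix.range_cons, Matrix.range_cons, Matrix.range_cons, Matrix.range_empty,
    Set.union_empty] at this

theorem finrank_span_two_le (Q R : VF) : Module.finrank ℝ (Submodule.span ℝ {Q, R}) ≤ 2 := by
  have := finrank_range_le_card (R := ℝ) (b := ![Q, R])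
  rwa [Matrix.range_cons, Matrix.range_cons, Matrix.range_empty, Set.union_empty] at this

theorem finrank_span_three_le (Q R S : VF) :
    Module.finrank ℝ (Submodule.span ℝ {Q, R, S}) ≤ 3 := by
  have := finrank_range_le_card (R := ℝ) (b := ![Q, R, S])
  rwa [Matrix.range_cons, Matrix.range_cons, Matrix.range_cons, Matrix.range_empty,
    Set.union_empty] at this

theorem finrank_nilrad : Module.finrank ℝ nilrad = 2 := by
  refine finrank_span_two fun x y h => ?_
  rw [vPx_eq, vG_eq, smul_gv, smul_gv, gv_add, ← gv_zero, gv_inj] at h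
  constructor <;> linarith

theorem finrank_levi_sup_nilrad : Module.finrank ℝ (levi ⊔ nilrad : Submodule ℝ VF) = 5 := by
  rw [levi_sup_nilrad_eq]
  have hl : LinearIndependent ℝ ![vPx, vG, vPt, vDt + (1 / 2 : ℝ) • vDx, vPi] := by
    rw [Fintype.linearIndependent_iff]
    intro g hg
    simp only [Fin.sum_univ_five, Matrix.cons_val_zero, Matrix.cons_val_one,
      Matrix.cons_val, vPx_eq, vG_eq, vPt_eq, vDt_eq, vDx_eq, vPi_eq, smul_gv, gv_add] at hg
    rw [← gv_zero, gv_inj] at hg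
    obtain ⟨h1, h2, h3, h4, h5, h6⟩ := hg
    intro i
    fin_cases i <;> simp only [Fin.zero_eta, Fin.mk_one, Fin.reduceFinMk] <;> linarith
  have := finrank_span_eq_card hl
  rwa [Matrix.range_cons, Matrix.range_cons, Matrix.range_cons, Matrix.range_cons,
    Matrix.range_cons, Matrix.range_empty, Set.union_empty] at this

theorem eq_zero_of_smul_tau {x a c k : ℝ} (hτ : a ≠ 0 ∨ c ≠ 0 ∨ k ≠ 0)
    (h1 : x * a = 0) (h2 : x * c = 0) (h3 : x * k = 0) : x = 0 := by
  simp only [mul_eq_zero] at h1 h2 h3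
  tauto

/-- Bracketing Q with a combination xQ + yR gives yQ, so a combination with zero τ has y = 0, and
then x = 0. -/
theorem BracketUnit.tau_independent {a b c d e k a' b' c' d' e' k' x y : ℝ}
    (hτ : a ≠ 0 ∨ c ≠ 0 ∨ k ≠ 0) (hb : BracketUnit a b c d e k a' b' c' d' e' k')
    (h1 : x * a + y * a' = 0) (h2 : x * c + y * c' = 0) (h3 : x * k + y * k' = 0) :
    x = 0 ∧ y = 0 := by
  obtain ⟨g1, -, g3, -, -, g6⟩ := hb
  have hy : y = 0 := by
    refine eq_zero_of_smul_tau hτ ?_ ?_ ?_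
    · linear_combination a * h2 - c * h1 - y * g1
    · linear_combination 2 * a * h3 - 2 * k * h1 - y * g3
    · linear_combination c * h3 - k * h2 - y * g6
  subst hy
  simp only [zero_mul, add_zero] at h1 h2 h3
  exact ⟨eq_zero_of_smul_tau hτ h1 h2 h3, rfl⟩

/-- The classification of the dimensions. -/
theorem finrank_symAlg {Ω : Set (ℝ × ℝ)} {f : ℝ × ℝ → ℝ} (hf : IsGBE Ω f) :
    (Module.finrank ℝ (symAlg Ω f) = 5 ∧ ∃ c, ∀ p ∈ Ω, f p = c) ∨
      Module.finrank ℝ (symAlg Ω f) ∈ ({0, 1, 2, 3} : Set ℕ) := by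
  cases symStructure hf with
  | bot h => rw [h, finrank_bot]; simp
  | full hc h => rw [h, finrank_levi_sup_nilrad]; simpa using hc
  | nil h => rw [h, finrank_nilrad]; simp
  | nilExt a c d k hτ hw h =>
    rw [h, finrank_span_three]
    · simp
    intro x y z h
    rw [smul_gv, smul_gv, smul_gv, gv_add, gv_add, ← gv_zero, gv_inj] at h
    obtain ⟨h1, h2, h3, h4, h5, h6⟩ := h
    have hz : z = 0 := eq_zero_of_smul_tau hτ (by linarith) (by linarith) (by linarith)
    subst hz
    refine ⟨by linarith, by linarith, rfl⟩
  | dil b e h =>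
    rw [h, finrank_span_one]
    · simp
    rw [← gv_zero, Ne, gv_inj]
    simp
  | dilExt b₀ e₀ a b c e k hτ hb he h =>
    rw [h, finrank_span_two]
    · simp
    intro x y h
    rw [smul_gv, smul_gv, gv_add, ← gv_zero, gv_inj] at h
    obtain ⟨h1, h2, h3, h4, h5, h6⟩ := h
    have hz : y = 0 := eq_zero_of_smul_tau hτ (by linarith) (by linarith) (by linarith)
    subst hz
    refine ⟨by linarith, rfl⟩
  | single a b c d e k hτ h =>
    rw [h, finrank_span_one]
    · simp
    rw [← gv_zero, Ne, gv_inj]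
    tauto
  | pair a b c d e k a' b' c' d' e' k' hτ hb hw h =>
    rw [h, finrank_span_two]
    · simp
    intro x y h
    rw [smul_gv, smul_gv, gv_add, ← gv_zero, gv_inj] at h
    exact hb.tau_independent hτ h.1 h.2.2.1 h.2.2.2.2.2

theorem symAlg_eq_of_const {Ω : Set (ℝ × ℝ)} {f : ℝ × ℝ → ℝ} (hf : IsGBE Ω f) {c : ℝ}
    (hc : ∀ p ∈ Ω, f p = c) : symAlg Ω f = levi ⊔ nilrad := by
  have h0 : ∀ p ∈ Ω, fderiv ℝ f p = 0 := by
    intro p hp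
    have : f =ᶠ[nhds p] fun _ => c := by
      filter_upwards [hf.isOpen.mem_nhds hp] with q hq using hc q hq
    rw [this.fderiv_eq]
    simp
  exact (const_of_fx_ft hf (fun p hp => by rw [h0 p hp]; rfl) fun p hp => by rw [h0 p hp]; rfl).2

theorem finrank_symAlg_of_const {Ω : Set (ℝ × ℝ)} {f : ℝ × ℝ → ℝ} (hf : IsGBE Ω f) {c : ℝ}
    (hc : ∀ p ∈ Ω, f p = c) : Module.finrank ℝ (symAlg Ω f) = 5 := by
  rw [symAlg_eq_of_const hf hc, finrank_levi_sup_nilrad]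

/-! ### Intersections with the radical -/

theorem nilrad_ne_cartan : nilrad ≠ cartan := by
  intro h
  have : gv 0 1 0 0 0 0 ∈ cartan := h ▸ mem_nilrad.2 ⟨rfl, rfl, rfl, rfl⟩
  simpa using (mem_cartan.1 this).2.1

theorem nilrad_ne_bot : nilrad ≠ ⊥ := by
  intro h
  have : gv 0 1 0 0 0 0 ∈ nilrad := mem_nilrad.2 ⟨rfl, rfl, rfl, rfl⟩
  rw [h, Submodule.mem_bot, ← gv_zero, gv_inj] at this
  simp at this

theorem cartan_ne_bot : cartan ≠ ⊥ := by
  intro h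
  have : gv 0 0 0 1 0 0 ∈ cartan := mem_cartan.2 ⟨rfl, rfl, rfl, rfl, rfl⟩
  rw [h, Submodule.mem_bot, ← gv_zero, gv_inj] at this
  simp at this

/-- The properties of appropriate subalgebras. -/
def RadProps (s : Submodule ℝ VF) : Prop :=
  (s ⊓ nilrad ≠ ⊥ → s ⊓ rad = nilrad) ∧
    (s ⊓ rad = cartan → s ≤ levi ⊔ cartan ∧ Module.finrank ℝ s ≤ 2) ∧
    (s ⊓ rad = nilrad → (Module.finrank ℝ s ≤ 3 ∧ s ⊓ levi = ⊥) ∨ s = levi ⊔ nilrad) ∧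
    (s ⊓ rad = ⊥ → Module.finrank ℝ s ≤ 2 ∧ (Module.finrank ℝ s = 2 →
      prC s = cartan ∧ ¬ SubalgEquiv s (Submodule.span ℝ {vPt, vDt})))

theorem radProps_of_nilrad {s : Submodule ℝ VF} (hs : s ⊓ rad = nilrad)
    (h : (Module.finrank ℝ s ≤ 3 ∧ s ⊓ levi = ⊥) ∨ s = levi ⊔ nilrad) : RadProps s :=
  ⟨fun _ => hs, fun h' => (nilrad_ne_cartan (hs.symm.trans h')).elim, fun _ => h,
    fun h' => (nilrad_ne_bot (hs.symm.trans h')).elim⟩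

theorem radProps_of_bot {s : Submodule ℝ VF} (hs : s ⊓ rad = ⊥)
    (h : Module.finrank ℝ s ≤ 2 ∧ (Module.finrank ℝ s = 2 →
      prC s = cartan ∧ ¬ SubalgEquiv s (Submodule.span ℝ {vPt, vDt}))) : RadProps s := by
  refine ⟨fun h' => (h' ?_).elim, fun h' => (cartan_ne_bot (h'.symm.trans hs)).elim,
    fun h' => (nilrad_ne_bot (h'.symm.trans hs)).elim, fun _ => h⟩
  rw [eq_bot_iff, ← hs]
  refine inf_le_inf_left _ ?_
  intro Q hQ
  obtain ⟨a, b, c, d, e, k, rfl⟩ := mem_algG.1 (nilrad_le hQ)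
  obtain ⟨h1, h2, h3, h4⟩ := mem_nilrad.1 hQ
  exact mem_rad.2 ⟨h1, h2, h4⟩

/-- The intersection with the radical is the line through the dilation. It misses the nilradical, is
nonzero, and equals 𝔠 only for b₀ = e₀ = 0, so only the second property has content. -/
theorem radProps_of_dilation {s : Submodule ℝ VF} {b₀ e₀ : ℝ} (hs : s ≤ algG)
    (hm : gv 0 b₀ 0 1 e₀ 0 ∈ s)
    (hr : ∀ b d e, gv 0 b 0 d e 0 ∈ s → b = d * b₀ ∧ e = d * e₀)
    (h : b₀ = 0 → e₀ = 0 → s ≤ levi ⊔ cartan ∧ Module.finrank ℝ s ≤ 2) : RadProps s := by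
  have hR : gv 0 b₀ 0 1 e₀ 0 ∈ s ⊓ rad := ⟨hm, mem_rad.2 ⟨rfl, rfl, rfl⟩⟩
  refine ⟨fun h' => (h' ?_).elim, fun h' => ?_, fun h' => ?_, fun h' => ?_⟩
  · rw [eq_bot_iff]
    rintro Q ⟨hQ, hQn⟩
    obtain ⟨a, b, c, d, e, k, rfl⟩ := mem_algG.1 (hs hQ)
    obtain ⟨rfl, rfl, rfl, rfl⟩ := mem_nilrad.1 hQn
    obtain ⟨rfl, rfl⟩ := hr _ _ _ hQ
    simp [gv_zero]
  · rw [h'] at hR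
    obtain ⟨-, h1, -, h2, -⟩ := mem_cartan.1 hR
    exact h h1 h2
  · rw [h'] at hR
    simpa using (mem_nilrad.1 hR).2.2.1
  · rw [h', Submodule.mem_bot, ← gv_zero, gv_inj] at hR
    simp at hR

theorem radProps_symAlg {Ω : Set (ℝ × ℝ)} {f : ℝ × ℝ → ℝ} (hf : IsGBE Ω f) :
    RadProps (symAlg Ω f) := by
  have hnr : nilrad ≤ rad := by
    intro Q hQ
    obtain ⟨a, b, c, d, e, k, rfl⟩ := mem_algG.1 (nilrad_le hQ)
    obtain ⟨h1, h2, h3, h4⟩ := mem_nilrad.1 hQ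
    exact mem_rad.2 ⟨h1, h2, h4⟩
  cases symStructure hf with
  | bot h =>
    rw [h]
    exact radProps_of_bot (by simp) (by simp)
  | full hc h =>
    rw [h]
    refine radProps_of_nilrad (le_antisymm ?_ (le_inf le_sup_right hnr)) (Or.inr rfl)
    rintro Q ⟨hQ, hQr⟩
    obtain ⟨a, b, c, d, e, k, rfl⟩ := mem_algG.1 (sup_le levi_le nilrad_le hQ)
    obtain ⟨rfl, rfl, rfl⟩ := mem_rad.1 hQr
    have := mem_levi_sup_nilrad.1 hQ
    exact mem_nilrad.2 ⟨rfl, rfl, by linarith, rfl⟩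
  | nil h =>
    rw [h]
    refine radProps_of_nilrad (inf_eq_left.2 hnr) (Or.inl ⟨finrank_nilrad.trans_le (by norm_num), ?_⟩)
    rw [eq_bot_iff]
    rintro Q ⟨hQ, hQr⟩
    obtain ⟨a, b, c, d, e, k, rfl⟩ := mem_algG.1 (nilrad_le hQ)
    obtain ⟨rfl, rfl, rfl, rfl⟩ := mem_nilrad.1 hQ
    obtain ⟨rfl, -, rfl⟩ := mem_levi.1 hQr
    simp [gv_zero]
  | nilExt a c d k hτ hw h =>
    have hmem : ∀ a' b' c' d' e' k', gv a' b' c' d' e' k' ∈ symAlg Ω f →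
        ∃ z, a' = z * a ∧ c' = z * c ∧ d' = z * d ∧ k' = z * k := by
      intro a' b' c' d' e' k' hm
      rw [h, Submodule.mem_span_triple] at hm
      obtain ⟨x, y, z, hm⟩ := hm
      rw [smul_gv, smul_gv, smul_gv, gv_add, gv_add, gv_inj] at hm
      refine ⟨z, ?_, ?_, ?_, ?_⟩ <;> linarith
    refine radProps_of_nilrad (le_antisymm ?_ (le_inf ?_ hnr)) (Or.inl ⟨?_, ?_⟩)
    · rintro Q ⟨hQ, hQr⟩
      obtain ⟨a', b', c', d', e', k', rfl⟩ := mem_algG.1 (symAlg_le hQ)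
      obtain ⟨z, h1, h2, h3, h4⟩ := hmem _ _ _ _ _ _ hQ
      obtain ⟨rfl, rfl, rfl⟩ := mem_rad.1 hQr
      have hz : z = 0 := eq_zero_of_smul_tau hτ h1.symm h2.symm h4.symm
      exact mem_nilrad.2 ⟨rfl, rfl, by rw [h3, hz, zero_mul], rfl⟩
    · rw [nilrad, Submodule.span_le, h, vPx_eq, vG_eq]
      rintro Q (rfl | rfl) <;> exact Submodule.subset_span (by simp)
    · rw [h]
      exact finrank_span_three_le ..
    · rw [eq_bot_iff]
      rintro Q ⟨hQ, hQr⟩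
      obtain ⟨a', b', c', d', e', k', rfl⟩ := mem_algG.1 (symAlg_le hQ)
      obtain ⟨z, rfl, rfl, rfl, rfl⟩ := hmem _ _ _ _ _ _ hQ
      obtain ⟨rfl, h2, rfl⟩ := mem_levi.1 hQr
      have hz : z * (2 * d - c) = 0 := by linarith
      obtain rfl := (mul_eq_zero.1 hz).resolve_right hw
      simp [gv_zero]
  | dil b e h =>
    refine radProps_of_dilation (b₀ := b) (e₀ := e) symAlg_le ?_ ?_ ?_
    · rw [h]
      exact Submodule.mem_span_singleton_self _
    · intro b' d' e' hm
      rw [h, Submodule.mem_span_singleton] at hm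
      obtain ⟨x, hm⟩ := hm
      rw [smul_gv, gv_inj] at hm
      obtain ⟨-, h2, -, h4, h5, -⟩ := hm
      obtain rfl : x = d' := by linarith
      exact ⟨h2.symm, h5.symm⟩
    · rintro rfl rfl
      rw [h]
      refine ⟨?_, (finrank_span_one ?_).trans_le (by norm_num)⟩
      · rw [Submodule.span_le]
        rintro _ rfl
        exact mem_levi_sup_cartan.2 ⟨rfl, rfl⟩
      · rw [← gv_zero, Ne, gv_inj]
        simp
  | dilExt b₀ e₀ a b c e k hτ hb he h =>
    have hmem : ∀ a' b' c' d' e' k', gv a' b' c' d' e' k' ∈ symAlg Ω f →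
        ∃ x y, a' = y * a ∧ b' = x * b₀ + y * b ∧ c' = y * c ∧ d' = x + y * (c / 2) ∧
          e' = x * e₀ + y * e ∧ k' = y * k := by
      intro a' b' c' d' e' k' hm
      rw [h, Submodule.mem_span_pair] at hm
      obtain ⟨x, y, hm⟩ := hm
      rw [smul_gv, smul_gv, gv_add, gv_inj] at hm
      refine ⟨x, y, ?_, ?_, ?_, ?_, ?_, ?_⟩ <;> linarith
    refine radProps_of_dilation (b₀ := b₀) (e₀ := e₀) symAlg_le ?_ ?_ ?_
    · rw [h]
      exact Submodule.subset_span (by simp)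
    · intro b' d' e' hm
      obtain ⟨x, y, h1, h2, h3, h4, h5, h6⟩ := hmem _ _ _ _ _ _ hm
      obtain rfl : y = 0 := eq_zero_of_smul_tau hτ h1.symm h3.symm h6.symm
      simp only [zero_mul, add_zero] at h2 h4 h5
      subst h4
      exact ⟨h2, h5⟩
    · rintro rfl rfl
      refine ⟨fun Q hQ => ?_, ?_⟩
      · obtain ⟨a', b', c', d', e', k', rfl⟩ := mem_algG.1 (symAlg_le hQ)
        obtain ⟨x, y, h1, h2, h3, h4, h5, h6⟩ := hmem _ _ _ _ _ _ hQ
        refine mem_levi_sup_cartan.2 ⟨?_, ?_⟩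
        · rw [h2, hb]
          ring
        · rw [h5, he]
          ring
      · rw [h]
        exact finrank_span_two_le ..
  | single a b c d e k hτ h =>
    have h1 : Module.finrank ℝ (symAlg Ω f) = 1 := by
      rw [h, finrank_span_one]
      rw [← gv_zero, Ne, gv_inj]
      tauto
    refine radProps_of_bot ?_ ⟨by omega, by omega⟩
    rw [eq_bot_iff]
    rintro Q ⟨hQ, hQr⟩
    rw [h] at hQ
    obtain ⟨x, rfl⟩ := Submodule.mem_span_singleton.1 hQ
    rw [smul_gv] at hQr
    obtain ⟨h1, h2, h3⟩ := mem_rad.1 hQr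
    simp [eq_zero_of_smul_tau hτ h1 h2 h3]
  | pair a b c d e k a' b' c' d' e' k' hτ hb hw h =>
    refine radProps_of_bot ?_ ⟨?_, fun _ => ⟨?_, not_equiv_translation_scale hf⟩⟩
    · rw [eq_bot_iff]
      rintro Q ⟨hQ, hQr⟩
      rw [h] at hQ
      obtain ⟨x, y, rfl⟩ := Submodule.mem_span_pair.1 hQ
      rw [smul_gv, smul_gv, gv_add] at hQr
      obtain ⟨h1, h2, h3⟩ := mem_rad.1 hQr
      obtain ⟨rfl, rfl⟩ := hb.tau_independent hτ h1 h2 h3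
      simp
    · rw [h]
      exact finrank_span_two_le ..
    · rw [prC, inf_eq_left]
      intro Q hQ
      obtain ⟨a1, b1, c1, d1, e1, k1, rfl⟩ := mem_algG.1 (cartan_le hQ)
      obtain ⟨rfl, rfl, rfl, rfl, rfl⟩ := mem_cartan.1 hQ
      have hR : gv a' b' c' d' e' k' ∈ symAlg Ω f := by
        rw [h]
        exact Submodule.subset_span (by simp)
      -- The multiple of R whose weight is that of the given element of 𝔠; the difference then has
      -- weight zero and lies in 𝔣 ⊕ 𝔫.
      set x := d1 / (d' - c' / 2) with hx
      have hne : d' - c' / 2 ≠ 0 := fun h0 => hw (by linarith)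
      have hL : gv (-(x * a')) (-(x * b')) (-(x * c')) (d1 - x * d') (-(x * e')) (-(x * k'))
          ∈ levi ⊔ nilrad := by
        rw [mem_levi_sup_nilrad]
        have : x * (d' - c' / 2) = d1 := div_mul_cancel₀ _ hne
        linarith
      have := Submodule.add_mem_sup (Submodule.smul_mem _ x hR) hL
      rw [smul_gv, gv_add] at this
      refine mem_of_eq this ?_ ?_ ?_ ?_ ?_ ?_ <;> ring

/-! ### Normal forms of the symmetry algebras -/

theorem span_gv_le {A : Set VF} (h : ∀ Q ∈ A, ∃ a b c d e k, Q = gv a b c d e k) :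
    Submodule.span ℝ A ≤ algG := by
  rw [Submodule.span_le]
  intro Q hQ
  obtain ⟨a, b, c, d, e, k, rfl⟩ := h Q hQ
  exact gv_mem_algG a b c d e k

/-- The algebras of the list in coordinates. -/
theorem FunRow.alg_eq (r : FunRow) : r.alg = match r with
    | g11 => Submodule.span ℝ {gv 0 0 0 1 0 0}
    | g12 => Submodule.span ℝ {gv 1 0 0 0 0 0}
    | g13 => Submodule.span ℝ {gv 1 0 0 0 1 0}
    | g14 => Submodule.span ℝ {gv 1 0 0 1 0 0}
    | g15 => Submodule.span ℝ {gv 0 1 1 0 0 0}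
    | g16 a => Submodule.span ℝ {gv 0 0 1 a 0 0}
    | g17 => Submodule.span ℝ {gv 0 0 1 1 1 0}
    | g18 a => Submodule.span ℝ {gv 1 0 0 a 0 1}
    | g21 => Submodule.span ℝ {gv 0 1 0 0 0 0, gv 0 0 0 0 1 0} := by
  cases r <;> simp [FunRow.alg, vPt_eq, vPx_eq, vDt_eq, vDx_eq, vG_eq, vPi_eq, gv_add, smul_gv]

theorem ConstRow.alg_eq (r : ConstRow) : r.alg = match r with
    | g22 => Submodule.span ℝ {gv 0 0 0 1 0 0, gv 1 0 0 0 0 0}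
    | g23 => Submodule.span ℝ {gv 0 0 0 1 0 0, gv 0 0 1 0 0 0}
    | g24 => Submodule.span ℝ {gv 0 0 0 1 0 0, gv 1 0 0 0 0 1}
    | g25 => Submodule.span ℝ {gv 1 0 0 0 0 0, gv 0 1 1 0 0 0}
    | g26 a => Submodule.span ℝ {gv 1 0 0 0 0 0, gv 0 0 1 a 0 0}
    | g27 => Submodule.span ℝ {gv 1 0 0 0 1 0, gv 0 0 1 2 0 0}
    | g31 => Submodule.span ℝ {gv 0 1 0 0 0 0, gv 0 0 0 0 1 0, gv 1 0 0 (1 / 2) 0 0}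
    | g32 a => Submodule.span ℝ {gv 0 1 0 0 0 0, gv 0 0 0 0 1 0, gv 0 0 1 a 0 0}
    | g33 a => Submodule.span ℝ {gv 0 1 0 0 0 0, gv 0 0 0 0 1 0, gv 1 0 0 a 0 1}
    | g5 => levi ⊔ nilrad := by
  cases r <;> simp [ConstRow.alg, vPt_eq, vPx_eq, vDt_eq, vDx_eq, vG_eq, vPi_eq, gv_add, smul_gv,
    levi_sup_nilrad_eq]

theorem FunRow.alg_le (r : FunRow) : r.alg ≤ algG := by
  cases r <;> rw [FunRow.alg_eq] <;> refine span_gv_le ?_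
  case g21 =>
    rintro Q (rfl | rfl) <;> exact ⟨_, _, _, _, _, _, rfl⟩
  all_goals
    rintro Q rfl
    exact ⟨_, _, _, _, _, _, rfl⟩

theorem ConstRow.alg_le (r : ConstRow) : r.alg ≤ algG := by
  cases r <;> rw [ConstRow.alg_eq]
  case g5 => exact sup_le levi_le nilrad_le
  case g31 | g32 | g33 =>
    refine span_gv_le ?_
    rintro Q (rfl | rfl | rfl) <;> exact ⟨_, _, _, _, _, _, rfl⟩
  all_goals
    refine span_gv_le ?_
    rintro Q (rfl | rfl) <;> exact ⟨_, _, _, _, _, _, rfl⟩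

theorem Row.alg_le : ∀ r : Row, r.alg ≤ algG
  | .fn r => r.alg_le
  | .const r => r.alg_le

/-- `s` is equivalent to one of the algebras of the list. -/
def Normalizable (s : Submodule ℝ VF) : Prop := ∃ r : Row, r.Gauged ∧ SubalgEquiv s r.alg

theorem Normalizable.of_fn (r : FunRow) (hg : r.Gauged) : Normalizable r.alg :=
  ⟨.fn r, hg, SubalgEquiv.refl r.alg_le⟩

theorem Normalizable.of_const (r : ConstRow) (hg : r.Gauged) : Normalizable r.alg :=
  ⟨.const r, hg, SubalgEquiv.refl r.alg_le⟩

theorem Normalizable.of_equiv {s s' : Submodule ℝ VF} (hs : s ≤ algG) (hs' : s' ≤ algG)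
    (h : SubalgEquiv s s') (h' : Normalizable s') : Normalizable s := by
  obtain ⟨r, hr, h'⟩ := h'
  exact ⟨r, hr, h.trans hs hs' r.alg_le h'⟩

section spans

variable {a b c d e k a' b' c' d' e' k' : ℝ}

theorem span_le_one : Submodule.span ℝ {gv a b c d e k} ≤ algG :=
  span_gv_le (by rintro Q rfl; exact ⟨_, _, _, _, _, _, rfl⟩)

theorem span_le_two : Submodule.span ℝ {gv a b c d e k, gv a' b' c' d' e' k'} ≤ algG :=
  span_gv_le (by rintro Q (rfl | rfl) <;> exact ⟨_, _, _, _, _, _, rfl⟩)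

theorem span_le_three : Submodule.span ℝ {gv 0 1 0 0 0 0, gv 0 0 0 0 1 0, gv a b c d e k} ≤ algG :=
  span_gv_le (by rintro Q (rfl | rfl | rfl) <;> exact ⟨_, _, _, _, _, _, rfl⟩)

end spans

theorem EqTrans.equiv_one {T : EqTrans} {l : ℝ} (hl : l ≠ 0) {Q Q' : VF}
    (h : T.Pushes Q (l • Q')) : SubalgEquiv (Submodule.span ℝ {Q}) (Submodule.span ℝ {Q'}) := by
  refine ⟨T, EqTrans.pushes_span ?_, EqTrans.pushes_span' ?_⟩
  · rintro _ rfl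
    exact ⟨_, Submodule.smul_mem _ l (Submodule.mem_span_singleton_self _), h⟩
  · rintro _ rfl
    refine ⟨l⁻¹ • Q, Submodule.smul_mem _ _ (Submodule.mem_span_singleton_self _), ?_⟩
    have := h.smul l⁻¹
    rwa [inv_smul_smul₀ hl] at this

/-- A triangular change of basis is allowed: the second generator needs to be matched only modulo
the first. -/
theorem EqTrans.equiv_two {T : EqTrans} {l m n : ℝ} (hl : l ≠ 0) (hm : m ≠ 0) {Q Q' R R' : VF}
    (h : T.Pushes Q (l • Q')) (h' : T.Pushes R (m • R' + n • Q')) :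
    SubalgEquiv (Submodule.span ℝ {Q, R}) (Submodule.span ℝ {Q', R'}) := by
  refine ⟨T, EqTrans.pushes_span ?_, EqTrans.pushes_span' ?_⟩
  · rintro _ (rfl | rfl)
    · exact ⟨_, Submodule.smul_mem _ l (Submodule.subset_span (by simp)), h⟩
    · exact ⟨_, Submodule.add_mem _ (Submodule.smul_mem _ m (Submodule.subset_span (by simp)))
        (Submodule.smul_mem _ n (Submodule.subset_span (by simp))), h'⟩
  · have hQ := h.smul l⁻¹
    rw [inv_smul_smul₀ hl] at hQ
    rintro _ (rfl | rfl)
    · exact ⟨l⁻¹ • Q, Submodule.smul_mem _ _ (Submodule.subset_span (by simp)), hQ⟩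
    · have hR := (h'.add (hQ.smul (-n))).smul m⁻¹
      rw [add_assoc, ← add_smul, add_neg_cancel, zero_smul, add_zero, inv_smul_smul₀ hm] at hR
      exact ⟨_, Submodule.smul_mem _ _ (Submodule.add_mem _ (Submodule.subset_span (by simp))
        (Submodule.smul_mem _ _ (Submodule.smul_mem _ _ (Submodule.subset_span (by simp))))), hR⟩

theorem EqTrans.pushes_nilrad (T : EqTrans) (b e : ℝ) : ∃ b' e' : ℝ,
    T.Pushes (gv 0 b 0 0 e 0) (gv 0 b' 0 0 e' 0) := by
  have := T.det_ne
  refine ⟨T.κ * (T.α * b - T.β * e) / (T.α * T.δ - T.β * T.γ),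
    T.κ * (T.δ * e - T.γ * b) / (T.α * T.δ - T.β * T.γ), Inter.pushes ⟨?_, ?_, ?_, ?_, ?_, ?_⟩⟩
  · ring
  · ring
  · ring
  · ring
  · generalize hD : T.α * T.δ - T.β * T.γ = D at this ⊢
    field_simp
    rw [← hD]
    ring
  · generalize hD : T.α * T.δ - T.β * T.γ = D at this ⊢
    field_simp
    rw [← hD]
    ring

theorem gv_nilrad (b e : ℝ) : gv 0 b 0 0 e 0 = b • gv 0 1 0 0 0 0 + e • gv 0 0 0 0 1 0 := by
  rw [smul_gv, smul_gv, gv_add, gv_inj]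
  refine ⟨?_, ?_, ?_, ?_, ?_, ?_⟩ <;> ring

/-- Every transformation maps the nilradical onto itself, so only the third generator has to be
matched. -/
theorem EqTrans.equiv_three {T : EqTrans} {l : ℝ} (hl : l ≠ 0) {Q Q' : VF}
    (h : T.Pushes Q (l • Q')) :
    SubalgEquiv (Submodule.span ℝ {gv 0 1 0 0 0 0, gv 0 0 0 0 1 0, Q})
      (Submodule.span ℝ {gv 0 1 0 0 0 0, gv 0 0 0 0 1 0, Q'}) := by
  have hn : ∀ (b e : ℝ) (Q : VF),
      gv 0 b 0 0 e 0 ∈ Submodule.span ℝ {gv 0 1 0 0 0 0, gv 0 0 0 0 1 0, Q} := by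
    intro b e Q
    exact Submodule.mem_span_triple.2 ⟨b, e, 0, by rw [zero_smul, add_zero, gv_nilrad b e]⟩
  have h1 : ∀ (b e : ℝ), ∃ Q'' ∈ Submodule.span ℝ {gv 0 1 0 0 0 0, gv 0 0 0 0 1 0, Q'},
      T.Pushes (gv 0 b 0 0 e 0) Q'' := by
    intro b e
    obtain ⟨b', e', h⟩ := T.pushes_nilrad b e
    exact ⟨_, hn _ _ _, h⟩
  have h2 : ∀ (b e : ℝ), ∃ Q'' ∈ Submodule.span ℝ {gv 0 1 0 0 0 0, gv 0 0 0 0 1 0, Q},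
      T.Pushes Q'' (gv 0 b 0 0 e 0) := by
    intro b e
    have hΔ := T.det_ne
    have hκ := T.κ_ne
    refine ⟨_, hn ((b * T.δ + e * T.β) / T.κ) ((e * T.α + b * T.γ) / T.κ) _,
      Inter.pushes ⟨?_, ?_, ?_, ?_, ?_, ?_⟩⟩
    · ring
    · ring
    · ring
    · ring
    · field_simp
      ring
    · field_simp
      ring
  refine ⟨T, EqTrans.pushes_span ?_, EqTrans.pushes_span' ?_⟩
  · rintro _ (rfl | rfl | rfl)
    · exact h1 _ _
    · exact h1 _ _
    · exact ⟨_, Submodule.smul_mem _ l (Submodule.subset_span (by simp)), h⟩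
  · rintro _ (rfl | rfl | rfl)
    · exact h2 _ _
    · exact h2 _ _
    · refine ⟨l⁻¹ • Q, Submodule.smul_mem _ _ (Submodule.subset_span (by simp)), ?_⟩
      have := h.smul l⁻¹
      rwa [inv_smul_smul₀ hl] at this

namespace EqTrans

/-- The projective transformation of `t` in `T` maps `(a + ct + kt²)∂_t` to
`(a' + c't + k't²)∂_t`. -/
def TauMap (T : EqTrans) (a c k a' c' k' : ℝ) : Prop :=
  c' / 2 * T.α + a' * T.γ = T.α * (c / 2) - T.β * k ∧
  c' / 2 * T.β + a' * T.δ = T.α * a - T.β * (c / 2) ∧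
  -k' * T.α - c' / 2 * T.γ = T.γ * (c / 2) - T.δ * k ∧
  -k' * T.β - c' / 2 * T.δ = T.γ * a - T.δ * (c / 2)

/-- Conjugation acts on the trace-free part of A, which encodes τ alone, and fixes the trace. Hence
d - c/2 is unchanged, and without shifts n is transformed linearly. -/
theorem TauMap.inter {T : EqTrans} {a c k a' c' k' : ℝ} (h : T.TauMap a c k a' c' k')
    (h1 : T.μ₁ = 0) (h0 : T.μ₀ = 0) (b d e : ℝ) :
    T.Inter a b c d e k a' (T.κ * (T.α * b - T.β * e) / (T.α * T.δ - T.β * T.γ)) c'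
      (d + (c' - c) / 2) (T.κ * (T.δ * e - T.γ * b) / (T.α * T.δ - T.β * T.γ)) k' := by
  have := T.det_ne
  obtain ⟨g1, g2, g3, g4⟩ := h
  refine ⟨?_, ?_, ?_, ?_, ?_, ?_⟩
  · linear_combination g1
  · linear_combination g2
  · linear_combination g3
  · linear_combination g4
  · rw [h1, h0]
    generalize hD : T.α * T.δ - T.β * T.γ = D at this ⊢
    field_simp
    rw [← hD]
    ring
  · rw [h1, h0]
    generalize hD : T.α * T.δ - T.β * T.γ = D at this ⊢
    field_simp
    rw [← hD]
    ring

/-- The fractional linear transformation with the given matrix. -/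
def proj (α β γ δ : ℝ) (h : α * δ - β * γ ≠ 0) : EqTrans := ⟨α, β, γ, δ, 1, 0, 0, h, one_ne_zero⟩

/-- A shift of `x` that is affine in `t`. -/
def shift (μ₁ μ₀ : ℝ) : EqTrans := ⟨1, 0, 0, 1, 1, μ₁, μ₀, by norm_num, one_ne_zero⟩

/-- Scaling of `t` and `x`. -/
def scale (α κ : ℝ) (hα : α ≠ 0) (hκ : κ ≠ 0) : EqTrans :=
  ⟨α, 0, 0, 1, κ, 0, 0, by simpa using hα, hκ⟩

theorem shift_inter (μ₁ μ₀ a b c d e k : ℝ) :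
    (shift μ₁ μ₀).Inter a b c d e k a (b + μ₁ * a - μ₀ * d) c d (e + μ₁ * (c - d) - μ₀ * k) k := by
  refine ⟨?_, ?_, ?_, ?_, ?_, ?_⟩ <;> simp only [shift] <;> ring

theorem scale_inter {α κ : ℝ} (hα : α ≠ 0) (hκ : κ ≠ 0) (a b c d e k : ℝ) :
    (scale α κ hα hκ).Inter a b c d e k (α * a) (κ * b) c d (κ * e / α) (k / α) := by
  refine ⟨?_, ?_, ?_, ?_, ?_, ?_⟩ <;> simp only [scale] <;> field_simp <;> ring

/-- The inversion of `t`. -/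
def inversion : EqTrans := proj 0 1 1 0 (by norm_num)

/-- Inversion turns D^t + aD^x into -(D^t + (1 - a)D^x) and exchanges P^x with G. This is the source
of the gauge a ≥ 1/2 and of the coincidence of 𝔤^1.5 and 𝔤^1.7. -/
theorem inversion_inter (a b c d e k : ℝ) :
    inversion.Inter a b c d e k (-k) e (-c) (d - c) b (-a) := by
  refine ⟨?_, ?_, ?_, ?_, ?_, ?_⟩ <;> simp only [inversion, proj] <;> ring

/-- A nonzero field (a + ct + kt²)∂_t on the projective line is, up to a fractional linear map, a
multiple of ∂_t, t∂_t or (1 + t²)∂_t according to the sign of its discriminant. -/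
theorem exists_tauMap {a c k : ℝ} (h : a ≠ 0 ∨ c ≠ 0 ∨ k ≠ 0) :
    ∃ (T : EqTrans) (l : ℝ), T.μ₁ = 0 ∧ T.μ₀ = 0 ∧ l ≠ 0 ∧
      (T.TauMap a c k l 0 0 ∨ T.TauMap a c k 0 l 0 ∨ T.TauMap a c k l 0 l) := by
  by_cases hk : k = 0
  · subst hk
    by_cases hc : c = 0
    · subst hc
      have ha : a ≠ 0 := by simpa using h
      refine ⟨proj 1 0 0 1 (by norm_num), a, rfl, rfl, ha, Or.inl ⟨?_, ?_, ?_, ?_⟩⟩ <;>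
        simp [proj]
    -- A translation moves the root -a/c to the origin.
    · refine ⟨proj 1 (a / c) 0 1 (by norm_num), c, rfl, rfl, hc, Or.inr (Or.inl ⟨?_, ?_, ?_, ?_⟩)⟩
        <;> simp only [proj] <;> field_simp <;> ring
  · obtain ⟨D, hD⟩ : ∃ D, D = c ^ 2 - 4 * a * k := ⟨_, rfl⟩
    rcases lt_trichotomy D 0 with hlt | heq | hgt
    · have hs := Real.sq_sqrt (neg_pos.2 hlt).le
      have hs0 := (Real.sqrt_pos.2 (neg_pos.2 hlt)).ne'
      set s := Real.sqrt (-D)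
      -- Completing the square: t̃ = (2kt + c)/s with s² = 4ak - c².
      refine ⟨proj (2 * k) c 0 s (by simp [hk, hs0]), s / 2, rfl, rfl, by simpa using hs0,
        Or.inr (Or.inr ⟨?_, ?_, ?_, ?_⟩)⟩ <;> simp only [proj]
      · ring
      · linear_combination (1 / 2) * hs - (1 / 2) * hD
      · ring
      · ring
    · rw [heq] at hD
      -- The double root -c/(2k) is sent to infinity.
      refine ⟨proj 0 (-1) 1 (c / (2 * k)) (by norm_num), k, rfl, rfl, hk,
        Or.inl ⟨?_, ?_, ?_, ?_⟩⟩ <;> simp only [proj] <;> field_simp <;> linarith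
    · have hs := Real.sq_sqrt hgt.le
      have hs0 := (Real.sqrt_pos.2 hgt).ne'
      set s := Real.sqrt D
      -- The two real roots are sent to 0 and infinity.
      refine ⟨proj (2 * k) (c - s) (2 * k) (c + s) ?_, s, rfl, rfl, hs0,
        Or.inr (Or.inl ⟨?_, ?_, ?_, ?_⟩)⟩
      · intro h0
        have : 4 * k * s = 0 := by linear_combination h0
        simp [hk, hs0] at this
      all_goals simp only [proj]
      · ring
      · linear_combination (-1 / 2) * hs - (1 / 2) * hD
      · ring
      · linear_combination (-1 / 2) * hs - (1 / 2) * hD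

end EqTrans

open EqTrans

/-! #### One-dimensional algebras -/

section single

variable {a b c d e k a' b' c' d' e' k' : ℝ}

theorem Normalizable.one {T : EqTrans} {l : ℝ} (hl : l ≠ 0)
    (h : T.Inter a b c d e k (l * a') (l * b') (l * c') (l * d') (l * e') (l * k'))
    (hn : Normalizable (Submodule.span ℝ {gv a' b' c' d' e' k'})) :
    Normalizable (Submodule.span ℝ {gv a b c d e k}) := by
  have hp := h.pushes
  rw [← smul_gv] at hp
  exact hn.of_equiv span_le_one span_le_one (equiv_one hl hp)

theorem EqTrans.Inter.congr {T : EqTrans} {a1 b1 c1 d1 e1 k1 : ℝ}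
    (h : T.Inter a b c d e k a' b' c' d' e' k') (h1 : a' = a1) (h2 : b' = b1) (h3 : c' = c1)
    (h4 : d' = d1) (h5 : e' = e1) (h6 : k' = k1) : T.Inter a b c d e k a1 b1 c1 d1 e1 k1 := by
  subst h1 h2 h3 h4 h5 h6
  exact h

/-- A shift changes b by μ₁ - μ₀d and e by -μ₁d. For d ≠ 0 both are removed and scaling of t makes d
= 1; for d = 0 only b is removed and e is scaled to 1 unless it is zero. -/
theorem normalizable_translation (b d e : ℝ) :
    Normalizable (Submodule.span ℝ {gv 1 b 0 d e 0}) := by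
  by_cases hd : d = 0
  · subst hd
    refine .one (l := 1) (a' := 1) (b' := 0) (c' := 0) (d' := 0) (e' := e) (k' := 0) one_ne_zero
      ((shift_inter (-b) 0 1 b 0 0 e 0).congr ?_ ?_ ?_ ?_ ?_ ?_) ?_
    iterate 6 ring
    by_cases he : e = 0
    · subst he
      have := Normalizable.of_fn .g12 trivial
      rwa [FunRow.alg_eq] at this
    · have := Normalizable.of_fn .g13 trivial
      rw [FunRow.alg_eq] at this
      refine .one (l := 1) one_ne_zero
        ((scale_inter one_ne_zero (inv_ne_zero he) _ _ _ _ _ _).congr ?_ ?_ ?_ ?_ ?_ ?_) this <;>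
      field_simp <;> simp
  · have := Normalizable.of_fn .g14 trivial
    rw [FunRow.alg_eq] at this
    refine .one (l := 1) (a' := 1) (b' := 0) (c' := 0) (d' := d) (e' := 0) (k' := 0) one_ne_zero
      ((shift_inter (e / d) ((b + e / d) / d) 1 b 0 d e 0).congr ?_ ?_ ?_ ?_ ?_ ?_)
        (.one (l := d) hd ((scale_inter hd one_ne_zero _ _ _ _ _ _).congr ?_ ?_ ?_ ?_ ?_ ?_) this)
    all_goals field_simp
    all_goals ring1

/-- A shift changes b by -μ₀d and e by μ₁(1 - d), so P^x resists only for d = 0 and G only for d =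
1. In the remaining cases inversion replaces d by 1 - d; in particular D^t becomes a multiple of D^t
+ D^x. -/
theorem normalizable_dilation (b d e : ℝ) :
    Normalizable (Submodule.span ℝ {gv 0 b 1 d e 0}) := by
  by_cases h0 : d = 0
  · subst h0
    refine .one (l := 1) (a' := 0) (b' := b) (c' := 1) (d' := 0) (e' := 0) (k' := 0) one_ne_zero
      ((shift_inter (-e) 0 0 b 1 0 e 0).congr ?_ ?_ ?_ ?_ ?_ ?_) ?_
    iterate 6 ring
    by_cases hb : b = 0
    · subst hb
      have := Normalizable.of_fn (.g16 1) (by norm_num [FunRow.Gauged])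
      rw [FunRow.alg_eq] at this
      refine .one (l := -1) (by norm_num)
        ((inversion_inter _ _ _ _ _ _).congr ?_ ?_ ?_ ?_ ?_ ?_) this <;> norm_num
    · have := Normalizable.of_fn .g15 trivial
      rw [FunRow.alg_eq] at this
      refine .one (l := 1) one_ne_zero
        ((scale_inter one_ne_zero (inv_ne_zero hb) _ _ _ _ _ _).congr ?_ ?_ ?_ ?_ ?_ ?_) this <;>
      field_simp <;> simp
  by_cases h1 : d = 1
  · subst h1
    refine .one (l := 1) (a' := 0) (b' := 0) (c' := 1) (d' := 1) (e' := e) (k' := 0) one_ne_zero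
      ((shift_inter 0 b 0 b 1 1 e 0).congr ?_ ?_ ?_ ?_ ?_ ?_) ?_
    iterate 6 ring
    by_cases he : e = 0
    · subst he
      have := Normalizable.of_fn (.g16 1) (by norm_num [FunRow.Gauged])
      rwa [FunRow.alg_eq] at this
    · have := Normalizable.of_fn .g17 trivial
      rw [FunRow.alg_eq] at this
      refine .one (l := 1) one_ne_zero
        ((scale_inter one_ne_zero (inv_ne_zero he) _ _ _ _ _ _).congr ?_ ?_ ?_ ?_ ?_ ?_) this <;>
      field_simp <;> simp
  have h1' : 1 - d ≠ 0 := fun h => h1 (by linarith)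
  refine .one (l := 1) (a' := 0) (b' := 0) (c' := 1) (d' := d) (e' := 0) (k' := 0) one_ne_zero
      ((shift_inter (-e / (1 - d)) (b / d) 0 b 1 d e 0).congr ?_ ?_ ?_ ?_ ?_ ?_) ?_
  any_goals field_simp
  any_goals first | ring1 | simp
  rcases le_total (1 / 2) d with hle | hle
  · have := Normalizable.of_fn (.g16 d) hle
    rwa [FunRow.alg_eq] at this
  · have := Normalizable.of_fn (.g16 (1 - d)) (by simp only [FunRow.Gauged]; linarith)
    rw [FunRow.alg_eq] at this
    refine .one (l := -1) (by norm_num)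
        ((inversion_inter _ _ _ _ _ _).congr ?_ ?_ ?_ ?_ ?_ ?_) this <;> ring

/-- The linear system for the shift that removes b and e has determinant -(d² + 1), so it is always
solvable; t ↦ -t then fixes the sign of d. -/
theorem normalizable_rotation (b d e : ℝ) :
    Normalizable (Submodule.span ℝ {gv 1 b 0 d e 1}) := by
  have hd : d ^ 2 + 1 ≠ 0 := by positivity
  refine .one (l := 1) (a' := 1) (b' := 0) (c' := 0) (d' := d) (e' := 0) (k' := 1) one_ne_zero
      ((shift_inter ((e * d - b) / (d ^ 2 + 1)) ((b * d + e) / (d ^ 2 + 1)) 1 b 0 d e 1).congr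
        ?_ ?_ ?_ ?_ ?_ ?_) ?_
  any_goals field_simp
  any_goals first | ring1 | simp
  rcases le_total 0 d with hle | hle
  · have := Normalizable.of_fn (.g18 d) hle
    rwa [FunRow.alg_eq] at this
  · have := Normalizable.of_fn (.g18 (-d)) (by simp only [FunRow.Gauged]; linarith)
    rw [FunRow.alg_eq] at this
    refine .one (l := -1) (by norm_num) ((scale_inter (α := -1) (by norm_num) one_ne_zero
      _ _ _ _ _ _).congr ?_ ?_ ?_ ?_ ?_ ?_) this <;> norm_num

theorem normalizable_single (hτ : a ≠ 0 ∨ c ≠ 0 ∨ k ≠ 0) (b d e : ℝ) :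
    Normalizable (Submodule.span ℝ {gv a b c d e k}) := by
  obtain ⟨T, l, h1, h0, hl, h | h | h⟩ := exists_tauMap hτ
  · refine .one hl ((h.inter h1 h0 b d e).congr (mul_one l).symm (mul_div_cancel₀ _ hl).symm
      (mul_zero l).symm (mul_div_cancel₀ _ hl).symm (mul_div_cancel₀ _ hl).symm (mul_zero l).symm)
      (normalizable_translation _ _ _)
  · refine .one hl ((h.inter h1 h0 b d e).congr (mul_zero l).symm (mul_div_cancel₀ _ hl).symm
      (mul_one l).symm (mul_div_cancel₀ _ hl).symm (mul_div_cancel₀ _ hl).symm (mul_zero l).symm)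
      (normalizable_dilation _ _ _)
  · refine .one hl ((h.inter h1 h0 b d e).congr (mul_one l).symm (mul_div_cancel₀ _ hl).symm
      (mul_zero l).symm (mul_div_cancel₀ _ hl).symm (mul_div_cancel₀ _ hl).symm (mul_one l).symm)
      (normalizable_rotation _ _ _)

end single

section classification

open EqTrans

/-! #### Algebras of higher dimension -/

section higher

variable {a b c d e k a' b' c' d' e' k' : ℝ}

theorem Normalizable.three {T : EqTrans} {l : ℝ} (hl : l ≠ 0)
    (h : T.Inter a b c d e k (l * a') (l * b') (l * c') (l * d') (l * e') (l * k'))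
    (hn : Normalizable
      (Submodule.span ℝ {gv 0 1 0 0 0 0, gv 0 0 0 0 1 0, gv a' b' c' d' e' k'})) :
    Normalizable (Submodule.span ℝ {gv 0 1 0 0 0 0, gv 0 0 0 0 1 0, gv a b c d e k}) := by
  have hp := h.pushes
  rw [← smul_gv] at hp
  exact hn.of_equiv span_le_three span_le_three (equiv_three hl hp)

theorem normalizable_nilrad_translation {d : ℝ} (hd : d ≠ 0) :
    Normalizable (Submodule.span ℝ {gv 0 1 0 0 0 0, gv 0 0 0 0 1 0, gv 1 0 0 d 0 0}) := by
  have := Normalizable.of_const .g31 trivial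
  rw [ConstRow.alg_eq] at this
  have h2 : 2 * d ≠ 0 := mul_ne_zero two_ne_zero hd
  refine .three (l := 2 * d) h2
    ((scale_inter h2 one_ne_zero _ _ _ _ _ _).congr ?_ ?_ ?_ ?_ ?_ ?_) this
  all_goals field_simp
  all_goals simp

theorem normalizable_nilrad_dilation {d : ℝ} (hd : 2 * d - 1 ≠ 0) :
    Normalizable (Submodule.span ℝ {gv 0 1 0 0 0 0, gv 0 0 0 0 1 0, gv 0 0 1 d 0 0}) := by
  rcases lt_or_ge (1 / 2) d with hle | hle
  · have := Normalizable.of_const (.g32 d) hle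
    rwa [ConstRow.alg_eq] at this
  · have hlt : d < 1 / 2 := lt_of_le_of_ne hle fun h => hd (by rw [h]; norm_num)
    have := Normalizable.of_const (.g32 (1 - d)) (by simp only [ConstRow.Gauged]; linarith)
    rw [ConstRow.alg_eq] at this
    refine .three (l := -1) (by norm_num)
      ((inversion_inter _ _ _ _ _ _).congr ?_ ?_ ?_ ?_ ?_ ?_) this <;> ring

theorem normalizable_nilrad_rotation {d : ℝ} (hd : d ≠ 0) :
    Normalizable (Submodule.span ℝ {gv 0 1 0 0 0 0, gv 0 0 0 0 1 0, gv 1 0 0 d 0 1}) := by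
  rcases hd.lt_or_gt with hlt | hlt
  · have := Normalizable.of_const (.g33 (-d)) (by simp only [ConstRow.Gauged]; linarith)
    rw [ConstRow.alg_eq] at this
    refine .three (l := -1) (by norm_num) ((scale_inter (α := -1) (by norm_num) one_ne_zero
      _ _ _ _ _ _).congr ?_ ?_ ?_ ?_ ?_ ?_) this <;> norm_num
  · have := Normalizable.of_const (.g33 d) hlt
    rwa [ConstRow.alg_eq] at this

theorem normalizable_nilrad (hτ : a ≠ 0 ∨ c ≠ 0 ∨ k ≠ 0) (hw : 2 * d - c ≠ 0) :
    Normalizable (Submodule.span ℝ {gv 0 1 0 0 0 0, gv 0 0 0 0 1 0, gv a 0 c d 0 k}) := by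
  obtain ⟨T, l, h1, h0, hl, h | h | h⟩ := exists_tauMap hτ
  · refine .three (l := l) hl ((h.inter h1 h0 0 d 0).congr (mul_one l).symm (by simp) (mul_zero l).symm
      (mul_div_cancel₀ _ hl).symm (by simp) (mul_zero l).symm)
      (normalizable_nilrad_translation (div_ne_zero (fun h => hw (by linarith)) hl))
  · have hm := mul_div_cancel₀ (d + (l - c) / 2) hl
    refine .three (l := l) hl ((h.inter h1 h0 0 d 0).congr (mul_zero l).symm (by simp) (mul_one l).symm
      hm.symm (by simp) (mul_zero l).symm) (normalizable_nilrad_dilation fun h => hw ?_)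
    linear_combination l * h - 2 * hm
  · refine .three (l := l) hl ((h.inter h1 h0 0 d 0).congr (mul_one l).symm (by simp) (mul_zero l).symm
      (mul_div_cancel₀ _ hl).symm (by simp) (mul_one l).symm)
      (normalizable_nilrad_rotation (div_ne_zero (fun h => hw (by linarith)) hl))

theorem Normalizable.two {a₁ b₁ c₁ d₁ e₁ k₁ a₂ b₂ c₂ d₂ e₂ k₂ : ℝ} {T : EqTrans}
    {l m n : ℝ} (hl : l ≠ 0) (hm : m ≠ 0)
    (h : T.Inter a b c d e k (l * a₁) (l * b₁) (l * c₁) (l * d₁) (l * e₁) (l * k₁))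
    (h' : T.Inter a' b' c' d' e' k' (m * a₂ + n * a₁) (m * b₂ + n * b₁) (m * c₂ + n * c₁)
      (m * d₂ + n * d₁) (m * e₂ + n * e₁) (m * k₂ + n * k₁))
    (hn : Normalizable (Submodule.span ℝ {gv a₁ b₁ c₁ d₁ e₁ k₁, gv a₂ b₂ c₂ d₂ e₂ k₂})) :
    Normalizable (Submodule.span ℝ {gv a b c d e k, gv a' b' c' d' e' k'}) := by
  have hp := h.pushes
  have hp' := h'.pushes
  rw [← smul_gv] at hp
  rw [← gv_add, ← smul_gv, ← smul_gv] at hp'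
  exact hn.of_equiv span_le_two span_le_two (equiv_two hl hm hp hp')

theorem shift_inter_dilation (b₀ e₀ : ℝ) :
    (shift e₀ b₀).Inter 0 b₀ 0 1 e₀ 0 0 0 0 1 0 0 :=
  (shift_inter e₀ b₀ 0 b₀ 0 1 e₀ 0).congr rfl (by ring) rfl rfl (by ring) rfl

/-- The shift that turns the dilation into D^x also kills the nilradical part of the second
generator, since that part is dictated by the dilation. Transformations of t alone preserve D^x and
normalise τ. -/
theorem normalizable_dilation_ext {b₀ e₀ : ℝ} (hτ : a ≠ 0 ∨ c ≠ 0 ∨ k ≠ 0)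
    (hb : b = b₀ * (c / 2) - a * e₀) (he : e = e₀ * (c / 2) + b₀ * k - c * e₀) :
    Normalizable (Submodule.span ℝ {gv 0 b₀ 0 1 e₀ 0, gv a b c (c / 2) e k}) := by
  refine .two (l := 1) (m := 1) (n := 0) (a₁ := 0) (b₁ := 0) (c₁ := 0) (d₁ := 1) (e₁ := 0)
    (k₁ := 0) (a₂ := a) (b₂ := 0) (c₂ := c) (d₂ := c / 2) (e₂ := 0) (k₂ := k) one_ne_zero
    one_ne_zero ((shift_inter_dilation b₀ e₀).congr ?_ ?_ ?_ ?_ ?_ ?_)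
    ((shift_inter e₀ b₀ a b c (c / 2) e k).congr ?_ ?_ ?_ ?_ ?_ ?_) ?_
  any_goals ring1
  · rw [hb]
    ring
  · rw [he]
    ring
  obtain ⟨T, l, h1, h0, hl, h⟩ := exists_tauMap hτ
  have hd : T.Inter 0 0 0 1 0 0 (1 * 0) (1 * 0) (1 * 0) (1 * 1) (1 * 0) (1 * 0) := by
    refine ⟨?_, ?_, ?_, ?_, ?_, ?_⟩ <;> simp [h1, h0]
  rcases h with h | h | h
  · have := Normalizable.of_const .g22 trivial
    rw [ConstRow.alg_eq] at this
    exact .two (n := 0) one_ne_zero hl hd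
      ((h.inter h1 h0 0 (c / 2) 0).congr (by ring) (by simp) (by ring) (by ring) (by simp) (by ring))
      this
  · have := Normalizable.of_const .g23 trivial
    rw [ConstRow.alg_eq] at this
    exact .two (n := l / 2) one_ne_zero hl hd
      ((h.inter h1 h0 0 (c / 2) 0).congr (by ring) (by simp) (by ring) (by ring) (by simp) (by ring))
      this
  · have := Normalizable.of_const .g24 trivial
    rw [ConstRow.alg_eq] at this
    exact .two (n := 0) one_ne_zero hl hd
      ((h.inter h1 h0 0 (c / 2) 0).congr (by ring) (by simp) (by ring) (by ring) (by simp) (by ring))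
      this

/-- If q = [q, r] for trace-free 2 × 2 matrices, then tr q² = tr q[q, r] = 0, so q is nilpotent. The
identity below is this computation in coordinates, and it forces τ to be equivalent to a constant.
-/
theorem BracketUnit.disc (h : BracketUnit a b c d e k a' b' c' d' e' k') :
    c ^ 2 - 4 * a * k = 0 := by
  obtain ⟨h1, -, h3, -, -, h6⟩ := h
  linear_combination -c * h3 + 2 * a * h6 + 2 * k * h1

/-- The bracket relation is invariant under equivalence transformations. -/
theorem BracketUnit.map {T : EqTrans} {a₁ b₁ c₁ d₁ e₁ k₁ a₂ b₂ c₂ d₂ e₂ k₂ : ℝ}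
    (hb : BracketUnit a b c d e k a' b' c' d' e' k')
    (h : T.Inter a b c d e k a₁ b₁ c₁ d₁ e₁ k₁) (h' : T.Inter a' b' c' d' e' k' a₂ b₂ c₂ d₂ e₂ k₂) :
    BracketUnit a₁ b₁ c₁ d₁ e₁ k₁ a₂ b₂ c₂ d₂ e₂ k₂ := by
  -- Conjugation respects commutators, so the brackets are related by T as well; uniqueness of the
  -- pushforward then transfers [Q, R] = Q.
  have key : T.Inter (a * c' - c * a') (a * e' + b * d' - a' * e - b' * d) (2 * (a * k' - k * a'))
      (a * k' - a' * k) (c * e' + e * d' + b * k' - c' * e - e' * d - b' * k) (c * k' - k * c')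
      (a₁ * c₂ - c₁ * a₂) (a₁ * e₂ + b₁ * d₂ - a₂ * e₁ - b₂ * d₁) (2 * (a₁ * k₂ - k₁ * a₂))
      (a₁ * k₂ - a₂ * k₁) (c₁ * e₂ + e₁ * d₂ + b₁ * k₂ - c₂ * e₁ - e₂ * d₁ - b₂ * k₁)
      (c₁ * k₂ - k₁ * c₂) := by
    obtain ⟨h1, h2, h3, h4, h5, h6⟩ := h
    obtain ⟨g1, g2, g3, g4, g5, g6⟩ := h'
    refine ⟨?_, ?_, ?_, ?_, ?_, ?_⟩
    · linear_combination (c₂ - d₂) * h1 + a₂ * h3 + (c - d) * g1 + (-k) * g2 - (c₁ - d₁) * g1 - a₁ * g3 - (c' - d') * h1 - (-k') * h2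
    · linear_combination (c₂ - d₂) * h2 + a₂ * h4 + a * g1 + (-d) * g2 - (c₁ - d₁) * g2 - a₁ * g4 - a' * h1 - (-d') * h2
    · linear_combination (-k₂) * h1 + (-d₂) * h3 + (c - d) * g3 + (-k) * g4 - (-k₁) * g1 - (-d₁) * g3 - (c' - d') * h3 - (-k') * h4
    · linear_combination (-k₂) * h2 + (-d₂) * h4 + a * g3 + (-d) * g4 - (-k₁) * g2 - (-d₁) * g4 - a' * h3 - (-d') * h4
    · linear_combination e₂ * h1 + b₂ * h3 + (c - d) * g5 + (-k) * g6 - e₁ * g1 - b₁ * g3 - (c' - d') * h5 - (-k') * h6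
    · linear_combination e₂ * h2 + b₂ * h4 + a * g5 + (-d) * g6 - e₁ * g2 - b₁ * g4 - a' * h5 - (-d') * h6
  obtain ⟨e1, e2, e3, e4, e5, e6⟩ := hb
  rw [e1, e2, e3, e4, e5, e6] at key
  obtain ⟨r1, r2, r3, r4, r5, r6⟩ := gv_onE_inj (T := T) fun p hp =>
    (key.pushes p hp).symm.trans (h.pushes p hp)
  exact ⟨r1, r2, r3, r4, r5, r6⟩

/-- With τ of Q made constant, [Q, R] = Q forces, modulo Q, Q = P^t + βP^x + εG and R = D^t + d₂D^x
+ … with ε(d₂ - 2) = 0. After the shifts, ε ≠ 0 gives row 2.7, ε = 0 ≠ d₂ row 2.6, and ε = d₂ = 0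
row 2.5 or the excluded algebra. The value d₂ = 1/2 is ruled out by the nonzero weight of R. -/
theorem normalizable_pair (hτ : a ≠ 0 ∨ c ≠ 0 ∨ k ≠ 0)
    (hb : BracketUnit a b c d e k a' b' c' d' e' k') (hw : 2 * d' - c' ≠ 0)
    (hn : ¬ SubalgEquiv (Submodule.span ℝ {gv a b c d e k, gv a' b' c' d' e' k'})
      (Submodule.span ℝ {vPt, vDt})) :
    Normalizable (Submodule.span ℝ {gv a b c d e k, gv a' b' c' d' e' k'}) := by
  obtain ⟨T, l, h1, h0, hl, h⟩ := exists_tauMap hτ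
  have h : T.TauMap a c k l 0 0 := by
    rcases h with h | h | h
    · exact h
    · have := (h.inter h1 h0 0 0 0).disc
      rw [hb.disc] at this
      simp [hl] at this
    · have := (h.inter h1 h0 0 0 0).disc
      rw [hb.disc] at this
      simp [hl] at this
  have hQ := h.inter h1 h0 b d e
  obtain ⟨a₂, b₂, c₂, d₂, e₂, k₂, hR⟩ := T.exists_inter a' b' c' d' e' k'
  have hb' := hb.map hQ hR
  have hw' := hR.weight
  generalize T.κ * (T.α * b - T.β * e) / (T.α * T.δ - T.β * T.γ) = b₁ at hQ hb'
  generalize T.κ * (T.δ * e - T.γ * b) / (T.α * T.δ - T.β * T.γ) = e₁ at hQ hb'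
  generalize d + (0 - c) / 2 = d₁ at hQ hb'
  obtain ⟨g1, g2, g3, g4, g5, -⟩ := hb'
  have hk : k₂ = 0 := mul_left_cancel₀ hl (by linarith)
  subst hk
  have hd : d₁ = 0 := by linarith
  subst hd
  have hc : c₂ = 1 := mul_left_cancel₀ hl (by linarith)
  subst hc
  rw [← hw'] at hw
  obtain ⟨β, rfl⟩ : ∃ β, b₁ = l * β := ⟨b₁ / l, (mul_div_cancel₀ _ hl).symm⟩
  obtain ⟨ε, rfl⟩ : ∃ ε, e₁ = l * ε := ⟨e₁ / l, (mul_div_cancel₀ _ hl).symm⟩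
  -- These are the P^x- and G-components of the bracket relation; the first makes the shift that
  -- kills β kill the G-component of R as well.
  have hE : e₂ - a₂ * ε + β * d₂ = β := mul_left_cancel₀ hl (by linear_combination g2)
  have hε : ε * (d₂ - 2) = 0 := mul_left_cancel₀ hl (by linear_combination g5)
  have s1 : SubalgEquiv (Submodule.span ℝ {gv a b c d e k, gv a' b' c' d' e' k'})
      (Submodule.span ℝ {gv 1 β 0 0 ε 0, gv 0 (b₂ - a₂ * β) 1 d₂ (e₂ - a₂ * ε) 0}) := by
    refine equiv_two (T := T) (l := l) (m := 1) (n := a₂) hl one_ne_zero ?_ ?_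
    · rw [smul_gv]
      exact (hQ.congr (by ring) rfl (by ring) (by ring) rfl (by ring)).pushes
    · rw [smul_gv, smul_gv, gv_add]
      exact (hR.congr (by ring) (by ring) (by ring) (by ring) (by ring) (by ring)).pushes
  generalize b₂ - a₂ * β = B at s1
  generalize e₂ - a₂ * ε = E at s1 hE
  obtain ⟨B', hB', s2⟩ : ∃ B', (d₂ ≠ 0 → B' = 0) ∧
      SubalgEquiv (Submodule.span ℝ {gv 1 β 0 0 ε 0, gv 0 B 1 d₂ E 0})
        (Submodule.span ℝ {gv 1 0 0 0 ε 0, gv 0 B' 1 d₂ 0 0}) := by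
    -- For d₂ = 0 the quotient B / d₂ is 0, so the same shift leaves B untouched.
    refine ⟨B - B / d₂ * d₂, fun h => by field_simp; ring, equiv_two (T := shift (-β) (B / d₂))
      (l := 1) (m := 1) (n := 0) one_ne_zero one_ne_zero ?_ ?_⟩
    · rw [smul_gv]
      exact ((shift_inter ..).congr (by ring) (by ring) (by ring) (by ring) (by ring)
        (by ring)).pushes
    · rw [smul_gv, smul_gv, gv_add]
      exact ((shift_inter ..).congr (by ring) (by ring) (by ring) (by ring)
        (by linear_combination hE) (by ring)).pushes
  have s3 := s1.trans span_le_two span_le_two span_le_two s2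
  refine Normalizable.of_equiv span_le_two span_le_two s3 ?_
  by_cases he : ε = 0
  · subst he
    by_cases hd : d₂ = 0
    · subst hd
      by_cases hB : B' = 0
      · subst hB
        rw [← vPt_eq, ← vDt_eq] at s3
        exact (hn s3).elim
      · have := Normalizable.of_const .g25 trivial
        rw [ConstRow.alg_eq] at this
        refine .two (T := scale 1 B'⁻¹ one_ne_zero (inv_ne_zero hB)) (l := 1) (m := 1) (n := 0)
          one_ne_zero one_ne_zero ((scale_inter ..).congr ?_ ?_ ?_ ?_ ?_ ?_)
          ((scale_inter ..).congr ?_ ?_ ?_ ?_ ?_ ?_) this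
        all_goals field_simp
        all_goals simp
    · obtain rfl := hB' hd
      have := Normalizable.of_const (.g26 d₂) ⟨hd, fun h => hw (by rw [h]; norm_num)⟩
      rwa [ConstRow.alg_eq] at this
  · obtain rfl : d₂ = 2 := by
      have := (mul_eq_zero.1 hε).resolve_left he
      linarith
    obtain rfl := hB' two_ne_zero
    have := Normalizable.of_const .g27 trivial
    rw [ConstRow.alg_eq] at this
    refine .two (T := scale 1 ε⁻¹ one_ne_zero (inv_ne_zero he)) (l := 1) (m := 1) (n := 0)
      one_ne_zero one_ne_zero ((scale_inter ..).congr ?_ ?_ ?_ ?_ ?_ ?_)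
      ((scale_inter ..).congr ?_ ?_ ?_ ?_ ?_ ?_) this
    all_goals field_simp
    all_goals simp

end higher

theorem normalizable_symAlg {Ω : Set (ℝ × ℝ)} {f : ℝ × ℝ → ℝ} (hf : IsGBE Ω f)
    (h0 : symAlg Ω f ≠ ⊥) : Normalizable (symAlg Ω f) := by
  have hn := not_equiv_translation_scale hf
  cases symStructure hf with
  | bot h => exact (h0 h).elim
  | full hc h =>
    rw [h]
    have := Normalizable.of_const .g5 trivial
    rwa [ConstRow.alg_eq] at this
  | nil h =>
    rw [h]
    exact Normalizable.of_fn .g21 trivial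
  | nilExt a c d k hτ hw h =>
    rw [h]
    exact normalizable_nilrad hτ hw
  | dil b e h =>
    rw [h]
    have := Normalizable.of_fn .g11 trivial
    rw [FunRow.alg_eq] at this
    refine .one (l := 1) one_ne_zero ((shift_inter_dilation b e).congr ?_ ?_ ?_ ?_ ?_ ?_) this <;>
      ring
  | dilExt b₀ e₀ a b c e k hτ hb he h =>
    rw [h]
    exact normalizable_dilation_ext hτ hb he
  | single a b c d e k hτ h =>
    rw [h]
    exact normalizable_single hτ b d e
  | pair a b c d e k a' b' c' d' e' k' hτ hb hw h =>
    rw [h] at hn ⊢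
    exact normalizable_pair hτ hb hw hn

end classification

/-! ### The families with constant parameters -/

/-- The linear functional with the components `x` and `y`. -/
def lin2 (x y : ℝ) : ℝ × ℝ →L[ℝ] ℝ :=
  x • ContinuousLinearMap.fst ℝ ℝ ℝ + y • ContinuousLinearMap.snd ℝ ℝ ℝ

@[simp]
theorem lin2_apply (x y : ℝ) (v : ℝ × ℝ) : lin2 x y v = x * v.1 + y * v.2 := by
  simp [lin2]

theorem hasFDerivAt_fst_comp {g : ℝ → ℝ} {g' : ℝ} {p : ℝ × ℝ} (h : HasDerivAt g g' p.1) :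
    HasFDerivAt (fun q : ℝ × ℝ => g q.1) (lin2 g' 0) p :=
  (h.comp_hasFDerivAt p hasFDerivAt_fst).congr_fderiv (by ext <;> simp)

theorem hasFDerivAt_snd_comp {g : ℝ → ℝ} {g' : ℝ} {p : ℝ × ℝ} (h : HasDerivAt g g' p.2) :
    HasFDerivAt (fun q : ℝ × ℝ => g q.2) (lin2 0 g') p :=
  (h.comp_hasFDerivAt p hasFDerivAt_snd).congr_fderiv (by ext <;> simp)

theorem hasFDerivAt_lin2_mul {F K : ℝ × ℝ → ℝ} {x y x' y' : ℝ} {p : ℝ × ℝ}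
    (hF : HasFDerivAt F (lin2 x y) p) (hK : HasFDerivAt K (lin2 x' y') p) :
    HasFDerivAt (fun q => F q * K q) (lin2 (x * K p + F p * x') (y * K p + F p * y')) p :=
  (hF.mul hK).congr_fderiv (by ext <;> simp <;> ring)

theorem hasFDerivAt_lin2_sub {F K : ℝ × ℝ → ℝ} {x y x' y' : ℝ} {p : ℝ × ℝ}
    (hF : HasFDerivAt F (lin2 x y) p) (hK : HasFDerivAt K (lin2 x' y') p) :
    HasFDerivAt (fun q => F q - K q) (lin2 (x - x') (y - y')) p :=
  (hF.sub hK).congr_fderiv (by ext <;> simp)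

theorem hasFDerivAt_comp_lin2 {g : ℝ → ℝ} {g' : ℝ} {F : ℝ × ℝ → ℝ} {x y : ℝ} {p : ℝ × ℝ}
    (h : HasDerivAt g g' (F p)) (hF : HasFDerivAt F (lin2 x y) p) :
    HasFDerivAt (fun q => g (F q)) (lin2 (g' * x) (g' * y)) p :=
  (h.comp_hasFDerivAt p hF).congr_fderiv (by ext <;> simp)

theorem lin2_congr {F : ℝ × ℝ → ℝ} {x y x' y' : ℝ} {p : ℝ × ℝ}
    (hF : HasFDerivAt F (lin2 x y) p) (hx : x = x') (hy : y = y') :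
    HasFDerivAt F (lin2 x' y') p := by
  subst hx hy
  exact hF

theorem hasDerivAt_abs_rpow_of_ne {x : ℝ} (hx : x ≠ 0) (s : ℝ) :
    HasDerivAt (fun y => |y| ^ s) (s * |x| ^ s / x) x := by
  have h : HasDerivAt (fun y => Real.exp (Real.log y * s)) (Real.exp (Real.log x * s) * (x⁻¹ * s))
      x := ((Real.hasDerivAt_log hx).mul_const s).exp
  -- `Real.log` is even, so one formula serves both signs of y.
  have he : ∀ y : ℝ, y ≠ 0 → |y| ^ s = Real.exp (Real.log y * s) := by
    intro y hy
    rw [Real.rpow_def_of_pos (abs_pos.2 hy), Real.log_abs]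
  have h2 : HasDerivAt (fun y => |y| ^ s) (Real.exp (Real.log x * s) * (x⁻¹ * s)) x :=
    h.congr_of_eventuallyEq ((eventually_ne_nhds hx).mono fun y hy => he y hy)
  convert h2 using 1
  rw [he x hx]
  field_simp

theorem hasFDerivAt_parabola (p : ℝ × ℝ) :
    HasFDerivAt (fun q : ℝ × ℝ => q.2 - q.1 ^ 2 / 2) (lin2 (-p.1) 1) p := by
  have h1 : HasDerivAt (fun t : ℝ => t ^ 2 / 2) p.1 p.1 := by
    simpa using (hasDerivAt_pow 2 p.1).div_const 2
  exact lin2_congr (hasFDerivAt_lin2_sub (hasFDerivAt_snd_comp (hasDerivAt_id' p.2))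
    (hasFDerivAt_fst_comp h1)) (by ring) (by ring)

section maximal

variable {Ω : Set (ℝ × ℝ)} {f : ℝ × ℝ → ℝ}

/-- Dependence on x excludes the cases of `symStructure` that contain the nilradical. Two
independent symmetries therefore already span the whole algebra, which is how maximality of the rows
2.2–2.7 is obtained. -/
theorem finrank_le_two_of_fx (hf : IsGBE Ω f) {p₀ : ℝ × ℝ} (hp₀ : p₀ ∈ Ω)
    (hx : fderiv ℝ f p₀ (0, 1) ≠ 0) : Module.finrank ℝ (symAlg Ω f) ≤ 2 := by
  have hn : ∀ A : Submodule ℝ VF, symAlg Ω f = A → gv 0 1 0 0 0 0 ∈ A → False := by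
    intro A hA hm
    rw [← hA] at hm
    simpa using (nilrad_trivial hf hp₀ hx hm).1
  cases symStructure hf with
  | bot h => rw [h, finrank_bot]; norm_num
  | full hc h => exact (hn _ h (mem_levi_sup_nilrad.2 (by norm_num))).elim
  | nil h => exact (hn _ h (mem_nilrad.2 ⟨rfl, rfl, rfl, rfl⟩)).elim
  | nilExt a c d k hτ hw h => exact (hn _ h (Submodule.subset_span (by simp))).elim
  | dil b e h => exact h ▸ (finrank_span_one (by simp [← gv_zero, gv_inj])).trans_le (by norm_num)
  | dilExt b₀ e₀ a b c e k hτ hb he h => exact h ▸ finrank_span_two_le ..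
  | single a b c d e k hτ h =>
    rw [h, finrank_span_one]
    · norm_num
    rw [← gv_zero, Ne, gv_inj]
    tauto
  | pair a b c d e k a' b' c' d' e' k' hτ hb hw h => exact h ▸ finrank_span_two_le ..

theorem finiteDimensional_symAlg : FiniteDimensional ℝ (symAlg Ω f) := by
  have : FiniteDimensional ℝ algG := by
    rw [algG]
    exact FiniteDimensional.span_of_finite ℝ (Set.toFinite _)
  exact Submodule.finiteDimensional_of_le symAlg_le

theorem symAlg_eq_of_finrank {s : Submodule ℝ VF} (hs : s ≤ symAlg Ω f)
    (h : Module.finrank ℝ (symAlg Ω f) ≤ Module.finrank ℝ s) : symAlg Ω f = s := by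
  have := finiteDimensional_symAlg (Ω := Ω) (f := f)
  exact (Submodule.eq_of_le_of_finrank_le hs h).symm

theorem symAlg_eq_two (hf : IsGBE Ω f) {p₀ : ℝ × ℝ} (hp₀ : p₀ ∈ Ω)
    (hx : fderiv ℝ f p₀ (0, 1) ≠ 0) {Q R : VF} (hQ : Q ∈ symAlg Ω f) (hR : R ∈ symAlg Ω f)
    (hi : ∀ x y : ℝ, x • Q + y • R = 0 → x = 0 ∧ y = 0) :
    symAlg Ω f = Submodule.span ℝ {Q, R} := by
  refine symAlg_eq_of_finrank ?_ ((finrank_le_two_of_fx hf hp₀ hx).trans_eq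
    (finrank_span_two hi).symm)
  rw [Submodule.span_le]
  rintro S (rfl | rfl) <;> assumption

/-- Dimension five would make f constant, which f_t ≠ 0 excludes; so three independent symmetries
are all. -/
theorem symAlg_eq_three (hf : IsGBE Ω f) (hx : ∀ p ∈ Ω, fderiv ℝ f p (0, 1) = 0)
    {p₀ : ℝ × ℝ} (hp₀ : p₀ ∈ Ω) (ht : fderiv ℝ f p₀ (1, 0) ≠ 0) {a c d k : ℝ}
    (hτ : a ≠ 0 ∨ c ≠ 0 ∨ k ≠ 0) (hQ : gv a 0 c d 0 k ∈ symAlg Ω f) :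
    symAlg Ω f = Submodule.span ℝ {gv 0 1 0 0 0 0, gv 0 0 0 0 1 0, gv a 0 c d 0 k} := by
  refine symAlg_eq_of_finrank ?_ ?_
  · rw [Submodule.span_le]
    rintro S (rfl | rfl | rfl)
    · exact nilrad_mem_of_fx hx 1 0
    · exact nilrad_mem_of_fx hx 0 1
    · exact hQ
  rw [finrank_span_three]
  · rcases finrank_symAlg hf with ⟨-, c, hc⟩ | h
    · refine (ht ?_).elim
      have : f =ᶠ[nhds p₀] fun _ => c := by
        filter_upwards [hf.isOpen.mem_nhds hp₀] with q hq using hc q hq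
      rw [this.fderiv_eq]
      simp
    · simp only [Set.mem_insert_iff, Set.mem_singleton_iff] at h
      omega
  · intro x y z h
    rw [smul_gv, smul_gv, smul_gv, gv_add, gv_add, ← gv_zero, gv_inj] at h
    obtain ⟨h1, h2, h3, h4, h5, h6⟩ := h
    have hz : z = 0 := eq_zero_of_smul_tau hτ (by linarith) (by linarith) (by linarith)
    subst hz
    refine ⟨by linarith, by linarith, rfl⟩

theorem fderiv_of_form (hΩ : IsOpen Ω) {c st sx : ℝ} {s : ℝ × ℝ → ℝ}
    (h : ∀ p ∈ Ω, f p = c * s p) {p : ℝ × ℝ} (hp : p ∈ Ω) (hs : HasFDerivAt s (lin2 st sx) p) :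
    fderiv ℝ f p (1, 0) = c * st ∧ fderiv ℝ f p (0, 1) = c * sx := by
  have he : f =ᶠ[nhds p] fun q => c * s q := by
    filter_upwards [hΩ.mem_nhds hp] with q hq using h q hq
  have h2 : HasFDerivAt (fun q => c * s q) (c • lin2 st sx) p := hs.const_mul c
  rw [he.fderiv_eq, h2.fderiv]
  simp

end maximal

namespace ConstRow

/-- The partial derivatives of the function `shape`. -/
def shapeT : ConstRow → ℝ × ℝ → ℝ
  | g22 => fun _ => 0
  | g23 => fun p => -p.2 ^ 2 / p.1 ^ 2
  | g24 => fun p => -2 * p.1 * p.2 ^ 2 / (p.1 ^ 2 + 1) ^ 2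
  | g25 => fun _ => 0
  | g26 _ => fun _ => 0
  | g27 => fun p => -p.1 * (3 / 2 * |p.2 - p.1 ^ 2 / 2| ^ (3 / 2 : ℝ) / (p.2 - p.1 ^ 2 / 2))
  | g31 => fun p => Real.exp p.1
  | g32 a => fun p => (2 * a - 1) * |p.1| ^ (2 * a - 1) / p.1
  | g33 a => fun p => 2 * a / (p.1 ^ 2 + 1) * Real.exp (2 * a * Real.arctan p.1)
  | g5 => fun _ => 0

def shapeX : ConstRow → ℝ × ℝ → ℝ
  | g22 => fun p => 2 * p.2
  | g23 => fun p => 2 * p.2 / p.1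
  | g24 => fun p => 2 * p.2 / (p.1 ^ 2 + 1)
  | g25 => fun p => -Real.exp (-p.2)
  | g26 a => fun p => (2 - 1 / a) * |p.2| ^ (2 - 1 / a) / p.2
  | g27 => fun p => 3 / 2 * |p.2 - p.1 ^ 2 / 2| ^ (3 / 2 : ℝ) / (p.2 - p.1 ^ 2 / 2)
  | _ => fun _ => 0

/-- The conditions for the differentiability of `shape` that follow from its nonvanishing. -/
def Regular : ConstRow → ℝ × ℝ → Prop
  | g23 => fun p => p.1 ≠ 0
  | g26 _ => fun p => p.2 ≠ 0
  | g27 => fun p => p.2 - p.1 ^ 2 / 2 ≠ 0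
  | g32 _ => fun p => p.1 ≠ 0
  | _ => fun _ => True

/-- At singular points the total functions give 0: division by zero is 0, and 0 ^ s = 0 for s ≠ 0.
Admissibility ensures that the exponents are nonzero, so nonvanishing of f keeps Ω away from these
points. -/
theorem regular_of_ne {r : ConstRow} (hr : r.Admissible) {p : ℝ × ℝ} (h : r.shape p ≠ 0) :
    r.Regular p := by
  cases r with
  | g23 => exact fun h0 => h (by simp [shape, h0])
  | g26 a =>
    obtain ⟨h1, h2⟩ := hr
    refine fun h0 => h ?_
    simp only [shape, h0, abs_zero]
    refine Real.zero_rpow fun h3 => h2 ?_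
    field_simp at h3 ⊢
    linarith
  | g27 => exact fun h0 => h (by simp [shape, h0])
  | g32 a =>
    refine fun h0 => h ?_
    simp only [shape, h0, abs_zero]
    refine Real.zero_rpow fun h3 => hr (by linarith)
  | _ => trivial

theorem hasFDerivAt_shape {r : ConstRow} {p : ℝ × ℝ} (hp : r.Regular p) :
    HasFDerivAt r.shape (lin2 (r.shapeT p) (r.shapeX p)) p := by
  have hsq : ∀ x : ℝ, HasDerivAt (fun y : ℝ => y ^ 2) (2 * x) x := fun x => by
    simpa using hasDerivAt_pow 2 x
  have hden : p.1 ^ 2 + 1 ≠ 0 := by positivity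
  cases r with
  | g22 => exact hasFDerivAt_snd_comp (hsq p.2)
  | g23 =>
    refine ((hasFDerivAt_div (hasFDerivAt_snd_comp (hsq p.2))
      (hasFDerivAt_fst_comp (hasDerivAt_id' p.1)) hp)).congr_fderiv ?_
    simp only [Regular] at hp
    ext <;> simp [shapeT, shapeX] <;> field_simp
  | g24 =>
    refine ((hasFDerivAt_div (hasFDerivAt_snd_comp (hsq p.2))
      (hasFDerivAt_fst_comp ((hsq p.1).add_const 1)) hden)).congr_fderiv ?_
    ext <;> simp [shapeT, shapeX] <;> field_simp
  | g25 =>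
    exact hasFDerivAt_snd_comp (by simpa using (hasDerivAt_neg' p.2).exp)
  | g26 a => exact hasFDerivAt_snd_comp (hasDerivAt_abs_rpow_of_ne hp _)
  | g27 =>
    exact lin2_congr (hasFDerivAt_comp_lin2 (hasDerivAt_abs_rpow_of_ne hp (3 / 2))
      (hasFDerivAt_parabola p)) (by simp only [shapeT]; ring) (by simp only [shapeX]; ring)
  | g31 => exact hasFDerivAt_fst_comp (Real.hasDerivAt_exp p.1)
  | g32 a => exact hasFDerivAt_fst_comp (hasDerivAt_abs_rpow_of_ne hp _)
  | g33 a =>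
    refine lin2_congr (hasFDerivAt_fst_comp (g := fun t => Real.exp (2 * a * Real.arctan t))
      (((Real.hasDerivAt_arctan p.1).const_mul (2 * a)).exp)) ?_ rfl
    simp only [shapeT]
    rw [add_comm (1 : ℝ)]
    field_simp
  | g5 => exact (hasFDerivAt_const (1 : ℝ) p).congr_fderiv (by ext <;> simp [shapeT, shapeX])

/-- For `f` of the form of an entry the algebra is maximal exactly for the admissible values of
the parameter. -/
theorem symAlg_eq_iff {r : ConstRow} {Ω : Set (ℝ × ℝ)} {f : ℝ × ℝ → ℝ} {C : ℝ} (hf : IsGBE Ω f)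
    (h : r.HasForm Ω f C) : symAlg Ω f = r.alg ↔ r.Admissible := by
  obtain ⟨p₀, hp₀⟩ := hf.isConnected.nonempty
  have hne : ∀ p ∈ Ω, C ≠ 0 ∧ r.shape p ≠ 0 := by
    intro p hp
    have := hf.ne_zero p hp
    rw [h p hp] at this
    exact mul_ne_zero_iff.1 this
  have hc := (hne p₀ hp₀).1
  constructor
  · intro hS
    have hconst : (∀ p ∈ Ω, f p = C) → Module.finrank ℝ r.alg ≤ 3 → False := by
      intro h1 h2
      have := finrank_symAlg_of_const hf h1
      rw [hS] at this
      omega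
    cases r with
    | g26 a =>
      refine ⟨?_, ?_⟩
      · rintro rfl
        -- Here 1 / 0 = 0, so the shape is x² and D^x is an additional symmetry.
        have h1 : gv 0 0 0 1 0 0 ∈ symAlg Ω f := by
          rw [mem_symAlg]
          intro p hp
          have hs : ∀ q ∈ Ω, f q = C * q.2 ^ 2 := by
            intro q hq
            rw [h q hq]
            simp [shape]
          obtain ⟨e1, e2⟩ := fderiv_of_form hf.isOpen hs hp
            (hasFDerivAt_shape (r := .g22) trivial)
          rw [cls, e1, e2, hs p hp]
          simp only [shapeT, shapeX]
          ring
        rw [hS, alg_eq, Submodule.mem_span_pair] at h1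
        obtain ⟨x, y, h1⟩ := h1
        rw [smul_gv, smul_gv, gv_add, gv_inj] at h1
        simpa using h1.2.2.2.1
      · rintro rfl
        -- For a = 1/2 the exponent is 0, so f is constant and its algebra has dimension five.
        refine hconst (fun p hp => ?_) ?_
        · rw [h p hp]
          simp only [shape]
          norm_num
        · rw [alg_eq]
          exact (finrank_span_two_le ..).trans (by norm_num)
    | g32 a =>
      rintro rfl
      refine hconst (fun p hp => ?_) ?_
      · rw [h p hp]
        simp only [shape]
        norm_num
      · rw [alg_eq]
        exact finrank_span_three_le ..
    | g33 a =>
      rintro rfl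
      refine hconst (fun p hp => ?_) ?_
      · rw [h p hp]
        simp [shape]
      · rw [alg_eq]
        exact finrank_span_three_le ..
    | _ => trivial
  · intro hr
    have hreg : ∀ p ∈ Ω, r.Regular p := fun p hp => regular_of_ne hr (hne p hp).2
    have hD : ∀ p ∈ Ω, fderiv ℝ f p (1, 0) = C * r.shapeT p ∧
        fderiv ℝ f p (0, 1) = C * r.shapeX p := fun p hp =>
      fderiv_of_form hf.isOpen h hp (hasFDerivAt_shape (hreg p hp))
    have hmem : ∀ a b c d e k, (∀ p ∈ Ω, (a + c * p.1 + k * p.1 ^ 2) * r.shapeT p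
        + (b + d * p.2 + e * p.1 + k * p.1 * p.2) * r.shapeX p = (2 * d - c) * r.shape p) →
        gv a b c d e k ∈ symAlg Ω f := by
      intro a b c d e k h1
      rw [mem_symAlg]
      intro p hp
      obtain ⟨e1, e2⟩ := hD p hp
      rw [cls, e1, e2, h p hp]
      linear_combination C * h1 p hp
    have hsh := (hne p₀ hp₀).2
    have hrg := hreg p₀ hp₀
    obtain ⟨ht₀, hx₀⟩ := hD p₀ hp₀
    have hden : ∀ p : ℝ × ℝ, p.1 ^ 2 + 1 ≠ 0 := fun p => by positivity
    have two : ∀ a b c d e k a' b' c' d' e' k', r.shapeX p₀ ≠ 0 → (∀ p ∈ Ω,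
        (a + c * p.1 + k * p.1 ^ 2) * r.shapeT p
          + (b + d * p.2 + e * p.1 + k * p.1 * p.2) * r.shapeX p = (2 * d - c) * r.shape p) →
        (∀ p ∈ Ω, (a' + c' * p.1 + k' * p.1 ^ 2) * r.shapeT p
          + (b' + d' * p.2 + e' * p.1 + k' * p.1 * p.2) * r.shapeX p
            = (2 * d' - c') * r.shape p) →
        (∀ x y : ℝ, x * a + y * a' = 0 ∧ x * c + y * c' = 0 ∧ x * d + y * d' = 0 →
          x = 0 ∧ y = 0) →
        symAlg Ω f = Submodule.span ℝ {gv a b c d e k, gv a' b' c' d' e' k'} := by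
      intro a b c d e k a' b' c' d' e' k' h0 h1 h2 h3
      refine symAlg_eq_two hf hp₀ (hx₀ ▸ mul_ne_zero hc h0) (hmem _ _ _ _ _ _ h1)
        (hmem _ _ _ _ _ _ h2) fun x y h4 => h3 x y ?_
      rw [smul_gv, smul_gv, gv_add, ← gv_zero, gv_inj] at h4
      exact ⟨h4.1, h4.2.2.1, h4.2.2.2.1⟩
    have three : ∀ a c d k, (∀ p ∈ Ω, r.shapeX p = 0) → r.shapeT p₀ ≠ 0 → (a ≠ 0 ∨ c ≠ 0 ∨ k ≠ 0) →
        (∀ p ∈ Ω, (a + c * p.1 + k * p.1 ^ 2) * r.shapeT p = (2 * d - c) * r.shape p) →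
        symAlg Ω f
          = Submodule.span ℝ {gv 0 1 0 0 0 0, gv 0 0 0 0 1 0, gv a 0 c d 0 k} := by
      intro a c d k h0 h1 h2 h3
      refine symAlg_eq_three hf (fun p hp => ?_) hp₀ (ht₀ ▸ mul_ne_zero hc h1) h2
        (hmem _ _ _ _ _ _ fun p hp => ?_)
      · rw [(hD p hp).2, h0 p hp, mul_zero]
      · rw [h0 p hp, mul_zero, add_zero, h3 p hp]
    rw [alg_eq]
    clear hmem hD
    cases r with
    | g22 =>
      simp only [shape] at hsh
      refine two _ _ _ _ _ _ _ _ _ _ _ _ ?_ (fun p hp => ?_) (fun p hp => ?_) ?_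
      · simpa [shapeX] using hsh
      · simp only [shape, shapeT, shapeX]
        ring
      · simp only [shape, shapeT, shapeX]
        ring
      · rintro x y ⟨h1, h2, h3⟩
        constructor <;> linarith
    | g23 =>
      simp only [shape] at hsh
      refine two _ _ _ _ _ _ _ _ _ _ _ _ ?_ (fun p hp => ?_) (fun p hp => ?_) ?_
      · simp only [shapeX]
        intro h0
        refine hsh ?_
        linear_combination p₀.2 / 2 * h0
      · simp only [shape, shapeT, shapeX]
        ring
      · have := hreg p hp
        simp only [shape, shapeT, shapeX, Regular] at this ⊢
        field_simp
        ring
      · rintro x y ⟨h1, h2, h3⟩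
        constructor <;> linarith
    | g24 =>
      simp only [shape] at hsh
      refine two _ _ _ _ _ _ _ _ _ _ _ _ ?_ (fun p hp => ?_) (fun p hp => ?_) ?_
      · simp only [shapeX]
        intro h0
        refine hsh ?_
        linear_combination p₀.2 / 2 * h0
      · simp only [shape, shapeT, shapeX]
        ring
      · have := hden p
        simp only [shape, shapeT, shapeX]
        field_simp
        ring
      · rintro x y ⟨h1, h2, h3⟩
        constructor <;> linarith
    | g25 =>
      refine two _ _ _ _ _ _ _ _ _ _ _ _ ?_ (fun p hp => ?_) (fun p hp => ?_) ?_
      · simp [shapeX]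
      · simp only [shape, shapeT, shapeX]
        ring
      · simp only [shape, shapeT, shapeX]
        ring
      · rintro x y ⟨h1, h2, h3⟩
        constructor <;> linarith
    | g26 a =>
      obtain ⟨ha0, ha1⟩ := hr
      simp only [shape, Regular] at hsh hrg
      refine two _ _ _ _ _ _ _ _ _ _ _ _ ?_ (fun p hp => ?_) (fun p hp => ?_) ?_
      · refine div_ne_zero (mul_ne_zero (fun h0 => ha1 ?_) hsh) hrg
        field_simp at h0 ⊢
        linarith
      · simp only [shape, shapeT, shapeX]
        ring
      · have := hreg p hp
        simp only [shape, shapeT, shapeX, Regular] at this ⊢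
        generalize |p.2| ^ (2 - 1 / a) = X
        field_simp
        ring
      · rintro x y ⟨h1, h2, h3⟩
        constructor <;> linarith
    | g27 =>
      simp only [shape, Regular] at hsh hrg
      refine two _ _ _ _ _ _ _ _ _ _ _ _ ?_ (fun p hp => ?_) (fun p hp => ?_) ?_
      · exact div_ne_zero (mul_ne_zero (by norm_num) hsh) hrg
      · simp only [shape, shapeT, shapeX]
        ring
      · have := hreg p hp
        simp only [shape, shapeT, shapeX, Regular] at this ⊢
        generalize |p.2 - p.1 ^ 2 / 2| ^ (3 / 2 : ℝ) = X
        -- Eliminating x in favour of y = x - t²/2 leaves a rational identity.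
        have h2 : p.2 = (p.2 - p.1 ^ 2 / 2) + p.1 ^ 2 / 2 := by ring
        generalize p.2 - p.1 ^ 2 / 2 = y at this h2 ⊢
        rw [h2]
        field_simp
        ring
      · rintro x y ⟨h1, h2, h3⟩
        constructor <;> linarith
    | g31 =>
      refine three _ _ _ _ (fun p hp => rfl) (by simp [shapeT]) (by simp) fun p hp => ?_
      simp only [shape, shapeT]
      ring
    | g32 a =>
      simp only [shape, Regular, Admissible] at hsh hrg hr
      refine three _ _ _ _ (fun p hp => rfl) ?_ (by simp) fun p hp => ?_
      · exact div_ne_zero (mul_ne_zero (fun h0 => hr (by linarith)) hsh) hrg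
      · have := hreg p hp
        simp only [shape, shapeT, Regular] at this ⊢
        field_simp
        ring
    | g33 a =>
      simp only [Admissible] at hr
      refine three _ _ _ _ (fun p hp => rfl) ?_ (by simp) fun p hp => ?_
      · exact mul_ne_zero (div_ne_zero (mul_ne_zero two_ne_zero hr) (hden _)) (Real.exp_ne_zero _)
      · have := hden p
        simp only [shape, shapeT]
        field_simp
        ring
    | g5 =>
      have h0 : ∀ p ∈ Ω, f p = C := fun p hp => by simpa [shape] using h p hp
      refine symAlg_eq_of_const hf h0

end ConstRow

/-! ### The families with an arbitrary function -/

theorem hasFDerivAt_lin2_div {F K : ℝ × ℝ → ℝ} {x y x' y' : ℝ} {p : ℝ × ℝ}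
    (hF : HasFDerivAt F (lin2 x y) p) (hK : HasFDerivAt K (lin2 x' y') p) (h : K p ≠ 0) :
    HasFDerivAt (fun q => F q / K q)
      (lin2 (x / K p - F p * x' / K p ^ 2) (y / K p - F p * y' / K p ^ 2)) p :=
  (hasFDerivAt_div hF hK h).congr_fderiv (by ext <;> simp <;> ring)

theorem hasDerivAt_exp_arctan (a t : ℝ) : HasDerivAt (fun s => Real.exp (a * Real.arctan s))
    (a / (t ^ 2 + 1) * Real.exp (a * Real.arctan t)) t := by
  have h := ((Real.hasDerivAt_arctan t).const_mul a).exp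
  convert h using 1
  rw [add_comm (1 : ℝ)]
  ring

theorem hasDerivAt_exp_arctan_div_sqrt (a t : ℝ) :
    HasDerivAt (fun s => Real.exp (-a * Real.arctan s) / Real.sqrt (s ^ 2 + 1))
      (-(a + t) / (t ^ 2 + 1) * (Real.exp (-a * Real.arctan t) / Real.sqrt (t ^ 2 + 1))) t := by
  have hpos : 0 < t ^ 2 + 1 := by positivity
  have h1 : HasDerivAt (fun s : ℝ => s ^ 2 + 1) (2 * t) t := by
    simpa using (hasDerivAt_pow 2 t).add_const 1
  have h2 := (hasDerivAt_exp_arctan (-a) t).div (h1.sqrt hpos.ne') (Real.sqrt_pos.2 hpos).ne'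
  refine h2.congr_deriv ?_
  have hs := Real.sq_sqrt hpos.le
  have hs0 := (Real.sqrt_pos.2 hpos).ne'
  rw [hs]
  field_simp
  rw [hs]
  ring

namespace FunRow

/-- The partial derivatives of `omega` and `coeff`. -/
def omegaT : FunRow → ℝ × ℝ → ℝ
  | g11 => fun _ => 1
  | g12 => fun _ => 0
  | g13 => fun p => -p.1
  | g14 => fun p => -(Real.exp (-p.1) * p.2)
  | g15 => fun p => -(1 / p.1)
  | g16 a => fun p => -(a / p.1) * (|p.1| ^ (-a) * p.2)
  | g17 => fun p => -(p.2 / p.1 ^ 2) - 1 / p.1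
  | g18 a => fun p => -(a + p.1) / (p.1 ^ 2 + 1)
      * (Real.exp (-a * Real.arctan p.1) / Real.sqrt (p.1 ^ 2 + 1) * p.2)
  | g21 => fun _ => 1

def omegaX : FunRow → ℝ × ℝ → ℝ
  | g11 => fun _ => 0
  | g12 => fun _ => 1
  | g13 => fun _ => 1
  | g14 => fun p => Real.exp (-p.1)
  | g15 => fun _ => 1
  | g16 a => fun p => |p.1| ^ (-a)
  | g17 => fun p => 1 / p.1
  | g18 a => fun p => Real.exp (-a * Real.arctan p.1) / Real.sqrt (p.1 ^ 2 + 1)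
  | g21 => fun _ => 0

def coeffT : FunRow → ℝ × ℝ → ℝ
  | g14 => fun p => 2 * Real.exp (2 * p.1)
  | g15 => fun p => -(1 / p.1 ^ 2)
  | g16 a => fun p => (2 * a - 1) / p.1 * (|p.1| ^ (2 * a) / p.1)
  | g17 => fun _ => 1
  | g18 a => fun p => 2 * a / (p.1 ^ 2 + 1) * Real.exp (2 * a * Real.arctan p.1)
  | _ => fun _ => 0

def coeffX : FunRow → ℝ × ℝ → ℝ
  | g11 => fun p => 2 * p.2
  | _ => fun _ => 0

/-- A section of `omega` through `p`. -/
def sec : FunRow → ℝ × ℝ → ℝ → ℝ × ℝ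
  | g11 => fun p w => (w, p.2)
  | g21 => fun p w => (w, p.2)
  | r => fun p w => (p.1, p.2 + (w - r.omega p) / r.omegaX p)

/-- The condition for the differentiability of `omega` and `coeff`. -/
def Regular : FunRow → ℝ × ℝ → Prop
  | g11 => fun p => p.2 ≠ 0
  | g15 => fun p => p.1 ≠ 0
  | g16 _ => fun p => p.1 ≠ 0
  | g17 => fun p => p.1 ≠ 0
  | _ => fun _ => True

theorem regular_of_ne {r : FunRow} {p : ℝ × ℝ} (h : r.coeff p ≠ 0) : r.Regular p := by
  cases r with
  | g11 | g15 | g16 | g17 => exact fun h0 => h (by simp [coeff, h0])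
  | _ => trivial

theorem hasFDerivAt_omega {r : FunRow} {p : ℝ × ℝ} (hp : r.Regular p) :
    HasFDerivAt r.omega (lin2 (r.omegaT p) (r.omegaX p)) p := by
  have hs := hasFDerivAt_snd_comp (hasDerivAt_id' p.2)
  have ht := hasFDerivAt_fst_comp (hasDerivAt_id' p.1)
  cases r with
  | g11 => exact ht
  | g12 => exact hs
  | g13 => exact hasFDerivAt_parabola p
  | g14 =>
    exact lin2_congr (hasFDerivAt_lin2_mul (hasFDerivAt_fst_comp (hasDerivAt_neg' p.1).exp) hs)
      (by simp [omegaT]) (by simp [omegaX])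
  | g15 =>
    have : omega g15 = fun p => p.2 - Real.log p.1 := by
      funext p
      simp [omega]
    rw [this]
    exact lin2_congr (hasFDerivAt_lin2_sub hs (hasFDerivAt_fst_comp (Real.hasDerivAt_log hp)))
      (by simp [omegaT]) (by simp [omegaX])
  | g16 a =>
    simp only [Regular] at hp
    refine lin2_congr (hasFDerivAt_lin2_mul
      (hasFDerivAt_fst_comp (hasDerivAt_abs_rpow_of_ne hp (-a))) hs) ?_ ?_
    · simp only [omegaT]
      ring
    · simp [omegaX]
  | g17 =>
    have : omega g17 = fun p => p.2 / p.1 - Real.log p.1 := by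
      funext p
      simp [omega]
    rw [this]
    simp only [Regular] at hp
    refine lin2_congr (hasFDerivAt_lin2_sub (hasFDerivAt_lin2_div hs ht hp)
      (hasFDerivAt_fst_comp (Real.hasDerivAt_log hp))) ?_ ?_
    · simp [omegaT]
    · simp [omegaX]
  | g18 a =>
    refine lin2_congr (hasFDerivAt_lin2_mul
      (hasFDerivAt_fst_comp (hasDerivAt_exp_arctan_div_sqrt a p.1)) hs) ?_ ?_
    · simp only [omegaT]
      ring
    · simp [omegaX]
  | g21 => exact ht

theorem hasFDerivAt_coeff {r : FunRow} {p : ℝ × ℝ} (hp : r.Regular p) :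
    HasFDerivAt r.coeff (lin2 (r.coeffT p) (r.coeffX p)) p := by
  have hs := hasFDerivAt_snd_comp (hasDerivAt_id' p.2)
  have ht := hasFDerivAt_fst_comp (hasDerivAt_id' p.1)
  have hc : ∀ c : ℝ, HasFDerivAt (fun _ : ℝ × ℝ => c) (lin2 0 0) p := fun c =>
    (hasFDerivAt_const c p).congr_fderiv (by ext <;> simp)
  cases r with
  | g11 => exact hasFDerivAt_snd_comp (by simpa using hasDerivAt_pow 2 p.2)
  | g12 | g13 | g21 => exact hc 1
  | g14 =>
    refine lin2_congr (hasFDerivAt_fst_comp ((hasDerivAt_id' p.1).const_mul 2).exp) ?_ rfl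
    simp only [coeffT]
    ring
  | g15 =>
    refine lin2_congr (hasFDerivAt_lin2_div (hc 1) ht hp) ?_ ?_
    · simp [coeffT]
    · simp [coeffX]
  | g16 a =>
    simp only [Regular] at hp
    refine lin2_congr (hasFDerivAt_lin2_div
      (hasFDerivAt_fst_comp (hasDerivAt_abs_rpow_of_ne hp (2 * a))) ht hp) ?_ ?_
    · simp only [coeffT]
      field_simp
    · simp [coeffX]
  | g17 => exact ht
  | g18 a => exact hasFDerivAt_fst_comp (hasDerivAt_exp_arctan (2 * a) p.1)

theorem omegaX_ne {r : FunRow} (h1 : r ≠ g11) (h2 : r ≠ g21) {p : ℝ × ℝ} (hp : r.Regular p) :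
    r.omegaX p ≠ 0 := by
  cases r with
  | g11 => exact (h1 rfl).elim
  | g21 => exact (h2 rfl).elim
  | g12 | g13 | g15 => exact one_ne_zero
  | g14 => exact Real.exp_ne_zero _
  | g16 a => exact (Real.rpow_pos_of_pos (abs_pos.2 hp) _).ne'
  | g17 => exact one_div_ne_zero hp
  | g18 a => exact div_ne_zero (Real.exp_ne_zero _) (Real.sqrt_pos.2 (by positivity)).ne'

theorem omega_sec {r : FunRow} {p : ℝ × ℝ} (hp : r.Regular p) (w : ℝ) :
    r.omega (r.sec p w) = w := by
  by_cases h : r = g11 ∨ r = g21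
  · rcases h with rfl | rfl <;> rfl
  push Not at h
  have hne := omegaX_ne h.1 h.2 hp
  have hm := mul_div_cancel₀ (w - r.omega p) hne
  cases r with
  | g11 => exact (h.1 rfl).elim
  | g21 => exact (h.2 rfl).elim
  | _ =>
    simp only [sec, omega, omegaX] at hm ⊢
    linear_combination hm

theorem sec_omega (r : FunRow) (p : ℝ × ℝ) : r.sec p (r.omega p) = p := by
  cases r <;> simp [sec, omega]

theorem continuous_sec (r : FunRow) (p : ℝ × ℝ) : Continuous (r.sec p) := by
  cases r <;> simp only [sec] <;> fun_prop

/-- The section of ω through p shows that the image contains a neighbourhood of ω(p), so that `deriv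
h` there is the true derivative of h. -/
theorem image_omega_mem_nhds {r : FunRow} {Ω : Set (ℝ × ℝ)} (hΩ : IsOpen Ω) {p : ℝ × ℝ}
    (hp : p ∈ Ω) (hr : r.Regular p) : r.omega '' Ω ∈ nhds (r.omega p) := by
  have h : Ω ∈ nhds (r.sec p (r.omega p)) := by
    rw [sec_omega]
    exact hΩ.mem_nhds hp
  filter_upwards [(r.continuous_sec p).continuousAt h] with w hw
  exact ⟨_, hw, omega_sec hr w⟩

section form

variable {r : FunRow} {Ω : Set (ℝ × ℝ)} {f : ℝ × ℝ → ℝ} {h : ℝ → ℝ}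

theorem HasForm.ne (hf : IsGBE Ω f) (hr : r.HasForm Ω f h) {p : ℝ × ℝ} (hp : p ∈ Ω) :
    r.coeff p ≠ 0 ∧ h (r.omega p) ≠ 0 := by
  have := hf.ne_zero p hp
  rw [hr.2 p hp] at this
  exact mul_ne_zero_iff.1 this

theorem HasForm.regular (hf : IsGBE Ω f) (hr : r.HasForm Ω f h) {p : ℝ × ℝ} (hp : p ∈ Ω) :
    r.Regular p := regular_of_ne (hr.ne hf hp).1

theorem HasForm.hasDerivAt (hf : IsGBE Ω f) (hr : r.HasForm Ω f h) {p : ℝ × ℝ} (hp : p ∈ Ω) :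
    HasDerivAt h (deriv h (r.omega p)) (r.omega p) :=
  ((hr.1.contDiffAt (image_omega_mem_nhds hf.isOpen hp (hr.regular hf hp))).differentiableAt
    (by simp)).hasDerivAt

theorem HasForm.fderiv (hf : IsGBE Ω f) (hr : r.HasForm Ω f h) {p : ℝ × ℝ} (hp : p ∈ Ω) :
    fderiv ℝ f p (1, 0)
        = r.coeffT p * h (r.omega p) + r.coeff p * (deriv h (r.omega p) * r.omegaT p) ∧
      fderiv ℝ f p (0, 1)
        = r.coeffX p * h (r.omega p) + r.coeff p * (deriv h (r.omega p) * r.omegaX p) := by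
  have hreg := hr.regular hf hp
  have he : f =ᶠ[nhds p] fun q => r.coeff q * h (r.omega q) := by
    filter_upwards [hf.isOpen.mem_nhds hp] with q hq using hr.2 q hq
  have h1 := hasFDerivAt_lin2_mul (hasFDerivAt_coeff hreg)
    (hasFDerivAt_comp_lin2 (hr.hasDerivAt hf hp) (hasFDerivAt_omega hreg))
  rw [he.fderiv_eq, h1.fderiv]
  simp

/-- The chain rule turns the classifying condition into a linear first-order equation for h along Ω;
all constraints of the list arise from it. -/
theorem HasForm.mem_iff (hf : IsGBE Ω f) (hr : r.HasForm Ω f h) {a b c d e k : ℝ} :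
    gv a b c d e k ∈ symAlg Ω f ↔ ∀ p ∈ Ω,
      ((a + c * p.1 + k * p.1 ^ 2) * r.coeffT p
          + (b + d * p.2 + e * p.1 + k * p.1 * p.2) * r.coeffX p - (2 * d - c) * r.coeff p)
          * h (r.omega p)
        + r.coeff p * ((a + c * p.1 + k * p.1 ^ 2) * r.omegaT p
          + (b + d * p.2 + e * p.1 + k * p.1 * p.2) * r.omegaX p) * deriv h (r.omega p) = 0 := by
  rw [mem_symAlg]
  refine forall₂_congr fun p hp => ?_
  obtain ⟨e1, e2⟩ := hr.fderiv hf hp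
  rw [cls, e1, e2, hr.2 p hp]
  constructor <;> intro h <;> linear_combination h

/-- The derivative of `h` does not vanish identically unless the nilradical consists of
symmetries. -/
theorem HasForm.exists_deriv_ne (hf : IsGBE Ω f) (hr : r.HasForm Ω f h)
    (hX : ∀ p, r.coeffX p = 0) (hn : gv 0 1 0 0 0 0 ∉ symAlg Ω f) :
    ∃ w ∈ r.omega '' Ω, deriv h w ≠ 0 := by
  by_contra hc
  push Not at hc
  refine hn ((hr.mem_iff hf).2 fun p hp => ?_)
  rw [hc _ ⟨p, hp, rfl⟩, hX]
  ring

theorem HasForm.exists_fx_ne (hf : IsGBE Ω f) (hr : r.HasForm Ω f h) (h1 : r ≠ g11)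
    (h2 : r ≠ g21) (hX : ∀ p, r.coeffX p = 0) (hd : ∃ w ∈ r.omega '' Ω, deriv h w ≠ 0) :
    ∃ p ∈ Ω, _root_.fderiv ℝ f p (0, 1) ≠ 0 := by
  obtain ⟨_, ⟨p, hp, rfl⟩, hd⟩ := hd
  refine ⟨p, hp, ?_⟩
  rw [(hr.fderiv hf hp).2, hX, zero_mul, zero_add]
  exact mul_ne_zero (hr.ne hf hp).1 (mul_ne_zero hd (omegaX_ne h1 h2 (hr.regular hf hp)))

end form
end FunRow

/-- A criterion for the maximal algebra to be one-dimensional. -/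
theorem symAlg_eq_single {Ω : Set (ℝ × ℝ)} {f : ℝ × ℝ → ℝ} (hf : IsGBE Ω f)
    (hx : ∃ p ∈ Ω, fderiv ℝ f p (0, 1) ≠ 0) {a b c d e k : ℝ}
    (hτ : a ≠ 0 ∨ c ≠ 0 ∨ k ≠ 0) (h0 : gv a b c d e k ∈ symAlg Ω f)
    (hD : ∀ b₀ e₀, gv 0 b₀ 0 1 e₀ 0 ∈ symAlg Ω f → b = b₀ * d - a * e₀ →
      e = e₀ * d + b₀ * k - c * e₀ → False)
    (hU : ∀ a' b' c' d' e' k', gv a' b' c' d' e' k' ∈ symAlg Ω f →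
      BracketUnit a b c d e k a' b' c' d' e' k' → False)
    (hV : ∀ l a' b' c' d' e' k', l ≠ 0 → gv a' b' c' d' e' k' ∈ symAlg Ω f →
      (a' ≠ 0 ∨ c' ≠ 0 ∨ k' ≠ 0) → a * c' - c * a' = l * a' →
      a * e' + b * d' - a' * e - b' * d = l * b' → 2 * (a * k' - k * a') = l * c' →
      a * k' - a' * k = l * d' →
      c * e' + e * d' + b * k' - c' * e - e' * d - b' * k = l * e' → c * k' - k * c' = l * k' →
      False) :
    symAlg Ω f = Submodule.span ℝ {gv a b c d e k} := by
  obtain ⟨p₀, hp₀, hx⟩ := hx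
  have hn : gv 0 1 0 0 0 0 ∉ symAlg Ω f := fun hm => by simpa using (nilrad_trivial hf hp₀ hx hm).1
  cases symStructure hf with
  | bot h =>
    rw [h, Submodule.mem_bot, ← gv_zero, gv_inj] at h0
    tauto
  | full hc h => exact (hn (h ▸ mem_levi_sup_nilrad.2 (by norm_num))).elim
  | nil h => exact (hn (h ▸ mem_nilrad.2 ⟨rfl, rfl, rfl, rfl⟩)).elim
  | nilExt a c d k hτ hw h => exact (hn (h ▸ Submodule.subset_span (by simp))).elim
  | dil b e h =>
    rw [h] at h0
    obtain ⟨l, h1⟩ := Submodule.mem_span_singleton.1 h0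
    rw [smul_gv, gv_inj] at h1
    obtain ⟨h1, -, h2, -, -, h3⟩ := h1
    simp only [mul_zero] at h1 h2 h3
    subst h1 h2 h3
    simp at hτ
  | dilExt b₀ e₀ a b c e k hτ hb he h =>
    have hm : gv 0 b₀ 0 1 e₀ 0 ∈ symAlg Ω f := h ▸ Submodule.subset_span (by simp)
    obtain ⟨h1, h2⟩ := components_of_dilation hf hp₀ hx hm h0
    exact (hD _ _ hm h1 h2).elim
  | single a₁ b₁ c₁ d₁ e₁ k₁ hτ₁ h =>
    rw [h] at h0 ⊢
    obtain ⟨l, h1⟩ := Submodule.mem_span_singleton.1 h0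
    have hl : l ≠ 0 := by
      rintro rfl
      rw [zero_smul, ← gv_zero, gv_inj] at h1
      obtain ⟨h1, -, h2, -, -, h3⟩ := h1
      subst h1 h2 h3
      simp at hτ
    rw [← h1, Submodule.span_singleton_smul_eq (IsUnit.mk0 l hl)]
  | pair a₁ b₁ c₁ d₁ e₁ k₁ a₂ b₂ c₂ d₂ e₂ k₂ hτ₁ hb hw h =>
    have h1 : gv a₁ b₁ c₁ d₁ e₁ k₁ ∈ symAlg Ω f := h ▸ Submodule.subset_span (by simp)
    have h2 : gv a₂ b₂ c₂ d₂ e₂ k₂ ∈ symAlg Ω f := h ▸ Submodule.subset_span (by simp)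
    rw [h] at h0
    obtain ⟨x, y, h3⟩ := Submodule.mem_span_pair.1 h0
    rw [smul_gv, smul_gv, gv_add, gv_inj] at h3
    obtain ⟨rfl, rfl, rfl, rfl, rfl, rfl⟩ := h3
    obtain ⟨g1, g2, g3, g4, g5, g6⟩ := hb
    -- The given field is xQ + yR with [Q, R] = Q. For y = 0 it satisfies [·, R] = itself; for y ≠ 0
    -- it has Q as an eigenvector with eigenvalue -y. These are the possibilities excluded by `hU`
    -- and `hV`.
    by_cases hy : y = 0
    · subst hy
      refine (hU _ _ _ _ _ _ h2 ⟨?_, ?_, ?_, ?_, ?_, ?_⟩).elim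
      · linear_combination x * g1
      · linear_combination x * g2
      · linear_combination x * g3
      · linear_combination x * g4
      · linear_combination x * g5
      · linear_combination x * g6
    · refine (hV (-y) _ _ _ _ _ _ (neg_ne_zero.2 hy) h1 hτ₁ ?_ ?_ ?_ ?_ ?_ ?_).elim
      · linear_combination -y * g1
      · linear_combination -y * g2
      · linear_combination -y * g3
      · linear_combination -y * g4
      · linear_combination -y * g5
      · linear_combination -y * g6

theorem coords_of_mem_span {a b c d e k a' b' c' d' e' k' : ℝ}
    (h : gv a' b' c' d' e' k' ∈ Submodule.span ℝ {gv a b c d e k}) :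
    ∃ l, a' = l * a ∧ b' = l * b ∧ c' = l * c ∧ d' = l * d ∧ e' = l * e ∧ k' = l * k := by
  obtain ⟨l, h⟩ := Submodule.mem_span_singleton.1 h
  rw [smul_gv, gv_inj] at h
  obtain ⟨h1, h2, h3, h4, h5, h6⟩ := h
  exact ⟨l, h1.symm, h2.symm, h3.symm, h4.symm, h5.symm, h6.symm⟩

namespace FunRow

/-! ### Maximality for the families with an arbitrary function -/

section maximal

variable {Ω : Set (ℝ × ℝ)} {f : ℝ × ℝ → ℝ} {h : ℝ → ℝ}

/-- D^x is always a symmetry, and modulo it the others have weight zero and no nilradical part. For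
such a field the condition is (τh)' = 0. -/
theorem symAlg_eq_iff_g11 (hf : IsGBE Ω f) (hr : g11.HasForm Ω f h) :
    symAlg Ω f = g11.alg ↔ g11.Constraint (g11.omega '' Ω) h := by
  have hder : ∀ p ∈ Ω, ∀ α β γ : ℝ, deriv (fun z => (α * z ^ 2 + β * z + γ) * h z) (omega g11 p)
      = (2 * α * p.1 + β) * h p.1 + (α * p.1 ^ 2 + β * p.1 + γ) * deriv h p.1 := by
    intro p hp α β γ
    have h1 : HasDerivAt (fun z : ℝ => α * z ^ 2 + β * z + γ) (2 * α * p.1 + β) p.1 := by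
      refine ((((hasDerivAt_pow 2 p.1).const_mul α).add
        ((hasDerivAt_id' p.1).const_mul β)).add_const γ).congr_deriv ?_
      simp
      ring
    exact (h1.mul (hr.hasDerivAt hf hp)).deriv
  have hmem : ∀ a c k, gv a 0 c (c / 2) 0 k ∈ symAlg Ω f ↔
      ∀ p ∈ Ω, (2 * k * p.1 + c) * h p.1 + (k * p.1 ^ 2 + c * p.1 + a) * deriv h p.1 = 0 := by
    intro a c k
    rw [hr.mem_iff hf]
    refine forall₂_congr fun p hp => ?_
    have hx : p.2 ≠ 0 := hr.regular hf hp
    simp only [coeff, coeffT, coeffX, omega, omegaT, omegaX]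
    constructor <;> intro h
    · refine mul_left_cancel₀ (pow_ne_zero 2 hx) ?_
      linear_combination h
    · linear_combination p.2 ^ 2 * h
  have hDx : gv 0 0 0 1 0 0 ∈ symAlg Ω f := by
    rw [hr.mem_iff hf]
    intro p hp
    simp only [coeff, coeffT, coeffX, omegaT, omegaX]
    ring
  rw [alg_eq]
  constructor
  · intro hS α β γ hne
    by_contra hc
    push Not at hc
    have : gv γ 0 β (β / 2) 0 α ∈ symAlg Ω f := (hmem _ _ _).2 fun p hp => by
      rw [← hder p hp]
      exact hc _ ⟨p, hp, rfl⟩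
    rw [hS] at this
    obtain ⟨l, h1, -, h2, -, -, h3⟩ := coords_of_mem_span this
    simp only [mul_zero] at h1 h2 h3
    subst h1 h2 h3
    exact hne rfl
  · intro hc
    refine le_antisymm (fun Q hQ => ?_) ?_
    · obtain ⟨a, b, c, d, e, k, rfl⟩ := mem_algG.1 (symAlg_le hQ)
      obtain ⟨p₀, hp₀⟩ := hf.isConnected.nonempty
      have hx : fderiv ℝ f p₀ (0, 1) ≠ 0 := by
        rw [(hr.fderiv hf hp₀).2]
        have hx : p₀.2 ≠ 0 := hr.regular hf hp₀
        simpa [coeffX, omegaX, hx] using (hr.ne hf hp₀).2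
      obtain ⟨h1, h2⟩ := components_of_dilation hf hp₀ hx hDx hQ
      obtain rfl : b = 0 := by linarith
      obtain rfl : e = 0 := by linarith
      have h3 : gv a 0 c (c / 2) 0 k ∈ symAlg Ω f :=
        mem_of_eq (lin_mem hQ hDx 1 (c / 2 - d)) (by ring) (by ring) (by ring) (by ring) (by ring)
          (by ring)
      rw [hmem] at h3
      have h4 : (k, c, a) = 0 := by
        by_contra hne
        obtain ⟨_, ⟨p, hp, rfl⟩, hw⟩ := hc k c a hne
        exact hw ((hder p hp _ _ _).trans (h3 p hp))
      simp only [Prod.mk_eq_zero] at h4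
      obtain ⟨rfl, rfl, rfl⟩ := h4
      rw [Submodule.mem_span_singleton]
      exact ⟨d, by simp [smul_gv]⟩
    · rw [Submodule.span_le]
      rintro _ rfl
      exact hDx

theorem symAlg_eq_iff_g21 (hf : IsGBE Ω f) (hr : g21.HasForm Ω f h) :
    symAlg Ω f = g21.alg ↔ g21.Constraint (g21.omega '' Ω) h := by
  have hmem : ∀ a b c d e k, gv a b c d e k ∈ symAlg Ω f ↔
      ∀ p ∈ Ω, (k * p.1 ^ 2 + c * p.1 + a) * deriv h p.1 = (2 * d - c) * h p.1 := by
    intro a b c d e k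
    rw [hr.mem_iff hf]
    refine forall₂_congr fun p hp => ?_
    simp only [coeff, coeffT, coeffX, omega, omegaT, omegaX]
    constructor <;> intro h <;> linear_combination h
  have hn : g21.alg = nilrad := rfl
  rw [hn]
  constructor
  · intro hS α β γ δ hne
    by_contra hc
    push Not at hc
    have : gv γ 0 β ((δ + β) / 2) 0 α ∈ symAlg Ω f := (hmem _ _ _ _ _ _).2 fun p hp => by
      have := hc _ ⟨p, hp, rfl⟩
      simp only [omega] at this
      linear_combination this
    rw [hS] at this
    obtain ⟨rfl, rfl, h3, rfl⟩ := mem_nilrad.1 this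
    obtain rfl : δ = 0 := by linarith
    exact hne rfl
  · intro hc
    refine le_antisymm (fun Q hQ => ?_) (fun Q hQ => ?_)
    · obtain ⟨a, b, c, d, e, k, rfl⟩ := mem_algG.1 (symAlg_le hQ)
      rw [hmem] at hQ
      have h4 : (k, c, a, 2 * d - c) = 0 := by
        by_contra hne
        obtain ⟨_, ⟨p, hp, rfl⟩, hw⟩ := hc k c a (2 * d - c) hne
        exact hw (hQ p hp)
      simp only [Prod.mk_eq_zero] at h4
      obtain ⟨rfl, rfl, rfl, h4⟩ := h4
      exact mem_nilrad.2 ⟨rfl, rfl, by linarith, rfl⟩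
    · obtain ⟨a, b, c, d, e, k, rfl⟩ := mem_algG.1 (nilrad_le hQ)
      obtain ⟨rfl, rfl, rfl, rfl⟩ := mem_nilrad.1 hQ
      exact (hmem _ _ _ _ _ _).2 fun p hp => by ring

/-- Possible extensions are by a dilation commuting with P^t or by R with [P^t, R] = P^t. In both
cases R modulo P^t is a combination of P^x, D^t, D^x, and its condition is (dx + b)h' = (2d - c)h.
-/
theorem symAlg_eq_iff_g12 (hf : IsGBE Ω f) (hr : g12.HasForm Ω f h) :
    symAlg Ω f = g12.alg ↔ g12.Constraint (g12.omega '' Ω) h := by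
  have hmem : ∀ a b c d, gv a b c d 0 0 ∈ symAlg Ω f ↔
      ∀ p ∈ Ω, (d * p.2 + b) * deriv h p.2 = (2 * d - c) * h p.2 := by
    intro a b c d
    rw [hr.mem_iff hf]
    refine forall₂_congr fun p hp => ?_
    simp only [coeff, coeffT, coeffX, omega, omegaT, omegaX]
    constructor <;> intro h <;> linear_combination h
  have h0 : gv 1 0 0 0 0 0 ∈ symAlg Ω f := (hmem _ _ _ _).2 fun p hp => by ring
  rw [alg_eq]
  constructor
  · intro hS α β γ hne
    by_contra hc
    push Not at hc
    have : gv 0 β (2 * α - γ) α 0 0 ∈ symAlg Ω f := (hmem _ _ _ _).2 fun p hp => by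
      have := hc _ ⟨p, hp, rfl⟩
      simp only [omega] at this
      linear_combination this
    rw [hS] at this
    obtain ⟨l, -, h2, h3, h4, -, -⟩ := coords_of_mem_span this
    simp only [mul_zero] at h2 h3 h4
    subst h2 h4
    obtain rfl : γ = 0 := by linarith
    exact hne rfl
  · intro hc
    have hx := hr.exists_fx_ne hf (by simp) (by simp) (fun _ => rfl) (by
      obtain ⟨w, hw, h1⟩ := hc 0 1 0 (by simp)
      exact ⟨w, hw, by simpa using h1⟩)
    refine symAlg_eq_single hf hx (by simp) h0 ?_ ?_ ?_
    · intro b₀ e₀ hm h1 h2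
      obtain rfl : e₀ = 0 := by linarith
      obtain ⟨_, ⟨p, hp, rfl⟩, hw⟩ := hc 1 b₀ 2 (by simp)
      have := (hmem _ _ _ _).1 hm p hp
      simp only [omega] at hw
      exact hw (by linear_combination this)
    · rintro a' b' c' d' e' k' hm ⟨h1, h2, h3, h4, h5, h6⟩
      obtain rfl : c' = 1 := by linarith
      obtain rfl : k' = 0 := by linarith
      obtain rfl : e' = 0 := by linarith
      obtain ⟨_, ⟨p, hp, rfl⟩, hw⟩ := hc d' b' (2 * d' - 1) (by
        intro h0
        simp only [Prod.mk_eq_zero] at h0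
        obtain ⟨rfl, -, h0⟩ := h0
        norm_num at h0)
      exact hw ((hmem _ _ _ _).1 hm p hp)
    -- ad P^t is nilpotent on τ, so it has no nonzero eigenvalue.
    · intro l a' b' c' d' e' k' hl hm hτ h1 h2 h3 h4 h5 h6
      have hk : k' = 0 := mul_left_cancel₀ hl (by linarith)
      have hc' : c' = 0 := mul_left_cancel₀ hl (by rw [← h3, hk]; ring)
      have ha : a' = 0 := mul_left_cancel₀ hl (by rw [← h1, hc']; ring)
      tauto

theorem symAlg_eq_iff_g13 (hf : IsGBE Ω f) (hr : g13.HasForm Ω f h) :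
    symAlg Ω f = g13.alg ↔ g13.Constraint (g13.omega '' Ω) h := by
  have hmem : ∀ a b c d e k, gv a b c d e k ∈ symAlg Ω f ↔
      ∀ p ∈ Ω, (b + d * p.2 + e * p.1 + k * p.1 * p.2 - p.1 * (a + c * p.1 + k * p.1 ^ 2))
        * deriv h (omega g13 p) = (2 * d - c) * h (omega g13 p) := by
    intro a b c d e k
    rw [hr.mem_iff hf]
    refine forall₂_congr fun p hp => ?_
    simp only [coeff, coeffT, coeffX, omegaT, omegaX]
    constructor <;> intro h <;> linear_combination h
  have h0 : gv 1 0 0 0 1 0 ∈ symAlg Ω f := (hmem _ _ _ _ _ _).2 fun p hp => by ring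
  rw [alg_eq]
  constructor
  · intro hS
    refine ⟨hr.exists_deriv_ne hf (fun _ => rfl) ?_, fun β => ?_⟩
    · rw [hS]
      intro hm
      obtain ⟨l, h1, h2, -⟩ := coords_of_mem_span hm
      simp at h2
    · by_contra hc
      push Not at hc
      have : gv 0 (2 * β) 1 2 0 0 ∈ symAlg Ω f := (hmem _ _ _ _ _ _).2 fun p hp => by
        have := hc _ ⟨p, hp, rfl⟩
        have h1 : omega g13 p = p.2 - p.1 ^ 2 / 2 := rfl
        linear_combination this - 2 * deriv h (omega g13 p) * h1
      rw [hS] at this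
      obtain ⟨l, -, -, h3, -, -, -⟩ := coords_of_mem_span this
      simp at h3
  · rintro ⟨hc1, hc2⟩
    have hx := hr.exists_fx_ne hf (by simp) (by simp) (fun _ => rfl) hc1
    refine symAlg_eq_single hf hx (by simp) h0 ?_ ?_ ?_
    · intro b₀ e₀ hm h1 h2
      linarith
    · rintro a' b' c' d' e' k' hm ⟨h1, h2, h3, h4, h5, h6⟩
      obtain rfl : c' = 1 := by linarith
      obtain rfl : k' = 0 := by linarith
      obtain rfl : e' = a' := by linarith
      obtain rfl : d' = 2 := by linarith
      -- The bracket relation forces R = D^t + 2D^x + b'P^x modulo P^t + G, whose condition is 2(ω +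
      -- b'/2)h' = 3h.
      obtain ⟨_, ⟨p, hp, rfl⟩, hw⟩ := hc2 (b' / 2)
      have := (hmem _ _ _ _ _ _).1 hm p hp
      have h1 : omega g13 p = p.2 - p.1 ^ 2 / 2 := rfl
      exact hw (by linear_combination this + 2 * deriv h (omega g13 p) * h1)
    · intro l a' b' c' d' e' k' hl hm hτ h1 h2 h3 h4 h5 h6
      have hk : k' = 0 := mul_left_cancel₀ hl (by linarith)
      have hc' : c' = 0 := mul_left_cancel₀ hl (by rw [← h3, hk]; ring)
      have ha : a' = 0 := mul_left_cancel₀ hl (by rw [← h1, hc']; ring)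
      tauto

/-- The only possible extension is by D^x: a bracket has weight zero while P^t + D^x has weight two,
and ad of this field has no nonzero eigenvalue on τ. -/
theorem symAlg_eq_iff_g14 (hf : IsGBE Ω f) (hr : g14.HasForm Ω f h) :
    symAlg Ω f = g14.alg ↔ g14.Constraint (g14.omega '' Ω) h := by
  have hom : ∀ p, omega g14 p = Real.exp (-p.1) * p.2 := fun _ => rfl
  have hD : gv 0 0 0 1 0 0 ∈ symAlg Ω f ↔
      ∀ p ∈ Ω, omega g14 p * deriv h (omega g14 p) = 2 * h (omega g14 p) := by
    rw [hr.mem_iff hf]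
    refine forall₂_congr fun p hp => ?_
    simp only [coeffT, coeffX, omegaT, omegaX]
    constructor <;> intro h1
    · refine mul_left_cancel₀ (hr.ne hf hp).1 ?_
      linear_combination h1 + coeff g14 p * deriv h (omega g14 p) * hom p
    · linear_combination coeff g14 p * h1 - coeff g14 p * deriv h (omega g14 p) * hom p
  have h0 : gv 1 0 0 1 0 0 ∈ symAlg Ω f := by
    rw [hr.mem_iff hf]
    intro p hp
    simp only [coeff, coeffT, coeffX, omegaT, omegaX]
    ring
  rw [alg_eq]
  constructor
  · intro hS
    refine ⟨hr.exists_deriv_ne hf (fun _ => rfl) ?_, ?_⟩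
    · rw [hS]
      intro hm
      obtain ⟨l, h1, h2, -⟩ := coords_of_mem_span hm
      simp at h2
    · by_contra hc
      push Not at hc
      have := hD.2 fun p hp => hc _ ⟨p, hp, rfl⟩
      rw [hS] at this
      obtain ⟨l, h1, -, -, h4, -⟩ := coords_of_mem_span this
      linarith
  · rintro ⟨hc1, hc2⟩
    have hx := hr.exists_fx_ne hf (by simp) (by simp) (fun _ => rfl) hc1
    refine symAlg_eq_single hf hx (by simp) h0 ?_ ?_ ?_
    · intro b₀ e₀ hm h1 h2
      obtain rfl : e₀ = 0 := by linarith
      obtain rfl : b₀ = 0 := by linarith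
      obtain ⟨_, ⟨p, hp, rfl⟩, hw⟩ := hc2
      exact hw (hD.1 hm p hp)
    · rintro a' b' c' d' e' k' hm ⟨h1, h2, h3, h4, h5, h6⟩
      linarith
    · intro l a' b' c' d' e' k' hl hm hτ h1 h2 h3 h4 h5 h6
      have hk : k' = 0 := mul_left_cancel₀ hl (by linarith)
      have hc' : c' = 0 := mul_left_cancel₀ hl (by rw [← h3, hk]; ring)
      have ha : a' = 0 := mul_left_cancel₀ hl (by rw [← h1, hc']; ring)
      tauto

/-- Only D^x can be added. The linear system for a commuting dilation has determinant ±(a² + 1), and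
ad(P^t + Π) has only the real eigenvalue 0 on τ. -/
theorem symAlg_eq_iff_g18 {a : ℝ} (hf : IsGBE Ω f) (hr : (g18 a).HasForm Ω f h) :
    symAlg Ω f = (g18 a).alg ↔ (g18 a).Constraint ((g18 a).omega '' Ω) h := by
  have hom : ∀ p, omega (g18 a) p
    = Real.exp (-a * Real.arctan p.1) / Real.sqrt (p.1 ^ 2 + 1) * p.2 := fun _ => rfl
  have hD : gv 0 0 0 1 0 0 ∈ symAlg Ω f ↔
      ∀ p ∈ Ω, omega (g18 a) p * deriv h (omega (g18 a) p) = 2 * h (omega (g18 a) p) := by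
    rw [hr.mem_iff hf]
    refine forall₂_congr fun p hp => ?_
    simp only [coeffT, coeffX, omegaT, omegaX]
    constructor <;> intro h1
    · refine mul_left_cancel₀ (hr.ne hf hp).1 ?_
      linear_combination h1 + coeff (g18 a) p * deriv h (omega (g18 a) p) * hom p
    · linear_combination coeff (g18 a) p * h1 - coeff (g18 a) p * deriv h (omega (g18 a) p) * hom p
  have h0 : gv 1 0 0 a 0 1 ∈ symAlg Ω f := by
    rw [hr.mem_iff hf]
    intro p hp
    have hden : p.1 ^ 2 + 1 ≠ 0 := by positivity
    simp only [coeff, coeffT, coeffX, omegaT, omegaX]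
    generalize Real.exp (-a * Real.arctan p.1) / Real.sqrt (p.1 ^ 2 + 1) = X
    field_simp
    ring
  rw [alg_eq]
  constructor
  · intro hS
    refine ⟨hr.exists_deriv_ne hf (fun _ => rfl) ?_, ?_⟩
    · rw [hS]
      intro hm
      obtain ⟨l, h1, h2, -⟩ := coords_of_mem_span hm
      simp at h2
    · by_contra hc
      push Not at hc
      have := hD.2 fun p hp => hc _ ⟨p, hp, rfl⟩
      rw [hS] at this
      obtain ⟨l, h1, -, -, h4, -⟩ := coords_of_mem_span this
      obtain rfl : l = 0 := by linarith
      linarith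
  · rintro ⟨hc1, hc2⟩
    have hx := hr.exists_fx_ne hf (by simp) (by simp) (fun _ => rfl) hc1
    refine symAlg_eq_single hf hx (by simp) h0 ?_ ?_ ?_
    · intro b₀ e₀ hm h1 h2
      have h3 : b₀ * (a ^ 2 + 1) = 0 := by linear_combination -a * h1 - h2
      obtain rfl : b₀ = 0 := (mul_eq_zero.1 h3).resolve_right (by positivity)
      obtain rfl : e₀ = 0 := by linarith
      obtain ⟨_, ⟨p, hp, rfl⟩, hw⟩ := hc2
      exact hw (hD.1 hm p hp)
    · rintro a' b' c' d' e' k' hm ⟨h1, h2, h3, h4, h5, h6⟩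
      linarith
    · intro l a' b' c' d' e' k' hl hm hτ h1 h2 h3 h4 h5 h6
      obtain rfl : k' = -a' := mul_left_cancel₀ hl (by linarith)
      -- A nonzero eigenvalue of a rotation on the quadratics satisfies l² = -4.
      have h7 : (l ^ 2 + 4) * a' = 0 := by linear_combination -l * h1 - h3
      obtain rfl : a' = 0 := (mul_eq_zero.1 h7).resolve_left (by positivity)
      obtain rfl : c' = 0 := by linarith
      simp at hτ

/-- The discriminant of D^t + P^x is nonzero, so it is not a bracket of the form [Q, R] = Q, and no
dilation commutes with it. The eigenvalues of its ad on τ are ±1 and 0, and only -1, with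
eigenvector P^t, yields an extension. -/
theorem symAlg_eq_iff_g15 (hf : IsGBE Ω f) (hr : g15.HasForm Ω f h) :
    symAlg Ω f = g15.alg ↔ g15.Constraint (g15.omega '' Ω) h := by
  have hD : gv 1 0 0 0 0 0 ∈ symAlg Ω f ↔
      ∀ p ∈ Ω, deriv h (omega g15 p) = -h (omega g15 p) := by
    rw [hr.mem_iff hf]
    refine forall₂_congr fun p hp => ?_
    have ht : p.1 ≠ 0 := hr.regular hf hp
    simp only [coeff, coeffT, coeffX, omegaT, omegaX]
    field_simp
    constructor <;> intro h1 <;> linear_combination -h1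
  have h0 : gv 0 1 1 0 0 0 ∈ symAlg Ω f := by
    rw [hr.mem_iff hf]
    intro p hp
    have ht : p.1 ≠ 0 := hr.regular hf hp
    simp only [coeff, coeffT, coeffX, omegaT, omegaX]
    field_simp
    ring
  rw [alg_eq]
  constructor
  · intro hS
    refine ⟨hr.exists_deriv_ne hf (fun _ => rfl) ?_, ?_⟩
    · rw [hS]
      intro hm
      obtain ⟨l, h1, h2, h3, -⟩ := coords_of_mem_span hm
      linarith
    · by_contra hc
      push Not at hc
      have := hD.2 fun p hp => hc _ ⟨p, hp, rfl⟩
      rw [hS] at this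
      obtain ⟨l, h1, -⟩ := coords_of_mem_span this
      simp at h1
  · rintro ⟨hc1, hc2⟩
    have hx := hr.exists_fx_ne hf (by simp) (by simp) (fun _ => rfl) hc1
    refine symAlg_eq_single hf hx (by simp) h0 ?_ ?_ ?_
    · intro b₀ e₀ hm h1 h2
      linarith
    · rintro a' b' c' d' e' k' hm ⟨h1, h2, h3, h4, h5, h6⟩
      linarith
    · intro l a' b' c' d' e' k' hl hm hτ h1 h2 h3 h4 h5 h6
      obtain rfl : c' = 0 := mul_left_cancel₀ hl (by linarith)
      obtain rfl : d' = 0 := mul_left_cancel₀ hl (by linarith)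
      obtain rfl : b' = 0 := mul_left_cancel₀ hl (by linarith)
      by_cases hk : k' = 0
      · subst hk
        have ha : a' ≠ 0 := by simpa using hτ
        obtain rfl : l = -1 := mul_right_cancel₀ ha (by linarith)
        obtain rfl : e' = 0 := by linarith
        have h7 : gv 1 0 0 0 0 0 ∈ symAlg Ω f := by
          refine mem_of_eq (lin_mem hm hm a'⁻¹ 0) ?_ ?_ ?_ ?_ ?_ ?_ <;> simp [ha]
        obtain ⟨_, ⟨p, hp, rfl⟩, hw⟩ := hc2
        exact hw (hD.1 h7 p hp)
      -- Since [D^t + P^x, Π] = Π + G, where G has the same eigenvalue 1, there is a Jordan block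
      -- and no eigenvector involving Π.
      · obtain rfl : l = 1 := mul_right_cancel₀ hk (by linarith)
        exact hk (by linarith)

/-- The mirror image of `symAlg_eq_iff_g15` under inversion of t: Π now plays the part of P^t, and
P^t sits in the Jordan block. -/
theorem symAlg_eq_iff_g17 (hf : IsGBE Ω f) (hr : g17.HasForm Ω f h) :
    symAlg Ω f = g17.alg ↔ g17.Constraint (g17.omega '' Ω) h := by
  have hD : gv 0 0 0 0 0 1 ∈ symAlg Ω f ↔
      ∀ p ∈ Ω, deriv h (omega g17 p) = h (omega g17 p) := by
    rw [hr.mem_iff hf]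
    refine forall₂_congr fun p hp => ?_
    have ht : p.1 ≠ 0 := hr.regular hf hp
    simp only [coeff, coeffT, coeffX, omegaT, omegaX]
    field_simp
    constructor <;> intro h1
    · refine mul_left_cancel₀ (pow_ne_zero 3 ht) ?_
      linear_combination -h1
    · linear_combination -p.1 ^ 3 * h1
  have h0 : gv 0 0 1 1 1 0 ∈ symAlg Ω f := by
    rw [hr.mem_iff hf]
    intro p hp
    have ht : p.1 ≠ 0 := hr.regular hf hp
    simp only [coeff, coeffT, coeffX, omegaT, omegaX]
    field_simp
    ring
  rw [alg_eq]
  constructor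
  · intro hS
    refine ⟨hr.exists_deriv_ne hf (fun _ => rfl) ?_, ?_⟩
    · rw [hS]
      intro hm
      obtain ⟨l, h1, h2, -⟩ := coords_of_mem_span hm
      simp at h2
    · by_contra hc
      push Not at hc
      have := hD.2 fun p hp => hc _ ⟨p, hp, rfl⟩
      rw [hS] at this
      obtain ⟨l, -, -, -, -, -, h1⟩ := coords_of_mem_span this
      simp at h1
  · rintro ⟨hc1, hc2⟩
    have hx := hr.exists_fx_ne hf (by simp) (by simp) (fun _ => rfl) hc1
    refine symAlg_eq_single hf hx (by simp) h0 ?_ ?_ ?_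
    · intro b₀ e₀ hm h1 h2
      linarith
    · rintro a' b' c' d' e' k' hm ⟨h1, h2, h3, h4, h5, h6⟩
      linarith
    · intro l a' b' c' d' e' k' hl hm hτ h1 h2 h3 h4 h5 h6
      obtain rfl : c' = 0 := mul_left_cancel₀ hl (by linarith)
      obtain rfl : d' = 0 := mul_left_cancel₀ hl (by linarith)
      obtain rfl : e' = 0 := mul_left_cancel₀ hl (by linarith)
      by_cases hk : k' = 0
      · subst hk
        have ha : a' ≠ 0 := by simpa using hτ
        obtain rfl : l = -1 := mul_right_cancel₀ ha (by linarith)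
        exact ha (by linarith)
      · obtain rfl : l = 1 := mul_right_cancel₀ hk (by linarith)
        obtain rfl : a' = 0 := by linarith
        obtain rfl : b' = 0 := by linarith
        have h7 : gv 0 0 0 0 0 1 ∈ symAlg Ω f := by
          refine mem_of_eq (lin_mem hm hm k'⁻¹ 0) ?_ ?_ ?_ ?_ ?_ ?_ <;> simp [hk]
        obtain ⟨_, ⟨p, hp, rfl⟩, hw⟩ := hc2
        exact hw (hD.1 h7 p hp)

end maximal
end FunRow

/-- The sign of `t` is constant on a connected set without points with `t = 0`. -/
theorem exists_abs_eq {Ω : Set (ℝ × ℝ)} (hΩ : IsConnected Ω) (h : ∀ p ∈ Ω, p.1 ≠ 0) :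
    ∃ σ : ℝ, σ ^ 2 = 1 ∧ ∀ p ∈ Ω, |p.1| = σ * p.1 := by
  have hc : (Prod.fst '' Ω).OrdConnected :=
    (hΩ.isPreconnected.image _ continuous_fst.continuousOn).ordConnected
  have h0 : (0 : ℝ) ∉ Prod.fst '' Ω := by
    rintro ⟨p, hp, h0⟩
    exact h p hp h0
  obtain ⟨p₀, hp₀⟩ := hΩ.nonempty
  rcases (h p₀ hp₀).lt_or_gt with hlt | hgt
  · refine ⟨-1, by norm_num, fun p hp => ?_⟩
    have : p.1 ≤ 0 := by
      by_contra! hp0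
      exact h0 (hc.out ⟨p₀, hp₀, rfl⟩ ⟨p, hp, rfl⟩ ⟨hlt.le, hp0.le⟩)
    rw [abs_of_nonpos this]
    ring
  · refine ⟨1, by norm_num, fun p hp => ?_⟩
    have : 0 ≤ p.1 := by
      by_contra! hp0
      exact h0 (hc.out ⟨p, hp, rfl⟩ ⟨p₀, hp₀, rfl⟩ ⟨hp0.le, hgt.le⟩)
    rw [abs_of_nonneg this]
    ring

namespace FunRow

section maximal

variable {Ω : Set (ℝ × ℝ)} {f : ℝ × ℝ → ℝ} {h : ℝ → ℝ} {a : ℝ}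

theorem mem_iff_dilation (hf : IsGBE Ω f) (hr : (g16 a).HasForm Ω f h) {b e : ℝ} :
    gv 0 b 0 1 e 0 ∈ symAlg Ω f ↔ ∀ p ∈ Ω,
      (omega (g16 a) p + |p.1| ^ (-a) * (b + e * p.1)) * deriv h (omega (g16 a) p)
        = 2 * h (omega (g16 a) p) := by
  have hom : ∀ p, omega (g16 a) p = |p.1| ^ (-a) * p.2 := fun _ => rfl
  rw [hr.mem_iff hf]
  refine forall₂_congr fun p hp => ?_
  simp only [coeffT, coeffX, omegaT, omegaX]
  constructor <;> intro h1
  · refine mul_left_cancel₀ (hr.ne hf hp).1 ?_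
    linear_combination h1 + coeff (g16 a) p * deriv h (omega (g16 a) p) * hom p
  · linear_combination coeff (g16 a) p * h1 - coeff (g16 a) p * deriv h (omega (g16 a) p) * hom p

theorem mem_iff_translation (hf : IsGBE Ω f) (hr : (g16 a).HasForm Ω f h) {b e : ℝ} :
    gv 1 b 0 0 e 0 ∈ symAlg Ω f ↔ ∀ p ∈ Ω,
      (a * omega (g16 a) p - |p.1| ^ (-a) * p.1 * (b + e * p.1)) * deriv h (omega (g16 a) p)
        = (2 * a - 1) * h (omega (g16 a) p) := by
  have hom : ∀ p, omega (g16 a) p = |p.1| ^ (-a) * p.2 := fun _ => rfl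
  have hco : ∀ p, coeff (g16 a) p = |p.1| ^ (2 * a) / p.1 := fun _ => rfl
  rw [hr.mem_iff hf]
  refine forall₂_congr fun p hp => ?_
  have ht : p.1 ≠ 0 := hr.regular hf hp
  have ht' : p.1⁻¹ * p.1 = 1 := inv_mul_cancel₀ ht
  simp only [coeffT, coeffX, omegaT, omegaX, ← hom, ← hco]
  constructor <;> intro h1
  · refine mul_left_cancel₀ (div_ne_zero (hr.ne hf hp).1 ht) ?_
    field_simp at h1 ⊢
    linear_combination -h1
  · field_simp
    linear_combination -coeff (g16 a) p * h1

theorem mem_iff_projective (hf : IsGBE Ω f) (hr : (g16 a).HasForm Ω f h) {b e : ℝ} :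
    gv 0 b 0 0 e 1 ∈ symAlg Ω f ↔ ∀ p ∈ Ω,
      ((a - 1) * omega (g16 a) p - |p.1| ^ (-a) * (b / p.1 + e)) * deriv h (omega (g16 a) p)
        = (2 * a - 1) * h (omega (g16 a) p) := by
  have hom : ∀ p, omega (g16 a) p = |p.1| ^ (-a) * p.2 := fun _ => rfl
  have hco : ∀ p, coeff (g16 a) p = |p.1| ^ (2 * a) / p.1 := fun _ => rfl
  rw [hr.mem_iff hf]
  refine forall₂_congr fun p hp => ?_
  have ht : p.1 ≠ 0 := hr.regular hf hp
  simp only [coeffT, coeffX, omegaT, omegaX, ← hom, ← hco]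
  have hK := hom p
  have hb : b / p.1 * p.1 = b := div_mul_cancel₀ b ht
  constructor <;> intro h1
  · refine mul_left_cancel₀ (mul_ne_zero (hr.ne hf hp).1 (pow_ne_zero 2 ht)) ?_
    field_simp at h1
    linear_combination -h1 - coeff (g16 a) p * p.1 * |p.1| ^ (-a) * deriv h (omega (g16 a) p) * hb
      - coeff (g16 a) p * p.1 ^ 2 * deriv h (omega (g16 a) p) * hK
  · field_simp
    linear_combination -coeff (g16 a) p * p.1 ^ 2 * h1
      - coeff (g16 a) p * p.1 * |p.1| ^ (-a) * deriv h (omega (g16 a) p) * hb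
      - coeff (g16 a) p * p.1 ^ 2 * deriv h (omega (g16 a) p) * hK

/-- Extensions are by a dilation commuting with D^t + aD^x or by an eigenvector of its ad, with
eigenvalue -1 (P^t + …) or 1 (Π + …). The admixtures P^x and G have eigenvalues -a and 1 - a, so
they occur only for special a: a = 0, 1 with the dilation, a = 1, 2 with P^t, a = -1, 0 with Π.
These exceptional values are the ones in the constraints, where they permit the shifts β, α, γ of ω.
-/
theorem symAlg_eq_iff_g16 (hf : IsGBE Ω f) (hr : (g16 a).HasForm Ω f h) :
    symAlg Ω f = (g16 a).alg ↔ (g16 a).Constraint ((g16 a).omega '' Ω) h := by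
  -- On the connected Ω the sign σ of t is constant, so for integer a the powers of |t| become
  -- rational up to σ.
  obtain ⟨σ, hσ, habs⟩ := exists_abs_eq hf.isConnected fun p hp => hr.regular hf hp
  have hne : ∀ p ∈ Ω, p.1 ≠ 0 := fun p hp => hr.regular hf hp
  have hσ0 : σ ≠ 0 := by
    rintro rfl
    norm_num at hσ
  have hσi : σ⁻¹ = σ := by
    field_simp
    exact hσ.symm
  have pow1 : ∀ p ∈ Ω, |p.1| ^ (-1 : ℝ) = σ / p.1 := by
    intro p hp
    rw [Real.rpow_neg_one, habs p hp, mul_inv, hσi, div_eq_mul_inv]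
  have pow2 : ∀ p ∈ Ω, |p.1| ^ (-2 : ℝ) = 1 / p.1 ^ 2 := by
    intro p hp
    rw [Real.rpow_neg (abs_nonneg _), Real.rpow_two, sq_abs, one_div]
  have pow0 : ∀ p : ℝ × ℝ, |p.1| ^ (-0 : ℝ) = 1 := by
    intro p
    rw [neg_zero, Real.rpow_zero]
  have pow3 : ∀ p ∈ Ω, |p.1| ^ (- -1 : ℝ) = σ * p.1 := by
    intro p hp
    rw [neg_neg, Real.rpow_one, habs p hp]
  have h0 : gv 0 0 1 a 0 0 ∈ symAlg Ω f := by
    rw [hr.mem_iff hf]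
    intro p hp
    have ht : p.1 ≠ 0 := hne p hp
    simp only [coeff, coeffT, coeffX, omegaT, omegaX]
    field_simp
    ring
  rw [alg_eq]
  constructor
  · intro hS
    refine ⟨hr.exists_deriv_ne hf (fun _ => rfl) ?_, fun α hα => ?_, fun β hβ => ?_, fun γ hγ => ?_⟩
    · rw [hS]
      intro hm
      obtain ⟨l, h1, h2, -⟩ := coords_of_mem_span hm
      simp at h2
    · by_contra hc
      push Not at hc
      -- For the exceptional a one admixture makes the extra term independent of t, hence a shift of
      -- ω; otherwise α is zero or drops out.
      have key : ∃ b e : ℝ, ∀ p ∈ Ω, |p.1| ^ (-a) * p.1 * (b + e * p.1) = -(a * α) := by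
        rcases mul_eq_zero.1 hα with h1 | h1
        · rcases mul_eq_zero.1 h1 with h2 | h2
          · obtain rfl : a = 2 := by linarith
            refine ⟨0, -(2 * α), fun p hp => ?_⟩
            have ht := hne p hp
            rw [pow2 p hp]
            field_simp
            ring
          · obtain rfl : a = 1 := by linarith
            refine ⟨-(σ * α), 0, fun p hp => ?_⟩
            have ht := hne p hp
            rw [pow1 p hp]
            field_simp
            linear_combination -α * hσ
        · exact ⟨0, 0, fun p hp => by rw [h1]; ring⟩
      obtain ⟨b, e, key⟩ := key
      have hm := (mem_iff_translation hf hr (b := b) (e := e)).2 fun p hp => by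
        rw [key p hp]
        linear_combination hc _ ⟨p, hp, rfl⟩
      rw [hS] at hm
      obtain ⟨l, h1, -⟩ := coords_of_mem_span hm
      simp at h1
    · by_contra hc
      push Not at hc
      have key : ∃ b e : ℝ, ∀ p ∈ Ω, |p.1| ^ (-a) * (b + e * p.1) = β := by
        rcases mul_eq_zero.1 hβ with h1 | h1
        · rcases mul_eq_zero.1 h1 with h2 | h2
          · obtain rfl : a = 1 := by linarith
            refine ⟨0, σ * β, fun p hp => ?_⟩
            have ht := hne p hp
            rw [pow1 p hp]
            field_simp
            linear_combination β * p.1 * hσ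
          · subst h2
            refine ⟨β, 0, fun p hp => ?_⟩
            rw [pow0]
            ring
        · exact ⟨0, 0, fun p hp => by rw [h1]; ring⟩
      obtain ⟨b, e, key⟩ := key
      have hm := (mem_iff_dilation hf hr (b := b) (e := e)).2 fun p hp => by
        rw [key p hp]
        exact hc _ ⟨p, hp, rfl⟩
      rw [hS] at hm
      obtain ⟨l, -, -, h1, h2, -⟩ := coords_of_mem_span hm
      obtain rfl : l = 0 := by linarith
      simp at h2
    · by_contra hc
      push Not at hc
      have key : ∃ b e : ℝ, ∀ p ∈ Ω, |p.1| ^ (-a) * (b / p.1 + e) = -((a - 1) * γ) := by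
        rcases mul_eq_zero.1 hγ with h1 | h1
        · rcases mul_eq_zero.1 h1 with h2 | h2
          · subst h2
            refine ⟨0, γ, fun p hp => ?_⟩
            rw [pow0]
            ring
          · obtain rfl : a = -1 := by linarith
            refine ⟨2 * σ * γ, 0, fun p hp => ?_⟩
            have ht := hne p hp
            rw [pow3 p hp]
            field_simp
            linear_combination 2 * γ * hσ
        · exact ⟨0, 0, fun p hp => by rw [h1]; ring⟩
      obtain ⟨b, e, key⟩ := key
      have hm := (mem_iff_projective hf hr (b := b) (e := e)).2 fun p hp => by
        rw [key p hp]
        linear_combination hc _ ⟨p, hp, rfl⟩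
      rw [hS] at hm
      obtain ⟨l, -, -, -, -, -, h1⟩ := coords_of_mem_span hm
      simp at h1
  · rintro ⟨hc1, hcα, hcβ, hcγ⟩
    have hx := hr.exists_fx_ne hf (by simp) (by simp) (fun _ => rfl) hc1
    refine symAlg_eq_single hf hx (by simp) h0 ?_ ?_ ?_
    · intro b e hm h1 h2
      have hb : b * a = 0 := by linarith
      have he : e * (a - 1) = 0 := by linarith
      -- Conversely, the eigenvalue conditions leave only admixtures whose contribution is a
      -- constant β.
      have key : ∃ β, (a - 1) * a * β = 0 ∧ ∀ p ∈ Ω, |p.1| ^ (-a) * (b + e * p.1) = β := by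
        by_cases ha : a = 0
        · subst ha
          obtain rfl : e = 0 := by linarith
          refine ⟨b, by ring, fun p hp => ?_⟩
          rw [pow0]
          ring
        obtain rfl := (mul_eq_zero.1 hb).resolve_right ha
        rcases mul_eq_zero.1 he with rfl | ha1
        · exact ⟨0, by ring, fun p hp => by ring⟩
        · obtain rfl : a = 1 := by linarith
          refine ⟨e * σ, by ring, fun p hp => ?_⟩
          have ht := hne p hp
          rw [pow1 p hp]
          field_simp
          ring
      obtain ⟨β, hβ, key⟩ := key
      obtain ⟨_, ⟨p, hp, rfl⟩, hw⟩ := hcβ β hβ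
      have := (mem_iff_dilation hf hr).1 hm p hp
      rw [key p hp] at this
      exact hw this
    · rintro a' b' c' d' e' k' hm ⟨h1, h2, h3, h4, h5, h6⟩
      linarith
    · intro l a' b' c' d' e' k' hl hm hτ h1 h2 h3 h4 h5 h6
      obtain rfl : c' = 0 := mul_left_cancel₀ hl (by linarith)
      obtain rfl : d' = 0 := mul_left_cancel₀ hl (by linarith)
      by_cases hk : k' = 0
      · subst hk
        have ha : a' ≠ 0 := by simpa using hτ
        obtain rfl : l = -1 := mul_right_cancel₀ ha (by linarith)
        obtain ⟨b, rfl⟩ : ∃ b, b' = a' * b := ⟨b' / a', (mul_div_cancel₀ _ ha).symm⟩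
        obtain ⟨e, rfl⟩ : ∃ e, e' = a' * e := ⟨e' / a', (mul_div_cancel₀ _ ha).symm⟩
        have hb : b * (a - 1) = 0 := mul_left_cancel₀ ha (by linear_combination -h2)
        have he : e * (a - 2) = 0 := mul_left_cancel₀ ha (by linear_combination -h5)
        have h7 : gv 1 b 0 0 e 0 ∈ symAlg Ω f := by
          refine mem_of_eq (lin_mem hm hm a'⁻¹ 0) ?_ ?_ ?_ ?_ ?_ ?_ <;> simp [ha]
        have key : ∃ α, (a - 2) * (a - 1) * α = 0 ∧
            ∀ p ∈ Ω, |p.1| ^ (-a) * p.1 * (b + e * p.1) = -(a * α) := by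
          by_cases ha1 : a = 1
          · subst ha1
            obtain rfl : e = 0 := by linarith
            refine ⟨-(σ * b), by ring, fun p hp => ?_⟩
            have ht := hne p hp
            rw [pow1 p hp]
            field_simp
            ring
          obtain rfl := (mul_eq_zero.1 hb).resolve_right fun h => ha1 (by linarith)
          rcases mul_eq_zero.1 he with rfl | ha2
          · exact ⟨0, by ring, fun p hp => by ring⟩
          · obtain rfl : a = 2 := by linarith
            refine ⟨-(e / 2), by ring, fun p hp => ?_⟩
            have ht := hne p hp
            rw [pow2 p hp]
            field_simp
            ring
        obtain ⟨α, hα, key⟩ := key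
        obtain ⟨_, ⟨p, hp, rfl⟩, hw⟩ := hcα α hα
        have := (mem_iff_translation hf hr).1 h7 p hp
        rw [key p hp] at this
        exact hw (by linear_combination this)
      · obtain rfl : l = 1 := mul_right_cancel₀ hk (by linarith)
        obtain rfl : a' = 0 := by linarith
        obtain ⟨b, rfl⟩ : ∃ b, b' = k' * b := ⟨b' / k', (mul_div_cancel₀ _ hk).symm⟩
        obtain ⟨e, rfl⟩ : ∃ e, e' = k' * e := ⟨e' / k', (mul_div_cancel₀ _ hk).symm⟩
        have hb : b * (a + 1) = 0 := mul_left_cancel₀ hk (by linear_combination -h2)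
        have he : e * a = 0 := mul_left_cancel₀ hk (by linear_combination -h5)
        have h7 : gv 0 b 0 0 e 1 ∈ symAlg Ω f := by
          refine mem_of_eq (lin_mem hm hm k'⁻¹ 0) ?_ ?_ ?_ ?_ ?_ ?_ <;> simp [hk]
        have key : ∃ γ, a * (a + 1) * γ = 0 ∧
            ∀ p ∈ Ω, |p.1| ^ (-a) * (b / p.1 + e) = -((a - 1) * γ) := by
          by_cases ha0 : a = 0
          · subst ha0
            obtain rfl : b = 0 := by linarith
            refine ⟨e, by ring, fun p hp => ?_⟩
            rw [pow0]
            ring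
          obtain rfl := (mul_eq_zero.1 he).resolve_right ha0
          rcases mul_eq_zero.1 hb with rfl | ha1
          · exact ⟨0, by ring, fun p hp => by ring⟩
          · obtain rfl : a = -1 := by linarith
            refine ⟨b * σ / 2, by ring, fun p hp => ?_⟩
            have ht := hne p hp
            rw [pow3 p hp]
            field_simp
            ring
        obtain ⟨γ, hγ, key⟩ := key
        obtain ⟨_, ⟨p, hp, rfl⟩, hw⟩ := hcγ γ hγ
        have := (mem_iff_projective hf hr).1 h7 p hp
        rw [key p hp] at this
        exact hw (by linear_combination this)

end maximal

theorem symAlg_eq_iff {r : FunRow} {Ω : Set (ℝ × ℝ)} {f : ℝ × ℝ → ℝ} {h : ℝ → ℝ} (hf : IsGBE Ω f)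
    (hr : r.HasForm Ω f h) : symAlg Ω f = r.alg ↔ r.Constraint (r.omega '' Ω) h := by
  cases r with
  | g11 => exact symAlg_eq_iff_g11 hf hr
  | g12 => exact symAlg_eq_iff_g12 hf hr
  | g13 => exact symAlg_eq_iff_g13 hf hr
  | g14 => exact symAlg_eq_iff_g14 hf hr
  | g15 => exact symAlg_eq_iff_g15 hf hr
  | g16 a => exact symAlg_eq_iff_g16 hf hr
  | g17 => exact symAlg_eq_iff_g17 hf hr
  | g18 a => exact symAlg_eq_iff_g18 hf hr
  | g21 => exact symAlg_eq_iff_g21 hf hr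

end FunRow

section classification

open EqTrans

/-! ### Inequivalence of the algebras of the list -/

/-- The element with the given coordinates is conjugate by shifts to one without component in
the nilradical. -/
def Splits (a b c d e k : ℝ) : Prop :=
  ∃ μ₁ μ₀ : ℝ, e = μ₁ * (c - d) - μ₀ * k ∧ b = μ₁ * a - μ₀ * d

/-- Splitting means n = νA for some row ν. Then n' = (μA + κνA)B⁻¹ = ((μ + κν)B⁻¹)A', which is the
new row. -/
theorem EqTrans.Inter.splits {T : EqTrans} {a b c d e k a' b' c' d' e' k' : ℝ}
    (h : T.Inter a b c d e k a' b' c' d' e' k') (hs : Splits a b c d e k) :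
    Splits a' b' c' d' e' k' := by
  obtain ⟨ν₁, ν₀, rfl, rfl⟩ := hs
  obtain ⟨g1, g2, g3, g4, -, -⟩ := h.inv
  obtain ⟨-, -, -, -, h5, h6⟩ := h
  simp only [EqTrans.inv] at g1 g2 g3 g4
  have hΔ := T.det_ne
  refine ⟨((T.μ₁ + T.κ * ν₁) * T.δ - (T.μ₀ + T.κ * ν₀) * T.γ) / (T.α * T.δ - T.β * T.γ),
    ((T.μ₀ + T.κ * ν₀) * T.α - (T.μ₁ + T.κ * ν₁) * T.β) / (T.α * T.δ - T.β * T.γ), ?_, ?_⟩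
  · rw [div_mul_eq_mul_div, div_mul_eq_mul_div, ← sub_div, eq_div_iff hΔ]
    linear_combination T.δ * h5 - T.γ * h6 + (T.μ₁ + T.κ * ν₁) * g1 + (T.μ₀ + T.κ * ν₀) * g3
  · rw [div_mul_eq_mul_div, div_mul_eq_mul_div, ← sub_div, eq_div_iff hΔ]
    linear_combination T.α * h6 - T.β * h5 + (T.μ₁ + T.κ * ν₁) * g2 + (T.μ₀ + T.κ * ν₀) * g4

/-- τ = 0 says that A is a scalar matrix, and conjugation fixes scalar matrices. -/
theorem EqTrans.Inter.tau {T : EqTrans} {a b c d e k a' b' c' d' e' k' : ℝ}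
    (h : T.Inter a b c d e k a' b' c' d' e' k') (h0 : a = 0 ∧ c = 0 ∧ k = 0) :
    a' = 0 ∧ c' = 0 ∧ k' = 0 := by
  obtain ⟨rfl, rfl, rfl⟩ := h0
  have hw := h.weight
  obtain ⟨h1, h2, h3, h4, h5, h6⟩ := h
  have hΔ := T.det_ne
  obtain rfl : d' = d + c' / 2 := by linarith
  refine ⟨?_, ?_, ?_⟩
  · refine mul_right_cancel₀ hΔ ?_
    linear_combination T.α * h2 - T.β * h1
  · refine mul_right_cancel₀ hΔ ?_
    linear_combination T.δ * h1 - T.γ * h2 + T.β * h3 - T.α * h4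
  · refine mul_right_cancel₀ hΔ ?_
    linear_combination T.γ * h4 - T.δ * h3

/-- The values of the invariants on the elements of a subspace. -/
structure SameInvariants (a b c d e k a' b' c' d' e' k' : ℝ) : Prop where
  weight : 2 * d' - c' = 2 * d - c
  disc : c' ^ 2 - 4 * a' * k' = c ^ 2 - 4 * a * k
  tau : (a' = 0 ∧ c' = 0 ∧ k' = 0) ↔ (a = 0 ∧ c = 0 ∧ k = 0)
  splits : Splits a' b' c' d' e' k' ↔ Splits a b c d e k

theorem EqTrans.Inter.same {T : EqTrans} {a b c d e k a' b' c' d' e' k' : ℝ}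
    (h : T.Inter a b c d e k a' b' c' d' e' k') :
    SameInvariants a b c d e k a' b' c' d' e' k' :=
  ⟨h.weight, h.disc, ⟨h.inv.tau, h.tau⟩, ⟨h.inv.splits, h.splits⟩⟩

/-- `s` has an element whose invariants `2d - c`, `c² - 4ak`, `τ = 0` and splitting have the
property `P`. -/
def HasInvariants (P : ℝ → ℝ → Prop → Prop → Prop) (s : Submodule ℝ VF) : Prop :=
  ∃ a b c d e k, gv a b c d e k ∈ s ∧
    P (2 * d - c) (c ^ 2 - 4 * a * k) (a = 0 ∧ c = 0 ∧ k = 0) (Splits a b c d e k)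

theorem HasInvariants.of_equiv {P : ℝ → ℝ → Prop → Prop → Prop} {s s' : Submodule ℝ VF}
    (hs' : s' ≤ algG) (h : SubalgEquiv s s') (hP : HasInvariants P s) : HasInvariants P s' := by
  obtain ⟨T, h1, -⟩ := h
  obtain ⟨a, b, c, d, e, k, hm, hP⟩ := hP
  obtain ⟨Q', hQ', hp⟩ := h1 _ hm
  obtain ⟨a', b', c', d', e', k', rfl⟩ := mem_algG.1 (hs' hQ')
  obtain ⟨g1, g2, g3, g4⟩ := (pushes_iff.1 hp).same
  refine ⟨_, _, _, _, _, _, hQ', ?_⟩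
  rwa [g1, g2, propext g3, propext g4]

theorem HasInvariants.iff_of_equiv (P : ℝ → ℝ → Prop → Prop → Prop) {s s' : Submodule ℝ VF}
    (hs : s ≤ algG) (hs' : s' ≤ algG) (h : SubalgEquiv s s') :
    HasInvariants P s ↔ HasInvariants P s' :=
  ⟨.of_equiv hs' h, .of_equiv hs (h.symm hs hs')⟩

/-- The linear equations of the algebras of the list. -/
def FunRow.Coords (a b c d e k : ℝ) : FunRow → Prop
  | g11 => a = 0 ∧ b = 0 ∧ c = 0 ∧ e = 0 ∧ k = 0
  | g12 => b = 0 ∧ c = 0 ∧ d = 0 ∧ e = 0 ∧ k = 0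
  | g13 => b = 0 ∧ c = 0 ∧ d = 0 ∧ e = a ∧ k = 0
  | g14 => b = 0 ∧ c = 0 ∧ d = a ∧ e = 0 ∧ k = 0
  | g15 => a = 0 ∧ b = c ∧ d = 0 ∧ e = 0 ∧ k = 0
  | g16 l => a = 0 ∧ b = 0 ∧ d = l * c ∧ e = 0 ∧ k = 0
  | g17 => a = 0 ∧ b = 0 ∧ d = c ∧ e = c ∧ k = 0
  | g18 l => b = 0 ∧ c = 0 ∧ d = l * a ∧ e = 0 ∧ k = a
  | g21 => a = 0 ∧ c = 0 ∧ d = 0 ∧ k = 0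

def ConstRow.Coords (a b c d e k : ℝ) : ConstRow → Prop
  | g22 => b = 0 ∧ c = 0 ∧ e = 0 ∧ k = 0
  | g23 => a = 0 ∧ b = 0 ∧ e = 0 ∧ k = 0
  | g24 => b = 0 ∧ c = 0 ∧ e = 0 ∧ k = a
  | g25 => b = c ∧ d = 0 ∧ e = 0 ∧ k = 0
  | g26 l => b = 0 ∧ d = l * c ∧ e = 0 ∧ k = 0
  | g27 => b = 0 ∧ d = 2 * c ∧ e = a ∧ k = 0
  | g31 => c = 0 ∧ d = a / 2 ∧ k = 0
  | g32 l => a = 0 ∧ d = l * c ∧ k = 0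
  | g33 l => c = 0 ∧ d = l * a ∧ k = a
  | g5 => 2 * d = c

theorem FunRow.mem_alg {r : FunRow} {a b c d e k : ℝ} :
    gv a b c d e k ∈ r.alg ↔ r.Coords a b c d e k := by
  rw [FunRow.alg_eq]
  cases r
  case g21 =>
    simp only [Submodule.mem_span_pair, smul_gv, gv_add, gv_inj, FunRow.Coords]
    exact ⟨fun ⟨x, y, h⟩ => by grind, fun h => ⟨b, e, by grind⟩⟩
  case g11 =>
    simp only [Submodule.mem_span_singleton, smul_gv, gv_inj, FunRow.Coords]
    exact ⟨fun ⟨x, h⟩ => by grind, fun h => ⟨d, by grind⟩⟩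
  case g12 | g13 | g14 | g18 =>
    simp only [Submodule.mem_span_singleton, smul_gv, gv_inj, FunRow.Coords]
    exact ⟨fun ⟨x, h⟩ => by grind, fun h => ⟨a, by grind⟩⟩
  case g15 | g16 | g17 =>
    simp only [Submodule.mem_span_singleton, smul_gv, gv_inj, FunRow.Coords]
    exact ⟨fun ⟨x, h⟩ => by grind, fun h => ⟨c, by grind⟩⟩

theorem ConstRow.mem_alg {r : ConstRow} {a b c d e k : ℝ} :
    gv a b c d e k ∈ r.alg ↔ r.Coords a b c d e k := by
  rw [ConstRow.alg_eq]
  cases r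
  case g5 => exact mem_levi_sup_nilrad
  case g22 | g24 =>
    simp only [Submodule.mem_span_pair, smul_gv, gv_add, gv_inj, ConstRow.Coords]
    exact ⟨fun ⟨x, y, h⟩ => by grind, fun h => ⟨d, a, by grind⟩⟩
  case g23 =>
    simp only [Submodule.mem_span_pair, smul_gv, gv_add, gv_inj, ConstRow.Coords]
    exact ⟨fun ⟨x, y, h⟩ => by grind, fun h => ⟨d, c, by grind⟩⟩
  case g25 | g26 | g27 =>
    simp only [Submodule.mem_span_pair, smul_gv, gv_add, gv_inj, ConstRow.Coords]
    exact ⟨fun ⟨x, y, h⟩ => by grind, fun h => ⟨a, c, by grind⟩⟩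
  case g31 | g33 =>
    simp only [Submodule.mem_span_triple, smul_gv, gv_add, gv_inj, ConstRow.Coords]
    exact ⟨fun ⟨x, y, z, h⟩ => by grind, fun h => ⟨b, e, a, by grind⟩⟩
  case g32 =>
    simp only [Submodule.mem_span_triple, smul_gv, gv_add, gv_inj, ConstRow.Coords]
    exact ⟨fun ⟨x, y, z, h⟩ => by grind, fun h => ⟨b, e, c, by grind⟩⟩

def Row.Coords (a b c d e k : ℝ) : Row → Prop
  | fn r => r.Coords a b c d e k
  | const r => r.Coords a b c d e k

theorem Row.mem_alg {a b c d e k : ℝ} : ∀ {r : Row}, gv a b c d e k ∈ r.alg ↔ r.Coords a b c d e k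
  | fn _ => FunRow.mem_alg
  | const _ => ConstRow.mem_alg

theorem splits_zero {a c d k : ℝ} : Splits a 0 c d 0 k := ⟨0, 0, by ring, by ring⟩

/-- An element of the nilradical. -/
def invNil (w _D : ℝ) (τ S : Prop) : Prop := τ ∧ w = 0 ∧ ¬S
/-- An element of the radical outside of the nilradical. -/
def invDil (w _D : ℝ) (τ _S : Prop) : Prop := τ ∧ w ≠ 0
def invParabolic (_w D : ℝ) (τ _S : Prop) : Prop := ¬τ ∧ D = 0
def invHyperbolic (_w D : ℝ) (_τ _S : Prop) : Prop := 0 < D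
def invElliptic (_w D : ℝ) (_τ _S : Prop) : Prop := D < 0
def invNonsplit (_w _D : ℝ) (_τ S : Prop) : Prop := ¬S
def invWeight (w D : ℝ) (τ _S : Prop) : Prop := ¬τ ∧ D = 0 ∧ w ≠ 0
def invParabolicNonsplit (w D : ℝ) (τ S : Prop) : Prop := ¬τ ∧ D = 0 ∧ w = 0 ∧ ¬S

/-! ### Tables of the invariants for the rows of the list -/

namespace Row

def hasNil : Row → Bool
  | fn .g21 | const .g31 | const (.g32 _) | const (.g33 _) | const .g5 => true
  | _ => false

def hasDil : Row → Bool
  | fn .g11 | const .g22 | const .g23 | const .g24 => true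
  | _ => false

def hasParabolic : Row → Bool
  | fn .g12 | fn .g13 | fn .g14 | const .g22 | const .g25 | const (.g26 _) | const .g27
  | const .g31 | const .g5 => true
  | _ => false

def hasHyperbolic : Row → Bool
  | fn .g15 | fn (.g16 _) | fn .g17 | const .g23 | const .g25 | const (.g26 _) | const .g27
  | const (.g32 _) | const .g5 => true
  | _ => false

def hasElliptic : Row → Bool
  | fn (.g18 _) | const .g24 | const (.g33 _) | const .g5 => true
  | _ => false

def hasNonsplit : Row → Bool
  | fn .g13 | fn .g15 | fn .g17 | fn .g21 | const .g25 | const .g27 | const .g31 | const (.g32 _)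
  | const (.g33 _) | const .g5 => true
  | _ => false

def hasWeight : Row → Bool
  | fn .g14 | const .g22 | const .g31 => true
  | _ => false

def hasParabolicNonsplit : Row → Bool
  | fn .g13 | const .g27 | const .g5 => true
  | _ => false

theorem not_splits_translation : ¬ Splits 0 1 0 0 0 0 := by
  rintro ⟨x, y, h1, h2⟩
  linarith

theorem hasNil_iff (r : Row) : HasInvariants invNil r.alg ↔ r.hasNil = true := by
  simp only [HasInvariants, mem_alg, invNil]
  rcases r with (_ | _ | _ | _ | _ | _ | _ | _ | _) | (_ | _ | _ | _ | _ | _ | _ | _ | _ | _) <;>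
    simp only [Coords, FunRow.Coords, ConstRow.Coords, hasNil, iff_true, Bool.false_eq_true,
      iff_false]
  case fn.g21 | const.g31 | const.g32 | const.g33 | const.g5 =>
    exact ⟨0, 1, 0, 0, 0, 0, by simp, by simp, by simp, not_splits_translation⟩
  all_goals
    rintro ⟨a, b, c, d, e, k, h, hτ, hw, hs⟩
    apply hs
    have hb : b = 0 := by grind
    have he : e = 0 := by grind
    rw [hb, he]
    exact splits_zero

theorem hasDil_iff (r : Row) : HasInvariants invDil r.alg ↔ r.hasDil = true := by
  simp only [HasInvariants, mem_alg, invDil]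
  rcases r with (_ | _ | _ | _ | _ | _ | _ | _ | _) | (_ | _ | _ | _ | _ | _ | _ | _ | _ | _) <;>
    simp only [Coords, FunRow.Coords, ConstRow.Coords, hasDil, iff_true, Bool.false_eq_true,
      iff_false]
  case fn.g11 | const.g22 | const.g23 | const.g24 =>
    exact ⟨0, 0, 0, 1, 0, 0, by simp, by simp⟩
  all_goals
    rintro ⟨a, b, c, d, e, k, h, hτ, hw⟩
    grind

theorem hasParabolic_iff (r : Row) : HasInvariants invParabolic r.alg ↔ r.hasParabolic = true := by
  simp only [HasInvariants, mem_alg, invParabolic]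
  rcases r with (_ | _ | _ | _ | _ | l | _ | l | _) | (_ | _ | _ | _ | l | _ | _ | l | l | _) <;>
    simp only [Coords, FunRow.Coords, ConstRow.Coords, hasParabolic, iff_true, Bool.false_eq_true,
      iff_false]
  case fn.g12 | const.g25 | const.g26 | const.g5 => exact ⟨1, 0, 0, 0, 0, 0, by simp, by simp⟩
  case fn.g13 | const.g27 => exact ⟨1, 0, 0, 0, 1, 0, by simp, by simp⟩
  case fn.g14 | const.g22 => exact ⟨1, 0, 0, 1, 0, 0, by simp, by simp⟩
  case const.g31 => exact ⟨1, 0, 0, 1 / 2, 0, 0, by simp, by simp⟩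
  all_goals
    rintro ⟨a, b, c, d, e, k, h, hτ, hD⟩
    grind

theorem hasHyperbolic_iff (r : Row) :
    HasInvariants invHyperbolic r.alg ↔ r.hasHyperbolic = true := by
  simp only [HasInvariants, mem_alg, invHyperbolic]
  rcases r with (_ | _ | _ | _ | _ | l | _ | l | _) | (_ | _ | _ | _ | l | _ | _ | l | l | _) <;>
    simp only [Coords, FunRow.Coords, ConstRow.Coords, hasHyperbolic, iff_true, Bool.false_eq_true,
      iff_false]
  case fn.g15 | const.g25 => exact ⟨0, 1, 1, 0, 0, 0, by simp, by simp⟩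
  case fn.g16 | const.g26 | const.g32 => exact ⟨0, 0, 1, l, 0, 0, by simp, by simp⟩
  case fn.g17 => exact ⟨0, 0, 1, 1, 1, 0, by simp, by simp⟩
  case const.g23 => exact ⟨0, 0, 1, 0, 0, 0, by simp, by simp⟩
  case const.g27 => exact ⟨0, 0, 1, 2, 0, 0, by simp, by simp⟩
  case const.g5 => exact ⟨0, 0, 1, 1 / 2, 0, 0, by simp, by simp⟩
  all_goals
    rintro ⟨a, b, c, d, e, k, h, hD⟩
    -- In the remaining rows c = 0 and k is 0 or a, so the discriminant -4ak is not positive.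
    have hc : c = 0 := by grind
    have hk : 0 ≤ a * k := by
      rcases (by grind : k = 0 ∨ k = a) with rfl | rfl
      · simp
      · exact mul_self_nonneg _
    rw [hc] at hD
    linarith

theorem hasElliptic_iff (r : Row) : HasInvariants invElliptic r.alg ↔ r.hasElliptic = true := by
  simp only [HasInvariants, mem_alg, invElliptic]
  rcases r with (_ | _ | _ | _ | _ | l | _ | l | _) | (_ | _ | _ | _ | l | _ | _ | l | l | _) <;>
    simp only [Coords, FunRow.Coords, ConstRow.Coords, hasElliptic, iff_true, Bool.false_eq_true,
      iff_false]
  case fn.g18 | const.g33 => exact ⟨1, 0, 0, l, 0, 1, by simp, by simp⟩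
  case const.g24 | const.g5 => exact ⟨1, 0, 0, 0, 0, 1, by simp, by simp⟩
  all_goals
    rintro ⟨a, b, c, d, e, k, h, hD⟩
    have hk : k = 0 := by grind
    rw [hk] at hD
    nlinarith [sq_nonneg c]

theorem hasNonsplit_iff (r : Row) : HasInvariants invNonsplit r.alg ↔ r.hasNonsplit = true := by
  simp only [HasInvariants, mem_alg, invNonsplit]
  rcases r with (_ | _ | _ | _ | _ | l | _ | l | _) | (_ | _ | _ | _ | l | _ | _ | l | l | _) <;>
    simp only [Coords, FunRow.Coords, ConstRow.Coords, hasNonsplit, iff_true, Bool.false_eq_true,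
      iff_false]
  case fn.g21 | const.g31 | const.g32 | const.g33 | const.g5 =>
    exact ⟨0, 1, 0, 0, 0, 0, by simp, not_splits_translation⟩
  case fn.g13 | const.g27 =>
    exact ⟨1, 0, 0, 0, 1, 0, by simp, fun ⟨x, y, h1, h2⟩ => by linarith⟩
  case fn.g15 | const.g25 =>
    exact ⟨0, 1, 1, 0, 0, 0, by simp, fun ⟨x, y, h1, h2⟩ => by linarith⟩
  case fn.g17 =>
    exact ⟨0, 0, 1, 1, 1, 0, by simp, fun ⟨x, y, h1, h2⟩ => by linarith⟩
  all_goals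
    rintro ⟨a, b, c, d, e, k, h, hs⟩
    apply hs
    have hb : b = 0 := by grind
    have he : e = 0 := by grind
    rw [hb, he]
    exact splits_zero

theorem hasWeight_iff (r : Row) : HasInvariants invWeight r.alg ↔ r.hasWeight = true := by
  simp only [HasInvariants, mem_alg, invWeight]
  rcases r with (_ | _ | _ | _ | _ | l | _ | l | _) | (_ | _ | _ | _ | l | _ | _ | l | l | _) <;>
    simp only [Coords, FunRow.Coords, ConstRow.Coords, hasWeight, iff_true, Bool.false_eq_true,
      iff_false]
  case fn.g14 | const.g22 => exact ⟨1, 0, 0, 1, 0, 0, by simp, by simp⟩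
  case const.g31 => exact ⟨1, 0, 0, 1 / 2, 0, 0, by simp, by simp⟩
  all_goals
    rintro ⟨a, b, c, d, e, k, h, hτ, hD, hw⟩
    grind

theorem hasParabolicNonsplit_iff (r : Row) :
    HasInvariants invParabolicNonsplit r.alg ↔ r.hasParabolicNonsplit = true := by
  simp only [HasInvariants, mem_alg, invParabolicNonsplit]
  rcases r with (_ | _ | _ | _ | _ | l | _ | l | _) | (_ | _ | _ | _ | l | _ | _ | l | l | _) <;>
    simp only [Coords, FunRow.Coords, ConstRow.Coords, hasParabolicNonsplit, iff_true,
      Bool.false_eq_true, iff_false]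
  case fn.g13 | const.g27 | const.g5 =>
    exact ⟨1, 0, 0, 0, 1, 0, by simp, by simp, by simp, by simp,
      fun ⟨x, y, h1, h2⟩ => by linarith⟩
  all_goals
    rintro ⟨a, b, c, d, e, k, h, hτ, hD, hw, hs⟩
    first
    | grind
    | apply hs
      have hb : b = 0 := by grind
      have he : e = 0 := by grind
      rw [hb, he]
      exact splits_zero

end Row

/-- The rows with equal invariants belong to the same family, or are the two equivalent ones. -/
theorem Row.eq_of_invariants {r r' : Row} (h1 : r.hasNil = r'.hasNil) (h2 : r.hasDil = r'.hasDil)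
    (h3 : r.hasParabolic = r'.hasParabolic) (h4 : r.hasHyperbolic = r'.hasHyperbolic)
    (h5 : r.hasElliptic = r'.hasElliptic) (h6 : r.hasNonsplit = r'.hasNonsplit)
    (h7 : r.hasWeight = r'.hasWeight) (h8 : r.hasParabolicNonsplit = r'.hasParabolicNonsplit) :
    r = r' ∨ (r = .fn .g15 ∧ r' = .fn .g17) ∨ (r = .fn .g17 ∧ r' = .fn .g15) ∨
      (∃ a a', r = .fn (.g16 a) ∧ r' = .fn (.g16 a')) ∨
      (∃ a a', r = .fn (.g18 a) ∧ r' = .fn (.g18 a')) ∨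
      (∃ a a', r = .const (.g26 a) ∧ r' = .const (.g26 a')) ∨
      (∃ a a', r = .const (.g32 a) ∧ r' = .const (.g32 a')) ∨
      (∃ a a', r = .const (.g33 a) ∧ r' = .const (.g33 a')) := by
  rcases r with (_ | _ | _ | _ | _ | _ | _ | _ | _) | (_ | _ | _ | _ | _ | _ | _ | _ | _ | _) <;>
  rcases r' with (_ | _ | _ | _ | _ | _ | _ | _ | _) | (_ | _ | _ | _ | _ | _ | _ | _ | _ | _) <;>
  first
  | cases h1; done
  | cases h2; done
  | cases h3; done
  | cases h4; done
  | cases h5; done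
  | cases h6; done
  | cases h7; done
  | cases h8; done
  | simp

/-- The values of the weight on the elements with a given discriminant. -/
theorem exists_weight_of_equiv {s s' : Submodule ℝ VF} (hs' : s' ≤ algG) (h : SubalgEquiv s s')
    {a b c d e k : ℝ} (hm : gv a b c d e k ∈ s) : ∃ a' b' c' d' e' k', gv a' b' c' d' e' k' ∈ s' ∧
      2 * d' - c' = 2 * d - c ∧ c' ^ 2 - 4 * a' * k' = c ^ 2 - 4 * a * k := by
  obtain ⟨T, h1, -⟩ := h
  obtain ⟨Q', hQ', hp⟩ := h1 _ hm
  obtain ⟨a', b', c', d', e', k', rfl⟩ := mem_algG.1 (hs' hQ')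
  exact ⟨_, _, _, _, _, _, hQ', (pushes_iff.1 hp).weight, (pushes_iff.1 hp).disc⟩

theorem eq_of_sq_eq_one {c x y : ℝ} (hc : c ^ 2 = 1) (h : c * x = y) (hx : 0 ≤ x) (hy : 0 ≤ y) :
    y = x := by
  rcases sq_eq_sq_iff_eq_or_eq_neg.1 (hc.trans (one_pow 2).symm) with rfl | rfl <;> linarith

/-- Algebras with dilations of the parameters `a` and `a'`. -/
theorem eq_of_equiv_dilation {s s' : Submodule ℝ VF} (hs' : s' ≤ algG) (h : SubalgEquiv s s')
    {a a' : ℝ} (hm : gv 0 0 1 a 0 0 ∈ s)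
    (hm' : ∀ a b c d e k, gv a b c d e k ∈ s' → k = 0 ∧ d = a' * c) (ha : 1 / 2 ≤ a)
    (ha' : 1 / 2 ≤ a') : a = a' := by
  obtain ⟨a₁, b₁, c₁, d₁, e₁, k₁, hQ, hw, hd⟩ := exists_weight_of_equiv hs' h hm
  obtain ⟨rfl, rfl⟩ := hm' _ _ _ _ _ _ hQ
  -- The discriminant gives c₁² = 1 and the weight gives (2a' - 1)c₁ = 2a - 1; the gauge makes both
  -- sides nonnegative and removes the sign.
  have := eq_of_sq_eq_one (c := c₁) (x := 2 * a' - 1) (y := 2 * a - 1) (by linarith) (by linarith)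
    (by linarith) (by linarith)
  linarith

/-- Algebras with rotations of the parameters `a` and `a'`. -/
theorem eq_of_equiv_rotation {s s' : Submodule ℝ VF} (hs' : s' ≤ algG) (h : SubalgEquiv s s')
    {a a' : ℝ} (hm : gv 1 0 0 a 0 1 ∈ s)
    (hm' : ∀ a b c d e k, gv a b c d e k ∈ s' → c = 0 ∧ k = a ∧ d = a' * a) (ha : 0 ≤ a)
    (ha' : 0 ≤ a') : a = a' := by
  obtain ⟨a₁, b₁, c₁, d₁, e₁, k₁, hQ, hw, hd⟩ := exists_weight_of_equiv hs' h hm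
  obtain ⟨rfl, rfl, rfl⟩ := hm' _ _ _ _ _ _ hQ
  exact eq_of_sq_eq_one (c := k₁) (by linarith) (by linarith) ha' ha

/-- No gauge of a is needed here: the image of the second generator still satisfies [Q, R] = Q,
which fixes c = 1, and the invariant weight 2a - 1 can then be read off without ambiguity of sign.
-/
theorem eq_of_equiv_pair {a a' : ℝ}
    (h : SubalgEquiv (ConstRow.g26 a).alg (ConstRow.g26 a').alg) : a = a' := by
  obtain ⟨T, h1, -⟩ := h
  obtain ⟨Q, hQ, hp⟩ := h1 (gv 1 0 0 0 0 0) (ConstRow.mem_alg.2 (by simp [ConstRow.Coords]))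
  obtain ⟨R, hR, hq⟩ := h1 (gv 0 0 1 a 0 0) (ConstRow.mem_alg.2 (by simp [ConstRow.Coords]))
  obtain ⟨a₁, b₁, c₁, d₁, e₁, k₁, rfl⟩ := mem_algG.1 (ConstRow.alg_le _ hQ)
  obtain ⟨a₂, b₂, c₂, d₂, e₂, k₂, rfl⟩ := mem_algG.1 (ConstRow.alg_le _ hR)
  have hp := pushes_iff.1 hp
  have hq := pushes_iff.1 hq
  have hb : BracketUnit 1 0 0 0 0 0 0 0 1 a 0 0 := by
    refine ⟨?_, ?_, ?_, ?_, ?_, ?_⟩ <;> ring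
  have hb' := hb.map hp hq
  have hw := hq.weight
  obtain ⟨rfl, rfl, rfl, rfl⟩ := ConstRow.mem_alg.1 hQ
  obtain ⟨rfl, rfl, rfl, rfl⟩ := ConstRow.mem_alg.1 hR
  have hd := hp.disc
  have hc : c₁ = 0 := by
    refine pow_eq_zero_iff two_ne_zero |>.1 ?_
    linarith
  subst hc
  have ha : a₁ ≠ 0 := fun h0 => by
    have := (hp.inv.tau ⟨h0, rfl, rfl⟩).1
    simp at this
  obtain ⟨g1, -⟩ := hb'
  have hc2 : c₂ = 1 := mul_left_cancel₀ ha (by linarith)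
  subst hc2
  linarith

/-- The only coincidence in the list. -/
theorem equiv_shift_galilean : SubalgEquiv FunRow.g15.alg FunRow.g17.alg := by
  have h1 : SubalgEquiv (Submodule.span ℝ {gv 0 1 1 0 0 0}) (Submodule.span ℝ {gv 0 0 1 1 (-1) 0}) := by
    refine equiv_one (T := inversion) (l := -1) (by norm_num) ?_
    rw [smul_gv]
    exact ((inversion_inter 0 1 1 0 0 0).congr (by ring) (by ring) (by ring) (by ring) (by ring)
      (by ring)).pushes
  have h2 : SubalgEquiv (Submodule.span ℝ {gv 0 0 1 1 (-1) 0}) (Submodule.span ℝ {gv 0 0 1 1 1 0}) := by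
    refine equiv_one (T := scale 1 (-1) one_ne_zero (by norm_num)) (l := 1) one_ne_zero ?_
    rw [smul_gv]
    exact ((scale_inter _ _ 0 0 1 1 (-1) 0).congr (by ring) (by ring) (by ring) (by ring) (by ring)
      (by ring)).pushes
  rw [FunRow.alg_eq, FunRow.alg_eq]
  exact h1.trans span_le_one span_le_one span_le_one h2

theorem Row.subalgEquiv_iff {r r' : Row} (hr : r.Gauged) (hr' : r'.Gauged) :
    SubalgEquiv r.alg r'.alg ↔
      r = r' ∨ (r = Row.fn .g15 ∧ r' = Row.fn .g17) ∨ (r = Row.fn .g17 ∧ r' = Row.fn .g15) := by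
  constructor
  · intro h
    have hI := fun P => HasInvariants.iff_of_equiv P r.alg_le r'.alg_le h
    have e1 := hI invNil
    have e2 := hI invDil
    have e3 := hI invParabolic
    have e4 := hI invHyperbolic
    have e5 := hI invElliptic
    have e6 := hI invNonsplit
    have e7 := hI invWeight
    have e8 := hI invParabolicNonsplit
    rw [hasNil_iff, hasNil_iff, ← Bool.eq_iff_iff] at e1
    rw [hasDil_iff, hasDil_iff, ← Bool.eq_iff_iff] at e2
    rw [hasParabolic_iff, hasParabolic_iff, ← Bool.eq_iff_iff] at e3
    rw [hasHyperbolic_iff, hasHyperbolic_iff, ← Bool.eq_iff_iff] at e4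
    rw [hasElliptic_iff, hasElliptic_iff, ← Bool.eq_iff_iff] at e5
    rw [hasNonsplit_iff, hasNonsplit_iff, ← Bool.eq_iff_iff] at e6
    rw [hasWeight_iff, hasWeight_iff, ← Bool.eq_iff_iff] at e7
    rw [hasParabolicNonsplit_iff, hasParabolicNonsplit_iff, ← Bool.eq_iff_iff] at e8
    rcases eq_of_invariants e1 e2 e3 e4 e5 e6 e7 e8 with
      h | h | h | ⟨a, a', rfl, rfl⟩ | ⟨a, a', rfl, rfl⟩ | ⟨a, a', rfl, rfl⟩ | ⟨a, a', rfl, rfl⟩ |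
      ⟨a, a', rfl, rfl⟩
    · exact .inl h
    · exact .inr (.inl h)
    · exact .inr (.inr h)
    · obtain rfl : a = a' := eq_of_equiv_dilation (FunRow.alg_le _) h
        (FunRow.mem_alg.2 (by simp [FunRow.Coords]))
        (fun a b c d e k hm => by obtain ⟨-, -, h3, -, h5⟩ := FunRow.mem_alg.1 hm; exact ⟨h5, h3⟩)
        hr hr'
      exact .inl rfl
    · obtain rfl : a = a' := eq_of_equiv_rotation (FunRow.alg_le _) h
        (FunRow.mem_alg.2 (by simp [FunRow.Coords]))
        (fun a b c d e k hm => by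
          obtain ⟨-, h2, h3, -, h5⟩ := FunRow.mem_alg.1 hm; exact ⟨h2, h5, h3⟩)
        hr hr'
      exact .inl rfl
    · obtain rfl := eq_of_equiv_pair h
      exact .inl rfl
    · obtain rfl : a = a' := eq_of_equiv_dilation (ConstRow.alg_le _) h
        (ConstRow.mem_alg.2 (by simp [ConstRow.Coords]))
        (fun a b c d e k hm => by obtain ⟨-, h2, h3⟩ := ConstRow.mem_alg.1 hm; exact ⟨h3, h2⟩)
        hr.le hr'.le
      exact .inl rfl
    · obtain rfl : a = a' := eq_of_equiv_rotation (ConstRow.alg_le _) h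
        (ConstRow.mem_alg.2 (by simp [ConstRow.Coords]))
        (fun a b c d e k hm => by obtain ⟨h1, h2, h3⟩ := ConstRow.mem_alg.1 hm; exact ⟨h1, h3, h2⟩)
        hr.le hr'.le
      exact .inl rfl
  · rintro (rfl | ⟨rfl, rfl⟩ | ⟨rfl, rfl⟩)
    · exact SubalgEquiv.refl r.alg_le
    · exact equiv_shift_galilean
    · exact equiv_shift_galilean.symm (FunRow.alg_le _) (FunRow.alg_le _)

/-! ### Realization of the algebras of the list -/

/-- A polynomial of degree at most four that vanishes near a point is zero. -/
theorem quartic_eq_zero {a b c d e t : ℝ}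
    (h : ∀ᶠ s in nhds t, a + b * s + c * s ^ 2 + d * s ^ 3 + e * s ^ 4 = 0) :
    a = 0 ∧ b = 0 ∧ c = 0 ∧ d = 0 ∧ e = 0 := by
  open Polynomial in
  have hP : (C a + C b * X + C c * X ^ 2 + C d * X ^ 3 + C e * X ^ 4 : Polynomial ℝ) = 0 := by
    refine Polynomial.eq_zero_of_infinite_isRoot _ ?_
    refine (infinite_of_mem_nhds t h).mono fun s hs => ?_
    simpa using hs
  have hc := fun n => congrArg (fun P => Polynomial.coeff P n) hP
  have h0 := hc 0
  have h1 := hc 1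
  have h2 := hc 2
  have h3 := hc 3
  have h4 := hc 4
  simp [Polynomial.coeff_X, Polynomial.coeff_C] at h0 h1 h2 h3 h4
  exact ⟨h0, h1, h2, h3, h4⟩

theorem contDiffAt_abs_rpow {x : ℝ} (hx : x ≠ 0) (a : ℝ) :
    ContDiffAt ℝ ∞ (fun y : ℝ => |y| ^ a) x :=
  (contDiffAt_abs hx).rpow_const_of_ne (abs_ne_zero.2 hx)

namespace FunRow

theorem contDiffAt_omega {r : FunRow} {p : ℝ × ℝ} (hp : r.Regular p) :
    ContDiffAt ℝ ∞ r.omega p := by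
  have h1 : ContDiffAt ℝ ∞ (fun q : ℝ × ℝ => q.1) p := contDiffAt_fst
  have h2 : ContDiffAt ℝ ∞ (fun q : ℝ × ℝ => q.2) p := contDiffAt_snd
  cases r with
  | g11 | g12 | g13 | g14 | g21 => unfold omega; fun_prop
  | g15 => exact h2.sub (((contDiffAt_abs hp).comp p h1).log (abs_ne_zero.2 hp))
  | g16 a => exact ((contDiffAt_abs_rpow hp (-a)).comp p h1).mul h2
  | g17 => exact (h2.div h1 hp).sub (((contDiffAt_abs hp).comp p h1).log (abs_ne_zero.2 hp))
  | g18 a =>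
    have h3 : ContDiffAt ℝ ∞ (fun q : ℝ × ℝ => Real.arctan q.1) p :=
      Real.contDiff_arctan.contDiffAt.comp p h1
    have h4 : p.1 ^ 2 + 1 ≠ 0 := by positivity
    have h5 : ContDiffAt ℝ ∞ (fun q : ℝ × ℝ => Real.sqrt (q.1 ^ 2 + 1)) p :=
      ContDiffAt.sqrt (by fun_prop) h4
    exact (ContDiffAt.div (contDiffAt_const.mul h3).exp h5 (by positivity)).mul h2

theorem contDiffAt_coeff {r : FunRow} {p : ℝ × ℝ} (hp : r.Regular p) :
    ContDiffAt ℝ ∞ r.coeff p := by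
  have h1 : ContDiffAt ℝ ∞ (fun q : ℝ × ℝ => q.1) p := contDiffAt_fst
  cases r with
  | g11 | g12 | g13 | g14 | g17 | g21 => unfold coeff; fun_prop
  | g15 => exact contDiffAt_const.div h1 hp
  | g16 a => exact ((contDiffAt_abs_rpow hp (2 * a)).comp p h1).div h1 hp
  | g18 a =>
    have h3 : ContDiffAt ℝ ∞ (fun q : ℝ × ℝ => Real.arctan q.1) p :=
      Real.contDiff_arctan.contDiffAt.comp p h1
    exact (contDiffAt_const.mul h3).exp

theorem coeff_ne {r : FunRow} {p : ℝ × ℝ} (hp : r.Regular p) : r.coeff p ≠ 0 := by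
  cases r with
  | g11 => exact pow_ne_zero 2 hp
  | g12 | g13 | g21 => exact one_ne_zero
  | g14 | g18 => exact Real.exp_ne_zero _
  | g15 => exact one_div_ne_zero hp
  | g16 a => exact div_ne_zero (Real.rpow_pos_of_pos (abs_pos.2 hp) _).ne' hp
  | g17 => exact hp

/-- The exponential function of the cube satisfies the constraints of all families. -/
theorem constraint_exp_cube {I : Set ℝ} {t : ℝ} (hI : I ∈ nhds t) (r : FunRow) :
    r.Constraint I fun w => Real.exp (w ^ 3) := by
  have hd : ∀ w : ℝ, HasDerivAt (fun z : ℝ => Real.exp (z ^ 3)) (3 * w ^ 2 * Real.exp (w ^ 3)) w :=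
    fun w => by simpa [mul_comm] using (hasDerivAt_pow 3 w).exp
  -- Since h' = 3w²h, each equation in the constraints is h times a polynomial of degree at most
  -- four, which cannot vanish on a neighbourhood unless it is zero.
  have key : ∀ a b c d e : ℝ, ∀ F G : ℝ → ℝ,
      (∀ w, F w - G w = (a + b * w + c * w ^ 2 + d * w ^ 3 + e * w ^ 4) * Real.exp (w ^ 3)) →
      ¬ (a = 0 ∧ b = 0 ∧ c = 0 ∧ d = 0 ∧ e = 0) → ∃ w ∈ I, F w ≠ G w := by
    intro a b c d e F G h hn
    by_contra! hc
    refine hn (quartic_eq_zero (t := t) ?_)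
    filter_upwards [hI] with w hw
    have := h w
    rw [hc w hw, sub_self] at this
    exact (mul_eq_zero.1 this.symm).resolve_right (Real.exp_ne_zero _)
  have h0 : ∃ w ∈ I, deriv (fun z : ℝ => Real.exp (z ^ 3)) w ≠ 0 :=
    key 0 0 3 0 0 _ (fun _ => 0) (fun w => by rw [(hd w).deriv]; ring) (by norm_num)
  have h1 : ∃ w ∈ I, w * deriv (fun z : ℝ => Real.exp (z ^ 3)) w ≠ 2 * Real.exp (w ^ 3) :=
    key (-2) 0 0 3 0 _ _ (fun w => by rw [(hd w).deriv]; ring) (by norm_num)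
  cases r with
  | g11 =>
    intro α β γ hn
    refine key β (2 * α) (3 * γ) (3 * β) (3 * α) _ (fun _ => 0) (fun w => ?_) (fun h => hn ?_)
    · have h2 : HasDerivAt (fun z : ℝ => α * z ^ 2 + β * z + γ) (2 * α * w + β) w := by
        refine ((((hasDerivAt_pow 2 w).const_mul α).add
          ((hasDerivAt_id' w).const_mul β)).add_const γ).congr_deriv ?_
        simp
        ring
      have h3 := (h2.mul (hd w)).deriv
      have e : ((fun z : ℝ => α * z ^ 2 + β * z + γ) * fun z : ℝ => Real.exp (z ^ 3))
          = fun z : ℝ => (α * z ^ 2 + β * z + γ) * Real.exp (z ^ 3) := rfl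
      rw [e] at h3
      rw [h3]
      ring
    · simp only [Prod.mk_eq_zero]
      refine ⟨?_, ?_, ?_⟩ <;> linarith
  | g12 =>
    intro α β γ hn
    refine key (-γ) 0 (3 * β) (3 * α) 0 _ _ (fun w => by rw [(hd w).deriv]; ring) (fun h => hn ?_)
    simp only [Prod.mk_eq_zero]
    refine ⟨?_, ?_, ?_⟩ <;> linarith
  | g13 =>
    exact ⟨h0, fun β => key (-3) 0 (6 * β) 6 0 _ _ (fun w => by rw [(hd w).deriv]; ring)
      (by norm_num)⟩
  | g14 => exact ⟨h0, h1⟩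
  | g15 =>
    exact ⟨h0, key 1 0 3 0 0 _ _ (fun w => by rw [(hd w).deriv]; ring) (by norm_num)⟩
  | g16 a =>
    refine ⟨h0, fun α _ => ?_, fun β _ => ?_, fun γ _ => ?_⟩
    · refine key (1 - 2 * a) 0 (3 * a * α) (3 * a) 0 _ _ (fun w => by rw [(hd w).deriv]; ring) ?_
      rintro ⟨e1, -, -, e2, -⟩
      linarith
    · exact key (-2) 0 (3 * β) 3 0 _ _ (fun w => by rw [(hd w).deriv]; ring) (by norm_num)
    · refine key (1 - 2 * a) 0 (3 * (a - 1) * γ) (3 * (a - 1)) 0 _ _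
        (fun w => by rw [(hd w).deriv]; ring) ?_
      rintro ⟨e1, -, -, e2, -⟩
      linarith
  | g17 =>
    exact ⟨h0, key (-1) 0 3 0 0 _ _ (fun w => by rw [(hd w).deriv]; ring) (by norm_num)⟩
  | g18 a => exact ⟨h0, h1⟩
  | g21 =>
    intro α β γ δ hn
    refine key (-δ) 0 (3 * γ) (3 * β) (3 * α) _ _ (fun w => by rw [(hd w).deriv]; ring)
      (fun h => hn ?_)
    simp only [Prod.mk_eq_zero]
    refine ⟨?_, ?_, ?_, ?_⟩ <;> linarith

end FunRow

theorem ConstRow.contDiffAt_shape {r : ConstRow} {p : ℝ × ℝ} (hp : r.Regular p) :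
    ContDiffAt ℝ ∞ r.shape p := by
  have h1 : ContDiffAt ℝ ∞ (fun q : ℝ × ℝ => q.1) p := contDiffAt_fst
  have h2 : ContDiffAt ℝ ∞ (fun q : ℝ × ℝ => q.2) p := contDiffAt_snd
  cases r with
  | g22 | g25 | g31 | g5 => unfold shape; fun_prop
  | g23 => exact (h2.pow 2).div h1 hp
  | g24 => exact (h2.pow 2).div ((h1.pow 2).add contDiffAt_const) (by positivity)
  | g26 a => exact (contDiffAt_abs_rpow hp (2 - 1 / a)).comp p h2
  | g27 =>
    have h3 : ContDiffAt ℝ ∞ (fun q : ℝ × ℝ => q.2 - q.1 ^ 2 / 2) p := by fun_prop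
    exact (contDiffAt_abs_rpow hp (3 / 2)).comp p h3
  | g32 a => exact (contDiffAt_abs_rpow hp (2 * a - 1)).comp p h1
  | g33 a =>
    have h3 : ContDiffAt ℝ ∞ (fun q : ℝ × ℝ => Real.arctan q.1) p :=
      Real.contDiff_arctan.contDiffAt.comp p h1
    exact (contDiffAt_const.mul h3).exp

/-- Points with large `t` where all expressions of the list are regular. -/
theorem exists_regular_domain (M : ℝ) : ∃ Ω : Set (ℝ × ℝ), IsOpen Ω ∧ IsConnected Ω ∧
    ∀ p ∈ Ω, M < p.1 ∧ 0 < p.1 ∧ 0 < p.2 ∧ 0 < p.2 - p.1 ^ 2 / 2 := by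
  have ho : IsOpen {p : ℝ × ℝ | M < p.1 ∧ 0 < p.1 ∧ 0 < p.2 ∧ 0 < p.2 - p.1 ^ 2 / 2} :=
    (isOpen_lt continuous_const continuous_fst).inter
      ((isOpen_lt continuous_const continuous_fst).inter
        ((isOpen_lt continuous_const continuous_snd).inter
          (isOpen_lt continuous_const (by fun_prop : Continuous fun p : ℝ × ℝ => p.2 - p.1 ^ 2 / 2))))
  have hm : ((|M| + 1, (|M| + 1) ^ 2) : ℝ × ℝ) ∈
      {p : ℝ × ℝ | M < p.1 ∧ 0 < p.1 ∧ 0 < p.2 ∧ 0 < p.2 - p.1 ^ 2 / 2} := by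
    have h1 := le_abs_self M
    have h2 : 0 < |M| + 1 := by positivity
    have h3 : 0 < (|M| + 1) ^ 2 := by positivity
    exact ⟨by simp only; linarith, h2, h3, by simp only; linarith⟩
  obtain ⟨Ω, h1, h2, h3, -⟩ := exists_ball_subset ho hm
  exact ⟨Ω, h2, h3, fun p hp => h1 hp⟩

/-- The bound M leaves freedom to place the domain where a given equivalence transformation is
defined. -/
theorem FunRow.exists_model (r : FunRow) (M : ℝ) : ∃ Ω f, IsGBE Ω f ∧ symAlg Ω f = r.alg ∧
    ∀ p ∈ Ω, M < p.1 := by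
  obtain ⟨Ω, h1, h2, h3⟩ := exists_regular_domain M
  have hr : ∀ p ∈ Ω, r.Regular p := by
    intro p hp
    obtain ⟨-, g1, g2, g3⟩ := h3 p hp
    cases r with
    | g11 => exact g2.ne'
    | g15 | g16 | g17 => exact g1.ne'
    | _ => trivial
  have hh : ContDiff ℝ ∞ fun w : ℝ => Real.exp (w ^ 3) := by fun_prop
  have hf : IsGBE Ω fun p => r.coeff p * Real.exp (r.omega p ^ 3) := by
    refine ⟨h1, h2, fun p hp => ContDiffAt.contDiffWithinAt ?_, fun p hp => ?_⟩
    · exact (contDiffAt_coeff (hr p hp)).mul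
        (hh.contDiffAt.comp p (contDiffAt_omega (hr p hp)))
    · exact mul_ne_zero (coeff_ne (hr p hp)) (Real.exp_ne_zero _)
  have hF : r.HasForm Ω (fun p => r.coeff p * Real.exp (r.omega p ^ 3))
      fun w => Real.exp (w ^ 3) := ⟨hh.contDiffOn, fun p _ => rfl⟩
  obtain ⟨p, hp⟩ := h2.nonempty
  exact ⟨Ω, _, hf, (symAlg_eq_iff hf hF).2
    (constraint_exp_cube (image_omega_mem_nhds h1 hp (hr p hp)) r), fun p hp => (h3 p hp).1⟩

theorem ConstRow.Gauged.admissible {r : ConstRow} (h : r.Gauged) : r.Admissible := by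
  cases r with
  | g26 a => exact h
  | g32 a => exact h.ne'
  | g33 a => exact h.ne'
  | _ => trivial

theorem ConstRow.exists_model (r : ConstRow) (hg : r.Gauged) (M : ℝ) :
    ∃ Ω f, IsGBE Ω f ∧ symAlg Ω f = r.alg ∧ ∀ p ∈ Ω, M < p.1 := by
  obtain ⟨Ω, h1, h2, h3⟩ := exists_regular_domain M
  have hr : ∀ p ∈ Ω, r.Regular p ∧ r.shape p ≠ 0 := by
    intro p hp
    obtain ⟨-, g1, g2, g3⟩ := h3 p hp
    cases r with
    | g22 => exact ⟨trivial, (pow_pos g2 2).ne'⟩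
    | g23 => exact ⟨g1.ne', (div_pos (pow_pos g2 2) g1).ne'⟩
    | g24 => exact ⟨trivial, (div_pos (pow_pos g2 2) (by positivity)).ne'⟩
    | g25 | g31 | g33 => exact ⟨trivial, Real.exp_ne_zero _⟩
    | g26 => exact ⟨g2.ne', (Real.rpow_pos_of_pos (abs_pos.2 g2.ne') _).ne'⟩
    | g27 => exact ⟨g3.ne', (Real.rpow_pos_of_pos (abs_pos.2 g3.ne') _).ne'⟩
    | g32 => exact ⟨g1.ne', (Real.rpow_pos_of_pos (abs_pos.2 g1.ne') _).ne'⟩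
    | g5 => exact ⟨trivial, one_ne_zero⟩
  have hf : IsGBE Ω r.shape :=
    ⟨h1, h2, fun p hp => (contDiffAt_shape (hr p hp).1).contDiffWithinAt, fun p hp => (hr p hp).2⟩
  exact ⟨Ω, _, hf, (symAlg_eq_iff (C := 1) hf fun p _ => (one_mul _).symm).2 hg.admissible,
    fun p hp => (h3 p hp).1⟩

theorem Row.exists_model (r : Row) (hg : r.Gauged) (M : ℝ) :
    ∃ Ω f, IsGBE Ω f ∧ symAlg Ω f = r.alg ∧ ∀ p ∈ Ω, M < p.1 :=
  match r with
  | .fn r => r.exists_model M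
  | .const r => r.exists_model hg M

/-- The transformations are defined for large `t`. -/
theorem EqTrans.exists_den_ne (T : EqTrans) : ∃ M, ∀ t, M < t → T.γ * t + T.δ ≠ 0 := by
  by_cases h : T.γ = 0
  · refine ⟨0, fun t _ h0 => T.det_ne ?_⟩
    have hδ : T.δ = 0 := by rw [h] at h0; linarith
    rw [h, hδ]
    ring
  · refine ⟨-T.δ / T.γ, fun t ht h0 => ht.ne' ?_⟩
    rw [eq_div_iff h]
    linarith

/-- Necessity is the normalisation of `symAlg`. For sufficiency, a model of the row with t so large
that the transformation from the row to s is defined is pushed forward to an equation with algebra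
s. -/
theorem isAppropriate_iff_equiv {s : Submodule ℝ VF} (hs : s ≤ algG) (h0 : s ≠ ⊥) :
    IsAppropriate s ↔ ∃ r : Row, r.Gauged ∧ SubalgEquiv s r.alg := by
  rw [isAppropriate_iff]
  constructor
  · rintro ⟨Ω, f, hf, rfl⟩
    exact normalizable_symAlg hf h0
  · rintro ⟨r, hg, h⟩
    obtain ⟨T, h1, h2⟩ := h.symm hs r.alg_le
    obtain ⟨M, hM⟩ := T.exists_den_ne
    obtain ⟨Ω, f, hf, he, hΩ⟩ := r.exists_model hg M
    have hT : T.DefinedOn Ω := fun p hp => hM p.1 (hΩ p hp)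
    have hm := mapsEq_push (f := f) hT
    exact ⟨_, _, hm.isGBE hf hT, symAlg_push hf hT hm hs he h1 h2⟩

/-- Equations without Lie symmetries. -/
theorem exists_symAlg_eq_bot {Ω : Set (ℝ × ℝ)} (h1 : IsOpen Ω) (h2 : IsConnected Ω) :
    ∃ f, IsGBE Ω f ∧ symAlg Ω f = ⊥ := by
  have hf : IsGBE Ω fun p => Real.exp (p.1 ^ 3 + p.2 ^ 3) :=
    ⟨h1, h2, ContDiff.contDiffOn (by fun_prop), fun p _ => Real.exp_ne_zero _⟩
  refine ⟨_, hf, eq_bot_iff.2 fun Q hQ => ?_⟩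
  obtain ⟨a, b, c, d, e, k, rfl⟩ := mem_algG.1 (symAlg_le hQ)
  rw [mem_symAlg] at hQ
  obtain ⟨p₀, hp₀⟩ := h2.nonempty
  have hd : ∀ p : ℝ × ℝ, HasFDerivAt (fun p : ℝ × ℝ => Real.exp (p.1 ^ 3 + p.2 ^ 3))
      (Real.exp (p.1 ^ 3 + p.2 ^ 3) • lin2 (3 * p.1 ^ 2) (3 * p.2 ^ 2)) p := by
    intro p
    have e1 : HasFDerivAt (fun q : ℝ × ℝ => q.1 ^ 3) (lin2 (3 * p.1 ^ 2) 0) p :=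
      hasFDerivAt_fst_comp (g := fun y : ℝ => y ^ 3) (by simpa using hasDerivAt_pow 3 p.1)
    have e2 : HasFDerivAt (fun q : ℝ × ℝ => q.2 ^ 3) (lin2 0 (3 * p.2 ^ 2)) p :=
      hasFDerivAt_snd_comp (g := fun y : ℝ => y ^ 3) (by simpa using hasDerivAt_pow 3 p.2)
    exact ((e1.add e2).congr_fderiv (by ext <;> simp)).exp
  -- Division by the exponential leaves a polynomial in x with coefficients polynomial in t;
  -- splitting first in x and then in t kills all six coordinates.
  have key : ∀ᶠ p in nhds p₀, (3 * p.1 ^ 2 * (a + c * p.1 + k * p.1 ^ 2) - (2 * d - c)) + 0 * p.2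
      + 3 * (b + e * p.1) * p.2 ^ 2 + 3 * (d + k * p.1) * p.2 ^ 3 + 0 * p.2 ^ 4 = 0 := by
    filter_upwards [h1.mem_nhds hp₀] with p hp
    have := hQ p hp
    rw [cls, (hd p).fderiv] at this
    refine (mul_eq_zero.1 ?_).resolve_left (Real.exp_ne_zero (p.1 ^ 3 + p.2 ^ 3))
    simp only [smul_apply, lin2_apply, smul_eq_mul] at this
    linear_combination this
  have hx : ∀ᶠ t in nhds p₀.1, 3 * t ^ 2 * (a + c * t + k * t ^ 2) - (2 * d - c) = 0 ∧
      b + e * t = 0 ∧ d + k * t = 0 := by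
    have := eventually_fst key.eventually_nhds
    filter_upwards [this] with t ht
    obtain ⟨g1, -, g3, g4, -⟩ := quartic_eq_zero (a := 3 * t ^ 2 * (a + c * t + k * t ^ 2)
      - (2 * d - c)) (b := 0) (c := 3 * (b + e * t)) (d := 3 * (d + k * t)) (e := 0)
      (eventually_snd ht)
    exact ⟨g1, by linarith, by linarith⟩
  obtain ⟨rfl, rfl, -⟩ := quadratic_eq_zero (a := b) (b := e) (c := 0) (t := p₀.1)
    (hx.mono fun t ht => by linarith [ht.2.1])
  obtain ⟨rfl, rfl, -⟩ := quadratic_eq_zero (a := d) (b := k) (c := 0) (t := p₀.1)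
    (hx.mono fun t ht => by linarith [ht.2.2])
  obtain ⟨-, -, h3, h4, -⟩ := quartic_eq_zero (a := c) (b := 0) (c := 3 * a) (d := 3 * c)
    (e := 0) (t := p₀.1) (hx.mono fun t ht => by linarith [ht.1])
  rw [Submodule.mem_bot, ← gv_zero, gv_inj]
  refine ⟨?_, rfl, ?_, rfl, rfl, rfl⟩ <;> linarith

theorem kernel_eq_zero {Ω : Set (ℝ × ℝ)} (h1 : IsOpen Ω) (h2 : IsConnected Ω) {Q : cyl Ω → E}
    (hQ : ∀ f, IsGBE Ω f → Q ∈ maxAlg Ω f) : Q = 0 := by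
  obtain ⟨f, hf, h⟩ := exists_symAlg_eq_bot h1 h2
  have := hQ f hf
  rw [maxAlg_eq hf, h, Submodule.map_bot] at this
  exact (Submodule.mem_bot ℝ).1 this

theorem exists_finrank {d : ℕ} (hd : d ∈ ({0, 1, 2, 3, 5} : Set ℕ)) :
    ∃ Ω f, IsGBE Ω f ∧ Module.finrank ℝ (maxAlg Ω f) = d := by
  suffices h : ∃ Ω f, IsGBE Ω f ∧ Module.finrank ℝ (symAlg Ω f) = d by
    obtain ⟨Ω, f, hf, h⟩ := h
    exact ⟨Ω, f, hf, (finrank_maxAlg hf).trans h⟩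
  rcases hd with rfl | rfl | rfl | rfl | rfl
  · obtain ⟨f, hf, h⟩ := exists_symAlg_eq_bot isOpen_univ (isConnected_univ (α := ℝ × ℝ))
    exact ⟨_, f, hf, by rw [h, finrank_bot]⟩
  · obtain ⟨Ω, f, hf, h, -⟩ := FunRow.g12.exists_model 0
    refine ⟨Ω, f, hf, ?_⟩
    rw [h, FunRow.alg_eq]
    exact finrank_span_one fun h => by
      rw [← gv_zero, gv_inj] at h
      exact one_ne_zero h.1
  · obtain ⟨Ω, f, hf, h, -⟩ := FunRow.g21.exists_model 0
    exact ⟨Ω, f, hf, by rw [h]; exact finrank_nilrad⟩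
  · obtain ⟨Ω, f, hf, h, -⟩ := ConstRow.g31.exists_model trivial 0
    refine ⟨Ω, f, hf, ?_⟩
    rw [h, ConstRow.alg_eq]
    refine finrank_span_three fun x y z h => ?_
    rw [smul_gv, smul_gv, smul_gv, gv_add, gv_add, ← gv_zero, gv_inj] at h
    obtain ⟨g1, g2, -, -, g5, -⟩ := h
    refine ⟨?_, ?_, ?_⟩ <;> linarith
  · obtain ⟨Ω, f, hf, h, -⟩ := ConstRow.g5.exists_model trivial 0
    refine ⟨Ω, f, hf, ?_⟩
    rw [h, ConstRow.alg, ← levi_sup_nilrad_eq, finrank_levi_sup_nilrad]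

/-! ### Local reduction to the list -/

/-- Small domains on which the symmetry algebra does not grow under restriction. -/
theorem exists_stable {Ω U : Set (ℝ × ℝ)} {f : ℝ × ℝ → ℝ} (hf : IsGBE Ω f) (hU : U ⊆ Ω)
    (h1 : IsOpen U) (h2 : U.Nonempty) : ∃ V ⊆ U, IsOpen V ∧ IsConnected V ∧
      ∀ W ⊆ V, IsOpen W → IsConnected W → symAlg W f = symAlg V f := by
  have hmem : ∀ V ⊆ U, IsOpen V → IsConnected V → Module.finrank ℝ (symAlg V f) ≤ 5 := by
    intro V hV g1 g2
    rcases finrank_symAlg (hf.mono (hV.trans hU) g1 g2) with ⟨h, -⟩ | h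
    · exact h.le
    · rcases h with h | h | h | h <;> rw [h] <;> norm_num
  -- Restriction can only enlarge the algebra and its dimension is at most five, so a subdomain of
  -- maximal dimension is stable.
  let S : Set ℕ := {n | ∃ V ⊆ U, IsOpen V ∧ IsConnected V ∧ Module.finrank ℝ (symAlg V f) = n}
  have hS : S.Nonempty := by
    obtain ⟨p, hp⟩ := h2
    obtain ⟨V, g1, g2, g3, -⟩ := exists_ball_subset h1 hp
    exact ⟨_, V, g1, g2, g3, rfl⟩
  have hb : BddAbove S := ⟨5, by rintro _ ⟨V, g1, g2, g3, rfl⟩; exact hmem V g1 g2 g3⟩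
  obtain ⟨V, g1, g2, g3, g4⟩ := Nat.sSup_mem hS hb
  refine ⟨V, g1, g2, g3, fun W hW k1 k2 => symAlg_eq_of_finrank (symAlg_mono hW) ?_⟩
  rw [g4]
  exact le_csSup hb ⟨W, hW.trans g1, k1, k2, rfl⟩

/-- Off the curves t = 0, x = 0 and x = t²/2 all expressions of the list are smooth and the shapes
are nonzero. The product of the three defining polynomials does not vanish on an open set. -/
theorem exists_generic {U : Set (ℝ × ℝ)} (h1 : IsOpen U) (h2 : U.Nonempty) :
    ∃ V ⊆ U, IsOpen V ∧ IsConnected V ∧ ∀ p ∈ V, p.1 ≠ 0 ∧ p.2 ≠ 0 ∧ p.2 - p.1 ^ 2 / 2 ≠ 0 := by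
  obtain ⟨p₀, hp₀⟩ := h2
  have hc : Continuous fun p : ℝ × ℝ => p.1 * p.2 * (p.2 - p.1 ^ 2 / 2) := by fun_prop
  have : ∃ p ∈ U, p.1 * p.2 * (p.2 - p.1 ^ 2 / 2) ≠ 0 := by
    by_contra! h
    have key : ∀ᶠ p in nhds p₀, p.1 * p.2 * (p.2 - p.1 ^ 2 / 2) = 0 := by
      filter_upwards [h1.mem_nhds hp₀] with p hp using h p hp
    have h3 : ∀ᶠ t in nhds p₀.1, t = 0 := by
      filter_upwards [eventually_fst key.eventually_nhds] with t ht
      exact (quadratic_eq_zero (a := 0) (b := -(t ^ 3 / 2)) (c := t)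
        ((eventually_snd ht).mono fun s hs => by simp only at hs; linarith)).2.2
    have := quadratic_eq_zero (a := 0) (b := 1) (c := 0) (h3.mono fun t ht => by linarith)
    exact one_ne_zero this.2.1
  obtain ⟨p, hp, hne⟩ := this
  obtain ⟨V, g1, g2, g3, -⟩ :=
    exists_ball_subset (h1.inter (isOpen_ne_fun hc continuous_const)) ⟨hp, hne⟩
  refine ⟨V, g1.trans Set.inter_subset_left, g2, g3, fun q hq => ?_⟩
  have := (g1 hq).2
  simp only [ne_eq, Set.mem_ofPred_eq, mul_eq_zero, not_or] at this
  exact ⟨this.1.1, this.1.2, this.2⟩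

theorem hasFDerivAt_lin2 {f : ℝ × ℝ → ℝ} {p : ℝ × ℝ} (h : DifferentiableAt ℝ f p) :
    HasFDerivAt f (lin2 (fderiv ℝ f p (1, 0)) (fderiv ℝ f p (0, 1))) p :=
  h.hasFDerivAt.congr_fderiv (by ext <;> simp)

theorem IsGBE.differentiableAt {Ω : Set (ℝ × ℝ)} {f : ℝ × ℝ → ℝ} (hf : IsGBE Ω f) {p : ℝ × ℝ}
    (hp : p ∈ Ω) : DifferentiableAt ℝ f p :=
  (hf.smooth.contDiffAt (hf.isOpen.mem_nhds hp)).differentiableAt (by simp)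

/-- Two covectors in the plane with a common nonzero kernel vector, the second one nonzero:
the first one vanishes on the kernel of the second. -/
theorem covector_eq_zero {x y A B v w g h : ℝ} (h1 : x ≠ 0 ∨ y ≠ 0) (h2 : A ≠ 0 ∨ B ≠ 0)
    (h3 : x * A + y * B = 0) (h4 : A * v + B * w = 0) (h5 : x * g + y * h = 0) :
    g * v + h * w = 0 := by
  have hv : x * w = y * v := by
    rcases h2 with h2 | h2
    · refine mul_left_cancel₀ h2 ?_
      linear_combination w * h3 - y * h4
    · refine mul_left_cancel₀ h2 ?_
      linear_combination x * h4 - v * h3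
  rcases h1 with h1 | h1
  · refine mul_left_cancel₀ h1 ?_
    linear_combination h * hv + v * h5
  · refine mul_left_cancel₀ h1 ?_
    linear_combination w * h5 - g * hv

namespace FunRow

/-- The coordinate complementary to `omega`. -/
def param : FunRow → ℝ × ℝ → ℝ
  | g11 => fun p => p.2
  | g21 => fun p => p.2
  | _ => fun p => p.1

/-- The point with the given values of `param` and `omega`. -/
def chart : FunRow → ℝ × ℝ → ℝ × ℝ
  | g11 => fun q => (q.2, q.1)
  | g21 => fun q => (q.2, q.1)
  | r => fun q => (q.1, (q.2 - r.omega (q.1, 0)) / r.omegaX (q.1, 0))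

theorem param_chart (r : FunRow) (q : ℝ × ℝ) : r.param (r.chart q) = q.1 := by cases r <;> rfl

theorem continuous_param (r : FunRow) : Continuous r.param := by
  cases r <;> first | exact continuous_fst | exact continuous_snd

theorem omega_affine {r : FunRow} (h1 : r ≠ g11) (h2 : r ≠ g21) (t x : ℝ) :
    r.omega (t, x) = r.omega (t, 0) + r.omegaX (t, 0) * x := by
  cases r with
  | g11 => exact (h1 rfl).elim
  | g21 => exact (h2 rfl).elim
  | _ => simp [omega, omegaX] <;> ring

theorem regular_congr {r : FunRow} (h1 : r ≠ g11) {t x y : ℝ} (h : r.Regular (t, x)) :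
    r.Regular (t, y) := by
  cases r with
  | g11 => exact (h1 rfl).elim
  | _ => exact h

theorem omega_chart {r : FunRow} {q : ℝ × ℝ} (hq : r.Regular (r.chart q)) :
    r.omega (r.chart q) = q.2 := by
  by_cases h : r = g11 ∨ r = g21
  · rcases h with rfl | rfl <;> rfl
  push Not at h
  have e : r.chart q = (q.1, (q.2 - r.omega (q.1, 0)) / r.omegaX (q.1, 0)) := by
    cases r <;> first | rfl | exact (h.1 rfl).elim | exact (h.2 rfl).elim
  rw [e] at hq ⊢
  rw [omega_affine h.1 h.2, mul_div_cancel₀ _ (omegaX_ne h.1 h.2 (regular_congr h.1 hq))]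
  ring

theorem chart_param {r : FunRow} {p : ℝ × ℝ} (hp : r.Regular p) :
    r.chart (r.param p, r.omega p) = p := by
  by_cases h : r = g11 ∨ r = g21
  · rcases h with rfl | rfl <;> rfl
  push Not at h
  obtain ⟨t, x⟩ := p
  have e : r.chart (r.param (t, x), r.omega (t, x))
      = (t, (r.omega (t, x) - r.omega (t, 0)) / r.omegaX (t, 0)) := by
    cases r <;> first | rfl | exact (h.1 rfl).elim | exact (h.2 rfl).elim
  rw [e, omega_affine h.1 h.2 t x, add_sub_cancel_left,
    mul_div_cancel_left₀ _ (omegaX_ne h.1 h.2 (regular_congr h.1 hp))]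

theorem contDiffAt_omegaX {r : FunRow} {p : ℝ × ℝ} (hp : r.Regular p) :
    ContDiffAt ℝ ∞ r.omegaX p := by
  have h1 : ContDiffAt ℝ ∞ (fun q : ℝ × ℝ => q.1) p := contDiffAt_fst
  cases r with
  | g11 | g12 | g13 | g15 | g21 => exact contDiffAt_const
  | g14 => unfold omegaX; fun_prop
  | g16 a => exact (contDiffAt_abs_rpow hp (-a)).comp p h1
  | g17 => exact contDiffAt_const.div h1 hp
  | g18 a =>
    have h3 : ContDiffAt ℝ ∞ (fun q : ℝ × ℝ => Real.arctan q.1) p :=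
      Real.contDiff_arctan.contDiffAt.comp p h1
    have h5 : ContDiffAt ℝ ∞ (fun q : ℝ × ℝ => Real.sqrt (q.1 ^ 2 + 1)) p :=
      ContDiffAt.sqrt (by fun_prop) (by positivity)
    exact ContDiffAt.div (contDiffAt_const.mul h3).exp h5 (by positivity)

theorem contDiffAt_chart {r : FunRow} {q : ℝ × ℝ} (hq : r.Regular (r.chart q)) :
    ContDiffAt ℝ ∞ r.chart q := by
  by_cases h : r = g11 ∨ r = g21
  · rcases h with rfl | rfl <;> exact contDiffAt_snd.prodMk contDiffAt_fst
  push Not at h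
  have e : r.chart = fun q => (q.1, (q.2 - r.omega (q.1, 0)) / r.omegaX (q.1, 0)) := by
    cases r <;> first | rfl | exact (h.1 rfl).elim | exact (h.2 rfl).elim
  rw [e] at hq ⊢
  have hr : r.Regular (q.1, 0) := regular_congr h.1 hq
  have hb : ContDiffAt ℝ ∞ (fun q : ℝ × ℝ => ((q.1, 0) : ℝ × ℝ)) q := by fun_prop
  have g1 : ContDiffAt ℝ ∞ (fun q : ℝ × ℝ => r.omega (q.1, 0)) q :=
    (contDiffAt_omega hr).comp (f := fun q : ℝ × ℝ => ((q.1, 0) : ℝ × ℝ)) q hb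
  have g2 : ContDiffAt ℝ ∞ (fun q : ℝ × ℝ => r.omegaX (q.1, 0)) q :=
    (contDiffAt_omegaX hr).comp (f := fun q : ℝ × ℝ => ((q.1, 0) : ℝ × ℝ)) q hb
  exact contDiffAt_fst.prodMk ((contDiffAt_snd.sub g1).div g2 (omegaX_ne h.1 h.2 hr))

theorem omegaT_or_omegaX_ne {r : FunRow} {p : ℝ × ℝ} (hp : r.Regular p) :
    r.omegaT p ≠ 0 ∨ r.omegaX p ≠ 0 := by
  by_cases h : r = g11 ∨ r = g21
  · left
    rcases h with rfl | rfl <;> exact one_ne_zero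
  push Not at h
  exact .inr (omegaX_ne h.1 h.2 hp)

/-- A symmetry of all equations of a family. -/
theorem exists_field (r : FunRow) : ∃ a b c d e k : ℝ, gv a b c d e k ∈ r.alg ∧
    ∀ p : ℝ × ℝ, r.Regular p →
      (a + c * p.1 + k * p.1 ^ 2 ≠ 0 ∨ b + d * p.2 + e * p.1 + k * p.1 * p.2 ≠ 0) ∧
      (a + c * p.1 + k * p.1 ^ 2) * r.omegaT p
        + (b + d * p.2 + e * p.1 + k * p.1 * p.2) * r.omegaX p = 0 ∧
      (a + c * p.1 + k * p.1 ^ 2) * r.coeffT p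
        + (b + d * p.2 + e * p.1 + k * p.1 * p.2) * r.coeffX p = (2 * d - c) * r.coeff p := by
  simp only [mem_alg]
  cases r with
  | g11 =>
    refine ⟨0, 0, 0, 1, 0, 0, by simp [Coords], fun p hp => ⟨.inr ?_, ?_, ?_⟩⟩
    · have hp' : p.2 ≠ 0 := hp
      simpa using hp'
    · simp [omegaX]
    · simp [coeffX, coeff]; ring
  | g12 =>
    refine ⟨1, 0, 0, 0, 0, 0, by simp [Coords], fun p hp => ⟨.inl ?_, ?_, ?_⟩⟩ <;>
      simp [omegaT, coeffT, coeffX]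
  | g13 =>
    refine ⟨1, 0, 0, 0, 1, 0, by simp [Coords], fun p hp => ⟨.inl ?_, ?_, ?_⟩⟩ <;>
      simp [omegaT, omegaX, coeffT, coeffX]
  | g14 =>
    refine ⟨1, 0, 0, 1, 0, 0, by simp [Coords], fun p hp => ⟨.inl ?_, ?_, ?_⟩⟩ <;>
      simp [omegaT, omegaX, coeffT, coeffX, coeff]
    ring
  | g15 =>
    refine ⟨0, 1, 1, 0, 0, 0, by simp [Coords], fun p hp => ?_⟩
    have hp' : p.1 ≠ 0 := hp
    refine ⟨.inl (by simpa using hp'), ?_, ?_⟩ <;>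
      simp [omegaT, omegaX, coeffT, coeffX, coeff] <;> field_simp
    ring
  | g16 a =>
    refine ⟨0, 0, 1, a, 0, 0, by simp [Coords], fun p hp => ?_⟩
    have hp' : p.1 ≠ 0 := hp
    refine ⟨.inl (by simpa using hp'), ?_, ?_⟩ <;>
      simp [omegaT, omegaX, coeffT, coeffX, coeff] <;> field_simp
    ring
  | g17 =>
    refine ⟨0, 0, 1, 1, 1, 0, by simp [Coords], fun p hp => ?_⟩
    have hp' : p.1 ≠ 0 := hp
    refine ⟨.inl (by simpa using hp'), ?_, ?_⟩ <;>
      simp [omegaT, omegaX, coeffT, coeffX, coeff] <;> field_simp <;> ring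
  | g18 a =>
    refine ⟨1, 0, 0, a, 0, 1, by simp [Coords], fun p hp => ?_⟩
    have hp' : p.1 ^ 2 + 1 ≠ 0 := by positivity
    refine ⟨.inl (by simpa [add_comm] using hp'), ?_, ?_⟩ <;>
      simp [omegaT, omegaX, coeffT, coeffX, coeff] <;> field_simp <;> ring
  | g21 =>
    refine ⟨0, 1, 0, 0, 0, 0, by simp [Coords], fun p hp => ⟨.inr ?_, ?_, ?_⟩⟩ <;>
      simp [omegaX, coeffT, coeffX]

end FunRow

theorem FunRow.regular_of_generic {r : FunRow} {p : ℝ × ℝ} (h1 : p.1 ≠ 0) (h2 : p.2 ≠ 0) :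
    r.Regular p := by
  cases r with
  | g11 => exact h2
  | g15 | g16 | g17 => exact h1
  | _ => trivial

/-- The ratio of `f` and `coeff` is constant along the curves `omega = const`. -/
theorem FunRow.deriv_ratio_eq_zero {r : FunRow} {Ω : Set (ℝ × ℝ)} {f : ℝ × ℝ → ℝ} (hf : IsGBE Ω f)
    (hs : r.alg ≤ symAlg Ω f) {q : ℝ × ℝ} (hq : r.chart q ∈ Ω) (hr : r.Regular (r.chart q))
    (hn : ∀ᶠ s in nhds q.1, r.Regular (r.chart (s, q.2))) :
    HasDerivAt (fun s => f (r.chart (s, q.2)) / r.coeff (r.chart (s, q.2))) 0 q.1 := by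
  have hχ : DifferentiableAt ℝ (fun s => r.chart (s, q.2)) q.1 := by
    have h1 : DifferentiableAt ℝ r.chart (q.1, q.2) := (contDiffAt_chart hr).differentiableAt (by simp)
    exact h1.comp (f := fun s : ℝ => (s, q.2)) q.1 (by fun_prop)
  have hχ := hχ.hasDerivAt
  set v := deriv (fun s => r.chart (s, q.2)) q.1
  have hω : HasDerivAt (fun s => r.omega (r.chart (s, q.2)))
      (r.omegaT (r.chart q) * v.1 + r.omegaX (r.chart q) * v.2) q.1 := by
    have := (hasFDerivAt_omega hr).comp_hasDerivAt (f := fun s => r.chart (s, q.2)) q.1 hχ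
    rwa [lin2_apply] at this
  have hω0 : HasDerivAt (fun s => r.omega (r.chart (s, q.2))) 0 q.1 :=
    (hasDerivAt_const q.1 q.2).congr_of_eventuallyEq (hn.mono fun s hs => omega_chart hs)
  have h4 := hω.unique hω0
  have hg := hasFDerivAt_lin2_div (hasFDerivAt_lin2 (hf.differentiableAt hq)) (hasFDerivAt_coeff hr)
    (coeff_ne hr)
  have hg' := hg.comp_hasDerivAt (f := fun s => r.chart (s, q.2)) q.1 hχ
  refine hg'.congr_deriv ?_
  rw [lin2_apply]
  obtain ⟨a, b, c, d, e, k, hm, hX⟩ := r.exists_field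
  obtain ⟨e1, e2, e3⟩ := hX _ hr
  -- Both the symmetry field and the velocity of the curve annihilate dω ≠ 0, so they are parallel;
  -- the field annihilates f/coeff because f and coeff satisfy the same equation with the same
  -- weight.
  refine covector_eq_zero e1 (omegaT_or_omegaX_ne hr) e2 h4 ?_
  have e4 := mem_symAlg.1 (hs hm) _ hq
  rw [cls] at e4
  have hc := coeff_ne hr
  refine mul_left_cancel₀ (pow_ne_zero 2 hc) ?_
  field_simp
  linear_combination r.coeff (r.chart q) * e4 - f (r.chart q) * e3

/-- Equations that admit an algebra with a functional parameter have locally the listed form. -/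
theorem FunRow.exists_form {r : FunRow} {Ω : Set (ℝ × ℝ)} {f : ℝ × ℝ → ℝ} (hf : IsGBE Ω f)
    (hs : r.alg ≤ symAlg Ω f) :
    ∃ W ⊆ Ω, IsOpen W ∧ IsConnected W ∧ ∃ h, r.HasForm W f h := by
  obtain ⟨V, hV, g1, g2, g3⟩ := exists_generic hf.isOpen hf.isConnected.nonempty
  replace hf := hf.mono hV g1 g2
  replace hs : r.alg ≤ symAlg V f := hs.trans (symAlg_mono hV)
  have hreg : ∀ p ∈ V, r.Regular p := fun p hp => regular_of_generic (g3 p hp).1 (g3 p hp).2.1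
  obtain ⟨p₀, hp₀⟩ := g2.nonempty
  have hchart : ∀ p ∈ V, r.chart (r.param p, r.omega p) = p := fun p hp => chart_param (hreg p hp)
  have hcont : ∀ q, r.chart q ∈ V → ContinuousAt r.chart q := fun q hq =>
    (contDiffAt_chart (hreg _ hq)).continuousAt
  have hnhds : r.chart ⁻¹' V ∈ nhds (r.param p₀, r.omega p₀) := by
    refine (hcont _ ?_) ?_ <;> rw [hchart p₀ hp₀]
    · exact hp₀
    · exact g1.mem_nhds hp₀
  -- A rectangle in the coordinates (param, ω) makes the curves ω = const connected, so that local
  -- constancy of f/coeff along them is constancy.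
  obtain ⟨ε, hε, hB⟩ := Metric.mem_nhds_iff.1 hnhds
  rw [← ball_prod_same] at hB
  set J := Metric.ball (r.param p₀) ε
  set K := Metric.ball (r.omega p₀) ε
  have hs₀ : r.param p₀ ∈ J := Metric.mem_ball_self hε
  have hw₀ : r.omega p₀ ∈ K := Metric.mem_ball_self hε
  have hJK : ∀ s ∈ J, ∀ w ∈ K, r.chart (s, w) ∈ V := fun s hs w hw => hB ⟨hs, hw⟩
  have hWe : r.chart '' (J ×ˢ K) = V ∩ (fun p => (r.param p, r.omega p)) ⁻¹' (J ×ˢ K) := by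
    ext p
    constructor
    · rintro ⟨⟨s, w⟩, ⟨h1, h2⟩, rfl⟩
      have hm := hJK s h1 w h2
      refine ⟨hm, ?_⟩
      rw [Set.mem_preimage, param_chart, omega_chart (hreg _ hm)]
      exact ⟨h1, h2⟩
    · rintro ⟨h1, h2⟩
      exact ⟨_, h2, hchart p h1⟩
  have hWo : IsOpen (r.chart '' (J ×ˢ K)) := by
    rw [hWe]
    refine ContinuousOn.isOpen_inter_preimage ?_ g1 (Metric.isOpen_ball.prod Metric.isOpen_ball)
    exact r.continuous_param.continuousOn.prodMk fun p hp =>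
      (contDiffAt_omega (hreg p hp)).continuousAt.continuousWithinAt
  have hWc : IsConnected (r.chart '' (J ×ˢ K)) := by
    refine IsConnected.image ?_ _ fun q hq => (hcont q (hB hq)).continuousWithinAt
    exact ((convex_ball _ _).prod (convex_ball _ _)).isConnected
      ⟨(r.param p₀, r.omega p₀), hs₀, hw₀⟩
  have hWV : r.chart '' (J ×ˢ K) ⊆ V := hWe.trans_subset Set.inter_subset_left
  have hconst : ∀ w ∈ K, ∀ s ∈ J, f (r.chart (s, w)) / r.coeff (r.chart (s, w))
      = f (r.chart (r.param p₀, w)) / r.coeff (r.chart (r.param p₀, w)) := by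
    intro w hw s hs'
    have hd : ∀ s ∈ J, HasDerivAt (fun s => f (r.chart (s, w)) / r.coeff (r.chart (s, w))) 0 s := by
      intro s hs'
      refine deriv_ratio_eq_zero (q := (s, w)) hf hs (hJK s hs' w hw) (hreg _ (hJK s hs' w hw)) ?_
      filter_upwards [Metric.isOpen_ball.mem_nhds hs'] with s hs' using hreg _ (hJK s hs' w hw)
    exact Metric.isOpen_ball.is_const_of_deriv_eq_zero (convex_ball _ _).isPreconnected
      (fun s hs' => (hd s hs').differentiableAt.differentiableWithinAt)
      (fun s hs' => (hd s hs').deriv) hs' hs₀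
  -- The function h is the ratio f/coeff on the transversal param = const through p₀.
  refine ⟨_, hWV.trans hV, hWo, hWc,
    fun w => f (r.chart (r.param p₀, w)) / r.coeff (r.chart (r.param p₀, w)), ?_, ?_⟩
  · rintro _ ⟨p, hp, rfl⟩
    rw [hWe] at hp
    have hm := hJK _ hs₀ _ hp.2.2
    have hc : ContDiffAt ℝ ∞ (fun w => r.chart (r.param p₀, w)) (r.omega p) :=
      ContDiffAt.comp (g := r.chart) (f := fun w : ℝ => (r.param p₀, w)) _
        (contDiffAt_chart (hreg _ hm)) (by fun_prop)
    have h1 : ContDiffAt ℝ ∞ (fun w => f (r.chart (r.param p₀, w))) (r.omega p) :=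
      ContDiffAt.comp (g := f) _ (hf.smooth.contDiffAt (g1.mem_nhds hm)) hc
    have h2 : ContDiffAt ℝ ∞ (fun w => r.coeff (r.chart (r.param p₀, w))) (r.omega p) :=
      ContDiffAt.comp (g := r.coeff) _ (contDiffAt_coeff (hreg _ hm)) hc
    exact (h1.div h2 (coeff_ne (hreg _ hm))).contDiffWithinAt
  · intro p hp
    rw [hWe] at hp
    have := hconst (r.omega p) hp.2.2 (r.param p) hp.2.1
    rw [hchart p hp.1] at this
    simp only
    rw [← this, mul_div_cancel₀ _ (coeff_ne (hreg p hp.1))]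

namespace ConstRow

theorem regular_of_generic {r : ConstRow} {p : ℝ × ℝ} (h1 : p.1 ≠ 0) (h2 : p.2 ≠ 0)
    (h3 : p.2 - p.1 ^ 2 / 2 ≠ 0) : r.Regular p ∧ r.shape p ≠ 0 := by
  cases r with
  | g22 => exact ⟨trivial, pow_ne_zero 2 h2⟩
  | g23 => exact ⟨h1, div_ne_zero (pow_ne_zero 2 h2) h1⟩
  | g24 => exact ⟨trivial, div_ne_zero (pow_ne_zero 2 h2) (by positivity)⟩
  | g25 | g31 | g33 => exact ⟨trivial, Real.exp_ne_zero _⟩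
  | g26 => exact ⟨h2, (Real.rpow_pos_of_pos (abs_pos.2 h2) _).ne'⟩
  | g27 => exact ⟨h3, (Real.rpow_pos_of_pos (abs_pos.2 h3) _).ne'⟩
  | g32 => exact ⟨h1, (Real.rpow_pos_of_pos (abs_pos.2 h1) _).ne'⟩
  | g5 => exact ⟨trivial, one_ne_zero⟩

/-- The symmetries act locally transitively on the plane. -/
theorem exists_fields {r : ConstRow} (hr : r.Admissible) {p : ℝ × ℝ} (h1 : p.1 ≠ 0) (h2 : p.2 ≠ 0)
    (h3 : p.2 - p.1 ^ 2 / 2 ≠ 0) : ∃ a b c d e k a' b' c' d' e' k' : ℝ,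
    gv a b c d e k ∈ r.alg ∧ gv a' b' c' d' e' k' ∈ r.alg ∧
    (a + c * p.1 + k * p.1 ^ 2) * (b' + d' * p.2 + e' * p.1 + k' * p.1 * p.2)
      - (b + d * p.2 + e * p.1 + k * p.1 * p.2) * (a' + c' * p.1 + k' * p.1 ^ 2) ≠ 0 := by
  have h4 : 1 + p.1 ^ 2 ≠ 0 := by positivity
  simp only [mem_alg]
  cases r with
  | g22 =>
    refine ⟨0, 0, 0, 1, 0, 0, 1, 0, 0, 0, 0, 0, by simp [Coords], by simp [Coords], ?_⟩
    simpa using h2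
  | g23 =>
    refine ⟨0, 0, 0, 1, 0, 0, 0, 0, 1, 0, 0, 0, by simp [Coords], by simp [Coords], ?_⟩
    simpa using ⟨h2, h1⟩
  | g24 =>
    refine ⟨0, 0, 0, 1, 0, 0, 1, 0, 0, 0, 0, 1, by simp [Coords], by simp [Coords], ?_⟩
    simpa using ⟨h2, h4⟩
  | g25 =>
    refine ⟨1, 0, 0, 0, 0, 0, 0, 1, 1, 0, 0, 0, by simp [Coords], by simp [Coords], by simp⟩
  | g26 a =>
    refine ⟨1, 0, 0, 0, 0, 0, 0, 0, 1, a, 0, 0, by simp [Coords], by simp [Coords], ?_⟩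
    simpa using ⟨hr.1, h2⟩
  | g27 =>
    refine ⟨1, 0, 0, 0, 1, 0, 0, 0, 1, 2, 0, 0, by simp [Coords], by simp [Coords], fun h => h3 ?_⟩
    linarith
  | g31 =>
    refine ⟨0, 1, 0, 0, 0, 0, 1, 0, 0, 1 / 2, 0, 0, by simp [Coords], by simp [Coords], by simp⟩
  | g32 a =>
    refine ⟨0, 1, 0, 0, 0, 0, 0, 0, 1, a, 0, 0, by simp [Coords], by simp [Coords], ?_⟩
    simpa using h1
  | g33 a =>
    refine ⟨0, 1, 0, 0, 0, 0, 1, 0, 0, a, 0, 1, by simp [Coords], by simp [Coords], ?_⟩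
    intro h
    exact h4 (by linarith)
  | g5 =>
    refine ⟨0, 1, 0, 0, 0, 0, 1, 0, 0, 0, 0, 0, by simp [Coords], by simp [Coords], by simp⟩

/-- Equations that admit an algebra without functional parameters have locally the listed form. -/
theorem exists_form {r : ConstRow} (ha : r.Admissible) {Ω : Set (ℝ × ℝ)} {f : ℝ × ℝ → ℝ}
    (hf : IsGBE Ω f) (hs : r.alg ≤ symAlg Ω f)
    (hΩ : ∀ p ∈ Ω, p.1 ≠ 0 ∧ p.2 ≠ 0 ∧ p.2 - p.1 ^ 2 / 2 ≠ 0) :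
    ∃ c ≠ 0, r.HasForm Ω f c := by
  have hr : ∀ p ∈ Ω, r.Regular p ∧ r.shape p ≠ 0 := fun p hp =>
    regular_of_generic (hΩ p hp).1 (hΩ p hp).2.1 (hΩ p hp).2.2
  have hg : IsGBE Ω r.shape := ⟨hf.isOpen, hf.isConnected,
    fun p hp => (contDiffAt_shape (hr p hp).1).contDiffWithinAt, fun p hp => (hr p hp).2⟩
  have hs' : symAlg Ω r.shape = r.alg :=
    (symAlg_eq_iff (C := 1) hg fun p _ => (one_mul _).symm).2 ha
  -- The shape admits the same algebra, so f and the shape satisfy the same two equations along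
  -- fields that span the plane; hence the gradient of their quotient vanishes.
  have hd : ∀ p ∈ Ω, HasFDerivAt (fun q => f q / r.shape q) (0 : ℝ × ℝ →L[ℝ] ℝ) p := by
    intro p hp
    refine (hasFDerivAt_lin2_div (hasFDerivAt_lin2 (hf.differentiableAt hp))
      (hasFDerivAt_lin2 (hg.differentiableAt hp)) (hr p hp).2).congr_fderiv ?_
    obtain ⟨a, b, c, d, e, k, a', b', c', d', e', k', h, h', hn⟩ :=
      exists_fields ha (hΩ p hp).1 (hΩ p hp).2.1 (hΩ p hp).2.2
    have e1 := mem_symAlg.1 (hs h) p hp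
    have e2 := mem_symAlg.1 (hs h') p hp
    have e3 := mem_symAlg.1 (hs'.ge h) p hp
    have e4 := mem_symAlg.1 (hs'.ge h') p hp
    simp only [cls] at e1 e2 e3 e4
    have hne := (hr p hp).2
    have ht : fderiv ℝ f p (1, 0) * r.shape p - f p * fderiv ℝ r.shape p (1, 0) = 0 := by
      refine mul_left_cancel₀ hn ?_
      linear_combination
        (b' + d' * p.2 + e' * p.1 + k' * p.1 * p.2) * (r.shape p * e1 - f p * e3)
          - (b + d * p.2 + e * p.1 + k * p.1 * p.2) * (r.shape p * e2 - f p * e4)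
    have hx : fderiv ℝ f p (0, 1) * r.shape p - f p * fderiv ℝ r.shape p (0, 1) = 0 := by
      refine mul_left_cancel₀ hn ?_
      linear_combination
        (a + c * p.1 + k * p.1 ^ 2) * (r.shape p * e2 - f p * e4)
          - (a' + c' * p.1 + k' * p.1 ^ 2) * (r.shape p * e1 - f p * e3)
    have gt : fderiv ℝ f p (1, 0) / r.shape p
        - f p * fderiv ℝ r.shape p (1, 0) / r.shape p ^ 2 = 0 := by
      field_simp
      linear_combination ht
    have gx : fderiv ℝ f p (0, 1) / r.shape p
        - f p * fderiv ℝ r.shape p (0, 1) / r.shape p ^ 2 = 0 := by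
      field_simp
      linear_combination hx
    rw [gt, gx]
    ext <;> simp
  obtain ⟨c, hc⟩ := hf.isOpen.exists_is_const_of_fderiv_eq_zero hf.isConnected.isPreconnected
    (fun p hp => (hd p hp).differentiableAt.differentiableWithinAt)
    (fun p hp => (hd p hp).fderiv)
  obtain ⟨p, hp⟩ := hf.isConnected.nonempty
  refine ⟨c, ?_, fun q hq => ?_⟩
  · rw [← hc p hp]
    exact div_ne_zero (hf.ne_zero p hp) (hr p hp).2
  · rw [← hc q hq, div_mul_cancel₀ _ (hr q hq).2]

/-- The constant multiplier can be gauged by an equivalence transformation. -/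
theorem exists_gauge (r : ConstRow) {c : ℝ} (hc : c ≠ 0) : ∃ (T : EqTrans), ∃ c' ∈ r.multipliers,
    (∀ t, t ≠ 0 → T.γ * t + T.δ ≠ 0) ∧ ∀ p : ℝ × ℝ, p.1 ≠ 0 →
      T.κ ^ 2 / (T.α * T.δ - T.β * T.γ) * (c * r.shape p) = c' * r.shape (T.onTX p) := by
  have hscale : ∀ (α κ : ℝ) (hα : α ≠ 0) (hκ : κ ≠ 0) (c' : ℝ), c' ∈ r.multipliers →
      (∀ p : ℝ × ℝ, κ ^ 2 / α * (c * r.shape p) = c' * r.shape (α * p.1, κ * p.2)) →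
      ∃ (T : EqTrans), ∃ c' ∈ r.multipliers,
        (∀ t, t ≠ 0 → T.γ * t + T.δ ≠ 0) ∧ ∀ p : ℝ × ℝ, p.1 ≠ 0 →
          T.κ ^ 2 / (T.α * T.δ - T.β * T.γ) * (c * r.shape p) = c' * r.shape (T.onTX p) := by
    intro α κ hα hκ c' hm h
    refine ⟨scale α κ hα hκ, c', hm, fun t _ => by simp [scale], fun p _ => ?_⟩
    have := h p
    simpa [scale, onTX] using this
  have habs : Real.sqrt |c|⁻¹ ^ 2 * c = 1 ∨ Real.sqrt |c|⁻¹ ^ 2 * c = -1 := by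
    rw [Real.sq_sqrt (by positivity)]
    rcases hc.lt_or_gt with h | h
    · right
      rw [abs_of_neg h]
      field_simp
    · left
      rw [abs_of_pos h]
      field_simp
  have hk : Real.sqrt |c|⁻¹ ≠ 0 := (Real.sqrt_pos.2 (by positivity)).ne'
  cases r with
  | g22 | g25 | g26 | g5 =>
    -- These shapes do not depend on t, so scaling t by c divides f by c.
    refine hscale c 1 hc one_ne_zero 1 rfl fun p => ?_
    simp [shape]
    field_simp
  | g23 =>
    rcases hc.lt_or_gt with h | h
    -- Inversion has determinant -1 and preserves the shape x²/t, so it reverses the sign of the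
    -- multiplier.
    · refine ⟨inversion, -c, neg_pos.2 h, fun t ht => by simpa [inversion, proj] using ht,
        fun p hp => ?_⟩
      simp only [inversion, proj, onTX, shape, zero_mul, zero_add, one_mul, add_zero]
      field_simp
      ring
    · exact hscale 1 1 one_ne_zero one_ne_zero c h fun p => by simp
  | g24 =>
    rcases hc.lt_or_gt with h | h
    -- The shape is even in t, so t ↦ -t reverses the sign of the multiplier.
    · exact hscale (-1) 1 (by norm_num) one_ne_zero (-c) (neg_pos.2 h) fun p => by simp [shape]
    · exact hscale 1 1 one_ne_zero one_ne_zero c h fun p => by simp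
  | g27 =>
    rcases hc.lt_or_gt with h | h
    · exact hscale (-1) 1 (by norm_num) one_ne_zero (-c) (neg_pos.2 h) fun p => by simp [shape]
    · exact hscale 1 1 one_ne_zero one_ne_zero c h fun p => by simp
  | g31 | g32 | g33 =>
    -- These shapes depend on t only; scaling x by |c|^(-1/2) leaves just the sign of c.
    rcases habs with h | h
    · refine hscale 1 _ one_ne_zero hk 1 (.inl rfl) fun p => ?_
      simp only [shape]
      rw [div_one, ← mul_assoc, h, one_mul p.1]
    · refine hscale 1 _ one_ne_zero hk (-1) (.inr rfl) fun p => ?_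
      simp only [shape]
      rw [div_one, ← mul_assoc, h, one_mul p.1]

end ConstRow

theorem EqTrans.comp_mapsEq {S T : EqTrans} {Ω : Set (ℝ × ℝ)} {f f' f'' : ℝ × ℝ → ℝ}
    (hT : T.DefinedOn Ω) (hS : S.DefinedOn (T.onTX '' Ω)) (h : T.MapsEq Ω f f')
    (h' : S.MapsEq (T.onTX '' Ω) f' f'') :
    (S.comp T).DefinedOn Ω ∧ (S.comp T).MapsEq Ω f f'' ∧
      (S.comp T).onTX '' Ω = S.onTX '' (T.onTX '' Ω) := by
  have hS' : ∀ p ∈ Ω, S.γ * (T.onTX p).1 + S.δ ≠ 0 := fun p hp => hS _ ⟨p, hp, rfl⟩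
  refine ⟨fun p hp => ?_, fun p hp => ?_, ?_⟩
  · rw [comp_den (hT p hp)]
    exact mul_ne_zero (hS' p hp) (hT p hp)
  · rw [comp_onTX (hT p hp) (hS' p hp), h' _ ⟨p, hp, rfl⟩, h p hp]
    have h1 := T.det_ne
    have h2 := S.det_ne
    have e : (S.comp T).α * (S.comp T).δ - (S.comp T).β * (S.comp T).γ
        = (S.α * S.δ - S.β * S.γ) * (T.α * T.δ - T.β * T.γ) := by
      simp only [comp]
      ring
    rw [e]
    simp only [comp]
    rw [← mul_assoc, div_mul_div_comm, mul_pow]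
  · rw [Set.image_image]
    exact Set.image_congr fun p hp => comp_onTX (hT p hp) (hS' p hp)

/-- The assumption on all subdomains is needed because the listed form is found only on a smaller
set, where maximality of the row's algebra must persist to yield the constraints. -/
theorem exists_entry {r : Row} (hr : r.Gauged) {Ω : Set (ℝ × ℝ)} {f : ℝ × ℝ → ℝ} (hf : IsGBE Ω f)
    (hs : ∀ W ⊆ Ω, IsOpen W → IsConnected W → symAlg W f = r.alg) :
    ∃ W ⊆ Ω, IsOpen W ∧ IsConnected W ∧ ∃ (T : EqTrans) (f' : ℝ × ℝ → ℝ),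
      T.DefinedOn W ∧ T.MapsEq W f f' ∧ r.IsEntry (T.onTX '' W) f' := by
  cases r with
  | fn r =>
    obtain ⟨W, hW, h1, h2, h, hF⟩ :=
      FunRow.exists_form hf (hs Ω subset_rfl hf.isOpen hf.isConnected).ge
    have hid : ∀ p : ℝ × ℝ, (scale 1 1 one_ne_zero one_ne_zero).onTX p = p := fun p => by
      simp [scale, onTX]
    refine ⟨W, hW, h1, h2, scale 1 1 one_ne_zero one_ne_zero, f, fun p _ => by simp [scale],
      fun p _ => by rw [hid]; simp [scale], ?_⟩
    have : (scale 1 1 one_ne_zero one_ne_zero).onTX '' W = W := by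
      rw [Set.image_congr fun p _ => hid p, Set.image_id']
    rw [this]
    exact ⟨hr, h, hF, (FunRow.symAlg_eq_iff (hf.mono hW h1 h2) hF).1 (hs W hW h1 h2)⟩
  | const r =>
    obtain ⟨W, hW, h1, h2, h3⟩ := exists_generic hf.isOpen hf.isConnected.nonempty
    have hg := hf.mono hW h1 h2
    obtain ⟨c, hc, hF⟩ := ConstRow.exists_form (ConstRow.Gauged.admissible hr) hg
      (hs W hW h1 h2).ge h3
    obtain ⟨T, c', hc', hT, hm⟩ := r.exists_gauge hc
    have hT' : T.DefinedOn W := fun p hp => hT _ (h3 p hp).1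
    refine ⟨W, hW, h1, h2, T, T.push f, hT', mapsEq_push hT', hr, c', hc', ?_⟩
    rintro _ ⟨p, hp, rfl⟩
    rw [mapsEq_push hT' p hp, hF p hp, hm p (h3 p hp).1]

/-- The local classification. -/
theorem exists_local_entry {Ω U : Set (ℝ × ℝ)} {f : ℝ × ℝ → ℝ} (hf : IsGBE Ω f) (hU : U ⊆ Ω)
    (h1 : IsOpen U) (h2 : U.Nonempty) : ∃ V ⊆ U, IsOpen V ∧ IsConnected V ∧
      (maxAlg V f = ⊥ ∨ ∃ (T : EqTrans) (f' : ℝ × ℝ → ℝ) (r : Row),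
        T.DefinedOn V ∧ T.MapsEq V f f' ∧ r.IsEntry (T.onTX '' V) f') := by
  obtain ⟨V, hV, g1, g2, g3⟩ := exists_stable hf hU h1 h2
  have hfV := hf.mono (hV.trans hU) g1 g2
  by_cases h0 : symAlg V f = ⊥
  · exact ⟨V, hV, g1, g2, .inl (by rw [maxAlg_eq hfV, h0, Submodule.map_bot])⟩
  obtain ⟨r, hr, T, t1, t2⟩ := normalizable_symAlg hfV h0
  have hden : ∃ p ∈ V, T.γ * p.1 + T.δ ≠ 0 := by
    by_contra! h
    obtain ⟨p, hp⟩ := g2.nonempty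
    have key : ∀ᶠ q in nhds p, T.γ * q.1 + T.δ = 0 := by
      filter_upwards [g1.mem_nhds hp] with q hq using h q hq
    obtain ⟨e1, e2, -⟩ := quadratic_eq_zero (a := T.δ) (b := T.γ) (c := 0) (t := p.1)
      ((eventually_fst key).mono fun t ht => by simp only at ht; linarith)
    exact T.det_ne (by rw [e1, e2]; ring)
  obtain ⟨p, hp, hne⟩ := hden
  obtain ⟨V', k1, k2, k3, -⟩ := exists_ball_subset (g1.inter T.isOpen_den) ⟨hp, hne⟩
  have hV' : V' ⊆ V := k1.trans Set.inter_subset_left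
  have hT : T.DefinedOn V' := fun q hq => (k1 hq).2
  have hm := mapsEq_push (f := f) hT
  have hf' := hm.isGBE (hfV.mono hV' k2 k3) hT
  have hTi : T.inv.DefinedOn (T.onTX '' V') := definedOn_inv hT
  have himage : ∀ W ⊆ T.onTX '' V', IsOpen W → IsConnected W → ∃ W' ⊆ V', IsOpen W' ∧
      IsConnected W' ∧ T.onTX '' W' = W := by
    intro W hW w1 w2
    have hW' : T.inv.DefinedOn W := fun q hq => hTi q (hW hq)
    refine ⟨T.inv.onTX '' W, ?_, isOpen_image w1 hW',
      w2.image _ (T.inv.continuousOn_onTX.mono hW'), ?_⟩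
    · exact (Set.image_mono hW).trans (inv_image hT).subset
    · rw [Set.image_image, Set.image_congr fun q hq => onTX_inv (hW' q hq), Set.image_id']
  -- Subdomains of the image are images of subdomains of V', so stability of the algebra passes
  -- through T.
  obtain ⟨W, hW, w1, w2, S, f'', s1, s2, s3⟩ := exists_entry hr hf' (fun W hW w1 w2 => by
    obtain ⟨W', hW', w3, w4, rfl⟩ := himage W hW w1 w2
    exact symAlg_push (hfV.mono (hW'.trans hV') w3 w4) (fun q hq => hT q (hW' hq))
      (fun q hq => hm q (hW' hq)) r.alg_le (g3 W' (hW'.trans hV') w3 w4) t1 t2)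
  obtain ⟨W', hW', w3, w4, rfl⟩ := himage W hW w1 w2
  obtain ⟨c1, c2, c3⟩ := comp_mapsEq (fun q hq => hT q (hW' hq)) s1 (fun q hq => hm q (hW' hq)) s2
  exact ⟨W', hW'.trans (hV'.trans hV), w3, w4, .inr ⟨S.comp T, f'', r, c1, c2, by rwa [c3]⟩⟩

end classification

end GBE

end

/-! ### The classification theorem -/

theorem mainTheorem2 :
    -- `𝔤` is isomorphic to `aff(2, ℝ)`
    (∃ φ : algG ≃ₗ[ℝ] aff2, ∀ X Y : algG, ∃ Z : algG,
      (Z : VF) = VectorField.lieBracket ℝ (X : VF) (Y : VF) ∧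
        (φ Z : Matrix (Fin 3) (Fin 3) ℝ) = (φ X).1 * (φ Y).1 - (φ Y).1 * (φ X).1) ∧
    -- the elements of `G^∼` transform equations of the class to equations of the class
    (∀ (T : EqTrans) (Ω : Set (ℝ × ℝ)) (f f' : ℝ × ℝ → ℝ), IsGBE Ω f → T.DefinedOn Ω →
      T.MapsEq Ω f f' → IsGBE (T.onTX '' Ω) f' ∧
        ∀ u u' : ℝ × ℝ → ℝ, ContDiffOn ℝ ∞ u Ω → ContDiffOn ℝ ∞ u' (T.onTX '' Ω) →
          (∀ p ∈ Ω, T.onE (p.1, p.2, u p)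
            = ((T.onTX p).1, (T.onTX p).2, u' (T.onTX p))) →
          (IsSolution Ω f u ↔ IsSolution (T.onTX '' Ω) f' u')) ∧
    -- every maximal Lie invariance algebra is (the restriction of) a subalgebra of `𝔤`
    (∀ Ω f, IsGBE Ω f → ∃ s ≤ algG, IsBracketClosed s ∧ maxAlg Ω f = s.map (res Ω)) ∧
    -- the kernel algebra is zero
    (∀ Ω : Set (ℝ × ℝ), IsOpen Ω → IsConnected Ω →
      ∀ Q : cyl Ω → E, (∀ f, IsGBE Ω f → Q ∈ maxAlg Ω f) → Q = 0) ∧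
    -- the possible dimensions
    (∀ Ω f, IsGBE Ω f → Module.finrank ℝ (maxAlg Ω f) ∈ ({0, 1, 2, 3, 5} : Set ℕ)) ∧
    (∀ d ∈ ({0, 1, 2, 3, 5} : Set ℕ), ∃ Ω f, IsGBE Ω f ∧ Module.finrank ℝ (maxAlg Ω f) = d) ∧
    -- dimension five occurs only for the classical Burgers equation
    (∀ Ω f, IsGBE Ω f →
      (Module.finrank ℝ (maxAlg Ω f) = 5 ↔ ∃ c : ℝ, ∀ p ∈ Ω, f p = c)) ∧
    -- properties of appropriate subalgebras
    (∀ s, IsAppropriate s →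
      (s ⊓ nilrad ≠ ⊥ → s ⊓ rad = nilrad) ∧
      (s ⊓ rad = cartan → s ≤ levi ⊔ cartan ∧ Module.finrank ℝ s ≤ 2) ∧
      (s ⊓ rad = nilrad →
        (Module.finrank ℝ s ≤ 3 ∧ s ⊓ levi = ⊥) ∨ s = levi ⊔ nilrad) ∧
      (s ⊓ rad = ⊥ → Module.finrank ℝ s ≤ 2 ∧
        (Module.finrank ℝ s = 2 →
          prC s = cartan ∧ ¬ SubalgEquiv s (Submodule.span ℝ {vPt, vDt})))) ∧
    -- the nonzero appropriate subalgebras are, up to equivalence, those of the list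
    (∀ s ≤ algG, s ≠ ⊥ →
      (IsAppropriate s ↔ ∃ r : Row, r.Gauged ∧ SubalgEquiv s r.alg)) ∧
    -- the listed subalgebras are pairwise inequivalent, with one exception
    (∀ r r' : Row, r.Gauged → r'.Gauged → (SubalgEquiv r.alg r'.alg ↔
      r = r' ∨ (r = Row.fn .g15 ∧ r' = Row.fn .g17) ∨ (r = Row.fn .g17 ∧ r' = Row.fn .g15))) ∧
    -- for `f` of a listed form, the listed algebra is maximal exactly under the constraints
    (∀ (r : FunRow) (Ω : Set (ℝ × ℝ)) (f : ℝ × ℝ → ℝ) (h : ℝ → ℝ),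
      IsGBE Ω f → r.HasForm Ω f h →
        (maxAlg Ω f = r.alg.map (res Ω) ↔ r.Constraint (r.omega '' Ω) h)) ∧
    (∀ (r : ConstRow) (Ω : Set (ℝ × ℝ)) (f : ℝ × ℝ → ℝ) (c : ℝ),
      IsGBE Ω f → r.HasForm Ω f c →
        (maxAlg Ω f = r.alg.map (res Ω) ↔ r.Admissible)) ∧
    -- every equation of the class is, locally near the points of an open dense set,
    -- without Lie symmetries or equivalent to an equation of the list
    (∀ Ω f, IsGBE Ω f → ∀ U ⊆ Ω, IsOpen U → U.Nonempty →
      ∃ V ⊆ U, IsOpen V ∧ IsConnected V ∧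
        (maxAlg V f = ⊥ ∨
          ∃ (T : EqTrans) (f' : ℝ × ℝ → ℝ) (r : Row),
            T.DefinedOn V ∧ T.MapsEq V f f' ∧ r.IsEntry (T.onTX '' V) f')) := by
  refine ⟨algG_equiv_aff2, ?_, ?_, ?_, ?_, ?_, ?_, ?_, ?_, ?_, ?_, ?_, ?_⟩
  · exact fun T Ω f f' hf hT h => ⟨h.isGBE hf hT, fun u u' _ hu' hu =>
      EqTrans.solution_map hf hT h hu' hu⟩
  · exact fun Ω f hf => ⟨symAlg Ω f, symAlg_le, symAlg_isBracketClosed hf, maxAlg_eq hf⟩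
  · exact fun Ω h1 h2 Q hQ => kernel_eq_zero h1 h2 hQ
  · intro Ω f hf
    rw [finrank_maxAlg hf]
    rcases finrank_symAlg hf with ⟨h, -⟩ | h
    · simp [h]
    · simp only [Set.mem_insert_iff, Set.mem_singleton_iff] at h ⊢
      tauto
  · exact fun d hd => exists_finrank hd
  · intro Ω f hf
    rw [finrank_maxAlg hf]
    refine ⟨fun h => ?_, fun ⟨c, hc⟩ => finrank_symAlg_of_const hf hc⟩
    rcases finrank_symAlg hf with ⟨-, hc⟩ | h'
    · exact hc
    · rw [h] at h'
      simp at h'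
  · intro s hs
    obtain ⟨Ω, f, hf, rfl⟩ := isAppropriate_iff.1 hs
    exact radProps_symAlg hf
  · exact fun s hs h0 => isAppropriate_iff_equiv hs h0
  · exact fun r r' hr hr' => Row.subalgEquiv_iff hr hr'
  · exact fun r Ω f h hf hr => (maxAlg_eq_map_iff hf r.alg_le).trans (FunRow.symAlg_eq_iff hf hr)
  · exact fun r Ω f c hf hr => (maxAlg_eq_map_iff hf r.alg_le).trans (ConstRow.symAlg_eq_iff hf hr)
  · exact fun Ω f hf U hU h1 h2 => exists_local_entry hf hU h1 h2
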